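/- **Setting.** Fix an integer $d>0$, a set $\mathfrak L$ of labels with a map $\deg:\mathfrak L\to\mathbb R$, injective maps $\mathfrak t\mapsto \mathfrak t^{(k)}$ on $\mathfrak L$ ($k\in\mathbb N^d$) with $\mathfrak t^{(0)}=\mathfrak t$, $(\mathfrak t^{(k)})^{(\ell)}=\mathfrak t^{(k+\ell)}$, $\deg\mathfrak t^{(k)}=\deg\mathfrak t-|k|$, and a label $\delta$ with $\deg\delta=-d$. Every label is of the form $\mathfrak t^{(k)}$ with $\mathfrak t$ in a fixed finite set, and $\mathfrak L_\star=\mathfrak L\setminus\{\delta^{(k)}\}_k$ is closed under $\mathfrak t\mapsto\mathfrak t^{(k)}$. **Diagrams.** A *Feynman diagram* $\Gamma$ is a finite directed multigraph with inner vertices $\mathcal V_\star$, internal edges $\mathcal E_\star$ labelled by $\mathfrak L_\star$, and finitely many numbered legs, each an incoming edge at an inner vertex with a label in $\{\delta^{(k)}\}_k$, such that every connected component has a leg. Each internal edge $e$ has two half-edges, the outgoing one $e_\leftarrow$ at its source and the incoming one $e_\rightarrow$ at its target (so a self-loop has two half-edges at its vertex); a leg has one half-edge, which is incoming. For a half-edge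 $h$ of $e$, $\partial_h^{\delta_i}\Gamma$ is $\Gamma$ with the label $\mathfrak t$ of $e$ replaced by $\mathfrak t^{(\delta_i)}$, multiplied by $-1$ if $h$ is outgoing. $\mathcal H$ is the free real vector space on isomorphism classes of Feynman diagrams modulo $\sum_{h\text{ at }v}\partial_h^{\delta_i}\Gamma=0$ for all $\Gamma$, $v\in\mathcal V_\star$, $i\le d$. A *connected vacuum diagram* $(\Gamma,v_\star,\mathfrak n)$ is a finite connected graph with at least one edge, without legs, with edges labelled by $\mathfrak L_\star$, a distinguished vertex $v_\star$ and a decoration $\mathfrak n:\mathcal V\to\mathbb N^d$; its degree is $\sum_e\deg\mathfrak t(e)+\sum_v|\mathfrak n(v)|+d(|\mathcal V|-1)$. $\hat{\mathcal H}_-$ is the free commutative real algebra on their isomorphism classes modulo the ideal generated by - $\sum_{h\text{ at }v}(\partial_h^{\delta_i}\Gamma,v_\star,\mathfrak n)+\mathfrak n(v)_i(\Gamma,v_\star,\mathfrak n-\delta_i\mathbf 1_v)$ for $v\ne v_\star$, - $\sum_{h\text{ at }v_\star}(\partial_h^{\delta_i}\Gamma,v_\star,\mathfrak n)-\sum_{v\ne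 v_\star}\mathfrak n(v)_i(\Gamma,v_\star,\mathfrak n-\delta_i\mathbf 1_v)$, - $(\Gamma,v_\star,\mathfrak n)-\sum_{\mathfrak m:\mathcal V\to\mathbb N^d}(-1)^{|\mathfrak m|}\binom{\mathfrak n}{\mathfrak m}(\Gamma,v,\mathfrak n-\mathfrak m+(\Sigma\mathfrak m)\mathbf 1_{v_\star})$ for all $v$, where $\Sigma\mathfrak m=\sum_u\mathfrak m(u)$. $\mathcal H_-$ is the quotient of $\hat{\mathcal H}_-$ by the ideal generated by the connected vacuum diagrams of strictly positive degree (equivalently, the algebra generated by those of degree $\le0$, modulo the same relations). **Subgraphs.** A subgraph $\gamma\subset\Gamma$ is a set of internal edges together with the vertices $\mathcal V_\gamma$ incident to them. Its boundary $\partial\gamma$ is the set of all half-edges (including those of legs) at vertices of $\gamma$ that do not belong to edges of $\gamma$. For $\ell:\partial\gamma\to\mathbb N^d$ (extended by $0$), $(\pi\ell)(v)=\sum_{h\text{ at }v}\ell(h)$, $|\mathrm{out}\,\ell|$ is the sum of $|\ell(h)|$ over outgoing $h$, $\ell!=\prod_h\prod_i\ell(h)_i!$, and $\Gamma/(\gamma,\ell)$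 is obtained by contracting each connected component of $\gamma$ to a node and replacing the labels $\mathfrak t$ of the other edges $e$ by $\mathfrak t^{(\ell(e_\leftarrow)+\ell(e_\rightarrow))}$ (and those of legs by $\mathfrak t^{(\ell(h))}$, $h$ the half-edge of the leg); if $\Gamma$ has a node decoration, the decorations of nodes that are contracted together are added. $(\gamma,\mathfrak m)$ denotes the product of the components of $\gamma$, with decoration $\mathfrak m$. As distinguished vertex of a component we take the distinguished vertex of the ambient component if it lies in it, and an arbitrary vertex otherwise (the results do not depend on this choice). For a Feynman diagram $\Gamma$ and a connected vacuum diagram $(\Gamma,v_\star,\mathfrak n)$, set $$\Delta\Gamma=\sum_{\gamma\subset\Gamma}\sum_{\ell:\partial\gamma\to\mathbb N^d}\frac{(-1)^{|\mathrm{out}\,\ell|}}{\ell!}(\gamma,\pi\ell)\otimes\Gamma/(\gamma,\ell)\in\mathcal H_-\otimes\mathcal H,$$ $$\Delta^-(\Gamma,v_\star,\mathfrak n)=\sum_{\gamma\subset\Gamma}\sum_{\ell:\partial\gamma\to\mathbb N^d}\sum_{\bar{\mathfrak n}:\mathcal V_\gamma\to\mathbb N^d}\frac{(-1)^{|\mathrm{out}\,\ell|}}{\ell!}\binom{\mathfrak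 n}{\bar{\mathfrak n}}(\gamma,\bar{\mathfrak n}+\pi\ell)\otimes(\Gamma,v_\star,\mathfrak n-\bar{\mathfrak n})/(\gamma,\ell)\in\mathcal H_-\otimes\hat{\mathcal H}_-,$$ where an isolated node is identified with $1$ if its decoration is $0$ and with $0$ otherwise. (Only finitely many terms are non-zero.) The *twisted antipode* is the morphism of unital algebras $\hat{\mathcal A}:\mathcal H_-\to\hat{\mathcal H}_-$ such that $\mathcal M(\hat{\mathcal A}\otimes\mathrm{id})\Delta^-\tau=0$ for every connected vacuum diagram $\tau$ (with at least one edge) with $\deg\tau\le0$, $\mathcal M$ being the product of $\hat{\mathcal H}_-$. **Forests.** For a Feynman diagram $\Gamma$, $\mathcal G_\Gamma^-$ is the set of non-empty connected subgraphs $\gamma$ with $\deg\gamma=\sum_{e\in\gamma}\deg\mathfrak t(e)+d(|\mathcal V_\gamma|-1)\le0$. A forest is a (possibly empty) set $\mathcal F\subset\mathcal G_\Gamma^-$ any two elements of which are comparable for inclusion or vertex-disjoint; $\mathcal F_\Gamma^-$ is the set of forests and $\rho(\mathcal F)$ is the set of maximal elements of $\mathcal F$. Let $\mathcal T_\Gamma$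 be the vector space spanned by the diagrams with the same internal edges and legs as $\Gamma$ (with possibly other labels and vertices), each component of which has either at least one leg or exactly one distinguished vertex but not both, with a node decoration $\mathfrak n$ that vanishes on components with legs. It maps to $\hat{\mathcal H}_-\otimes\mathcal H$: the product of the components with a distinguished vertex is put in the first factor, and the components with legs in the second one. For a non-empty set $\gamma$ of internal edges, $\mathcal C_\gamma:\mathcal T_\Gamma\to\mathcal T_\Gamma$ is given by $\mathcal C_\gamma(\hat\Gamma,\mathfrak n)=0$ if $\gamma$ is not connected in $\hat\Gamma$, and otherwise by $$\mathcal C_\gamma(\hat\Gamma,\mathfrak n)=\sum_{\ell:\partial\gamma\to\mathbb N^d}\sum_{\bar{\mathfrak n}:\mathcal V_\gamma\to\mathbb N^d}\frac{(-1)^{|\mathrm{out}\,\ell|}}{\ell!}\mathbf 1_{\deg(\gamma,\bar{\mathfrak n}+\pi\ell)\le0}\binom{\mathfrak n}{\bar{\mathfrak n}}\,(\gamma,\bar{\mathfrak n}+\pi\ell)\cdot(\hat\Gamma,\mathfrak n-\bar{\mathfrak n})/(\gamma,\ell),$$ where $\partial\gamma$ and $\mathcal V_\gamma$ are taken in $\hat\Gamma$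 and $\cdot$ is the disjoint union. Finally $\mathcal C_\emptyset\Gamma=\Gamma$ and $\mathcal C_{\mathcal F}\Gamma=\mathcal C_{\mathcal F\setminus\rho(\mathcal F)}\prod_{\gamma\in\rho(\mathcal F)}\mathcal C_\gamma\Gamma$ for $\mathcal F\neq\emptyset$, the factors of the product being taken in an arbitrary order. **Proposition (Zimmermann's forest formula).** There is exactly one twisted antipode $\hat{\mathcal A}$, and for every Feynman diagram $\Gamma$ one has, in $\hat{\mathcal H}_-\otimes\mathcal H$, $$(\hat{\mathcal A}\otimes\mathrm{id})\Delta\Gamma=\sum_{\mathcal F\in\mathcal F_\Gamma^-}(-1)^{|\mathcal F|}\,\mathcal C_{\mathcal F}\Gamma.$$ -/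

import Mathlib

open scoped TensorProduct Classical

noncomputable section

namespace BPHZ

/-! ### Multiindices -/

/-- Multiindices in `ℕ^d`. -/
abbrev MultiIndex (d : ℕ) := Fin d → ℕ

/-- `|k|`. -/
def order {d : ℕ} (k : MultiIndex d) : ℕ := ∑ i, k i

/-- `ℓ! = ∏_a ∏_i ℓ(a)_i!`. -/
def multiFactorial {d : ℕ} {α : Type} [Fintype α] (l : α → MultiIndex d) : ℕ :=
  ∏ a, ∏ i, (l a i).factorial

/-- `n choose m`, a product of ordinary binomial coefficients; it vanishes unless `m ≤ n`. -/
def multiChoose {d : ℕ} {α : Type} [Fintype α] (n m : α → MultiIndex d) : ℕ :=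
  ∏ a, ∏ i, (n a i).choose (m a i)

/-- Extension by zero of a function defined on a subset. -/
def extendZero {d : ℕ} {α : Type} {p : α → Prop} (l : {a // p a} → MultiIndex d) :
    α → MultiIndex d :=
  fun a => if h : p a then l ⟨a, h⟩ else 0

/-! ### Labels -/

/-- A set of labels `𝔏` with degrees, derivatives `t ↦ t^(k)` and a distinguished label `δ`. -/
structure LabelSystem (d : ℕ) (𝔏 : Type) where
  /-- the degree of a label -/
  deg : 𝔏 → ℝ
  /-- `diff k t` is `t^(k)` -/
  diff : MultiIndex d → 𝔏 → 𝔏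
  /-- the label `δ` -/
  delta : 𝔏
  diff_injective : ∀ k, Function.Injective (diff k)
  diff_zero : ∀ t, diff 0 t = t
  diff_diff : ∀ k l t, diff l (diff k t) = diff (k + l) t
  deg_diff : ∀ k t, deg (diff k t) = deg t - order k
  deg_delta : deg delta = -(d : ℝ)
  /-- derivatives of internal labels are internal labels -/
  internal_diff : ∀ k t, (∃ m, diff k t = diff m delta) → ∃ m, t = diff m delta
  /-- all labels are derivatives of finitely many of them -/
  finite_generation : ∃ L₀ : Finset 𝔏, ∀ t, ∃ t₀ ∈ L₀, ∃ k, t = diff k t₀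

variable {d : ℕ} {𝔏 : Type}

/-- The label is one of the `δ^(k)`; the other labels form `𝔏_⋆`. -/
def LabelSystem.IsDelta (𝔖 : LabelSystem d 𝔏) (t : 𝔏) : Prop := ∃ k, t = 𝔖.diff k 𝔖.delta

lemma LabelSystem.IsDelta.diff {𝔖 : LabelSystem d 𝔏} {t : 𝔏} (h : 𝔖.IsDelta t)
    (k : MultiIndex d) : 𝔖.IsDelta (𝔖.diff k t) := by
  obtain ⟨m, rfl⟩ := h
  exact ⟨m + k, 𝔖.diff_diff _ _ _⟩

lemma LabelSystem.not_isDelta_diff {𝔖 : LabelSystem d 𝔏} {t : 𝔏} (h : ¬ 𝔖.IsDelta t)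
    (k : MultiIndex d) : ¬ 𝔖.IsDelta (𝔖.diff k t) :=
  fun h' => h (𝔖.internal_diff k t h')

/-! ### Labelled directed multigraphs with legs -/

/-- A directed multigraph with inner vertices `V`, internal edges `E` and `k` numbered legs, with
labels. The leg vertices `[1], …, [k]` carry no information beyond the vertex that the leg is
attached to and its label, and are left implicit. -/
structure LGraph (𝔖 : LabelSystem d 𝔏) (V E : Type) (k : ℕ) where
  src : E → V
  tgt : E → V
  lab : E → 𝔏
  lab_internal : ∀ e, ¬ 𝔖.IsDelta (lab e)
  /-- the inner vertex to which a leg is attached -/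
  leg : Fin k → V
  legLab : Fin k → 𝔏
  legLab_delta : ∀ j, 𝔖.IsDelta (legLab j)

/-- Half-edges at inner vertices: `inl (e, false)` is the outgoing half-edge of `e` (at its
source), `inl (e, true)` the incoming one (at its target), `inr j` the incoming half-edge of the
leg `j`. A self-loop has two half-edges. -/
abbrev HalfEdge (E : Type) (k : ℕ) := (E × Bool) ⊕ Fin k

/-- `-1` for outgoing half-edges, `1` for incoming ones. -/
def halfSign {E : Type} {k : ℕ} : HalfEdge E k → ℝ
  | Sum.inl (_, false) => -1
  | Sum.inl (_, true) => 1
  | Sum.inr _ => 1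

/-- `|out ℓ|`. -/
def outOrder {E : Type} {k : ℕ} [Fintype E] (l : HalfEdge E k → MultiIndex d) : ℕ :=
  ∑ e : E, order (l (Sum.inl (e, false)))

namespace LGraph

variable {𝔖 : LabelSystem d 𝔏} {V E : Type} {k : ℕ}

/-- The inner vertex of a half-edge. -/
def vert (G : LGraph 𝔖 V E k) : HalfEdge E k → V
  | Sum.inl (e, false) => G.src e
  | Sum.inl (e, true) => G.tgt e
  | Sum.inr j => G.leg j

/-- Every internal label `t(e)` becomes `t(e)^(ℓ(e_←) + ℓ(e_→))`, and similarly for legs. -/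
def shift (G : LGraph 𝔖 V E k) (l : HalfEdge E k → MultiIndex d) : LGraph 𝔖 V E k where
  src := G.src
  tgt := G.tgt
  lab e := 𝔖.diff (l (Sum.inl (e, false)) + l (Sum.inl (e, true))) (G.lab e)
  lab_internal e := LabelSystem.not_isDelta_diff (G.lab_internal e) _
  leg := G.leg
  legLab j := 𝔖.diff (l (Sum.inr j)) (G.legLab j)
  legLab_delta j := (G.legLab_delta j).diff _

/-- Two vertices are related if they are joined by an undirected path of edges of `S`. -/
def conn (G : LGraph 𝔖 V E k) (S : Finset E) : Setoid V :=
  Relation.EqvGen.setoid (fun v w => ∃ e ∈ S, G.src e = v ∧ G.tgt e = w)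

lemma conn_edge (G : LGraph 𝔖 V E k) {S : Finset E} {e : E} (he : e ∈ S) :
    G.conn S (G.src e) (G.tgt e) :=
  Relation.EqvGen.rel _ _ ⟨e, he, rfl, rfl⟩

/-- Connectivity is the smallest equivalence relation relating the end points of edges. -/
lemma conn_le (G : LGraph 𝔖 V E k) {S : Finset E} {s : Setoid V}
    (h : ∀ e ∈ S, s (G.src e) (G.tgt e)) {v w : V} (hvw : G.conn S v w) : s v w := by
  induction hvw with
  | rel x y h' =>
    obtain ⟨e, he, rfl, rfl⟩ := h'
    exact h e he
  | refl x => exact s.refl x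
  | symm x y _ ih => exact s.symm ih
  | trans x y z _ _ ih ih' => exact s.trans ih ih'

lemma conn_map (G : LGraph 𝔖 V E k) {S : Finset E} {V' : Type} (f : V → V') (s : Setoid V')
    (h : ∀ e ∈ S, s (f (G.src e)) (f (G.tgt e))) {v w : V} (hvw : G.conn S v w) :
    s (f v) (f w) :=
  G.conn_le (s := Setoid.comap f s) h hvw

/-- The vertices incident to an edge of `S`. A subgraph is given by its set of edges `S`, its
vertices being `G.verts S`. -/
def verts [Fintype V] (G : LGraph 𝔖 V E k) (S : Finset E) : Finset V :=
  Finset.univ.filter fun v => ∃ e ∈ S, G.src e = v ∨ G.tgt e = v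

lemma src_mem [Fintype V] (G : LGraph 𝔖 V E k) {S : Finset E} {e : E} (he : e ∈ S) :
    G.src e ∈ G.verts S := by
  simp only [verts, Finset.mem_filter, Finset.mem_univ, true_and]
  exact ⟨e, he, Or.inl rfl⟩

lemma tgt_mem [Fintype V] (G : LGraph 𝔖 V E k) {S : Finset E} {e : E} (he : e ∈ S) :
    G.tgt e ∈ G.verts S := by
  simp only [verts, Finset.mem_filter, Finset.mem_univ, true_and]
  exact ⟨e, he, Or.inr rfl⟩

/-- `S` is a non-empty connected subgraph. -/
def IsConn (G : LGraph 𝔖 V E k) (S : Finset E) : Prop :=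
  S.Nonempty ∧ ∀ e ∈ S, ∀ e' ∈ S, G.conn S (G.src e) (G.src e')

/-- The edges of the connected component of `v` in the graph with edges `S`. -/
def comp (G : LGraph 𝔖 V E k) (S : Finset E) (v : V) : Finset E :=
  S.filter fun e => G.conn S v (G.src e)

/-- The connected components of the subgraph `S`, each given by its set of edges. -/
def comps (G : LGraph 𝔖 V E k) (S : Finset E) : Finset (Finset E) :=
  S.image fun e => G.comp S (G.src e)

/-- The degree of the subgraph `S` with node decoration `m` (supported on `G.verts S`). -/
def subDeg [Fintype V] (G : LGraph 𝔖 V E k) (S : Finset E) (m : V → MultiIndex d) : ℝ :=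
  ∑ e ∈ S, 𝔖.deg (G.lab e) + ∑ v ∈ G.verts S, (order (m v) : ℝ)
    + (d : ℝ) * (((G.verts S).card : ℝ) - 1)

/-- The boundary of a subgraph: the half-edges at its vertices that are not half-edges of one of
its edges. -/
def boundary [Fintype V] [Fintype E] (G : LGraph 𝔖 V E k) (S : Finset E) :
    Finset (HalfEdge E k) :=
  Finset.univ.filter fun h => G.vert h ∈ G.verts S ∧ ∀ e ∈ S, ∀ b, h ≠ Sum.inl (e, b)

/-- `(πℓ)(v) = ∑ ℓ(h)`, the sum over the half-edges `h` at `v`. -/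
def push [Fintype E] (G : LGraph 𝔖 V E k) (l : HalfEdge E k → MultiIndex d) :
    V → MultiIndex d :=
  fun v => ∑ h ∈ Finset.univ.filter (fun h => G.vert h = v), l h

/-- The subgraph `S` as a graph without legs. -/
def sub [Fintype V] (G : LGraph 𝔖 V E k) (S : Finset E) :
    LGraph 𝔖 {v // v ∈ G.verts S} {e // e ∈ S} 0 where
  src e := ⟨G.src e.1, G.src_mem e.2⟩
  tgt e := ⟨G.tgt e.1, G.tgt_mem e.2⟩
  lab e := G.lab e.1
  lab_internal e := G.lab_internal e.1
  leg j := j.elim0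
  legLab j := j.elim0
  legLab_delta j := j.elim0

/-- The graph obtained by contracting every connected component of `S` to a node. -/
def contract (G : LGraph 𝔖 V E k) (S : Finset E) :
    LGraph 𝔖 (Quotient (G.conn S)) {e // e ∉ S} k where
  src e := Quotient.mk _ (G.src e.1)
  tgt e := Quotient.mk _ (G.tgt e.1)
  lab e := G.lab e.1
  lab_internal e := G.lab_internal e.1
  leg j := Quotient.mk _ (G.leg j)
  legLab := G.legLab
  legLab_delta := G.legLab_delta

/-- The node decoration of a contracted graph: the decorations of all nodes that are contracted
to the same node are summed up. -/
def contractDec [Fintype V] (G : LGraph 𝔖 V E k) (S : Finset E) (n : V → MultiIndex d) :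
    Quotient (G.conn S) → MultiIndex d :=
  fun q => ∑ v ∈ Finset.univ.filter (fun v => Quotient.mk (G.conn S) v = q), n v

/-- An isomorphism of labelled graphs with legs. -/
structure Iso {V' E' : Type} {k' : ℕ} (G : LGraph 𝔖 V E k) (G' : LGraph 𝔖 V' E' k') where
  onV : V ≃ V'
  onE : E ≃ E'
  legs : k = k'
  src_eq : ∀ e, G'.src (onE e) = onV (G.src e)
  tgt_eq : ∀ e, G'.tgt (onE e) = onV (G.tgt e)
  lab_eq : ∀ e, G'.lab (onE e) = G.lab e
  leg_eq : ∀ j, G'.leg (Fin.cast legs j) = onV (G.leg j)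
  legLab_eq : ∀ j, G'.legLab (Fin.cast legs j) = G.legLab j

/-! Facts on connectivity needed for the constructions below. -/

lemma conn_shift (G : LGraph 𝔖 V E k) (l : HalfEdge E k → MultiIndex d) (S : Finset E) :
    (G.shift l).conn S = G.conn S := rfl

lemma conn_comp (G : LGraph 𝔖 V E k) {S : Finset E} {v w x : V} (h : G.conn S w x) :
    G.conn S v w → G.conn (G.comp S v) w x := by
  suffices (G.conn S v w ↔ G.conn S v x) ∧ (G.conn S v w → G.conn (G.comp S v) w x) from this.2
  induction h with
  | rel x y h' =>
    obtain ⟨e, he, rfl, rfl⟩ := h'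
    refine ⟨⟨fun h => (G.conn S).trans h (G.conn_edge he),
      fun h => (G.conn S).trans h ((G.conn S).symm (G.conn_edge he))⟩, fun h => ?_⟩
    exact G.conn_edge (Finset.mem_filter.2 ⟨he, h⟩)
  | refl x => exact ⟨Iff.rfl, fun _ => (G.conn _).refl x⟩
  | symm x y _ ih => exact ⟨ih.1.symm, fun h => (G.conn _).symm (ih.2 (ih.1.2 h))⟩
  | trans x y z _ _ ih ih' =>
    exact ⟨ih.1.trans ih'.1, fun h => (G.conn _).trans (ih.2 h) (ih'.2 (ih.1.1 h))⟩

lemma isConn_comp (G : LGraph 𝔖 V E k) {S : Finset E} {v : V} (h : (G.comp S v).Nonempty) :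
    G.IsConn (G.comp S v) := by
  refine ⟨h, fun e he e' he' => ?_⟩
  have h1 := (Finset.mem_filter.1 he).2
  have h2 := (Finset.mem_filter.1 he').2
  exact G.conn_comp ((G.conn S).trans ((G.conn S).symm h1) h2) h1

lemma isConn_of_mem_comps (G : LGraph 𝔖 V E k) {S c : Finset E} (h : c ∈ G.comps S) :
    G.IsConn c := by
  obtain ⟨e, he, rfl⟩ := Finset.mem_image.1 h
  exact G.isConn_comp ⟨e, Finset.mem_filter.2 ⟨he, (G.conn S).refl _⟩⟩

lemma verts_nonempty [Fintype V] (G : LGraph 𝔖 V E k) {S : Finset E} (h : S.Nonempty) :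
    (G.verts S).Nonempty :=
  ⟨_, G.src_mem h.choose_spec⟩

/-- A choice of distinguished vertex for a non-empty subgraph: a vertex in `R`, the set of already
distinguished vertices, if there is one in the subgraph, and an arbitrary vertex otherwise. -/
def pick [Fintype V] (G : LGraph 𝔖 V E k) (R : Finset V) (S : Finset E) (hS : S.Nonempty) :
    {v // v ∈ G.verts S} :=
  if h : ∃ v, v ∈ R ∧ v ∈ G.verts S then ⟨h.choose, h.choose_spec.2⟩
  else ⟨(G.verts_nonempty hS).choose, (G.verts_nonempty hS).choose_spec⟩

lemma conn_sub_aux [Fintype V] (G : LGraph 𝔖 V E k) {S : Finset E} {v w : V}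
    (h : G.conn S v w) : v = w ∨ ∃ (hv : v ∈ G.verts S) (hw : w ∈ G.verts S),
      (G.sub S).conn Finset.univ ⟨v, hv⟩ ⟨w, hw⟩ := by
  induction h with
  | rel x y h' =>
    obtain ⟨e, he, rfl, rfl⟩ := h'
    exact Or.inr ⟨G.src_mem he, G.tgt_mem he,
      (G.sub S).conn_edge (e := ⟨e, he⟩) (Finset.mem_univ _)⟩
  | refl x => exact Or.inl rfl
  | symm x y _ ih =>
    rcases ih with rfl | ⟨hv, hw, h⟩
    · exact Or.inl rfl
    · exact Or.inr ⟨hw, hv, Setoid.symm' _ h⟩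
  | trans x y z _ _ ih ih' =>
    rcases ih with rfl | ⟨hv, hw, h⟩
    · exact ih'
    · rcases ih' with rfl | ⟨hv', hw', h'⟩
      · exact Or.inr ⟨hv, hw, h⟩
      · exact Or.inr ⟨hv, hw', Setoid.trans' _ h h'⟩

lemma conn_of_mem_verts [Fintype V] (G : LGraph 𝔖 V E k) {S : Finset E} (hS : G.IsConn S)
    {v w : V} (hv : v ∈ G.verts S) (hw : w ∈ G.verts S) : G.conn S v w := by
  have key : ∀ u ∈ G.verts S, ∃ e ∈ S, G.conn S (G.src e) u := by
    intro u hu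
    simp only [verts, Finset.mem_filter, Finset.mem_univ, true_and] at hu
    obtain ⟨e, he, rfl | rfl⟩ := hu
    · exact ⟨e, he, (G.conn S).refl _⟩
    · exact ⟨e, he, G.conn_edge he⟩
  obtain ⟨e, he, h⟩ := key v hv
  obtain ⟨e', he', h'⟩ := key w hw
  exact (G.conn S).trans ((G.conn S).symm h) ((G.conn S).trans (hS.2 e he e' he') h')

lemma conn_sub [Fintype V] (G : LGraph 𝔖 V E k) {S : Finset E} (hS : G.IsConn S)
    (v w : {v // v ∈ G.verts S}) : (G.sub S).conn Finset.univ v w := by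
  rcases G.conn_sub_aux (G.conn_of_mem_verts hS v.2 w.2) with h | ⟨_, _, h⟩
  · rw [Subtype.ext h]
  · exact h

lemma conn_contract [Fintype E] (G : LGraph 𝔖 V E k) {S : Finset E} {v w : V}
    (h : G.conn Finset.univ v w) :
    (G.contract S).conn Finset.univ (Quotient.mk _ v) (Quotient.mk _ w) := by
  refine G.conn_map (Quotient.mk (G.conn S)) _ (fun e _ => ?_) h
  by_cases he : e ∈ S
  · have : (Quotient.mk (G.conn S) (G.src e)) = Quotient.mk _ (G.tgt e) :=
      Quotient.sound (G.conn_edge he)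
    rw [this]
  · exact (G.contract S).conn_edge (e := ⟨e, he⟩) (Finset.mem_univ _)

end LGraph

/-! ### Feynman diagrams and the space `H` -/

/-- A Feynman diagram: every connected component contains at least one leg. -/
structure FeynmanDiagram (𝔖 : LabelSystem d 𝔏) : Type 1 where
  V : Type
  E : Type
  [fintypeV : Fintype V]
  [fintypeE : Fintype E]
  k : ℕ
  G : LGraph 𝔖 V E k
  has_leg : ∀ v, ∃ j, G.conn Finset.univ v (G.leg j)

attribute [instance] FeynmanDiagram.fintypeV FeynmanDiagram.fintypeE

namespace FeynmanDiagram

variable {𝔖 : LabelSystem d 𝔏}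

/-- Change of labels. -/
def shift (Γ : FeynmanDiagram 𝔖) (l : HalfEdge Γ.E Γ.k → MultiIndex d) : FeynmanDiagram 𝔖 where
  V := Γ.V
  E := Γ.E
  k := Γ.k
  G := Γ.G.shift l
  has_leg := Γ.has_leg

/-- `Γ / (S, ℓ)`. -/
def contract (Γ : FeynmanDiagram 𝔖) (S : Finset Γ.E) (l : HalfEdge Γ.E Γ.k → MultiIndex d) :
    FeynmanDiagram 𝔖 where
  V := Quotient (Γ.G.conn S)
  E := {e // e ∉ S}
  k := Γ.k
  G := (Γ.G.shift l).contract S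
  has_leg q := by
    induction q using Quotient.inductionOn with
    | h v =>
      obtain ⟨j, hj⟩ := Γ.has_leg v
      exact ⟨j, (Γ.G.shift l).conn_contract hj⟩

end FeynmanDiagram

/-- The free vector space on Feynman diagrams. Isomorphic diagrams are identified only in the
quotient `H` below. -/
abbrev T (𝔖 : LabelSystem d 𝔏) := FeynmanDiagram 𝔖 →₀ ℝ

/-- The relations defining `H`: isomorphic diagrams are identified, and for every inner vertex `v`
and direction `i` the sum of `∂_h^{δ_i} Γ` over the half-edges `h` at `v` vanishes. -/
inductive IsRelT (𝔖 : LabelSystem d 𝔏) : T 𝔖 → Prop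
  | iso (Γ Γ' : FeynmanDiagram 𝔖) (f : LGraph.Iso Γ.G Γ'.G) :
      IsRelT 𝔖 (Finsupp.single Γ 1 - Finsupp.single Γ' 1)
  | ibp (Γ : FeynmanDiagram 𝔖) (v : Γ.V) (i : Fin d) :
      IsRelT 𝔖 (∑ h ∈ Finset.univ.filter (fun h => Γ.G.vert h = v),
        Finsupp.single (Γ.shift (Pi.single h (Pi.single i 1))) (halfSign h))

/-- The space spanned by the relations. -/
def dT (𝔖 : LabelSystem d 𝔏) : Submodule ℝ (T 𝔖) := Submodule.span ℝ {x | IsRelT 𝔖 x}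

/-- Feynman diagrams modulo integration by parts. -/
abbrev H (𝔖 : LabelSystem d 𝔏) := T 𝔖 ⧸ dT 𝔖

/-- The class of a Feynman diagram in `H`. -/
def FeynmanDiagram.toH {𝔖 : LabelSystem d 𝔏} (Γ : FeynmanDiagram 𝔖) : H 𝔖 :=
  (dT 𝔖).mkQ (Finsupp.single Γ 1)

/-! ### Vacuum diagrams and the algebras `Ĥ_-` and `H_-` -/

/-- A connected vacuum diagram `(Γ, v_⋆, n)` with at least one edge. The unique leg is replaced by
the distinguished vertex `root` to which it is attached. -/
structure VacDiagram (𝔖 : LabelSystem d 𝔏) : Type 1 where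
  V : Type
  E : Type
  [fintypeV : Fintype V]
  [fintypeE : Fintype E]
  [nonemptyE : Nonempty E]
  G : LGraph 𝔖 V E 0
  connected : ∀ v w, G.conn Finset.univ v w
  root : V
  n : V → MultiIndex d

attribute [instance] VacDiagram.fintypeV VacDiagram.fintypeE VacDiagram.nonemptyE

namespace VacDiagram

variable {𝔖 : LabelSystem d 𝔏}

/-- The degree of a connected vacuum diagram. -/
def deg (τ : VacDiagram 𝔖) : ℝ :=
  ∑ e, 𝔖.deg (τ.G.lab e) + ∑ v, (order (τ.n v) : ℝ) + (d : ℝ) * ((Fintype.card τ.V : ℝ) - 1)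

/-- Change of edge labels. -/
def shift (τ : VacDiagram 𝔖) (l : HalfEdge τ.E 0 → MultiIndex d) : VacDiagram 𝔖 where
  V := τ.V
  E := τ.E
  G := τ.G.shift l
  connected := τ.connected
  root := τ.root
  n := τ.n

/-- The same graph with another distinguished vertex and node decoration. -/
def redecorate (τ : VacDiagram 𝔖) (v : τ.V) (m : τ.V → MultiIndex d) : VacDiagram 𝔖 where
  V := τ.V
  E := τ.E
  G := τ.G
  connected := τ.connected
  root := v
  n := m

/-- The contraction of a subgraph `S` other than the full graph, with new labels given by `ℓ` and
with the node decoration obtained by summation of `m`. -/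
def contract (τ : VacDiagram 𝔖) (S : Finset τ.E) (hS : S ≠ Finset.univ)
    (l : HalfEdge τ.E 0 → MultiIndex d) (m : τ.V → MultiIndex d) : VacDiagram 𝔖 where
  V := Quotient (τ.G.conn S)
  E := {e // e ∉ S}
  nonemptyE := by
    by_contra h
    exact hS (Finset.eq_univ_iff_forall.2 fun e => by_contra fun he => h ⟨⟨e, he⟩⟩)
  G := (τ.G.shift l).contract S
  connected p q := by
    induction p using Quotient.inductionOn with
    | h v =>
      induction q using Quotient.inductionOn with
      | h w => exact (τ.G.shift l).conn_contract (τ.connected v w)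
  root := Quotient.mk _ τ.root
  n := τ.G.contractDec S m

end VacDiagram

/-- The algebra of vacuum diagrams all of whose components have an edge: the free commutative
algebra on connected such diagrams. Isomorphic diagrams are identified only in the quotients. -/
abbrev That (𝔖 : LabelSystem d 𝔏) := MvPolynomial (VacDiagram 𝔖) ℝ

/-- A connected vacuum diagram as an element of the algebra of vacuum diagrams. -/
abbrev VacDiagram.toThat {𝔖 : LabelSystem d 𝔏} (τ : VacDiagram 𝔖) : That 𝔖 := MvPolynomial.X τ

/-- The sum of `(∂_h^{δ_i} Γ, v_⋆, n)` over the half-edges `h` at `v`. -/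
def VacDiagram.sumHalf {𝔖 : LabelSystem d 𝔏} (τ : VacDiagram 𝔖) (v : τ.V) (i : Fin d) : That 𝔖 :=
  ∑ h ∈ Finset.univ.filter (fun h => τ.G.vert h = v),
    halfSign h • (τ.shift (Pi.single h (Pi.single i 1))).toThat

/-- `n(v)_i (Γ, v_⋆, n - δ_i 1_v)`. -/
def VacDiagram.lower {𝔖 : LabelSystem d 𝔏} (τ : VacDiagram 𝔖) (v : τ.V) (i : Fin d) : That 𝔖 :=
  (τ.n v i : ℝ) • (τ.redecorate τ.root (τ.n - Pi.single v (Pi.single i 1))).toThat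

/-- The relations between vacuum diagrams: isomorphism, integration by parts at a vertex other
than the distinguished one, integration by parts at the distinguished vertex, and change of the
distinguished vertex. -/
inductive IsRelVac (𝔖 : LabelSystem d 𝔏) : That 𝔖 → Prop
  | iso (τ τ' : VacDiagram 𝔖) (f : LGraph.Iso τ.G τ'.G) (hroot : τ'.root = f.onV τ.root)
      (hn : ∀ v, τ'.n (f.onV v) = τ.n v) : IsRelVac 𝔖 (τ.toThat - τ'.toThat)
  | ibp (τ : VacDiagram 𝔖) (v : τ.V) (hv : v ≠ τ.root) (i : Fin d) :
      IsRelVac 𝔖 (τ.sumHalf v i + τ.lower v i)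
  | ibpRoot (τ : VacDiagram 𝔖) (i : Fin d) :
      IsRelVac 𝔖 (τ.sumHalf τ.root i
        - ∑ v ∈ Finset.univ.filter (fun v => v ≠ τ.root), τ.lower v i)
  | moveRoot (τ : VacDiagram 𝔖) (v : τ.V) :
      IsRelVac 𝔖 (τ.toThat - ∑ᶠ m : τ.V → MultiIndex d,
        ((-1 : ℝ) ^ (∑ u, order (m u)) * (multiChoose τ.n m : ℝ)) •
          (τ.redecorate v (τ.n - m + Pi.single τ.root (∑ u, m u))).toThat)

/-- The ideal generated by the relations. -/
def dThat (𝔖 : LabelSystem d 𝔏) : Ideal (That 𝔖) := Ideal.span {x | IsRelVac 𝔖 x}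

/-- The ideal generated by the vacuum diagrams of strictly positive degree. -/
def Jplus (𝔖 : LabelSystem d 𝔏) : Ideal (That 𝔖) :=
  Ideal.span {x | ∃ τ : VacDiagram 𝔖, 0 < τ.deg ∧ x = τ.toThat}

/-- The algebra `Ĥ_-`. -/
abbrev Hhat (𝔖 : LabelSystem d 𝔏) := That 𝔖 ⧸ dThat 𝔖

/-- The algebra `H_-`, in which vacuum diagrams with a component of positive degree vanish. -/
abbrev Hminus (𝔖 : LabelSystem d 𝔏) := That 𝔖 ⧸ (dThat 𝔖 ⊔ Jplus 𝔖)

/-- The projection onto `Ĥ_-`. -/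
def toHhat (𝔖 : LabelSystem d 𝔏) : That 𝔖 →ₐ[ℝ] Hhat 𝔖 := Ideal.Quotient.mkₐ ℝ _

/-- The projection onto `H_-`. -/
def toHminus (𝔖 : LabelSystem d 𝔏) : That 𝔖 →ₐ[ℝ] Hminus 𝔖 := Ideal.Quotient.mkₐ ℝ _

/-! ### Extraction of subgraphs, coaction and coproduct -/

namespace LGraph

variable {𝔖 : LabelSystem d 𝔏} {V E : Type} {k : ℕ}

/-- A connected subgraph with a node decoration `m` as a vacuum diagram; its distinguished vertex
is an element of `R` if it contains one, and an arbitrary vertex otherwise. -/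
def piece [Fintype V] (G : LGraph 𝔖 V E k) (R : Finset V) (S : Finset E) (hS : G.IsConn S)
    (m : V → MultiIndex d) : VacDiagram 𝔖 where
  V := {v // v ∈ G.verts S}
  E := {e // e ∈ S}
  nonemptyE := hS.1.to_subtype
  G := G.sub S
  connected := G.conn_sub hS
  root := G.pick R S hS.1
  n v := m v.1

/-- The vacuum diagram `(S, m)` given by a subgraph `S`, as product of its components. -/
def extract [Fintype V] (G : LGraph 𝔖 V E k) (R : Finset V) (S : Finset E)
    (m : V → MultiIndex d) : That 𝔖 :=
  ∏ c ∈ (G.comps S).attach, (G.piece R c.1 (G.isConn_of_mem_comps c.2) m).toThat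

end LGraph

/-- The coaction `Δ`, on a Feynman diagram. -/
def coaction {𝔖 : LabelSystem d 𝔏} (Γ : FeynmanDiagram 𝔖) : Hminus 𝔖 ⊗[ℝ] H 𝔖 :=
  ∑ S : Finset Γ.E, ∑ᶠ l : {h // h ∈ Γ.G.boundary S} → MultiIndex d,
    ((-1 : ℝ) ^ outOrder (extendZero l) / (multiFactorial l : ℝ)) •
      (toHminus 𝔖 (Γ.G.extract ∅ S (Γ.G.push (extendZero l)))
        ⊗ₜ[ℝ] (Γ.contract S (extendZero l)).toH)

/-- `(Γ, v_⋆, m) / (S, ℓ)` in the algebra of vacuum diagrams. If `S` is all of `Γ`, this is an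
isolated node, identified with `1` if its decoration vanishes and with `0` otherwise. -/
def VacDiagram.quot {𝔖 : LabelSystem d 𝔏} (τ : VacDiagram 𝔖) (S : Finset τ.E)
    (l : HalfEdge τ.E 0 → MultiIndex d) (m : τ.V → MultiIndex d) : That 𝔖 :=
  if hS : S ≠ Finset.univ then (τ.contract S hS l m).toThat
  else if ∑ v, m v = 0 then 1 else 0

/-- The map `Δ^-`, on a connected vacuum diagram. -/
def coproduct {𝔖 : LabelSystem d 𝔏} (τ : VacDiagram 𝔖) : Hminus 𝔖 ⊗[ℝ] Hhat 𝔖 :=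
  ∑ S : Finset τ.E, ∑ᶠ l : {h // h ∈ τ.G.boundary S} → MultiIndex d,
    ∑ᶠ m : {v // v ∈ τ.G.verts S} → MultiIndex d,
      ((-1 : ℝ) ^ outOrder (extendZero l) / (multiFactorial l : ℝ)
          * (multiChoose τ.n (extendZero m) : ℝ)) •
        (toHminus 𝔖 (τ.G.extract {τ.root} S (extendZero m + τ.G.push (extendZero l)))
          ⊗ₜ[ℝ] toHhat 𝔖 (τ.quot S (extendZero l) (τ.n - extendZero m)))

/-- The defining property of the twisted antipode: `M (Â ⊗ id) Δ^- τ = 0` for every connected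
vacuum diagram `τ` with an edge such that `deg τ ≤ 0`. -/
def IsTwistedAntipode {𝔖 : LabelSystem d 𝔏} (A : Hminus 𝔖 →ₐ[ℝ] Hhat 𝔖) : Prop :=
  ∀ τ : VacDiagram 𝔖, τ.deg ≤ 0 →
    LinearMap.mul' ℝ (Hhat 𝔖) (TensorProduct.map A.toLinearMap LinearMap.id (coproduct τ)) = 0

/-! ### Contraction operators -/

/-- The generators of the space `T_Γ` if `Γ` has internal edges `E` and `k` legs: diagrams with the
same internal edges and legs, such that each connected component has either at least one leg or a
unique distinguished vertex (an element of `roots`), but not both, with a node decoration that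
vanishes on components with legs. -/
structure MixedDiagram (𝔖 : LabelSystem d 𝔏) (E : Type) [Fintype E] (k : ℕ) : Type 1 where
  V : Type
  [fintypeV : Fintype V]
  G : LGraph 𝔖 V E k
  roots : Finset V
  n : V → MultiIndex d
  covered : ∀ v, (∃ j, G.conn Finset.univ v (G.leg j)) ∨ ∃ r ∈ roots, G.conn Finset.univ v r
  no_leg : ∀ r ∈ roots, ∀ j, ¬ G.conn Finset.univ r (G.leg j)
  root_unique : ∀ r ∈ roots, ∀ r' ∈ roots, G.conn Finset.univ r r' → r = r'
  n_eq_zero : ∀ v j, G.conn Finset.univ v (G.leg j) → n v = 0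

attribute [instance] MixedDiagram.fintypeV

/-- The space `T_Γ`. -/
abbrev TMixed (𝔖 : LabelSystem d 𝔏) (E : Type) [Fintype E] (k : ℕ) := MixedDiagram 𝔖 E k →₀ ℝ

/-- A Feynman diagram as an element of `T_Γ`. -/
def FeynmanDiagram.toMixed {𝔖 : LabelSystem d 𝔏} (Γ : FeynmanDiagram 𝔖) :
    MixedDiagram 𝔖 Γ.E Γ.k where
  V := Γ.V
  G := Γ.G
  roots := ∅
  n := 0
  covered v := Or.inl (Γ.has_leg v)
  no_leg := by simp
  root_unique := by simp
  n_eq_zero _ _ _ := rfl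

namespace LGraph

variable {𝔖 : LabelSystem d 𝔏} {V E : Type} {k : ℕ}

/-- The disjoint union of the subgraph `S` and of the graph where `S` is contracted, with the same
edges and legs as the original graph. -/
def splitOff [Fintype V] (G : LGraph 𝔖 V E k) (S : Finset E) :
    LGraph 𝔖 ({v // v ∈ G.verts S} ⊕ Quotient (G.conn S)) E k where
  src e := if h : e ∈ S then Sum.inl ⟨G.src e, G.src_mem h⟩ else Sum.inr (Quotient.mk _ (G.src e))
  tgt e := if h : e ∈ S then Sum.inl ⟨G.tgt e, G.tgt_mem h⟩ else Sum.inr (Quotient.mk _ (G.tgt e))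
  lab := G.lab
  lab_internal := G.lab_internal
  leg j := Sum.inr (Quotient.mk _ (G.leg j))
  legLab := G.legLab
  legLab_delta := G.legLab_delta

lemma splitOff_conn_inl [Fintype V] [Fintype E] (G : LGraph 𝔖 V E k) {S : Finset E}
    (hS : G.IsConn S) (v w : {v // v ∈ G.verts S}) :
    (G.splitOff S).conn Finset.univ (Sum.inl v) (Sum.inl w) := by
  refine (G.sub S).conn_map Sum.inl _ (fun e _ => ?_) (G.conn_sub hS v w)
  have h := (G.splitOff S).conn_edge (Finset.mem_univ e.1)
  simpa [splitOff, sub, contract, e.2] using h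

lemma splitOff_conn_inr [Fintype V] [Fintype E] (G : LGraph 𝔖 V E k) (S : Finset E) {v w : V}
    (h : G.conn Finset.univ v w) :
    (G.splitOff S).conn Finset.univ (Sum.inr (Quotient.mk _ v)) (Sum.inr (Quotient.mk _ w)) := by
  refine (G.contract S).conn_map Sum.inr _ (fun e _ => ?_)
    (G.conn_contract (S := S) h)
  have h := (G.splitOff S).conn_edge (Finset.mem_univ e.1)
  simpa [splitOff, sub, contract, e.2] using h

/-- The component in the original graph of a vertex of the contracted part. -/
def compOf [Fintype V] [Fintype E] (G : LGraph 𝔖 V E k) (S : Finset E) :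
    {v // v ∈ G.verts S} ⊕ Quotient (G.conn S) → Option (Quotient (G.conn Finset.univ))
  | Sum.inl _ => none
  | Sum.inr q => some (Quotient.map' id (fun _ _ h =>
      G.conn_le (s := G.conn Finset.univ) (fun _ _ => G.conn_edge (Finset.mem_univ _)) h) q)

lemma splitOff_reflect [Fintype V] [Fintype E] (G : LGraph 𝔖 V E k) {S : Finset E}
    {x y : {v // v ∈ G.verts S} ⊕ Quotient (G.conn S)}
    (h : (G.splitOff S).conn Finset.univ x y) : G.compOf S x = G.compOf S y := by
  refine (G.splitOff S).conn_le (s := Setoid.ker (G.compOf S)) (fun e _ => ?_) h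
  rw [Setoid.ker_def]
  by_cases he : e ∈ S
  · simp [splitOff, he, compOf]
  · simp only [splitOff, he, compOf, dite_false]
    exact congrArg some (Quotient.sound (G.conn_edge (Finset.mem_univ e)))

lemma splitOff_reflect_inr [Fintype V] [Fintype E] (G : LGraph 𝔖 V E k) {S : Finset E} {v w : V}
    (h : (G.splitOff S).conn Finset.univ (Sum.inr (Quotient.mk _ v))
      (Sum.inr (Quotient.mk _ w))) : G.conn Finset.univ v w :=
  Quotient.exact (Option.some.inj (G.splitOff_reflect h))

/-- The part of a graph made of the components that contain a leg. -/
def legPart [Fintype E] (G : LGraph 𝔖 V E k) :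
    LGraph 𝔖 {v // ∃ j, G.conn Finset.univ v (G.leg j)}
      {e // ∃ j, G.conn Finset.univ (G.src e) (G.leg j)} k where
  src e := ⟨G.src e.1, e.2⟩
  tgt e := ⟨G.tgt e.1, e.2.imp fun _ h =>
    (G.conn _).trans ((G.conn _).symm (G.conn_edge (Finset.mem_univ _))) h⟩
  lab e := G.lab e.1
  lab_internal e := G.lab_internal e.1
  leg j := ⟨G.leg j, j, (G.conn _).refl _⟩
  legLab := G.legLab
  legLab_delta := G.legLab_delta

lemma conn_legPart [Fintype E] (G : LGraph 𝔖 V E k) {v w : V} (h : G.conn Finset.univ v w) :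
    ((∃ j, G.conn Finset.univ v (G.leg j)) ↔ ∃ j, G.conn Finset.univ w (G.leg j)) ∧
    ∀ hv hw, G.legPart.conn Finset.univ ⟨v, hv⟩ ⟨w, hw⟩ := by
  induction h with
  | rel x y h' =>
    obtain ⟨e, he, rfl, rfl⟩ := h'
    refine ⟨exists_congr fun j => ⟨fun h => (G.conn _).trans ((G.conn _).symm (G.conn_edge he)) h,
      fun h => (G.conn _).trans (G.conn_edge he) h⟩, fun hv hw => ?_⟩
    exact G.legPart.conn_edge (e := ⟨e, hv⟩) (Finset.mem_univ _)
  | refl x => exact ⟨Iff.rfl, fun _ _ => Setoid.refl' _ _⟩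
  | symm x y _ ih => exact ⟨ih.1.symm, fun hv hw => Setoid.symm' _ (ih.2 hw hv)⟩
  | trans x y z _ _ ih ih' =>
    exact ⟨ih.1.trans ih'.1, fun hv hw =>
      Setoid.trans' _ (ih.2 hv (ih.1.1 hv)) (ih'.2 (ih.1.1 hv) hw)⟩

end LGraph

namespace MixedDiagram

variable {𝔖 : LabelSystem d 𝔏} {E : Type} [Fintype E] {k : ℕ}

/-- The product `(γ, m + πℓ) · (Γ, n - m) / (γ, ℓ)`. The extracted copy of `γ` has as its
distinguished vertex the one already distinguished in `Γ` if there is one in `γ`, and an arbitrary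
vertex otherwise; the distinguished vertices of the quotient are the images of those of `Γ`. -/
def splitOff (D : MixedDiagram 𝔖 E k) (γ : Finset E) (hγ : D.G.IsConn γ)
    (l : HalfEdge E k → MultiIndex d) (m : D.V → MultiIndex d) : MixedDiagram 𝔖 E k where
  V := {v // v ∈ D.G.verts γ} ⊕ Quotient (D.G.conn γ)
  G := (D.G.shift l).splitOff γ
  roots := insert (Sum.inl (D.G.pick D.roots γ hγ.1))
    (D.roots.image fun r => Sum.inr (Quotient.mk _ r))
  n := Sum.elim (fun v => (m + D.G.push l) v.1) (D.G.contractDec γ (D.n - m))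
  covered x := by
    rcases x with v | q
    · exact Or.inr ⟨_, Finset.mem_insert_self _ _, (D.G.shift l).splitOff_conn_inl hγ _ _⟩
    · induction q using Quotient.inductionOn with
      | h v =>
        rcases D.covered v with ⟨j, hj⟩ | ⟨r, hr, h⟩
        · exact Or.inl ⟨j, (D.G.shift l).splitOff_conn_inr γ hj⟩
        · exact Or.inr ⟨_, Finset.mem_insert_of_mem (Finset.mem_image_of_mem _ hr),
            (D.G.shift l).splitOff_conn_inr γ h⟩
  no_leg r hr j h := by
    rcases Finset.mem_insert.1 hr with rfl | hr
    · have := (D.G.shift l).splitOff_reflect h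
      simp [LGraph.compOf, LGraph.splitOff] at this
    · obtain ⟨r, hr₀, rfl⟩ := Finset.mem_image.1 hr
      exact D.no_leg r hr₀ j ((D.G.shift l).splitOff_reflect_inr h)
  root_unique r hr r' hr' h := by
    rcases Finset.mem_insert.1 hr with rfl | hr <;> rcases Finset.mem_insert.1 hr' with rfl | hr'
    · rfl
    · obtain ⟨r', hr₁, rfl⟩ := Finset.mem_image.1 hr'
      have := (D.G.shift l).splitOff_reflect h
      simp [LGraph.compOf] at this
    · obtain ⟨r, hr₀, rfl⟩ := Finset.mem_image.1 hr
      have := (D.G.shift l).splitOff_reflect h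
      simp [LGraph.compOf] at this
    · obtain ⟨r, hr₀, rfl⟩ := Finset.mem_image.1 hr
      obtain ⟨r', hr₁, rfl⟩ := Finset.mem_image.1 hr'
      rw [D.root_unique r hr₀ r' hr₁ ((D.G.shift l).splitOff_reflect_inr h)]
  n_eq_zero x j h := by
    rcases x with v | q
    · have := (D.G.shift l).splitOff_reflect h
      simp [LGraph.compOf, LGraph.splitOff] at this
    · induction q using Quotient.inductionOn with
      | h v =>
        have hv : D.G.conn Finset.univ v (D.G.leg j) := (D.G.shift l).splitOff_reflect_inr h
        refine Finset.sum_eq_zero fun w hw => ?_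
        have hw' : D.G.conn γ w v := Quotient.exact (Finset.mem_filter.1 hw).2
        have hw'' : D.G.conn Finset.univ w v :=
          D.G.conn_le (fun e _ => D.G.conn_edge (Finset.mem_univ e)) hw'
        have := D.n_eq_zero w j ((D.G.conn _).trans hw'' hv)
        simp [this]

/-- The element `C_γ D` of `T_Γ`. It vanishes if `γ` is not connected in `D`. -/
def contractAt (γ : Finset E) (D : MixedDiagram 𝔖 E k) : TMixed 𝔖 E k :=
  if hγ : D.G.IsConn γ then
    ∑ᶠ l : {h // h ∈ D.G.boundary γ} → MultiIndex d,
      ∑ᶠ m : {v // v ∈ D.G.verts γ} → MultiIndex d,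
        if D.G.subDeg γ (extendZero m + D.G.push (extendZero l)) ≤ 0 then
          Finsupp.single (D.splitOff γ hγ (extendZero l) (extendZero m))
            ((-1 : ℝ) ^ outOrder (extendZero l) / (multiFactorial l : ℝ)
              * (multiChoose D.n (extendZero m) : ℝ))
        else 0
  else 0

/-- The contribution of the component with distinguished vertex `r`. An isolated node is identified
with `1` if its decoration vanishes and with `0` otherwise. -/
def rootComponent (D : MixedDiagram 𝔖 E k) (r : D.V) : That 𝔖 :=
  if h : (D.G.comp Finset.univ r).Nonempty then
    (D.G.piece D.roots (D.G.comp Finset.univ r) (D.G.isConn_comp h) D.n).toThat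
  else if D.n r = 0 then 1 else 0

/-- The Feynman diagram made of the components with legs. -/
def legPart (D : MixedDiagram 𝔖 E k) : FeynmanDiagram 𝔖 where
  V := {v // ∃ j, D.G.conn Finset.univ v (D.G.leg j)}
  E := {e // ∃ j, D.G.conn Finset.univ (D.G.src e) (D.G.leg j)}
  k := k
  G := D.G.legPart
  has_leg v := by
    obtain ⟨j, hj⟩ := v.2
    exact ⟨j, (D.G.conn_legPart hj).2 _ _⟩

/-- The image in `Ĥ_- ⊗ H`: the components with a distinguished vertex are kept in the first
factor, those with legs in the second one. -/
def toTensor (D : MixedDiagram 𝔖 E k) : Hhat 𝔖 ⊗[ℝ] H 𝔖 :=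
  toHhat 𝔖 (∏ r ∈ D.roots, D.rootComponent r) ⊗ₜ[ℝ] D.legPart.toH

end MixedDiagram

/-- The contraction operator `C_γ` on `T_Γ`. -/
def contractOp (𝔖 : LabelSystem d 𝔏) {E : Type} [Fintype E] (k : ℕ) (γ : Finset E) :
    Module.End ℝ (TMixed 𝔖 E k) :=
  Finsupp.linearCombination ℝ (MixedDiagram.contractAt γ)

/-- The canonical linear map from `T_Γ` to `Ĥ_- ⊗ H`. -/
def toTensor (𝔖 : LabelSystem d 𝔏) (E : Type) [Fintype E] (k : ℕ) :
    TMixed 𝔖 E k →ₗ[ℝ] Hhat 𝔖 ⊗[ℝ] H 𝔖 :=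
  Finsupp.linearCombination ℝ MixedDiagram.toTensor

/-! ### Forests -/

/-- The roots of a set of subgraphs: its maximal elements. -/
def forestRoots {E : Type} (F : Finset (Finset E)) : Finset (Finset E) :=
  F.filter fun γ => ∀ γ' ∈ F, γ ⊆ γ' → γ' = γ

lemma forestRoots_nonempty {E : Type} {F : Finset (Finset E)} (hF : F.Nonempty) :
    (forestRoots F).Nonempty := by
  obtain ⟨γ, hγ⟩ := F.exists_maximal hF
  exact ⟨γ, Finset.mem_filter.2 ⟨hγ.1, fun γ' h h' => (hγ.2 h h').antisymm h'⟩⟩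

/-- The operator `C_F`: the roots are contracted first, in an arbitrary order, and then the
remaining elements of the forest, recursively. -/
def forestOp (𝔖 : LabelSystem d 𝔏) {E : Type} [Fintype E] (k : ℕ) (F : Finset (Finset E)) :
    Module.End ℝ (TMixed 𝔖 E k) :=
  if hF : F.Nonempty then
    forestOp 𝔖 k (F \ forestRoots F) * ((forestRoots F).toList.map (contractOp 𝔖 k)).prod
  else 1
termination_by F.card
decreasing_by
  have h := forestRoots_nonempty hF
  exact Finset.card_lt_card (Finset.sdiff_ssubset (Finset.filter_subset _ _) h)

namespace FeynmanDiagram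

variable {𝔖 : LabelSystem d 𝔏}

/-- A forest: a set of connected divergent subgraphs any two of which are either comparable or
vertex-disjoint. -/
def IsForest (Γ : FeynmanDiagram 𝔖) (F : Finset (Finset Γ.E)) : Prop :=
  (∀ γ ∈ F, Γ.G.IsConn γ ∧ Γ.G.subDeg γ 0 ≤ 0) ∧
  ∀ γ ∈ F, ∀ γ' ∈ F, γ ⊆ γ' ∨ γ' ⊆ γ ∨ Disjoint (Γ.G.verts γ) (Γ.G.verts γ')

/-- The set of all forests, including the empty one. -/
def forests (Γ : FeynmanDiagram 𝔖) : Finset (Finset (Finset Γ.E)) :=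
  Finset.univ.filter Γ.IsForest

/-- `C_F Γ`. -/
def contractForest (Γ : FeynmanDiagram 𝔖) (F : Finset (Finset Γ.E)) : TMixed 𝔖 Γ.E Γ.k :=
  forestOp 𝔖 Γ.k F (Finsupp.single Γ.toMixed 1)

end FeynmanDiagram

end BPHZ

end

/-!
Feynman diagrams and connected vacuum diagrams stand for integrals in which the vertices are
integration variables, and a decoration `n` for the monomial `X^n`. The relations say that these
integrals are compatible with integration by parts and with translations.

*Extraction.* The term of a subgraph `S` in `Δ` and in `Δ^-` is a sum over families of multiindices
on the half-edges of the boundary and on the vertices of `S`, which has the form of an exponential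
series (`extraction`). Hence it has an adjointness property (`esum_adjoint`, `extraction_adjoint`):
lowering the decoration of the extracted subgraph at a vertex amounts to differentiating the
half-edges at this vertex and lowering the decoration there in the quotient. So the relations in the
extracted subgraph turn into those in the quotient, and extraction is compatible with integration by
parts (`extractWeight_ibp`). A change of the distinguished vertices changes the result by images of
the generators of translations only (`translate_eq`). This implies that the distinguished vertices
chosen for the extracted components do not matter (`extractWeight_congr_root`), and that extraction
is compatible with the third type of relations (`vacExtract_translate`).

*The twisted antipode.* The full graph contributes `χ τ` to `M (χ ⊗ id) Δ^- τ`
(`VacDiagram.term_univ`), and the other subgraphs only involve values of `χ` on diagrams with fewer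
edges. The defining identity is therefore a recursion on the number of edges, which yields uniqueness
(`IsTwistedAntipode.unique`). For existence, the function on diagrams defined by the recursion has
to respect the relations. This is the compatibility of extraction with the relations, summed over
all proper subgraphs (`properSum_invariant`); moreover, the relations are homogeneous and are thus
not affected by setting the function to zero in positive degree (`VacInvariant.truncate`).

*The forest formula.* Both sides are sums over subgraphs `S`: on the right-hand side, the forests are
sorted by their union. It is shown by induction on `S` that the extraction of `S`, evaluated by the
twisted antipode `χ`, is the sum over the forests with union `S` (`extractValue_eq_sum_forests`).

- Extraction of `S` is the same as contraction of its components one after the other, followed by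
  evaluation of these components by `χ` (`extractValue_union`, `value_contractList`). The terms with
  a component of positive degree are those in which `χ` vanishes; in the operators `C_γ` they are
  removed by the indicator function.
- Once the components of `S` are on their own, the identity defining the antipode expresses `χ` on
  each of them by the extraction of proper subgraphs, with a sign. Since extraction factorizes over
  the components (`extractWeight_insert`), this gives `(-1)` to the number of components of `S`
  times the sum of the extractions of all subgraphs of `S` that contain no component of `S`
  (`value_eq_sum`). To these the induction hypothesis applies.
- The maximal elements of a forest are the components of its union (`IsForest.roots_eq`), and their
  removal leaves an arbitrary forest whose union is contained in `S` and contains no component of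
  `S` (`sum_forests_edges`).
-/

open scoped TensorProduct Classical

noncomputable section

set_option linter.unusedSectionVars false
namespace BPHZ
variable {d : ℕ} {𝔏 : Type}

open LGraph

/-! ### Sums over multiindices -/

section MultiSums

variable {α β γ V M : Type*}

/-- The family of multiindices that is `δ_i` at `a` and vanishes elsewhere. -/
abbrev unit [DecidableEq α] (a : α) (i : Fin d) : α → MultiIndex d := Pi.single a (Pi.single i 1)

/-- The total order of a family of multiindices. -/
def tot [Fintype α] (y : α → MultiIndex d) : ℕ := ∑ a, order (y a)

/-- The families of multiindices supported in `I`. -/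
def Supp (d : ℕ) (I : Set α) : Set (α → MultiIndex d) := {y | ∀ a, a ∉ I → y a = 0}

/-- The sum of `f` over the families of multiindices supported in `I`. -/
def esum [AddCommMonoid M] (I : Set α) (f : (α → MultiIndex d) → M) : M :=
  ∑ᶠ y, (Supp d I).indicator f y

lemma order_add (k l : MultiIndex d) : order (k + l) = order k + order l :=
  Finset.sum_add_distrib

lemma order_zero : order (0 : MultiIndex d) = 0 := by simp [order]

lemma order_single (i : Fin d) (n : ℕ) : order (Pi.single i n : MultiIndex d) = n := by
  simp [order]

lemma order_sum {ι : Type*} (s : Finset ι) (f : ι → MultiIndex d) :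
    order (∑ a ∈ s, f a) = ∑ a ∈ s, order (f a) := by
  simp only [order, Finset.sum_apply]
  exact Finset.sum_comm

lemma tot_add [Fintype α] (y z : α → MultiIndex d) : tot (y + z) = tot y + tot z := by
  simp [tot, order_add, Finset.sum_add_distrib]

lemma tot_unit [Fintype α] [DecidableEq α] (a : α) (i : Fin d) :
    tot (unit a i : α → MultiIndex d) = 1 := by
  unfold tot
  rw [Finset.sum_eq_single a]
  · simp [order_single]
  · intro b _ hb
    simp [Pi.single_eq_of_ne hb, order_zero]
  · simp

lemma tot_zero [Fintype α] : tot (0 : α → MultiIndex d) = 0 := by simp [tot, order_zero]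

lemma le_tot [Fintype α] (y : α → MultiIndex d) (a : α) (i : Fin d) : y a i ≤ tot y :=
  (Finset.single_le_sum (f := fun i => y a i) (fun _ _ => Nat.zero_le _) (Finset.mem_univ i)).trans
    (Finset.single_le_sum (f := fun a => order (y a)) (fun _ _ => Nat.zero_le _)
      (Finset.mem_univ a))

lemma tot_eq_zero [Fintype α] {y : α → MultiIndex d} (h : tot y = 0) : y = 0 := by
  funext a i
  exact Nat.le_zero.1 (h ▸ le_tot y a i)

lemma finite_tot_le [Fintype α] (N : ℕ) : {y : α → MultiIndex d | tot y ≤ N}.Finite :=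
  (Set.finite_Iic (fun (_ : α) (_ : Fin d) => N)).subset fun y hy a i => (le_tot y a i).trans hy

lemma zero_mem_Supp (I : Set α) : (0 : α → MultiIndex d) ∈ Supp d I := fun _ _ => rfl

lemma add_unit_mem_Supp [DecidableEq α] {I : Set α} {y : α → MultiIndex d} {a : α} (ha : a ∈ I)
    (i : Fin d) : y + unit a i ∈ Supp d I ↔ y ∈ Supp d I := by
  refine forall_congr' fun b => imp_congr_right fun hb => ?_
  have : b ≠ a := fun h => hb (h ▸ ha)
  simp [Pi.single_eq_of_ne this]

/-- The function is supported on multiindices of bounded order. -/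
def Bounded [Fintype α] [Zero M] (I : Set α) (f : (α → MultiIndex d) → M) : Prop :=
  ∃ N, ∀ y ∈ Supp d I, N < tot y → f y = 0

section AddCommMonoid

variable [Fintype α] [Fintype β] [Fintype γ] [AddCommMonoid M]

lemma Bounded.finite {I : Set α} {f : (α → MultiIndex d) → M} (hf : Bounded I f) :
    (Function.support ((Supp d I).indicator f)).Finite := by
  obtain ⟨N, hN⟩ := hf
  refine (finite_tot_le N).subset fun y hy => ?_
  by_contra h
  refine hy ?_
  by_cases hI : y ∈ Supp d I
  · rw [Set.indicator_of_mem hI]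
    exact hN y hI (not_le.1 h)
  · exact Set.indicator_of_notMem hI _

lemma esum_congr {I : Set α} {f g : (α → MultiIndex d) → M} (h : ∀ y ∈ Supp d I, f y = g y) :
    esum I f = esum I g := by
  unfold esum
  congr 1
  funext y
  by_cases hI : y ∈ Supp d I
  · rw [Set.indicator_of_mem hI, Set.indicator_of_mem hI, h y hI]
  · rw [Set.indicator_of_notMem hI, Set.indicator_of_notMem hI]

lemma esum_zero {I : Set α} {f : (α → MultiIndex d) → M} (h : ∀ y ∈ Supp d I, f y = 0) :
    esum I f = 0 := by
  rw [esum_congr h]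
  simp [esum]

lemma Bounded.congr {I : Set α} {f g : (α → MultiIndex d) → M} (hf : Bounded I f)
    (h : ∀ y ∈ Supp d I, f y = 0 → g y = 0) : Bounded I g := by
  obtain ⟨N, hN⟩ := hf
  exact ⟨N, fun y hy hy' => h y hy (hN y hy hy')⟩

lemma Bounded.sum {ι : Type*} {s : Finset ι} {I : Set α} {f : ι → (α → MultiIndex d) → M}
    (hf : ∀ c ∈ s, Bounded I (f c)) : Bounded I (fun y => ∑ c ∈ s, f c y) := by
  choose! N hN using hf
  refine ⟨s.sup N, fun y hy hy' => Finset.sum_eq_zero fun c hc => hN c hc y hy ?_⟩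
  exact (Finset.le_sup hc).trans_lt hy'

lemma esum_add {I : Set α} {f g : (α → MultiIndex d) → M} (hf : Bounded I f)
    (hg : Bounded I g) : esum I (fun y => f y + g y) = esum I f + esum I g := by
  unfold esum
  rw [← finsum_add_distrib hf.finite hg.finite]
  congr 1
  funext y
  exact congrFun (Set.indicator_add (Supp d I) f g) y

lemma esum_sum {ι : Type*} {s : Finset ι} {I : Set α} {f : ι → (α → MultiIndex d) → M}
    (hf : ∀ c ∈ s, Bounded I (f c)) :
    esum I (fun y => ∑ c ∈ s, f c y) = ∑ c ∈ s, esum I (f c) := by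
  induction s using Finset.induction_on with
  | empty => simpa using esum_zero (M := M) (I := I) (fun _ _ => rfl)
  | insert c s hc ih =>
    simp only [Finset.sum_insert hc]
    rw [esum_add (hf c (Finset.mem_insert_self _ _))
      (Bounded.sum fun c hc => hf c (Finset.mem_insert_of_mem hc)),
      ih fun c hc => hf c (Finset.mem_insert_of_mem hc)]

lemma esum_map {M' : Type*} [AddCommMonoid M'] (φ : M →+ M') {I : Set α}
    {f : (α → MultiIndex d) → M} (hf : Bounded I f) :
    φ (esum I f) = esum I (fun y => φ (f y)) := by
  unfold esum
  rw [φ.map_finsum hf.finite]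
  congr 1
  funext y
  by_cases hI : y ∈ Supp d I
  · rw [Set.indicator_of_mem hI, Set.indicator_of_mem hI]
  · rw [Set.indicator_of_notMem hI, Set.indicator_of_notMem hI, map_zero]

/-- Change of summation variable `y ↦ y + δ_i 1_a`. -/
lemma esum_shift [DecidableEq α] {I : Set α} {f : (α → MultiIndex d) → M} {a : α} (ha : a ∈ I)
    (i : Fin d) (h : ∀ y ∈ Supp d I, y a i = 0 → f y = 0) :
    esum I f = esum I (fun y => f (y + unit a i)) := by
  have hinj : Function.Injective (fun y : α → MultiIndex d => y + unit a i) :=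
    add_left_injective _
  unfold esum
  have h1 : ∀ y, (Supp d I).indicator (fun y => f (y + unit a i)) y
      = (Supp d I).indicator f (y + unit a i) := fun y => by
    simp only [Set.indicator, add_unit_mem_Supp ha]
  simp only [h1]
  rw [← finsum_mem_range hinj, finsum_mem_def]
  congr 1
  funext y
  by_cases hy : y ∈ Set.range (fun y : α → MultiIndex d => y + unit a i)
  · rw [Set.indicator_of_mem hy]
  · rw [Set.indicator_of_notMem hy]
    by_cases hI : y ∈ Supp d I
    · rw [Set.indicator_of_mem hI]
      refine h y hI (by_contra fun hne => hy ⟨y - unit a i, ?_⟩)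
      funext b j
      by_cases hb : b = a
      · subst hb
        by_cases hj : j = i
        · subst hj
          simpa using Nat.sub_add_cancel (Nat.pos_of_ne_zero hne)
        · simp [Pi.single_eq_of_ne hj]
      · simp [Pi.single_eq_of_ne hb]
    · exact Set.indicator_of_notMem hI _

/-- Change of the index type in a sum over multiindices. -/
lemma esum_bij {I : Set α} {J : Set β} {f : (α → MultiIndex d) → M}
    {g : (β → MultiIndex d) → M} (p : (α → MultiIndex d) → (β → MultiIndex d))
    (q : (β → MultiIndex d) → (α → MultiIndex d)) (hp : ∀ y ∈ Supp d I, p y ∈ Supp d J)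
    (hq : ∀ z ∈ Supp d J, q z ∈ Supp d I) (hqp : ∀ y ∈ Supp d I, q (p y) = y)
    (hpq : ∀ z ∈ Supp d J, p (q z) = z) (h : ∀ y ∈ Supp d I, f y = g (p y)) :
    esum I f = esum J g := by
  unfold esum
  rw [← finsum_mem_def, ← finsum_mem_def]
  exact finsum_mem_eq_of_bijOn p ⟨hp, fun y hy z hz hyz => by
    rw [← hqp y hy, ← hqp z hz, hyz], fun z hz => ⟨q z, hq z hz, hpq z hz⟩⟩ h

/-- Splitting of the summation variable into two. -/
lemma esum_prod {I : Set α} {J : Set β} {K : Set γ} {f : (γ → MultiIndex d) → M}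
    (e : (α → MultiIndex d) → (β → MultiIndex d) → (γ → MultiIndex d))
    (p : (γ → MultiIndex d) → (α → MultiIndex d)) (q : (γ → MultiIndex d) → (β → MultiIndex d))
    (he : ∀ y ∈ Supp d I, ∀ z ∈ Supp d J, e y z ∈ Supp d K ∧ p (e y z) = y ∧ q (e y z) = z)
    (hpq : ∀ x ∈ Supp d K, p x ∈ Supp d I ∧ q x ∈ Supp d J ∧ e (p x) (q x) = x)
    (hf : Bounded K f) :
    esum K f = esum I (fun y => esum J (fun z => f (e y z))) := by
  set F : (α → MultiIndex d) × (β → MultiIndex d) → M :=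
    (Supp d I ×ˢ Supp d J).indicator (fun x => f (e x.1 x.2)) with hF
  have h1 : esum K f = ∑ᶠ x, F x := by
    unfold esum
    rw [← finsum_mem_def, hF, ← finsum_mem_def]
    refine finsum_mem_eq_of_bijOn (fun x => (p x, q x)) ⟨fun x hx => ⟨(hpq x hx).1, (hpq x hx).2.1⟩,
      fun x hx y hy hxy => ?_, fun x hx => ⟨e x.1 x.2, (he _ hx.1 _ hx.2).1, ?_⟩⟩ ?_
    · have := Prod.mk.inj hxy
      rw [← (hpq x hx).2.2, ← (hpq y hy).2.2, this.1, this.2]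
    · exact Prod.ext (he _ hx.1 _ hx.2).2.1 (he _ hx.1 _ hx.2).2.2
    · intro x hx
      simp only [(hpq x hx).2.2]
  have hfin : (Function.support F).Finite := by
    refine ((hf.finite).image (fun x => (p x, q x))).subset fun x hx => ?_
    have hx' : x ∈ Supp d I ×ˢ Supp d J := by
      by_contra h
      exact hx (Set.indicator_of_notMem h _)
    refine ⟨e x.1 x.2, ?_, Prod.ext (he _ hx'.1 _ hx'.2).2.1 (he _ hx'.1 _ hx'.2).2.2⟩
    rw [Function.mem_support, hF, Set.indicator_of_mem hx'] at hx
    rw [Function.mem_support, Set.indicator_of_mem (he _ hx'.1 _ hx'.2).1]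
    exact hx
  rw [h1, finsum_curry F hfin]
  unfold esum
  congr 1
  funext y
  by_cases hy : y ∈ Supp d I
  · rw [Set.indicator_of_mem hy]
    congr 1
    funext z
    by_cases hz : z ∈ Supp d J
    · rw [Set.indicator_of_mem hz, hF, Set.indicator_of_mem (Set.mk_mem_prod hy hz)]
    · rw [Set.indicator_of_notMem hz, hF, Set.indicator_of_notMem fun h => hz h.2]
  · rw [Set.indicator_of_notMem hy]
    have : ∀ z, F (y, z) = 0 := fun z => by
      rw [hF, Set.indicator_of_notMem fun h => hy h.1]
    simp [this]

end AddCommMonoid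

lemma extendZero_mem_Supp {α : Type} {p : α → Prop} (l : {a // p a} → MultiIndex d) :
    extendZero l ∈ Supp d {a | p a} := fun a ha => by
  simp only [extendZero]
  exact dif_neg ha

lemma extendZero_restrict {α : Type} {p : α → Prop} {y : α → MultiIndex d}
    (hy : y ∈ Supp d {a | p a}) : extendZero (fun a : {a // p a} => y a.1) = y := by
  funext a
  by_cases h : p a
  · simp [extendZero, h]
  · simp [extendZero, h, hy a h]

lemma extendZero_apply {α : Type} {p : α → Prop} (l : {a // p a} → MultiIndex d)
    (a : {a // p a}) : extendZero l a.1 = l a := by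
  simp [extendZero, a.2]

/-- A sum over functions on a subset is a sum over functions with support in this subset. -/
lemma finsum_extendZero [AddCommMonoid M] {α : Type} {p : α → Prop}
    (f : (α → MultiIndex d) → M) :
    (∑ᶠ l : {a // p a} → MultiIndex d, f (extendZero l)) = esum {a | p a} f := by
  unfold esum
  rw [← finsum_mem_def]
  have hinj : Function.Injective (extendZero (d := d) (p := p)) := fun l l' h => by
    funext a
    rw [← extendZero_apply l a, ← extendZero_apply l' a, h]
  have hr : Set.range (extendZero (d := d) (p := p)) = Supp d {a | p a} := by
    ext y
    refine ⟨?_, fun hy => ⟨_, extendZero_restrict hy⟩⟩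
    rintro ⟨l, rfl⟩
    exact extendZero_mem_Supp l
  rw [← hr, finsum_mem_range hinj]

/-- `1 / y!`. -/
def invFact [Fintype α] (y : α → MultiIndex d) : ℝ := (∏ a, ∏ i, ((y a i).factorial : ℝ))⁻¹

lemma prod_prod_add_unit [Fintype α] [DecidableEq α] {R : Type*} [CommMonoid R] (a : α)
    (i : Fin d) (f g : α → Fin d → R) (c : R) (h : f a i = c * g a i)
    (h' : ∀ b j, (b ≠ a ∨ j ≠ i) → f b j = g b j) :
    ∏ b, ∏ j, f b j = c * ∏ b, ∏ j, g b j := by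
  rw [← Finset.mul_prod_erase Finset.univ _ (Finset.mem_univ a),
    ← Finset.mul_prod_erase Finset.univ (fun b => ∏ j, g b j) (Finset.mem_univ a),
    ← Finset.mul_prod_erase Finset.univ _ (Finset.mem_univ i),
    ← Finset.mul_prod_erase Finset.univ (g a) (Finset.mem_univ i), h,
    Finset.prod_congr rfl (fun j hj => h' a j (Or.inr (Finset.ne_of_mem_erase hj))),
    Finset.prod_congr (s₁ := Finset.univ.erase a) rfl (fun b hb => Finset.prod_congr rfl
      (fun j _ => h' b j (Or.inl (Finset.ne_of_mem_erase hb))))]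
  simp only [mul_assoc]

lemma unit_apply_same [DecidableEq α] (a : α) (i : Fin d) : (unit a i : α → MultiIndex d) a i = 1 := by
  simp

lemma unit_apply_ne [DecidableEq α] {a b : α} {i j : Fin d} (h : b ≠ a ∨ j ≠ i) :
    (unit a i : α → MultiIndex d) b j = 0 := by
  rcases eq_or_ne b a with rfl | hb
  · rcases eq_or_ne j i with rfl | hj
    · simp at h
    · simp [Pi.single_eq_of_ne hj]
  · simp [Pi.single_eq_of_ne hb]

lemma invFact_add_unit [Fintype α] [DecidableEq α] (y : α → MultiIndex d) (a : α) (i : Fin d) :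
    ((y a i : ℝ) + 1) * invFact (y + unit a i) = invFact y := by
  unfold invFact
  rw [prod_prod_add_unit a i _ (fun b j => ((y b j).factorial : ℝ)) ((y a i : ℝ) + 1)]
  · rw [mul_inv, ← mul_assoc, mul_inv_cancel₀ (by positivity), one_mul]
  · simp [Pi.add_apply, Nat.factorial_succ]
  · intro b j h
    simp only [Pi.add_apply, unit_apply_ne h, add_zero]

/-- The sum of a family of multiindices over the fibres of a map. -/
def fib [Fintype α] (vt : α → V) (y : α → MultiIndex d) (v : V) : MultiIndex d :=
  ∑ a ∈ Finset.univ.filter (fun a => vt a = v), y a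

lemma fib_add [Fintype α] (vt : α → V) (y z : α → MultiIndex d) :
    fib vt (y + z) = fib vt y + fib vt z := by
  funext v
  simp [fib, Finset.sum_add_distrib]

lemma fib_unit [Fintype α] [DecidableEq α] [DecidableEq V] (vt : α → V) (a : α) (i : Fin d) :
    fib vt (unit a i) = unit (vt a) i := by
  funext v
  unfold fib
  rw [Finset.sum_filter]
  by_cases h : v = vt a
  · subst h
    rw [Finset.sum_eq_single a]
    · simp
    · intro b _ hb
      simp [Pi.single_eq_of_ne hb]
    · simp
  · rw [show (unit (vt a) i : V → MultiIndex d) v = 0 from Pi.single_eq_of_ne h _]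
    refine Finset.sum_eq_zero fun b _ => ?_
    rcases eq_or_ne b a with rfl | hb
    · rw [if_neg (Ne.symm h)]
    · simp [Pi.single_eq_of_ne hb]

section Module

variable [AddCommGroup M] [Module ℝ M] [Fintype α] [DecidableEq α] [Fintype V] [DecidableEq V]

lemma esum_smul (c : ℝ) {I : Set α} {f : (α → MultiIndex d) → M} (hf : Bounded I f) :
    esum I (fun y => c • f y) = c • esum I f :=
  (esum_map (DistribSMul.toAddMonoidHom M c) hf).symm

/-- Multiplication by `∂_v` in the first argument is dual to the sum of the derivatives in the
directions that are sent to `v`: this is the derivative of `exp(∑_a X_{v(a)} ∂_a)` with respect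
to `X_v`. -/
lemma esum_adjoint {I : Set α} (vt : α → V) (K : (V → MultiIndex d) → (α → MultiIndex d) → M)
    (v : V) (i : Fin d) (hK : ∃ N, ∀ y ∈ Supp d I, N < tot y → ∀ z, K (fib vt y) z = 0) :
    esum I (fun y => invFact y • (fib vt y v i : ℝ) • K (fib vt y - unit v i) y)
      = ∑ a ∈ Finset.univ.filter (fun a => a ∈ I ∧ vt a = v),
        esum I (fun y => invFact y • K (fib vt y) (y + unit a i)) := by
  obtain ⟨N, hN⟩ := hK
  have h1 : ∀ y ∈ Supp d I, invFact y • (fib vt y v i : ℝ) • K (fib vt y - unit v i) y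
      = ∑ a ∈ Finset.univ.filter (fun a => a ∈ I ∧ vt a = v),
        invFact y • (y a i : ℝ) • K (fib vt y - unit v i) y := by
    intro y hy
    rw [← Finset.smul_sum, ← Finset.sum_smul]
    congr 2
    simp only [fib, Finset.sum_apply]
    push_cast
    symm
    refine Finset.sum_subset (fun a ha => ?_) fun a ha ha' => ?_
    · simp only [Finset.mem_filter, Finset.mem_univ, true_and] at ha ⊢
      exact ha.2
    · simp only [Finset.mem_filter, Finset.mem_univ, true_and] at ha ha'
      rw [hy a fun h => ha' ⟨h, ha⟩]
      simp
  rw [esum_congr h1, esum_sum]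
  · refine Finset.sum_congr rfl fun a ha => ?_
    simp only [Finset.mem_filter, Finset.mem_univ, true_and] at ha
    rw [esum_shift ha.1 i (fun y _ h => by rw [h]; simp)]
    refine esum_congr fun y _ => ?_
    rw [fib_add, fib_unit, ha.2, add_tsub_cancel_right, smul_smul, Pi.add_apply, Pi.add_apply,
      unit_apply_same, mul_comm]
    push_cast
    rw [invFact_add_unit]
  · intro a ha
    simp only [Finset.mem_filter, Finset.mem_univ, true_and] at ha
    refine ⟨N + 1, fun y hy hNy => ?_⟩
    rcases Nat.eq_zero_or_pos (y a i) with h0 | h0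
    · beta_reduce
      rw [h0]; simp
    have hle : y - unit a i + unit a i = y := by
      funext b j
      by_cases h : b ≠ a ∨ j ≠ i
      · simp only [Pi.add_apply, Pi.sub_apply, unit_apply_ne h, tsub_zero, add_zero]
      · simp only [not_or, not_not] at h
        obtain ⟨rfl, rfl⟩ := h
        simp only [Pi.add_apply, Pi.sub_apply, unit_apply_same]
        omega
    have h2 : fib vt y - unit v i = fib vt (y - unit a i) := by
      conv_lhs => rw [← hle, fib_add, fib_unit, ha.2, add_tsub_cancel_right]
    beta_reduce
    rw [h2, hN _ ((add_unit_mem_Supp ha.1 i).1 (by rw [hle]; exact hy)), smul_zero, smul_zero]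
    have := tot_add (y - unit a i) (unit a i)
    rw [hle, tot_unit] at this
    omega

/-! ### Translation of decorations -/

lemma multiChoose_eq_zero {V : Type} [Fintype V] {n m : V → MultiIndex d} (h : tot n < tot m) :
    multiChoose n m = 0 := by
  have : ∃ v i, n v i < m v i := by
    by_contra hh
    push Not at hh
    exact absurd (Finset.sum_le_sum fun v _ => Finset.sum_le_sum fun i _ => hh v i) (not_le.2 h)
  obtain ⟨v, i, hvi⟩ := this
  exact Finset.prod_eq_zero (Finset.mem_univ v)
    (Finset.prod_eq_zero (Finset.mem_univ i) (Nat.choose_eq_zero_of_lt hvi))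

end Module

section Translate

variable {V : Type} [Fintype V] [AddCommGroup M] [Module ℝ M]

lemma multiChoose_le {n m : V → MultiIndex d} (h : multiChoose n m ≠ 0) : m ≤ n := by
  intro v i
  by_contra hvi
  exact h (Finset.prod_eq_zero (Finset.mem_univ v)
    (Finset.prod_eq_zero (Finset.mem_univ i) (Nat.choose_eq_zero_of_lt (not_le.1 hvi))))

/-- `(j_v + 1) (n choose j + 1_v) = n_v (n - 1_v choose j)`. -/
lemma multiChoose_add_unit (n j : V → MultiIndex d) (v : V) (i : Fin d) :
    ((j v i : ℝ) + 1) * (multiChoose n (j + unit v i) : ℝ)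
      = (n v i : ℝ) * (multiChoose (n - unit v i) j : ℝ) := by
  have h : (j v i + 1) * multiChoose n (j + unit v i) = n v i * multiChoose (n - unit v i) j := by
    unfold multiChoose
    rw [← Finset.mul_prod_erase Finset.univ _ (Finset.mem_univ v),
      ← Finset.mul_prod_erase Finset.univ _ (Finset.mem_univ i),
      ← Finset.mul_prod_erase (f := fun a => ∏ i', ((n - unit v i) a i').choose (j a i'))
        Finset.univ (Finset.mem_univ v),
      ← Finset.mul_prod_erase (f := fun i' => ((n - unit v i) v i').choose (j v i'))
        Finset.univ (Finset.mem_univ i), ← mul_assoc, ← mul_assoc, ← mul_assoc, ← mul_assoc]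
    congr 1
    · congr 1
      · simp only [Pi.add_apply, Pi.sub_apply, unit_apply_same]
        rcases Nat.eq_zero_or_pos (n v i) with h0 | h0
        · rw [h0]; simp
        · obtain ⟨k, hk⟩ := Nat.exists_eq_add_of_lt h0
          rw [hk, zero_add, Nat.add_sub_cancel, mul_comm, ← Nat.add_one_mul_choose_eq]
      · refine Finset.prod_congr rfl fun i' hi' => ?_
        simp only [Pi.add_apply, Pi.sub_apply, unit_apply_ne (Or.inr (Finset.ne_of_mem_erase hi')),
          add_zero, tsub_zero]
    · refine Finset.prod_congr rfl fun v' hv' => Finset.prod_congr rfl fun i' _ => ?_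
      simp only [Pi.add_apply, Pi.sub_apply, unit_apply_ne (Or.inl (Finset.ne_of_mem_erase hv')),
        add_zero, tsub_zero]
  exact_mod_cast h

/-- `(n_v - j_v) (n choose j) = (j_v + 1) (n choose j + 1_v)`. -/
lemma sub_mul_multiChoose (n j : V → MultiIndex d) (v : V) (i : Fin d) :
    (((n - j) v i : ℕ) : ℝ) * (multiChoose n j : ℝ)
      = ((j v i : ℝ) + 1) * (multiChoose n (j + unit v i) : ℝ) := by
  have h : (n - j) v i * multiChoose n j = (j v i + 1) * multiChoose n (j + unit v i) := by
    unfold multiChoose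
    rw [← Finset.mul_prod_erase Finset.univ _ (Finset.mem_univ v),
      ← Finset.mul_prod_erase Finset.univ _ (Finset.mem_univ i),
      ← Finset.mul_prod_erase (f := fun a => ∏ i', (n a i').choose ((j + unit v i) a i'))
        Finset.univ (Finset.mem_univ v),
      ← Finset.mul_prod_erase (f := fun i' => (n v i').choose ((j + unit v i) v i'))
        Finset.univ (Finset.mem_univ i), ← mul_assoc, ← mul_assoc, ← mul_assoc, ← mul_assoc]
    congr 1
    · congr 1
      · simp only [Pi.add_apply, Pi.sub_apply, unit_apply_same]
        rw [mul_comm, ← Nat.choose_succ_right_eq, mul_comm]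
      · refine Finset.prod_congr rfl fun i' hi' => ?_
        simp only [Pi.add_apply, unit_apply_ne (Or.inr (Finset.ne_of_mem_erase hi')), add_zero]
    · refine Finset.prod_congr rfl fun v' hv' => Finset.prod_congr rfl fun i' _ => ?_
      simp only [Pi.add_apply, unit_apply_ne (Or.inl (Finset.ne_of_mem_erase hv')), add_zero]
  exact_mod_cast h

/-- The sum of all multiindices of a family. -/
def total (j : V → MultiIndex d) : MultiIndex d := ∑ v, j v

lemma total_add_unit (j : V → MultiIndex d) (v : V) (i : Fin d) :
    total (j + unit v i) = total j + Pi.single i 1 := by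
  simp [total, Finset.sum_add_distrib]

lemma order_total (j : V → MultiIndex d) : order (total j) = tot j := order_sum _ _

/-- If `F n` stands for the monomial `X^n`, then `translate C r F n` stands for the product of the
`(X_v - X_r)^{n_v}` over `v ∈ C` and of the `X_v^{n_v}` over the other vertices. -/
def translate (C : Set V) (r : V) (F : (V → MultiIndex d) → M) (n : V → MultiIndex d) : M :=
  esum C fun j => ((-1 : ℝ) ^ tot j * (multiChoose n j : ℝ)) •
    F (n - j + Pi.single r (total j))

/-- The remainder in `translate C r F n = F n + ∑_i ∑_{v ∈ C} n(v)_i (E_i (n - δ_i 1_v))`. -/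
def translateRem (C : Set V) (r : V) (F : (V → MultiIndex d) → M) (i : Fin d)
    (n : V → MultiIndex d) : M :=
  esum C fun j => (-((-1 : ℝ) ^ tot j) / ((tot j : ℝ) + 1) * (multiChoose n j : ℝ)) •
    F (n - j + Pi.single r (total j + Pi.single i 1))

lemma bounded_choose (C : Set V) (n : V → MultiIndex d) (c : (V → MultiIndex d) → ℝ)
    (f : (V → MultiIndex d) → M) :
    Bounded C (fun j => (c j * (multiChoose n j : ℝ)) • f j) :=
  ⟨tot n, fun j _ h => by beta_reduce; rw [multiChoose_eq_zero h]; simp⟩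

/-- Translation changes a function of the decoration only by images of the generators of translations
`F ↦ ∑_{v ∈ C} n(v)_i F (n - δ_i 1_v)`. -/
lemma translate_eq (C : Finset V) (r : V) (F : (V → MultiIndex d) → M) (n : V → MultiIndex d) :
    translate (C : Set V) r F n = F n + ∑ i, ∑ v ∈ C,
      (n v i : ℝ) • translateRem (C : Set V) r F i (n - unit v i) := by
  set t : (V → MultiIndex d) → M := fun j => ((-1 : ℝ) ^ tot j * (multiChoose n j : ℝ)) •
    F (n - j + Pi.single r (total j)) with ht
  have hb : ∀ c : (V → MultiIndex d) → ℝ, Bounded (C : Set V) (fun j => c j • t j) := fun c =>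
    ⟨tot n, fun j _ h => by simp only [ht]; rw [multiChoose_eq_zero h]; simp⟩
  have h1 : ∀ j ∈ Supp d (C : Set V), t j = (if j = 0 then (1 : ℝ) else 0) • t j
      + ∑ i, ∑ v ∈ C, ((j v i : ℝ) / (tot j : ℝ)) • t j := by
    intro j hj
    simp only [← Finset.sum_smul, ← Finset.sum_div]
    have h2 : ∑ i, ∑ v ∈ C, (j v i : ℝ) = (tot j : ℝ) := by
      rw [Finset.sum_comm]
      unfold tot order
      push_cast
      refine Finset.sum_subset (Finset.subset_univ _) fun v _ hv => ?_
      rw [hj v hv]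
      simp
    rw [h2, ← add_smul]
    by_cases h : j = 0
    · subst h
      simp [tot_zero]
    · have h3 : (tot j : ℝ) ≠ 0 := fun h0 => h (tot_eq_zero (by exact_mod_cast h0))
      rw [if_neg h, div_self h3, zero_add, one_smul]
  unfold translate
  rw [esum_congr h1, esum_add (hb _) (Bounded.sum fun i _ => Bounded.sum fun v _ => hb _),
    esum_sum (fun i _ => Bounded.sum fun v _ => hb _)]
  congr 1
  · unfold esum
    rw [finsum_eq_single _ 0]
    · rw [Set.indicator_of_mem (zero_mem_Supp _)]
      simp [ht, tot_zero, multiChoose, total]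
    · intro j hj
      by_cases h : j ∈ Supp d (C : Set V)
      · rw [Set.indicator_of_mem h, if_neg hj, zero_smul]
      · exact Set.indicator_of_notMem h _
  · refine Finset.sum_congr rfl fun i _ => ?_
    rw [esum_sum (fun v _ => hb _)]
    refine Finset.sum_congr rfl fun v hv => ?_
    rw [esum_shift (Finset.mem_coe.2 hv) i (fun y _ h => by rw [h]; simp), translateRem,
      ← esum_smul _ (bounded_choose _ _ _ _)]
    refine esum_congr fun j _ => ?_
    simp only [ht]
    rw [smul_smul, smul_smul, tot_add, tot_unit, total_add_unit, tsub_add_eq_tsub_tsub_swap]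
    congr 1
    have := multiChoose_add_unit n j v i
    simp only [Pi.add_apply, unit_apply_same]
    push_cast
    rw [pow_succ]
    linear_combination (-(-1 : ℝ) ^ tot j / ((tot j : ℝ) + 1)) * this

/-- Translation invariant polynomials are killed by the generator of translations. -/
lemma translate_sum_lower (r : V) (F : (V → MultiIndex d) → M) (i : Fin d)
    (n : V → MultiIndex d) :
    translate (Set.univ : Set V) r (fun n => ∑ v, (n v i : ℝ) • F (n - unit v i)) n = 0 := by
  unfold translate
  set s : (V → MultiIndex d) → M := fun j => F (n - j + Pi.single r (total j) - unit r i) with hs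
  have key : ∀ j ∈ Supp d (Set.univ : Set V),
      ((-1 : ℝ) ^ tot j * (multiChoose n j : ℝ)) • ∑ v,
        (((n - j + (Pi.single r (total j) : V → MultiIndex d)) v i : ℕ) : ℝ) •
          F (n - j + Pi.single r (total j) - unit v i)
      = (∑ v, ((-1 : ℝ) ^ tot j * ((((j v i : ℝ) + 1)) * multiChoose n (j + unit v i))) •
          F (n - (j + unit v i) + Pi.single r (total j)))
        + ∑ v, (((-1 : ℝ) ^ tot j * (j v i : ℝ)) * multiChoose n j) • s j := by
    intro j _
    rw [Finset.smul_sum]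
    have h1 : ∀ v, ((-1 : ℝ) ^ tot j * (multiChoose n j : ℝ)) •
          (((n - j + (Pi.single r (total j) : V → MultiIndex d)) v i : ℕ) : ℝ) •
          F (n - j + Pi.single r (total j) - unit v i)
        = ((-1 : ℝ) ^ tot j * ((((j v i : ℝ) + 1)) * multiChoose n (j + unit v i))) •
          F (n - (j + unit v i) + Pi.single r (total j))
        + (if v = r then ((-1 : ℝ) ^ tot j * multiChoose n j * (total j i : ℝ)) • s j else 0) := by
      intro v
      have h2 : ((-1 : ℝ) ^ tot j * (multiChoose n j : ℝ)) • (((n - j) v i : ℕ) : ℝ) •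
          F (n - j + Pi.single r (total j) - unit v i)
          = ((-1 : ℝ) ^ tot j * ((((j v i : ℝ) + 1)) * multiChoose n (j + unit v i))) •
          F (n - (j + unit v i) + Pi.single r (total j)) := by
        rw [smul_smul, mul_assoc, mul_comm (multiChoose n j : ℝ), sub_mul_multiChoose]
        rcases Nat.eq_zero_or_pos ((n - j) v i) with h0 | h0
        · have := sub_mul_multiChoose n j v i
          rw [h0, Nat.cast_zero, zero_mul] at this
          rw [← this]; simp
        · congr 2
          funext u k
          by_cases h : u ≠ v ∨ k ≠ i
          · simp only [Pi.add_apply, Pi.sub_apply, unit_apply_ne h]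
            omega
          · simp only [not_or, not_not] at h
            obtain ⟨rfl, rfl⟩ := h
            simp only [Pi.add_apply, Pi.sub_apply, unit_apply_same] at h0 ⊢
            omega
      by_cases hv : v = r
      · subst hv
        rw [if_pos rfl, ← h2]
        simp only [Pi.add_apply, Pi.single_eq_same]
        push_cast
        simp only [smul_smul, ← add_smul, hs]
        congr 1
        ring
      · rw [if_neg hv, add_zero, ← h2]
        simp only [Pi.add_apply, Pi.single_eq_of_ne hv, Pi.zero_apply, add_zero]
    simp only [h1]
    rw [Finset.sum_add_distrib, Finset.sum_ite_eq' Finset.univ r, if_pos (Finset.mem_univ _)]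
    congr 1
    rw [← Finset.sum_smul]
    congr 1
    simp only [total, Finset.sum_apply]
    push_cast
    rw [Finset.mul_sum]
    exact Finset.sum_congr rfl fun v _ => by ring
  have b1 : ∀ v, Bounded (Set.univ : Set V) (fun j : V → MultiIndex d =>
      ((-1 : ℝ) ^ tot j * ((((j v i : ℝ) + 1)) * multiChoose n (j + unit v i))) •
          F (n - (j + unit v i) + Pi.single r (total j))) := fun v =>
    ⟨tot n, fun j _ h => by beta_reduce; rw [multiChoose_eq_zero (by rw [tot_add]; omega)]; simp⟩
  have b2 : ∀ v, Bounded (Set.univ : Set V) (fun j : V → MultiIndex d =>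
      (((-1 : ℝ) ^ tot j * (j v i : ℝ)) * multiChoose n j) • s j) := fun v =>
    bounded_choose _ _ _ _
  rw [esum_congr key, esum_add (Bounded.sum fun v _ => b1 v) (Bounded.sum fun v _ => b2 v),
    esum_sum (fun v _ => b1 v), esum_sum (fun v _ => b2 v), ← Finset.sum_add_distrib]
  refine Finset.sum_eq_zero fun v _ => ?_
  rw [esum_shift (f := fun j => (((-1 : ℝ) ^ tot j * (j v i : ℝ)) * multiChoose n j) • s j)
    (Set.mem_univ v) i (fun y _ h => by rw [h]; simp), ← esum_add (b1 v)
      ⟨tot n, fun j _ h => by rw [multiChoose_eq_zero (by rw [tot_add]; omega)]; simp⟩]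
  refine esum_zero fun j _ => ?_
  simp only [hs]
  have h3 : n - (j + unit v i) + Pi.single r (total (j + unit v i)) - unit r i
      = n - (j + unit v i) + Pi.single r (total j) := by
    rw [total_add_unit, Pi.single_add, ← add_assoc, add_tsub_cancel_right]
  rw [h3, ← add_smul, tot_add, tot_unit, pow_succ]
  simp only [Pi.add_apply, unit_apply_same]
  push_cast
  rw [show ∀ a b c : ℝ, a * (b * c) + a * -1 * b * c = 0 from fun a b c => by ring, zero_smul]

end Translate

end MultiSums

section Translate

variable {V : Type} [Fintype V] {M : Type*} [AddCommGroup M] [Module ℝ M]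

/-- Pascal's rule. -/
lemma multiChoose_pascal (n j : V → MultiIndex d) (v : V) (i : Fin d) :
    multiChoose (n + unit v i) j
      = multiChoose n j + if j v i = 0 then 0 else multiChoose n (j - unit v i) := by
  unfold multiChoose
  have h : ∀ n' j' : V → MultiIndex d, (∀ u i', (u ≠ v ∨ i' ≠ i) → n' u i' = n u i') →
      (∀ u i', (u ≠ v ∨ i' ≠ i) → j' u i' = j u i') →
      ∏ u, ∏ i', (n' u i').choose (j' u i') = (n' v i).choose (j' v i) *
        ((∏ i' ∈ Finset.univ.erase i, (n v i').choose (j v i')) *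
          ∏ u ∈ Finset.univ.erase v, ∏ i', (n u i').choose (j u i')) := by
    intro n' j' hn hj
    rw [← Finset.mul_prod_erase Finset.univ _ (Finset.mem_univ v),
      ← Finset.mul_prod_erase Finset.univ _ (Finset.mem_univ i), mul_assoc]
    congr 2
    · refine Finset.prod_congr rfl fun i' hi' => ?_
      rw [hn _ _ (Or.inr (Finset.ne_of_mem_erase hi')), hj _ _ (Or.inr (Finset.ne_of_mem_erase hi'))]
    · refine Finset.prod_congr rfl fun u hu => Finset.prod_congr rfl fun i' _ => ?_
      rw [hn _ _ (Or.inl (Finset.ne_of_mem_erase hu)), hj _ _ (Or.inl (Finset.ne_of_mem_erase hu))]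
  rw [h (n + unit v i) j (fun u i' hu => by simp only [Pi.add_apply, unit_apply_ne hu, add_zero])
    fun _ _ _ => rfl, h n j (fun _ _ _ => rfl) fun _ _ _ => rfl,
    h n (j - unit v i) (fun _ _ _ => rfl)
      fun u i' hu => by simp only [Pi.sub_apply, unit_apply_ne hu, tsub_zero]]
  simp only [Pi.add_apply, Pi.sub_apply, unit_apply_same]
  split_ifs with h0
  · rw [h0]; simp
  · obtain ⟨m, hm⟩ := Nat.exists_eq_succ_of_ne_zero h0
    rw [hm, Nat.succ_sub_one, Nat.succ_eq_add_one, Nat.choose_succ_succ', ← add_mul]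
    ring

/-- `X_r - X_r = 0`. -/
lemma translate_eq_zero (C : Set V) {r : V} (hr : r ∈ C) (F : (V → MultiIndex d) → M)
    {n : V → MultiIndex d} (hn : n r ≠ 0) : translate C r F n = 0 := by
  obtain ⟨i, hi⟩ : ∃ i, n r i ≠ 0 := by
    by_contra h
    push Not at h
    exact hn (funext h)
  set n' := n - unit r i with hn'
  have hnn : n = n' + unit r i := by
    funext u j
    by_cases h : u ≠ r ∨ j ≠ i
    · simp only [hn', Pi.add_apply, Pi.sub_apply, unit_apply_ne h, tsub_zero, add_zero]
    · simp only [not_or, not_not] at h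
      obtain ⟨rfl, rfl⟩ := h
      simp only [hn', Pi.add_apply, Pi.sub_apply, unit_apply_same]
      omega
  unfold translate
  have h1 : ∀ j ∈ Supp d C, ((-1 : ℝ) ^ tot j * (multiChoose n j : ℝ)) •
      F (n - j + Pi.single r (total j))
      = ((-1 : ℝ) ^ tot j * (multiChoose n' j : ℝ)) • F (n - j + Pi.single r (total j))
      + ((-1 : ℝ) ^ tot j * ((if j r i = 0 then 0 else multiChoose n' (j - unit r i) : ℕ) : ℝ)) •
        F (n - j + Pi.single r (total j)) := by
    intro j _
    rw [hnn, multiChoose_pascal, ← add_smul]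
    push_cast
    rw [mul_add]
  have b1 : Bounded C (fun j => ((-1 : ℝ) ^ tot j * (multiChoose n' j : ℝ)) •
      F (n - j + Pi.single r (total j))) := bounded_choose _ _ _ _
  have hsub : ∀ j : V → MultiIndex d, j r i ≠ 0 → tot j = tot (j - unit r i) + 1 := fun j hj => by
    have : j = (j - unit r i) + unit r i := by
      funext u k
      by_cases h : u ≠ r ∨ k ≠ i
      · simp only [Pi.add_apply, Pi.sub_apply, unit_apply_ne h, tsub_zero, add_zero]
      · simp only [not_or, not_not] at h
        obtain ⟨rfl, rfl⟩ := h
        simp only [Pi.add_apply, Pi.sub_apply, unit_apply_same]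
        omega
    conv_lhs => rw [this, tot_add, tot_unit]
  have b2 : Bounded C (fun j => ((-1 : ℝ) ^ tot j *
      ((if j r i = 0 then 0 else multiChoose n' (j - unit r i) : ℕ) : ℝ)) •
        F (n - j + Pi.single r (total j))) := by
    refine ⟨tot n' + 1, fun j _ hj => ?_⟩
    beta_reduce
    split_ifs with h0
    · simp
    · rw [multiChoose_eq_zero (by have := hsub j h0; omega)]; simp
  rw [esum_congr h1, esum_add b1 b2, esum_shift (f := fun j => ((-1 : ℝ) ^ tot j *
      ((if j r i = 0 then 0 else multiChoose n' (j - unit r i) : ℕ) : ℝ)) •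
        F (n - j + (Pi.single r (total j) : V → MultiIndex d))) hr i
      (fun y _ h => by rw [h]; simp), ← esum_add b1]
  · refine esum_zero fun j _ => ?_
    have h2 : (j + unit r i) r i ≠ 0 := by simp
    rw [if_neg h2, add_tsub_cancel_right, tot_add, tot_unit]
    by_cases hc : multiChoose n' j = 0
    · rw [hc]; simp
    · have hle := multiChoose_le hc
      have h3 : n - (j + unit r i) + Pi.single r (total (j + unit r i))
          = n - j + Pi.single r (total j) := by
        rw [hnn, total_add_unit, Pi.single_add, ← add_assoc, add_tsub_add_eq_tsub_right,
          add_right_comm, tsub_add_eq_add_tsub hle]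
      rw [h3, ← add_smul, pow_succ]
      rw [show ∀ a b : ℝ, a * b + a * -1 * b = 0 from fun a b => by ring, zero_smul]
  · refine ⟨tot n', fun j _ hj => ?_⟩
    have h2 : (j + unit r i) r i ≠ 0 := by simp
    beta_reduce
    rw [if_neg h2, add_tsub_cancel_right, multiChoose_eq_zero hj]
    simp

end Translate

/-! ### Graphs and isomorphisms of subgraphs -/

/-- Two surjective maps with the same fibres have isomorphic targets. -/
lemma exists_equiv_of_ker {Z A A' : Type*} (p : Z → A) (p' : Z → A') (hp : Function.Surjective p)
    (hp' : Function.Surjective p') (h : ∀ z z', p z = p z' ↔ p' z = p' z') :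
    ∃ e : A ≃ A', ∀ z, e (p z) = p' z := by
  have h1 : ∀ z, p' (Function.surjInv hp (p z)) = p' z := fun z =>
    (h _ _).1 (Function.surjInv_eq hp (p z))
  refine ⟨Equiv.ofBijective (fun a => p' (Function.surjInv hp a)) ⟨fun a b hab => ?_, fun a' => ?_⟩,
    h1⟩
  · have := (h _ _).2 hab
    rwa [Function.surjInv_eq hp, Function.surjInv_eq hp] at this
  · obtain ⟨z, rfl⟩ := hp' a'
    exact ⟨p z, h1 z⟩

namespace LGraph

variable {𝔖 : LabelSystem d 𝔏} {V E V' E' : Type} {k k' : ℕ}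

lemma ext_of {G G' : LGraph 𝔖 V E k} (h1 : ∀ e, G.src e = G'.src e) (h2 : ∀ e, G.tgt e = G'.tgt e)
    (h3 : ∀ e, G.lab e = G'.lab e) (h4 : ∀ j, G.leg j = G'.leg j)
    (h5 : ∀ j, G.legLab j = G'.legLab j) : G = G' := by
  cases G
  cases G'
  congr
  all_goals funext x
  exacts [h1 x, h2 x, h3 x, h4 x, h5 x]

lemma shift_shift (G : LGraph 𝔖 V E k) (l l' : HalfEdge E k → MultiIndex d) :
    (G.shift l).shift l' = G.shift (l + l') := by
  refine ext_of (fun _ => rfl) (fun _ => rfl) (fun e => ?_) (fun _ => rfl) fun j => ?_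
  · simp only [shift, 𝔖.diff_diff, Pi.add_apply]
    rw [add_add_add_comm]
  · simp only [shift, 𝔖.diff_diff, Pi.add_apply]

lemma shift_zero (G : LGraph 𝔖 V E k) : G.shift 0 = G := by
  refine ext_of (fun _ => rfl) (fun _ => rfl) (fun e => ?_) (fun _ => rfl) fun j => ?_
  · simp [shift, 𝔖.diff_zero]
  · simp [shift, 𝔖.diff_zero]

lemma mem_verts [Fintype V] {G : LGraph 𝔖 V E k} {S : Finset E} {v : V} :
    v ∈ G.verts S ↔ ∃ e ∈ S, ∃ b, G.vert (Sum.inl (e, b)) = v := by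
  simp only [verts, Finset.mem_filter, Finset.mem_univ, true_and, Bool.exists_bool, vert]

lemma vert_mem [Fintype V] (G : LGraph 𝔖 V E k) {S : Finset E} {e : E} (he : e ∈ S) (b : Bool) :
    G.vert (Sum.inl (e, b)) ∈ G.verts S := mem_verts.2 ⟨e, he, b, rfl⟩

lemma conn_vert (G : LGraph 𝔖 V E k) {S : Finset E} {e : E} (he : e ∈ S) (b : Bool) :
    G.conn S (G.src e) (G.vert (Sum.inl (e, b))) := by
  cases b
  · exact (G.conn S).refl _
  · exact G.conn_edge he

lemma conn_mono (G : LGraph 𝔖 V E k) {S T : Finset E} (h : S ⊆ T) {v w : V}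
    (hvw : G.conn S v w) : G.conn T v w :=
  G.conn_le (fun _ he => G.conn_edge (h he)) hvw

lemma verts_mono [Fintype V] (G : LGraph 𝔖 V E k) {S T : Finset E} (h : S ⊆ T) :
    G.verts S ⊆ G.verts T := fun v hv => by
  obtain ⟨e, he, b, rfl⟩ := mem_verts.1 hv
  exact G.vert_mem (h he) b

lemma mem_verts_of_conn [Fintype V] (G : LGraph 𝔖 V E k) {S : Finset E} {v w : V}
    (h : G.conn S v w) (hne : v ≠ w) : v ∈ G.verts S ∧ w ∈ G.verts S := by
  rcases G.conn_sub_aux h with h | ⟨hv, hw, _⟩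
  · exact absurd h hne
  · exact ⟨hv, hw⟩

lemma mem_comp {G : LGraph 𝔖 V E k} {S : Finset E} {v : V} {e : E} :
    e ∈ G.comp S v ↔ e ∈ S ∧ G.conn S v (G.src e) := Finset.mem_filter

lemma mem_verts_comp [Fintype V] {G : LGraph 𝔖 V E k} {S : Finset E} {v w : V} :
    w ∈ G.verts (G.comp S v) ↔ w ∈ G.verts S ∧ G.conn S v w := by
  constructor
  · intro h
    obtain ⟨e, he, b, rfl⟩ := mem_verts.1 h
    rw [mem_comp] at he
    exact ⟨G.vert_mem he.1 b, (G.conn S).trans he.2 (G.conn_vert he.1 b)⟩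
  · rintro ⟨h, h'⟩
    obtain ⟨e, he, b, rfl⟩ := mem_verts.1 h
    exact G.vert_mem (mem_comp.2 ⟨he, (G.conn S).trans h' ((G.conn S).symm (G.conn_vert he b))⟩) b

lemma root_mem_verts_comp [Fintype V] {G : LGraph 𝔖 V E k} {S : Finset E} {v : V}
    (h : (G.comp S v).Nonempty) : v ∈ G.verts (G.comp S v) := by
  obtain ⟨e, he⟩ := h
  rw [mem_comp] at he
  rw [mem_verts_comp]
  refine ⟨?_, (G.conn S).refl _⟩
  by_cases hv : v = G.src e
  · rw [hv]; exact G.src_mem he.1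
  · exact (G.mem_verts_of_conn he.2 hv).1

/-! ### Connected components as vacuum diagrams -/

/-- A connected subgraph with a node decoration and a prescribed distinguished vertex. -/
abbrev pieceAt [Fintype V] (G : LGraph 𝔖 V E k) (S : Finset E) (hS : G.IsConn S)
    (r : {v // v ∈ G.verts S}) (m : V → MultiIndex d) : VacDiagram 𝔖 where
  V := {v // v ∈ G.verts S}
  E := {e // e ∈ S}
  nonemptyE := hS.1.to_subtype
  G := G.sub S
  connected := G.conn_sub hS
  root := r
  n v := m v.1

/-- The connected subgraph `S` with distinguished vertex `r` and decoration `m`, as a vacuum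
diagram. If `S` is empty, this is the isolated node `r`, identified with `1` or `0`. -/
def vac [Fintype V] (G : LGraph 𝔖 V E k) (S : Finset E) (r : V) (m : V → MultiIndex d) :
    That 𝔖 :=
  if h : G.IsConn S ∧ r ∈ G.verts S then (G.pieceAt S h.1 ⟨r, h.2⟩ m).toThat
  else if m r = 0 then 1 else 0

lemma piece_toThat [Fintype V] (G : LGraph 𝔖 V E k) (R : Finset V) (S : Finset E)
    (hS : G.IsConn S) (m : V → MultiIndex d) :
    (G.piece R S hS m).toThat = G.vac S (G.pick R S hS.1).1 m := by
  rw [vac, dif_pos ⟨hS, (G.pick R S hS.1).2⟩]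
  rfl

lemma pieceAt_deg [Fintype V] (G : LGraph 𝔖 V E k) (S : Finset E) (hS : G.IsConn S)
    (r : {v // v ∈ G.verts S}) (m : V → MultiIndex d) :
    (G.pieceAt S hS r m).deg = G.subDeg S m := by
  unfold VacDiagram.deg subDeg
  congr 1
  · congr 1
    · exact Finset.sum_coe_sort S (fun e => 𝔖.deg (G.lab e))
    · exact Finset.sum_coe_sort (G.verts S) (fun v => (order (m v) : ℝ))
  · congr 2
    exact_mod_cast Fintype.card_coe (G.verts S)

/-- The subgraphs `S` of `G` and `S'` of `G'` are isomorphic via the map `φ` between edges. -/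
structure SubIso (G : LGraph 𝔖 V E k) (G' : LGraph 𝔖 V' E' k') (φ : E → E') (S : Finset E)
    (S' : Finset E') : Prop where
  maps : ∀ e ∈ S, φ e ∈ S'
  surj : ∀ e' ∈ S', ∃ e ∈ S, φ e = e'
  inj : ∀ e ∈ S, ∀ e' ∈ S, φ e = φ e' → e = e'
  vert : ∀ e ∈ S, ∀ e' ∈ S, ∀ b b', G.vert (Sum.inl (e, b)) = G.vert (Sum.inl (e', b')) ↔
    G'.vert (Sum.inl (φ e, b)) = G'.vert (Sum.inl (φ e', b'))
  lab : ∀ e ∈ S, G'.lab (φ e) = G.lab e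

/-- Vertices of `S` are represented by pairs of an edge and one of its ends. A map of edges that
respects the coincidences of ends respects the connectedness of ends. -/
lemma conn_tokens {G : LGraph 𝔖 V E k} {G' : LGraph 𝔖 V' E' k'} {φ : E → E'} {S : Finset E}
    {S' : Finset E'} (hS : ∀ e ∈ S, φ e ∈ S')
    (hv : ∀ e ∈ S, ∀ e' ∈ S, ∀ b b', G.vert (Sum.inl (e, b)) = G.vert (Sum.inl (e', b')) →
      G'.vert (Sum.inl (φ e, b)) = G'.vert (Sum.inl (φ e', b')))
    {e e' : E} (he : e ∈ S) (he' : e' ∈ S) (b b' : Bool)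
    (h : G.conn S (G.vert (Sum.inl (e, b))) (G.vert (Sum.inl (e', b')))) :
    G'.conn S' (G'.vert (Sum.inl (φ e, b))) (G'.vert (Sum.inl (φ e', b'))) := by
  suffices H : ∀ v w, G.conn S v w → (v = w) ∨ ∃ e ∈ S, ∃ b, G.vert (Sum.inl (e, b)) = v ∧
      ∃ e' ∈ S, ∃ b', G.vert (Sum.inl (e', b')) = w ∧
      G'.conn S' (G'.vert (Sum.inl (φ e, b))) (G'.vert (Sum.inl (φ e', b'))) by
    rcases H _ _ h with h | ⟨e₁, he₁, b₁, h₁, e₂, he₂, b₂, h₂, h₃⟩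
    · rw [hv e he e' he' b b' h]
    · rwa [hv e he e₁ he₁ b b₁ h₁.symm, hv e' he' e₂ he₂ b' b₂ h₂.symm]
  intro v w hvw
  induction hvw with
  | rel x y h' =>
    obtain ⟨e, he, rfl, rfl⟩ := h'
    exact Or.inr ⟨e, he, false, rfl, e, he, true, rfl, G'.conn_edge (hS e he)⟩
  | refl x => exact Or.inl rfl
  | symm x y _ ih =>
    rcases ih with h | ⟨e₁, he₁, b₁, h₁, e₂, he₂, b₂, h₂, h₃⟩
    · exact Or.inl h.symm
    · exact Or.inr ⟨e₂, he₂, b₂, h₂, e₁, he₁, b₁, h₁, (G'.conn S').symm h₃⟩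
  | trans x y z _ _ ih ih' =>
    rcases ih with h | ⟨e₁, he₁, b₁, h₁, e₂, he₂, b₂, h₂, h₃⟩
    · rw [h]; exact ih'
    · rcases ih' with h | ⟨e₁', he₁', b₁', h₁', e₂', he₂', b₂', h₂', h₃'⟩
      · rw [← h]; exact Or.inr ⟨e₁, he₁, b₁, h₁, e₂, he₂, b₂, h₂, h₃⟩
      · refine Or.inr ⟨e₁, he₁, b₁, h₁, e₂', he₂', b₂', h₂', ?_⟩
        rw [← hv e₂ he₂ e₁' he₁' b₂ b₁' (h₂.trans h₁'.symm)] at h₃'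
        exact (G'.conn S').trans h₃ h₃'

namespace SubIso

variable {G : LGraph 𝔖 V E k} {G' : LGraph 𝔖 V' E' k'} {φ : E → E'} {S : Finset E}
    {S' : Finset E'}

lemma mono (h : SubIso G G' φ S S') {T : Finset E} (hT : T ⊆ S) :
    SubIso G G' φ T (T.image φ) where
  maps _ he := Finset.mem_image_of_mem _ he
  surj _ he' := Finset.mem_image.1 he'
  inj e he e' he' := h.inj e (hT he) e' (hT he')
  vert e he e' he' := h.vert e (hT he) e' (hT he')
  lab e he := h.lab e (hT he)

lemma image_eq (h : SubIso G G' φ S S') : S.image φ = S' := by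
  ext e'
  rw [Finset.mem_image]
  refine ⟨?_, h.surj e'⟩
  rintro ⟨e, he, rfl⟩
  exact h.maps e he

lemma conn_iff (h : SubIso G G' φ S S') {e e' : E} (he : e ∈ S) (he' : e' ∈ S) (b b' : Bool) :
    G.conn S (G.vert (Sum.inl (e, b))) (G.vert (Sum.inl (e', b'))) ↔
      G'.conn S' (G'.vert (Sum.inl (φ e, b))) (G'.vert (Sum.inl (φ e', b'))) := by
  refine ⟨conn_tokens h.maps (fun e he e' he' b b' => (h.vert e he e' he' b b').1) he he' b b',
    fun hc => ?_⟩
  have : Nonempty E := ⟨e⟩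
  choose! ψ hψ hφψ using h.surj
  have hψφ : ∀ e ∈ S, ψ (φ e) = e := fun e he =>
    h.inj _ (hψ _ (h.maps e he)) _ he (hφψ _ (h.maps e he))
  have := conn_tokens (φ := ψ) (G := G') (G' := G) hψ (fun e he e' he' b b' hv =>
    (h.vert _ (hψ e he) _ (hψ e' he') b b').2 (by rwa [hφψ e he, hφψ e' he']))
    (h.maps e he) (h.maps e' he') b b' hc
  rwa [hψφ e he, hψφ e' he'] at this

lemma isConn_iff (h : SubIso G G' φ S S') : G.IsConn S ↔ G'.IsConn S' := by
  refine and_congr ⟨fun ⟨e, he⟩ => ⟨_, h.maps e he⟩, fun ⟨e', he'⟩ => ?_⟩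
    ⟨fun hc e₁ he₁ e₂ he₂ => ?_, fun hc e he e' he' => ?_⟩
  · obtain ⟨e, he, _⟩ := h.surj e' he'
    exact ⟨e, he⟩
  · obtain ⟨e, he, rfl⟩ := h.surj e₁ he₁
    obtain ⟨e', he', rfl⟩ := h.surj e₂ he₂
    exact (h.conn_iff he he' false false).1 (hc e he e' he')
  · exact (h.conn_iff he he' false false).2 (hc _ (h.maps e he) _ (h.maps e' he'))

/-- An isomorphism of subgraphs is given on edges only. The map between vertices is determined by
it. -/
lemma exists_verts_equiv [Fintype V] [Fintype V'] (h : SubIso G G' φ S S') :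
    ∃ f : {v // v ∈ G.verts S} ≃ {v // v ∈ G'.verts S'}, ∀ e (he : e ∈ S) b,
      f ⟨G.vert (Sum.inl (e, b)), G.vert_mem he b⟩
        = ⟨G'.vert (Sum.inl (φ e, b)), G'.vert_mem (h.maps e he) b⟩ := by
  obtain ⟨f, hf⟩ := exists_equiv_of_ker
    (fun z : {e // e ∈ S} × Bool =>
      (⟨G.vert (Sum.inl (z.1.1, z.2)), G.vert_mem z.1.2 z.2⟩ : {v // v ∈ G.verts S}))
    (fun z : {e // e ∈ S} × Bool =>
      (⟨G'.vert (Sum.inl (φ z.1.1, z.2)), G'.vert_mem (h.maps _ z.1.2) z.2⟩ :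
        {v // v ∈ G'.verts S'}))
    (fun v => by
      obtain ⟨e, he, b, hv⟩ := mem_verts.1 v.2
      exact ⟨(⟨e, he⟩, b), Subtype.ext hv⟩)
    (fun v => by
      obtain ⟨e', he', b, hv⟩ := mem_verts.1 v.2
      obtain ⟨e, he, rfl⟩ := h.surj e' he'
      exact ⟨(⟨e, he⟩, b), Subtype.ext hv⟩)
    (fun z z' => by
      rw [Subtype.mk.injEq, Subtype.mk.injEq]
      exact h.vert _ z.1.2 _ z'.1.2 _ _)
  exact ⟨f, fun e he b => hf (⟨e, he⟩, b)⟩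

end SubIso

section Character

variable {B : Type*} [CommRing B] [Algebra ℝ B] {χ : That 𝔖 →ₐ[ℝ] B}

/-- Isomorphic subgraphs have the same value. The last hypothesis is only relevant if `S` is empty,
so that the subgraph is an isolated vertex. -/
lemma vac_congr (hχ : ∀ x, IsRelVac 𝔖 x → χ x = 0) [Fintype V] [Fintype V'] {G : LGraph 𝔖 V E k}
    {G' : LGraph 𝔖 V' E' k'} {φ : E → E'} {S : Finset E} {S' : Finset E'}
    (h : SubIso G G' φ S S') {r : V} {r' : V'} {n : V → MultiIndex d} {n' : V' → MultiIndex d}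
    (hn : ∀ e ∈ S, ∀ b, n' (G'.vert (Sum.inl (φ e, b))) = n (G.vert (Sum.inl (e, b))))
    (hr : ∀ e ∈ S, ∀ b, G.vert (Sum.inl (e, b)) = r ↔ G'.vert (Sum.inl (φ e, b)) = r')
    (hr0 : n r = 0 ↔ n' r' = 0) : χ (G.vac S r n) = χ (G'.vac S' r' n') := by
  have hr' : r ∈ G.verts S ↔ r' ∈ G'.verts S' := by
    rw [mem_verts, mem_verts]
    constructor
    · rintro ⟨e, he, b, hb⟩
      exact ⟨φ e, h.maps e he, b, (hr e he b).1 hb⟩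
    · rintro ⟨e', he', b, hb⟩
      obtain ⟨e, he, rfl⟩ := h.surj e' he'
      exact ⟨e, he, b, (hr e he b).2 hb⟩
  unfold vac
  by_cases hc : G.IsConn S ∧ r ∈ G.verts S
  · have hc' : G'.IsConn S' ∧ r' ∈ G'.verts S' := ⟨h.isConn_iff.1 hc.1, hr'.1 hc.2⟩
    rw [dif_pos hc, dif_pos hc', ← sub_eq_zero, ← map_sub]
    obtain ⟨f, hf⟩ := h.exists_verts_equiv
    refine hχ _ (IsRelVac.iso _ _ ⟨f, Equiv.ofBijective (fun e => ⟨φ e.1, h.maps _ e.2⟩)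
      ⟨fun e e' hee' => Subtype.ext (h.inj _ e.2 _ e'.2 (Subtype.mk.inj hee')), fun e' => ?_⟩,
      rfl, ?_, ?_, ?_, ?_, ?_⟩ ?_ ?_)
    · obtain ⟨e, he, hee'⟩ := h.surj _ e'.2
      exact ⟨⟨e, he⟩, Subtype.ext hee'⟩
    · exact fun e => (hf e.1 e.2 false).symm
    · exact fun e => (hf e.1 e.2 true).symm
    · exact fun e => h.lab e.1 e.2
    · exact fun j => j.elim0
    · exact fun j => j.elim0
    · obtain ⟨e, he, b, hb⟩ := mem_verts.1 hc.2
      have h1 := hf e he b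
      have h2 : (⟨G.vert (Sum.inl (e, b)), G.vert_mem he b⟩ : {v // v ∈ G.verts S}) = ⟨r, hc.2⟩ :=
        Subtype.ext hb
      rw [h2] at h1
      refine Eq.trans ?_ h1.symm
      exact Subtype.ext ((hr e he b).1 hb).symm
    · rintro ⟨v, hv⟩
      obtain ⟨e, he, b, rfl⟩ := mem_verts.1 hv
      have h1 := hf e he b
      refine Eq.trans (congrArg (fun v : {v // v ∈ G'.verts S'} => n' v.1) h1) ?_
      exact hn e he b
  · have hc' : ¬ (G'.IsConn S' ∧ r' ∈ G'.verts S') := fun hc' =>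
      hc ⟨h.isConn_iff.2 hc'.1, hr'.2 hc'.2⟩
    rw [dif_neg hc, dif_neg hc']
    simp only [hr0]

/-- The half-edge belongs to an edge of `S`. -/
def InHalf (S : Finset E) (h : HalfEdge E k) : Prop := ∃ e ∈ S, ∃ b, h = Sum.inl (e, b)

/-- The half-edges of the subgraph `S` as half-edges of the ambient graph. -/
def halfIncl (k : ℕ) (S : Finset E) : HalfEdge {e // e ∈ S} 0 → HalfEdge E k
  | Sum.inl (e, b) => Sum.inl (e.1, b)
  | Sum.inr j => j.elim0

lemma halfIncl_injective (S : Finset E) : Function.Injective (halfIncl k S) := by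
  rintro (⟨e, b⟩ | j) (⟨e', b'⟩ | j') h
  · simp only [halfIncl, Sum.inl.injEq, Prod.mk.injEq] at h
    rw [Subtype.ext h.1, h.2]
  all_goals first | exact j.elim0 | exact j'.elim0

lemma halfSign_halfIncl (S : Finset E) (h : HalfEdge {e // e ∈ S} 0) :
    halfSign (halfIncl k S h) = halfSign h := by
  rcases h with (⟨e, b⟩ | j)
  · cases b <;> rfl
  · exact j.elim0

lemma shift_pieceAt [Fintype V] (G : LGraph 𝔖 V E k) (S : Finset E) (hS : G.IsConn S)
    (r : {v // v ∈ G.verts S}) (m : V → MultiIndex d) (l : HalfEdge E k → MultiIndex d) :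
    (G.shift l).pieceAt S hS r m = (G.pieceAt S hS r m).shift (fun h => l (halfIncl k S h)) := by
  have : (G.shift l).sub S = (G.sub S).shift (fun h => l (halfIncl k S h)) :=
    ext_of (fun _ => rfl) (fun _ => rfl) (fun _ => rfl) (fun j => j.elim0) (fun j => j.elim0)
  unfold pieceAt VacDiagram.shift
  congr 1

lemma vac_of_isConn [Fintype V] {G : LGraph 𝔖 V E k} {S : Finset E} (hS : G.IsConn S) {r : V}
    (hr : r ∈ G.verts S) (m : V → MultiIndex d) :
    G.vac S r m = (G.pieceAt S hS ⟨r, hr⟩ m).toThat := dif_pos ⟨hS, hr⟩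

lemma single_comp_injective {α β : Type} {_ : DecidableEq α} {_ : DecidableEq β} {f : α → β}
    (hf : Function.Injective f) (a : α) (i : Fin d) :
    (fun x => (unit (f a) i : β → MultiIndex d) (f x)) = unit a i := by
  funext x
  by_cases h : x = a
  · subst h; simp
  · simp [Pi.single_eq_of_ne h, Pi.single_eq_of_ne (hf.ne h)]

/-- Integration by parts at the distinguished vertex, where the term of the distinguished vertex
itself is added on both sides. -/
lemma sumHalf_root (hχ : ∀ x, IsRelVac 𝔖 x → χ x = 0) (τ : VacDiagram 𝔖) (i : Fin d) :
    χ (τ.sumHalf τ.root i) + χ (τ.lower τ.root i) = ∑ v, χ (τ.lower v i) := by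
  have h := hχ _ (IsRelVac.ibpRoot τ i)
  rw [map_sub, map_sum, sub_eq_zero] at h
  rw [h, ← Finset.sum_filter_add_sum_filter_not Finset.univ (fun v => v ≠ τ.root)]
  congr 1
  simp only [not_not]
  rw [Finset.sum_filter, Finset.sum_ite_eq' Finset.univ τ.root, if_pos (Finset.mem_univ _)]

/-- Integration by parts at a vertex of a connected subgraph. -/
lemma vac_ibp (hχ : ∀ x, IsRelVac 𝔖 x → χ x = 0) [Fintype V] [Fintype E] {G : LGraph 𝔖 V E k}
    {S : Finset E} (hS : G.IsConn S) {r v : V} (hr : r ∈ G.verts S) (hv : v ∈ G.verts S)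
    (n : V → MultiIndex d) (i : Fin d) :
    (∑ h ∈ Finset.univ.filter (fun h => InHalf S h ∧ G.vert h = v),
      halfSign h • χ ((G.shift (unit h i)).vac S r n)) + (n v i : ℝ) • χ (G.vac S r (n - unit v i))
      = if v = r then ∑ u ∈ G.verts S, (n u i : ℝ) • χ (G.vac S r (n - unit u i)) else 0 := by
  have h1 : χ ((G.pieceAt S hS ⟨r, hr⟩ n).sumHalf ⟨v, hv⟩ i)
      = ∑ h ∈ Finset.univ.filter (fun h => InHalf S h ∧ G.vert h = v),
        halfSign h • χ ((G.shift (unit h i)).vac S r n) := by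
    unfold VacDiagram.sumHalf
    rw [map_sum]
    refine Finset.sum_bij (fun h _ => halfIncl k S h) ?_ ?_ ?_ ?_
    · rintro (⟨e, b⟩ | j) hh
      · simp only [Finset.mem_filter, Finset.mem_univ, true_and] at hh ⊢
        refine ⟨⟨e.1, e.2, b, rfl⟩, ?_⟩
        cases b <;> exact congrArg Subtype.val hh
      · exact j.elim0
    · exact fun h _ h' _ hh => halfIncl_injective S hh
    · intro h hh
      simp only [Finset.mem_filter, Finset.mem_univ, true_and] at hh
      obtain ⟨⟨e, he, b, rfl⟩, hb⟩ := hh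
      refine ⟨Sum.inl (⟨e, he⟩, b), ?_, rfl⟩
      simp only [Finset.mem_filter, Finset.mem_univ, true_and]
      cases b <;> exact Subtype.ext hb
    · intro h _
      rw [map_smul, halfSign_halfIncl]
      refine congrArg (fun x => halfSign h • χ x) ?_
      refine Eq.trans ?_ (vac_of_isConn (G := G.shift _) hS hr n).symm
      refine congrArg VacDiagram.toThat (Eq.trans ?_ (shift_pieceAt G S hS ⟨r, hr⟩ n _).symm)
      exact congrArg _ (single_comp_injective (halfIncl_injective S) h i).symm
  have h2 : ∀ u (hu : u ∈ G.verts S), χ ((G.pieceAt S hS ⟨r, hr⟩ n).lower ⟨u, hu⟩ i)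
      = (n u i : ℝ) • χ (G.vac S r (n - unit u i)) := by
    intro u hu
    unfold VacDiagram.lower
    rw [map_smul, vac_of_isConn hS hr]
    congr 3
    unfold VacDiagram.redecorate pieceAt
    congr 1
    funext w
    exact congrArg (fun x => n w.1 - x) (congrFun (single_comp_injective
      (Subtype.val_injective (p := fun v => v ∈ G.verts S)) ⟨u, hu⟩ i) w).symm
  rw [← h1, ← h2 v hv]
  split_ifs with hvr
  · subst hvr
    refine (sumHalf_root hχ (G.pieceAt S hS ⟨v, hr⟩ n) i).trans ?_
    refine (Finset.sum_congr rfl fun u _ => h2 u.1 u.2).trans ?_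
    exact Finset.sum_coe_sort (G.verts S) (fun u => (n u i : ℝ) • χ (G.vac S v (n - unit u i)))
  · have h3 := hχ _ (IsRelVac.ibp (G.pieceAt S hS ⟨r, hr⟩ n) ⟨v, hv⟩ 
      (fun h => hvr (congrArg Subtype.val h)) i)
    rwa [map_add] at h3

lemma single_val {V : Type} {p : V → Prop} {_ : DecidableEq {v // p v}} {_ : DecidableEq V}
    (r : {v // p v}) (x : MultiIndex d) (w : {v // p v}) :
    (Pi.single r x : {v // p v} → MultiIndex d) w = (Pi.single r.1 x : V → MultiIndex d) w.1 := by
  by_cases hw : w = r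
  · subst hw; simp
  · rw [Pi.single_eq_of_ne hw, Pi.single_eq_of_ne fun h => hw (Subtype.ext h)]

lemma multiChoose_extendZero {V : Type} [Fintype V] (s : Finset V) (n : V → MultiIndex d)
    (m : {v // v ∈ s} → MultiIndex d) :
    multiChoose (fun v : {v // v ∈ s} => n v.1) m = multiChoose n (extendZero m) := by
  unfold multiChoose
  have h : ∀ v : {v // v ∈ s}, ∏ i, (n v.1 i).choose (m v i)
      = ∏ i, (n v.1 i).choose (extendZero m v.1 i) := fun v => by rw [extendZero_apply]
  rw [Finset.prod_congr rfl fun v _ => h v,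
    Finset.prod_coe_sort s fun v => ∏ i, (n v i).choose (extendZero m v i)]
  refine Finset.prod_subset (Finset.subset_univ _) fun v _ hv => ?_
  simp [extendZero, hv]

lemma sum_extendZero {V N : Type} [Fintype V] [AddCommMonoid N] (s : Finset V)
    (m : {v // v ∈ s} → MultiIndex d) (f : MultiIndex d → N) (hf : f 0 = 0) :
    ∑ v, f (m v) = ∑ v, f (extendZero m v) := by
  have h : ∀ v : {v // v ∈ s}, f (m v) = f (extendZero m v.1) := fun v => by rw [extendZero_apply]
  rw [Finset.sum_congr rfl fun v _ => h v, Finset.sum_coe_sort s fun v => f (extendZero m v)]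
  refine Finset.sum_subset (Finset.subset_univ _) fun v _ hv => ?_
  simp [extendZero, hv, hf]

/-- Change of the distinguished vertex of a connected subgraph. -/
lemma vac_translate (hχ : ∀ x, IsRelVac 𝔖 x → χ x = 0) [Fintype V] {G : LGraph 𝔖 V E k}
    {S : Finset E} (hS : G.IsConn S) {r r' : V} (hr : r ∈ G.verts S) (hr' : r' ∈ G.verts S)
    (n : V → MultiIndex d) :
    χ (G.vac S r n) = translate (G.verts S : Set V) r (fun n => χ (G.vac S r' n)) n := by
  have h3 := hχ _ (IsRelVac.moveRoot (G.pieceAt S hS ⟨r, hr⟩ n) ⟨r', hr'⟩)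
  rw [map_sub, sub_eq_zero] at h3
  rw [vac_of_isConn hS hr, h3]
  refine (congrArg χ ((finsum_congr fun m => ?_).trans (finsum_extendZero (p := (· ∈ G.verts S))
    fun j => ((-1 : ℝ) ^ tot j * (multiChoose n j : ℝ)) •
      G.vac S r' (n - j + Pi.single r (total j))))).trans ?_
  · have h2 : ∑ u, m u = total (extendZero m) := sum_extendZero _ m id rfl
    have h4 : ∑ u, order (m u) = tot (extendZero m) := sum_extendZero _ m order order_zero
    have h5 : multiChoose (G.pieceAt S hS ⟨r, hr⟩ n).n m = multiChoose n (extendZero m) :=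
      multiChoose_extendZero _ n m
    rw [vac_of_isConn hS hr', h4, h5, h2]
    congr 2
    unfold VacDiagram.redecorate pieceAt
    congr 1
    funext w
    have h6 : m w = extendZero m w.1 := (extendZero_apply m w).symm
    exact congrArg₂ (fun x y => n w.1 - x + y) h6 (single_val _ _ _)
  · have h5 := esum_map (I := (G.verts S : Set V)) (χ.toLinearMap.toAddMonoidHom)
      (bounded_choose (G.verts S : Set V) n (fun j => (-1 : ℝ) ^ tot j)
        (fun j => G.vac S r' (n - j + Pi.single r (total j))))
    refine h5.trans (esum_congr fun j _ => ?_)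
    exact map_smul χ _ _

/-- For `v = v_⋆` the third type of relation says that a decoration at the distinguished vertex
stands for a power of `X_{v_⋆} - X_{v_⋆} = 0`. -/
lemma vac_root_ne_zero (hχ : ∀ x, IsRelVac 𝔖 x → χ x = 0) [Fintype V] {G : LGraph 𝔖 V E k}
    {S : Finset E} {r : V} {n : V → MultiIndex d} (hn : n r ≠ 0) : χ (G.vac S r n) = 0 := by
  by_cases h : G.IsConn S ∧ r ∈ G.verts S
  · rw [vac_translate hχ h.1 h.2 h.2]
    exact translate_eq_zero _ (Finset.mem_coe.2 h.2) _ hn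
  · rw [vac, dif_neg h, if_neg hn, map_zero]

lemma vac_deg_pos (hJ : ∀ τ : VacDiagram 𝔖, 0 < τ.deg → χ τ.toThat = 0) [Fintype V]
    {G : LGraph 𝔖 V E k} {S : Finset E} (hS : G.IsConn S) {r : V} (hr : r ∈ G.verts S)
    {n : V → MultiIndex d} (hn : 0 < G.subDeg S n) : χ (G.vac S r n) = 0 := by
  rw [vac_of_isConn hS hr]
  exact hJ _ (by rwa [pieceAt_deg])

end Character

/-- The connected component of `r`, as a vacuum diagram with distinguished vertex `r`. -/
def rootVac [Fintype V] [Fintype E] (G : LGraph 𝔖 V E k) (r : V) (n : V → MultiIndex d) :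
    That 𝔖 := G.vac (G.comp Finset.univ r) r n

/-! ### Components with legs -/

/-- The Feynman diagram made of the components with legs. -/
abbrev legDiagram [Fintype V] [Fintype E] (G : LGraph 𝔖 V E k) : FeynmanDiagram 𝔖 where
  V := {v // ∃ j, G.conn Finset.univ v (G.leg j)}
  E := {e // ∃ j, G.conn Finset.univ (G.src e) (G.leg j)}
  k := k
  G := G.legPart
  has_leg v := by
    obtain ⟨j, hj⟩ := v.2
    exact ⟨j, (G.conn_legPart hj).2 _ _⟩

/-- The half-edges of the part with legs as half-edges of the ambient graph. -/
def legIncl (p : E → Prop) : HalfEdge {e // p e} k → HalfEdge E k :=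
  Sum.map (Prod.map Subtype.val id) id

lemma legIncl_injective (p : E → Prop) : Function.Injective (legIncl (k := k) p) :=
  (Subtype.val_injective.prodMap Function.injective_id).sumMap Function.injective_id

lemma halfSign_legIncl (p : E → Prop) (h : HalfEdge {e // p e} k) :
    halfSign (legIncl p h) = halfSign h := by
  rcases h with (⟨e, b⟩ | j)
  · cases b <;> rfl
  · rfl

lemma legDiagram_shift [Fintype V] [Fintype E] (G : LGraph 𝔖 V E k)
    (l : HalfEdge E k → MultiIndex d) :
    (G.shift l).legDiagram = G.legDiagram.shift (fun h => l (legIncl _ h)) := rfl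

lemma conn_vert_univ [Fintype E] (G : LGraph 𝔖 V E k) (e : E) (b : Bool) :
    G.conn Finset.univ (G.src e) (G.vert (Sum.inl (e, b))) := G.conn_vert (Finset.mem_univ e) b

/-- Integration by parts at a vertex of the part with legs. -/
lemma leg_ibp [Fintype V] [Fintype E] (G : LGraph 𝔖 V E k) {v : V}
    (hv : ∃ j, G.conn Finset.univ v (G.leg j)) (i : Fin d) :
    ∑ h ∈ Finset.univ.filter (fun h => G.vert h = v),
      halfSign h • (G.shift (unit h i)).legDiagram.toH = 0 := by
  have h1 : (dT 𝔖).mkQ _ = 0 :=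
    (Submodule.Quotient.mk_eq_zero _).2 (Submodule.subset_span (IsRelT.ibp G.legDiagram ⟨v, hv⟩ i))
  rw [map_sum] at h1
  rw [← h1]
  symm
  refine Finset.sum_bij (fun h _ => legIncl _ h) ?_ ?_ ?_ ?_
  · rintro (⟨e, b⟩ | j) hh
    · simp only [Finset.mem_filter, Finset.mem_univ, true_and] at hh ⊢
      cases b <;> exact congrArg Subtype.val hh
    · simp only [Finset.mem_filter, Finset.mem_univ, true_and] at hh ⊢
      exact congrArg Subtype.val hh
  · exact fun h _ h' _ hh => legIncl_injective _ hh
  · rintro (⟨e, b⟩ | j) hh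
    · simp only [Finset.mem_filter, Finset.mem_univ, true_and] at hh
      obtain ⟨j, hj⟩ := hv
      have he : ∃ j, G.conn Finset.univ (G.src e) (G.leg j) :=
        ⟨j, (G.conn _).trans (hh ▸ G.conn_vert_univ e b) hj⟩
      refine ⟨Sum.inl (⟨e, he⟩, b), ?_, rfl⟩
      simp only [Finset.mem_filter, Finset.mem_univ, true_and]
      cases b <;> exact Subtype.ext hh
    · simp only [Finset.mem_filter, Finset.mem_univ, true_and] at hh
      refine ⟨Sum.inr j, ?_, rfl⟩
      simp only [Finset.mem_filter, Finset.mem_univ, true_and]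
      exact Subtype.ext hh
  · intro h _
    rw [halfSign_legIncl, legDiagram_shift, single_comp_injective (legIncl_injective _),
      FeynmanDiagram.toH, ← map_smul, Finsupp.smul_single, smul_eq_mul, mul_one]

/-- The edge belongs to a component with a leg. -/
def LegEdge [Fintype E] (G : LGraph 𝔖 V E k) (e : E) : Prop :=
  ∃ j, G.conn Finset.univ (G.src e) (G.leg j)

lemma toH_eq_of_iso {Γ Γ' : FeynmanDiagram 𝔖} (f : Iso Γ.G Γ'.G) : Γ.toH = Γ'.toH := by
  rw [FeynmanDiagram.toH, FeynmanDiagram.toH, ← sub_eq_zero, ← map_sub]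
  exact (Submodule.Quotient.mk_eq_zero _).2 (Submodule.subset_span (IsRelT.iso Γ Γ' f))

/-- Isomorphic parts with legs define the same element of `H`. -/
lemma legDiagram_congr [Fintype V] [Fintype E] [Fintype V'] [Fintype E'] {G : LGraph 𝔖 V E k}
    {G' : LGraph 𝔖 V' E' k} (φ : E → E') (hE : ∀ e, G.LegEdge e → G'.LegEdge (φ e))
    (hE' : ∀ e', G'.LegEdge e' → ∃ e, G.LegEdge e ∧ φ e = e')
    (hinj : ∀ e e', G.LegEdge e → G.LegEdge e' → φ e = φ e' → e = e')
    (hv : ∀ h h' : HalfEdge E k, (∀ e b, h = Sum.inl (e, b) → G.LegEdge e) →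
      (∀ e b, h' = Sum.inl (e, b) → G.LegEdge e) →
      (G.vert h = G.vert h' ↔ G'.vert (Sum.map (Prod.map φ id) id h)
        = G'.vert (Sum.map (Prod.map φ id) id h')))
    (hlab : ∀ e, G.LegEdge e → G'.lab (φ e) = G.lab e)
    (hleg : ∀ j, G'.legLab j = G.legLab j) : G.legDiagram.toH = G'.legDiagram.toH := by
  have surj : ∀ {V E : Type} [Fintype V] [Fintype E] (G : LGraph 𝔖 V E k),
      Function.Surjective G.legDiagram.G.vert := by
    intro V E _ _ G ⟨v, j, hj⟩
    by_cases h : v = G.leg j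
    · exact ⟨Sum.inr j, Subtype.ext h.symm⟩
    · obtain ⟨e, -, b, hb⟩ := mem_verts.1 (G.mem_verts_of_conn hj h).1
      refine ⟨Sum.inl (⟨e, j, (G.conn _).trans (hb ▸ G.conn_vert_univ e b) hj⟩, b), ?_⟩
      cases b <;> exact Subtype.ext hb
  set φ' : HalfEdge G.legDiagram.E k → HalfEdge G'.legDiagram.E k :=
    Sum.map (Prod.map (fun e => ⟨φ e.1, hE _ e.2⟩) id) id with hφ'
  have hval : ∀ h, (G.legDiagram.G.vert h).1 = G.vert (legIncl _ h) := by
    rintro (⟨e, b⟩ | j)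
    · cases b <;> rfl
    · rfl
  have hval' : ∀ h, (G'.legDiagram.G.vert (φ' h)).1
      = G'.vert (Sum.map (Prod.map φ id) id (legIncl _ h)) := by
    rintro (⟨e, b⟩ | j)
    · cases b <;> rfl
    · rfl
  have hLE : ∀ (h : HalfEdge G.legDiagram.E k) e b, legIncl _ h = Sum.inl (e, b) →
      G.LegEdge e := by
    rintro (⟨e', b'⟩ | j) e b h
    · have := Sum.inl.inj h
      exact (Prod.mk.inj this).1 ▸ e'.2
    · simp [legIncl] at h
  obtain ⟨f, hf⟩ := exists_equiv_of_ker G.legDiagram.G.vert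
    (fun h => G'.legDiagram.G.vert (φ' h)) (surj G) (fun v => by
      obtain ⟨h, rfl⟩ := surj G' v
      rcases h with (⟨e', b⟩ | j)
      · obtain ⟨e, he, hee⟩ := hE' _ e'.2
        refine ⟨Sum.inl (⟨e, he⟩, b), ?_⟩
        have : (⟨φ e, hE _ he⟩ : G'.legDiagram.E) = e' := Subtype.ext hee
        exact congrArg (fun e' => G'.legDiagram.G.vert (Sum.inl (e', b))) this
      · exact ⟨Sum.inr j, rfl⟩) (fun h h' => by
      have := hv _ _ (hLE h) (hLE h')
      rw [← hval, ← hval, ← hval', ← hval'] at this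
      exact Subtype.ext_iff.trans (this.trans Subtype.ext_iff.symm))
  refine toH_eq_of_iso ⟨f, Equiv.ofBijective (fun e => ⟨φ e.1, hE _ e.2⟩)
      ⟨fun e e' hee' => Subtype.ext (hinj _ _ e.2 e'.2 (Subtype.mk.inj hee')), fun e' => ?_⟩,
      rfl, ?_, ?_, ?_, ?_, ?_⟩
  · obtain ⟨e, he, hee'⟩ := hE' _ e'.2
    exact ⟨⟨e, he⟩, Subtype.ext hee'⟩
  · exact fun e => (hf (Sum.inl (e, false))).symm
  · exact fun e => (hf (Sum.inl (e, true))).symm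
  · exact fun e => hlab e.1 e.2
  · exact fun j => (hf (Sum.inr j)).symm
  · exact fun j => hleg j

end LGraph

namespace LGraph

variable {𝔖 : LabelSystem d 𝔏} {V E V' E' : Type} {k k' : ℕ}

/-! ### The connected components of a subgraph -/

lemma mem_comps {G : LGraph 𝔖 V E k} {S c : Finset E} :
    c ∈ G.comps S ↔ ∃ e ∈ S, G.comp S (G.src e) = c := Finset.mem_image

lemma comps_subset {G : LGraph 𝔖 V E k} {S c : Finset E} (hc : c ∈ G.comps S) : c ⊆ S := by
  obtain ⟨e, _, rfl⟩ := mem_comps.1 hc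
  exact Finset.filter_subset _ _

lemma comp_congr (G : LGraph 𝔖 V E k) {S : Finset E} {v w : V} (h : G.conn S v w) :
    G.comp S v = G.comp S w := by
  refine Finset.filter_congr fun e _ => ⟨fun h' => (G.conn S).trans ((G.conn S).symm h) h',
    fun h' => (G.conn S).trans h h'⟩

lemma comp_mem_comps [Fintype V] {G : LGraph 𝔖 V E k} {S : Finset E} {v : V}
    (hv : v ∈ G.verts S) : G.comp S v ∈ G.comps S ∧ v ∈ G.verts (G.comp S v) := by
  refine ⟨?_, mem_verts_comp.2 ⟨hv, (G.conn S).refl _⟩⟩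
  obtain ⟨e, he, b, rfl⟩ := mem_verts.1 hv
  exact mem_comps.2 ⟨e, he, G.comp_congr (G.conn_vert he b)⟩

lemma eq_comp_of_mem [Fintype V] {G : LGraph 𝔖 V E k} {S c : Finset E} {v : V}
    (hc : c ∈ G.comps S) (hv : v ∈ G.verts c) : c = G.comp S v := by
  obtain ⟨e, _, rfl⟩ := mem_comps.1 hc
  exact G.comp_congr (mem_verts_comp.1 hv).2

lemma comps_disjoint [Fintype V] {G : LGraph 𝔖 V E k} {S c c' : Finset E} (hc : c ∈ G.comps S)
    (hc' : c' ∈ G.comps S) (hne : c ≠ c') {v : V} (hv : v ∈ G.verts c) : v ∉ G.verts c' :=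
  fun hv' => hne ((eq_comp_of_mem hc hv).trans (eq_comp_of_mem hc' hv').symm)

lemma verts_comps_subset [Fintype V] {G : LGraph 𝔖 V E k} {S c : Finset E}
    (hc : c ∈ G.comps S) : G.verts c ⊆ G.verts S := G.verts_mono (comps_subset hc)

lemma conn_iff_mem_verts [Fintype V] {G : LGraph 𝔖 V E k} {S c : Finset E} {v w : V}
    (hc : c ∈ G.comps S) (hv : v ∈ G.verts c) : G.conn S v w ↔ w ∈ G.verts c := by
  rw [eq_comp_of_mem hc hv, mem_verts_comp]
  refine ⟨fun h => ⟨?_, h⟩, fun h => h.2⟩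
  by_cases hvw : v = w
  · rw [← hvw]; exact verts_comps_subset hc hv
  · exact (G.mem_verts_of_conn h hvw).2

/-! ### Extraction of a subgraph -/

/-- The directions in which a Taylor expansion is done when `S` is extracted: the boundary
half-edges and, for the node decoration, the vertices of `S`. -/
def slots [Fintype V] [Fintype E] (G : LGraph 𝔖 V E k) (S : Finset E) :
    Set (HalfEdge E k ⊕ V) :=
  {x | Sum.elim (· ∈ G.boundary S) (· ∈ G.verts S) x}

/-- The vertex at which a direction is located. -/
def slotVert (G : LGraph 𝔖 V E k) : HalfEdge E k ⊕ V → V := Sum.elim G.vert id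

end LGraph


/-- The part of a family of multiindices located at half-edges. -/
def halfPart {A V : Type} (y : A ⊕ V → MultiIndex d) : A → MultiIndex d := fun h => y (Sum.inl h)

/-- The part of a family of multiindices located at vertices. -/
def vertPart {A V : Type} (y : A ⊕ V → MultiIndex d) : V → MultiIndex d := fun v => y (Sum.inr v)

/-- The coefficient `(-1)^|out ℓ| n! / (n - m)!` of `y = (ℓ, m)`. -/
def slotCoeff {V E : Type} {k : ℕ} [Fintype V] [Fintype E] (n : V → MultiIndex d)
    (y : HalfEdge E k ⊕ V → MultiIndex d) : ℝ :=
  (-1 : ℝ) ^ outOrder (halfPart y) *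
    ∏ v, ∏ i, ((n v i).descFactorial (y (Sum.inr v) i) : ℝ)

section Extraction

variable {𝔖 : LabelSystem d 𝔏} {V E : Type} {k : ℕ} [Fintype V] [Fintype E]
variable {B M : Type*} [CommRing B] [Algebra ℝ B] [AddCommGroup M] [Module ℝ M] [Module B M]
  [IsScalarTower ℝ B M]

/-- The sum defining the extraction of `S`: the function `L` gives the value of the extracted
subgraph as function of its decoration, and `g` the value of the quotient as function of the
changes of labels and of the decoration. -/
def extraction (G : LGraph 𝔖 V E k) (S : Finset E) (L : (V → MultiIndex d) → B)
    (g : (HalfEdge E k → MultiIndex d) → (V → MultiIndex d) → M) (n : V → MultiIndex d) : M :=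
  esum (G.slots S) fun y => invFact y •
    slotCoeff n y • L (fib G.slotVert y) • g (halfPart y) (n - vertPart y)

/-- The function vanishes on decorations of large order on the vertices of `S`. -/
def Truncated (G : LGraph 𝔖 V E k) (S : Finset E) (L : (V → MultiIndex d) → B) : Prop :=
  ∃ N : ℕ, ∀ a, N < ∑ v ∈ G.verts S, order (a v) → L a = 0

variable {G : LGraph 𝔖 V E k} {S : Finset E}

lemma slotVert_mem {x : HalfEdge E k ⊕ V} (hx : x ∈ G.slots S) : G.slotVert x ∈ G.verts S := by
  rcases x with h | v
  · exact (Finset.mem_filter.1 hx).2.1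
  · exact hx

lemma tot_le_fib {y : HalfEdge E k ⊕ V → MultiIndex d} (hy : y ∈ Supp d (G.slots S)) :
    tot y = ∑ v ∈ G.verts S, order (fib G.slotVert y v) := by
  unfold fib
  simp only [order_sum]
  simp only [Finset.sum_filter]
  rw [Finset.sum_comm]
  refine Finset.sum_congr rfl fun x _ => ?_
  rw [Finset.sum_ite_eq]
  split_ifs with hx
  · rfl
  · rw [hy x fun h => hx (slotVert_mem h), order_zero]

lemma Truncated.exists_bound {L : (V → MultiIndex d) → B} (hL : Truncated G S L) :
    ∃ N, ∀ y ∈ Supp d (G.slots S), N < tot y → L (fib G.slotVert y) = 0 := by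
  obtain ⟨N, hN⟩ := hL
  exact ⟨N, fun y hy h => hN _ (by rwa [← tot_le_fib hy])⟩

lemma Truncated.bounded {L : (V → MultiIndex d) → B} (hL : Truncated G S L)
    (c c' : (HalfEdge E k ⊕ V → MultiIndex d) → ℝ)
    (g : (HalfEdge E k ⊕ V → MultiIndex d) → M) :
    Bounded (G.slots S) (fun y => c y • c' y • L (fib G.slotVert y) • g y) := by
  obtain ⟨N, hN⟩ := hL.exists_bound
  exact ⟨N, fun y hy h => by beta_reduce; rw [hN y hy h]; simp⟩

lemma Truncated.sum {ι : Type*} {s : Finset ι} {L : ι → (V → MultiIndex d) → B} {c : ι → ℝ}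
    (hL : ∀ j ∈ s, Truncated G S (L j)) : Truncated G S (fun a => ∑ j ∈ s, c j • L j a) := by
  choose! N hN using hL
  refine ⟨s.sup N, fun a ha => Finset.sum_eq_zero fun j hj => ?_⟩
  rw [hN j hj a ((Finset.le_sup hj).trans_lt ha), smul_zero]

lemma Truncated.lower {L : (V → MultiIndex d) → B} (hL : Truncated G S L) (v : V) (i : Fin d) :
    Truncated G S (fun a => (a v i : ℝ) • L (a - unit v i)) := by
  obtain ⟨N, hN⟩ := hL
  refine ⟨N + 1, fun a ha => ?_⟩
  beta_reduce
  rw [hN, smul_zero]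
  have h1 : ∀ u, order (a u) ≤ order ((a - unit v i) u) + order ((unit v i : V → MultiIndex d) u) := by
    intro u
    rw [← order_add]
    refine Finset.sum_le_sum fun j _ => ?_
    simp only [Pi.sub_apply, Pi.add_apply]
    omega
  have h2 : ∑ u ∈ G.verts S, order ((unit v i : V → MultiIndex d) u) ≤ 1 :=
    (Finset.sum_le_sum_of_subset (Finset.subset_univ _)).trans (tot_unit v i).le
  have h3 := Finset.sum_le_sum fun u (_ : u ∈ G.verts S) => h1 u
  rw [Finset.sum_add_distrib] at h3
  omega

lemma extraction_congr {L L' : (V → MultiIndex d) → B}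
    {g g' : (HalfEdge E k → MultiIndex d) → (V → MultiIndex d) → M} {n : V → MultiIndex d}
    (hL : ∀ y ∈ Supp d (G.slots S), L (fib G.slotVert y) = L' (fib G.slotVert y))
    (hg : ∀ y ∈ Supp d (G.slots S),
      g (halfPart y) (n - vertPart y) = g' (halfPart y) (n - vertPart y)) :
    extraction G S L g n = extraction G S L' g' n :=
  esum_congr fun y hy => by rw [hL y hy, hg y hy]

lemma extraction_sum_right {ι : Type*} {s : Finset ι} {L : (V → MultiIndex d) → B}
    (hL : Truncated G S L) (c : ι → ℝ)
    (g : ι → (HalfEdge E k → MultiIndex d) → (V → MultiIndex d) → M) (n : V → MultiIndex d) :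
    extraction G S L (fun l b => ∑ j ∈ s, c j • g j l b) n
      = ∑ j ∈ s, c j • extraction G S L (g j) n := by
  unfold extraction
  simp only [← fun j => esum_smul (c j) (hL.bounded invFact (slotCoeff n)
    fun y => g j (halfPart y) (n - vertPart y))]
  rw [← esum_sum fun j _ => (hL.bounded (fun y => c j • invFact y) (slotCoeff n)
    fun y => g j (halfPart y) (n - vertPart y)).congr fun y _ h => by rw [← h, smul_assoc]]
  refine esum_congr fun y _ => ?_
  simp only [Finset.smul_sum]
  refine Finset.sum_congr rfl fun j _ => ?_
  rw [smul_comm (L _) (c j), smul_comm _ (c j), smul_comm _ (c j)]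

lemma extraction_add_right {L : (V → MultiIndex d) → B} (hL : Truncated G S L)
    (g g' : (HalfEdge E k → MultiIndex d) → (V → MultiIndex d) → M) (n : V → MultiIndex d) :
    extraction G S L (fun l b => g l b + g' l b) n
      = extraction G S L g n + extraction G S L g' n := by
  have := extraction_sum_right (s := Finset.univ) hL (fun _ : Bool => 1)
    (fun b => if b then g else g') n
  simpa using this

lemma extraction_sum_left {ι : Type*} {s : Finset ι} {L : ι → (V → MultiIndex d) → B}
    (hL : ∀ j ∈ s, Truncated G S (L j)) (c : ι → ℝ)
    (g : (HalfEdge E k → MultiIndex d) → (V → MultiIndex d) → M) (n : V → MultiIndex d) :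
    extraction G S (fun a => ∑ j ∈ s, c j • L j a) g n
      = ∑ j ∈ s, c j • extraction G S (L j) g n := by
  unfold extraction
  rw [Finset.sum_congr rfl fun j hj => (esum_smul (c j) ((hL j hj).bounded invFact (slotCoeff n)
    fun y => g (halfPart y) (n - vertPart y))).symm]
  rw [← esum_sum fun j hj => ((hL j hj).bounded (fun y => c j • invFact y) (slotCoeff n)
    fun y => g (halfPart y) (n - vertPart y)).congr fun y _ h => by rw [← h, smul_assoc]]
  refine esum_congr fun y _ => ?_
  simp only [Finset.smul_sum, Finset.sum_smul]
  refine Finset.sum_congr rfl fun j _ => ?_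
  rw [smul_assoc, smul_comm _ (c j), smul_comm _ (c j)]

lemma extraction_add_left {L L' : (V → MultiIndex d) → B} (hL : Truncated G S L)
    (hL' : Truncated G S L')
    (g : (HalfEdge E k → MultiIndex d) → (V → MultiIndex d) → M) (n : V → MultiIndex d) :
    extraction G S (fun a => L a + L' a) g n
      = extraction G S L g n + extraction G S L' g n := by
  have := extraction_sum_left (s := Finset.univ) (L := fun b : Bool => if b then L else L')
    (by rintro (_ | _) _ <;> assumption) (fun _ : Bool => 1) g n
  simpa using this

lemma outOrder_add_unit (l : HalfEdge E k → MultiIndex d) (h : HalfEdge E k) (i : Fin d) :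
    (-1 : ℝ) ^ outOrder (l + unit h i) = halfSign h * (-1 : ℝ) ^ outOrder l := by
  have h1 : outOrder (l + unit h i) = outOrder l
      + ∑ e : E, order ((unit h i : HalfEdge E k → MultiIndex d) (Sum.inl (e, false))) := by
    simp [outOrder, order_add, Finset.sum_add_distrib]
  rw [h1, pow_add, mul_comm]
  congr 1
  rcases h with (⟨e, b⟩ | j)
  · cases b
    · rw [Finset.sum_eq_single e]
      · simp [order_single, halfSign]
      · intro e' _ he'
        have : (Sum.inl (e', false) : HalfEdge E k) ≠ Sum.inl (e, false) := by simpa using he'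
        simp [Pi.single_eq_of_ne this, order_zero]
      · simp
    · rw [Finset.sum_eq_zero]
      · simp [halfSign]
      · intro e' _
        simp [order_zero]
  · rw [Finset.sum_eq_zero]
    · simp [halfSign]
    · intro e' _
      simp [order_zero]

omit [Fintype V] [Fintype E] in
lemma halfPart_add_inl (y : HalfEdge E k ⊕ V → MultiIndex d) (h : HalfEdge E k) (i : Fin d) :
    halfPart (y + unit (Sum.inl h) i) = halfPart y + unit h i ∧
      vertPart (y + unit (Sum.inl h) i) = vertPart y := by
  constructor
  · funext h'
    by_cases hh : h' = h
    · subst hh; simp [halfPart]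
    · have : (Sum.inl h' : HalfEdge E k ⊕ V) ≠ Sum.inl h := by simpa using hh
      simp [halfPart, Pi.single_eq_of_ne this, Pi.single_eq_of_ne hh]
  · funext v
    simp [vertPart]

omit [Fintype V] [Fintype E] in
lemma halfPart_add_inr (y : HalfEdge E k ⊕ V → MultiIndex d) (v : V) (i : Fin d) :
    halfPart (y + unit (Sum.inr v) i) = halfPart y ∧
      vertPart (y + unit (Sum.inr v) i) = vertPart y + unit v i := by
  constructor
  · funext h
    simp [halfPart]
  · funext w
    by_cases hh : w = v
    · subst hh; simp [vertPart]
    · have : (Sum.inr w : HalfEdge E k ⊕ V) ≠ Sum.inr v := by simpa using hh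
      simp [vertPart, Pi.single_eq_of_ne this, Pi.single_eq_of_ne hh]

lemma slotCoeff_add_inl (n : V → MultiIndex d) (y : HalfEdge E k ⊕ V → MultiIndex d)
    (h : HalfEdge E k) (i : Fin d) :
    slotCoeff n (y + unit (Sum.inl h) i) = halfSign h * slotCoeff n y := by
  unfold slotCoeff
  rw [(halfPart_add_inl y h i).1, outOrder_add_unit, mul_assoc]
  have : ∀ v, (y + unit (Sum.inl h) i : HalfEdge E k ⊕ V → MultiIndex d) (Sum.inr v) = y (Sum.inr v) :=
    congrFun (halfPart_add_inl y h i).2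
  simp only [this]

lemma slotCoeff_add_inr (n : V → MultiIndex d) (y : HalfEdge E k ⊕ V → MultiIndex d)
    (v : V) (i : Fin d) :
    slotCoeff n (y + unit (Sum.inr v) i) = ((n - vertPart y) v i : ℕ) * slotCoeff n y := by
  unfold slotCoeff
  rw [(halfPart_add_inr y v i).1, mul_left_comm]
  congr 1
  have : ∀ w, (y + unit (Sum.inr v) i : HalfEdge E k ⊕ V → MultiIndex d) (Sum.inr w) = (vertPart y + unit v i : V → MultiIndex d) w :=
    congrFun (halfPart_add_inr y v i).2
  simp only [this]
  refine prod_prod_add_unit v i _ _ _ ?_ fun w j hj => ?_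
  · simp only [Pi.add_apply, unit_apply_same, Nat.descFactorial_succ, Pi.sub_apply, vertPart]
    push_cast
    rfl
  · simp only [Pi.add_apply, unit_apply_ne hj, add_zero, vertPart]

/-- `n_v (n - 1_v)! / (n - 1_v - m)! = (n - m)_v n! / (n - m)!`. -/
lemma mul_slotCoeff_sub (n : V → MultiIndex d) (y : HalfEdge E k ⊕ V → MultiIndex d)
    (v : V) (i : Fin d) :
    (n v i : ℝ) * slotCoeff (n - unit v i) y = ((n - vertPart y) v i : ℕ) * slotCoeff n y := by
  rw [← slotCoeff_add_inr]
  unfold slotCoeff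
  rw [(halfPart_add_inr y v i).1, mul_left_comm]
  congr 1
  have : ∀ w, (y + unit (Sum.inr v) i : HalfEdge E k ⊕ V → MultiIndex d) (Sum.inr w) = (vertPart y + unit v i : V → MultiIndex d) w :=
    congrFun (halfPart_add_inr y v i).2
  simp only [this]
  symm
  refine prod_prod_add_unit v i _ _ _ ?_ fun w j hj => ?_
  · simp only [Pi.add_apply, unit_apply_same, Pi.sub_apply, vertPart]
    rcases Nat.eq_zero_or_pos (n v i) with h0 | h0
    · simp [h0]
    · obtain ⟨m, hm⟩ := Nat.exists_eq_succ_of_ne_zero h0.ne'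
      rw [hm, Nat.succ_sub_one, Nat.succ_descFactorial_succ]
      push_cast
      rfl
  · simp only [Pi.add_apply, unit_apply_ne hj, add_zero, Pi.sub_apply, tsub_zero, vertPart]

/-- Lowering of the decoration before extraction amounts to lowering it in the quotient. -/
lemma extraction_lower {L : (V → MultiIndex d) → B} (hL : Truncated G S L)
    (g : (HalfEdge E k → MultiIndex d) → (V → MultiIndex d) → M) (n : V → MultiIndex d)
    (v : V) (i : Fin d) :
    (n v i : ℝ) • extraction G S L g (n - unit v i)
      = extraction G S L (fun l b => (b v i : ℝ) • g l (b - unit v i)) n := by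
  unfold extraction
  rw [← esum_smul _ (hL.bounded _ _ _)]
  refine esum_congr fun y _ => ?_
  rw [smul_comm (n v i : ℝ), smul_smul (n v i : ℝ), mul_slotCoeff_sub, smul_comm (L _),
    smul_smul (slotCoeff n y), mul_comm, tsub_right_comm]

/-- Lowering of the decoration of the extracted subgraph at `v` is dual to integration by parts
in the quotient. -/
lemma extraction_adjoint {L : (V → MultiIndex d) → B} (hL : Truncated G S L)
    (g : (HalfEdge E k → MultiIndex d) → (V → MultiIndex d) → M) (n : V → MultiIndex d)
    {v : V} (hv : v ∈ G.verts S) (i : Fin d) :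
    extraction G S (fun a => (a v i : ℝ) • L (a - unit v i)) g n
      = extraction G S L (fun l b =>
        (∑ h ∈ Finset.univ.filter (fun h => h ∈ G.boundary S ∧ G.vert h = v),
          halfSign h • g (l + unit h i) b) + (b v i : ℝ) • g l (b - unit v i)) n := by
  obtain ⟨N, hN⟩ := hL.exists_bound
  have h1 := esum_adjoint (I := G.slots S) G.slotVert
    (fun a z => slotCoeff n z • L a • g (halfPart z) (n - vertPart z)) v i
    ⟨N, fun y hy h z => by rw [hN y hy h]; simp⟩
  have h2 : extraction G S (fun a => (a v i : ℝ) • L (a - unit v i)) g n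
      = esum (G.slots S) fun y => invFact y • (fib G.slotVert y v i : ℝ) •
        slotCoeff n y • L (fib G.slotVert y - unit v i) • g (halfPart y) (n - vertPart y) := by
    refine esum_congr fun y _ => ?_
    rw [smul_assoc, smul_comm (slotCoeff n y)]
  rw [h2, h1, extraction_add_right hL, extraction_sum_right hL, Finset.sum_filter,
    Fintype.sum_sum_type]
  congr 1
  · rw [Finset.sum_filter]
    refine Finset.sum_congr rfl fun h _ => ?_
    refine if_congr Iff.rfl ?_ rfl
    unfold extraction
    rw [← esum_smul _ (hL.bounded _ _ _)]
    refine esum_congr fun y _ => ?_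
    rw [(halfPart_add_inl y h i).1, (halfPart_add_inl y h i).2, slotCoeff_add_inl, mul_smul,
      smul_comm (invFact y) (halfSign h)]
  · rw [Finset.sum_eq_single v]
    · rw [if_pos ⟨hv, rfl⟩]
      refine esum_congr fun y _ => ?_
      rw [(halfPart_add_inr y v i).1, (halfPart_add_inr y v i).2, slotCoeff_add_inr,
        smul_comm (L _) (((n - vertPart y) v i : ℕ) : ℝ), smul_smul (slotCoeff n y), mul_comm,
        tsub_add_eq_tsub_tsub]
    · intro w _ hw
      exact if_neg fun h => hw h.2
    · simp

/-! ### The extracted subgraph -/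

variable {χ : That 𝔖 →ₐ[ℝ] B}

/-- The product of the connected components of `S`, with distinguished vertices given by `ρ`. -/
def leftPart (χ : That 𝔖 →ₐ[ℝ] B) (G : LGraph 𝔖 V E k) (S : Finset E) (ρ : Finset E → V)
    (a : V → MultiIndex d) : B := ∏ c ∈ G.comps S, χ (G.vac c (ρ c) a)

omit [Fintype E] in
lemma vac_congr_dec {c : Finset E} {r : V} {a a' : V → MultiIndex d} (hr : r ∈ G.verts c)
    (h : ∀ v ∈ G.verts c, a v = a' v) : G.vac c r a = G.vac c r a' := by
  unfold vac
  split_ifs with h1 h2 h2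
  · congr 1
    unfold pieceAt
    congr 1
    funext v
    exact h v.1 v.2
  · rfl
  · exact absurd ((h r hr).symm.trans ‹a r = 0›) h2
  · exact absurd ((h r hr).trans ‹a' r = 0›) h2
  · rfl

omit [Fintype E] in
lemma vac_shift_eq {c : Finset E} {r : V} {a : V → MultiIndex d}
    {l : HalfEdge E k → MultiIndex d} (h : ∀ e ∈ c, ∀ b, l (Sum.inl (e, b)) = 0) :
    (G.shift l).vac c r a = G.vac c r a := by
  unfold vac
  by_cases h1 : G.IsConn c ∧ r ∈ G.verts c
  · rw [dif_pos h1]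
    refine (dif_pos h1).trans ?_
    congr 1
    unfold pieceAt
    congr 1
    refine ext_of (fun _ => rfl) (fun _ => rfl) (fun e => ?_) (fun j => j.elim0) fun j => j.elim0
    simp only [sub, shift, h e.1 e.2]
    rw [add_zero, 𝔖.diff_zero]
  · rw [dif_neg h1]
    exact dif_neg h1

lemma order_le_sum_comps (a : V → MultiIndex d) :
    ∑ v ∈ G.verts S, order (a v) ≤ ∑ c ∈ G.comps S, ∑ v ∈ G.verts c, order (a v) := by
  rw [← Finset.sum_biUnion]
  · refine Finset.sum_le_sum_of_subset fun v hv => Finset.mem_biUnion.2 ⟨_, comp_mem_comps hv⟩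
  · intro c hc c' hc' hne
    exact Finset.disjoint_left.2 fun v hv => comps_disjoint hc hc' hne hv

/-- The degree of a decorated subgraph is that of the subgraph plus the order of the decoration. -/
lemma subDeg_eq (c : Finset E) (a : V → MultiIndex d) :
    G.subDeg c a = G.subDeg c 0 + ((∑ v ∈ G.verts c, order (a v) : ℕ) : ℝ) := by
  unfold subDeg
  simp only [Pi.zero_apply, order_zero]
  push_cast
  rw [Finset.sum_const_zero]
  ring

/-- A product over components vanishes on decorations of large order, if each of the factors
does on the corresponding component. -/
lemma truncated_prod {L : Finset E → (V → MultiIndex d) → B}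
    (hL : ∀ c ∈ G.comps S, ∃ N : ℕ, ∀ a, N < ∑ v ∈ G.verts c, order (a v) → L c a = 0) :
    Truncated G S (fun a => ∏ c ∈ G.comps S, L c a) := by
  choose! N hN using hL
  refine ⟨∑ c ∈ G.comps S, N c, fun a ha => ?_⟩
  obtain ⟨c, hc, hlt⟩ := Finset.exists_lt_of_sum_lt (ha.trans_le (order_le_sum_comps a))
  exact Finset.prod_eq_zero hc (hN c hc a hlt)

lemma vac_truncated (hJ : ∀ τ : VacDiagram 𝔖, 0 < τ.deg → χ τ.toThat = 0) {c : Finset E}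
    (hc : G.IsConn c) {r : V} (hr : r ∈ G.verts c) :
    ∃ N : ℕ, ∀ a, N < ∑ v ∈ G.verts c, order (a v) → χ (G.vac c r a) = 0 := by
  obtain ⟨N, hN⟩ := exists_nat_gt (-G.subDeg c 0)
  refine ⟨N, fun a ha => vac_deg_pos hJ hc hr ?_⟩
  rw [subDeg_eq]
  have : (N : ℝ) < ((∑ v ∈ G.verts c, order (a v) : ℕ) : ℝ) := by exact_mod_cast ha
  linarith

/-- The choice of distinguished vertices in the components of `S` is admissible. -/
def RootChoice (G : LGraph 𝔖 V E k) (S : Finset E) (ρ : Finset E → V) : Prop :=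
  ∀ c ∈ G.comps S, ρ c ∈ G.verts c

/-- Since diagrams of positive degree vanish, only finitely many terms contribute to an extraction.
-/
lemma leftPart_truncated (hJ : ∀ τ : VacDiagram 𝔖, 0 < τ.deg → χ τ.toThat = 0)
    {ρ : Finset E → V} (hρ : RootChoice G S ρ) : Truncated G S (leftPart χ G S ρ) :=
  truncated_prod fun c hc => vac_truncated hJ (G.isConn_of_mem_comps hc) (hρ c hc)

lemma vac_congr_unit {c : Finset E} {r u : V} (hr : r ∈ G.verts c) (hu : u ∉ G.verts c)
    (a : V → MultiIndex d) (i : Fin d) : G.vac c r (a - unit u i) = G.vac c r a :=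
  vac_congr_dec hr fun v hv => by
    have : v ≠ u := fun h => hu (h ▸ hv)
    simp [Pi.single_eq_of_ne this]

omit [Fintype V] [Fintype E] in
lemma inHalf_mono {S T : Finset E} (h : S ⊆ T) {x : HalfEdge E k} (hx : InHalf S x) :
    InHalf T x := by
  obtain ⟨e, he, b, rfl⟩ := hx
  exact ⟨e, h he, b, rfl⟩

omit [Fintype E] in
lemma vert_mem_of_inHalf {x : HalfEdge E k} (hx : InHalf S x) : G.vert x ∈ G.verts S := by
  obtain ⟨e, he, b, rfl⟩ := hx
  exact G.vert_mem he b

omit [Fintype V] [Fintype E] in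
lemma unit_inHalf {S : Finset E} {x : HalfEdge E k} (i : Fin d) (hx : ¬ InHalf S x) :
    ∀ e ∈ S, ∀ b, (unit x i : HalfEdge E k → MultiIndex d) (Sum.inl (e, b)) = 0 := fun e he b =>
  Pi.single_eq_of_ne (fun h => hx ⟨e, he, b, h.symm⟩) _

/-- Integration by parts in the extracted subgraph. -/
lemma leftPart_ibp (hχ : ∀ x, IsRelVac 𝔖 x → χ x = 0) {ρ : Finset E → V}
    (hρ : RootChoice G S ρ) {c : Finset E} (hc : c ∈ G.comps S) {v : V} (hv : v ∈ G.verts c)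
    (a : V → MultiIndex d) (i : Fin d) :
    (∑ h ∈ Finset.univ.filter (fun h => InHalf S h ∧ G.vert h = v),
      halfSign h • leftPart χ (G.shift (unit h i)) S ρ a)
        + (a v i : ℝ) • leftPart χ G S ρ (a - unit v i)
      = if v = ρ c then ∑ u ∈ G.verts c, (a u i : ℝ) • leftPart χ G S ρ (a - unit u i) else 0 := by
  have hmem : ∀ h : HalfEdge E k, InHalf S h ∧ G.vert h = v ↔ InHalf c h ∧ G.vert h = v := by
    refine fun h => ⟨fun ⟨h1, h2⟩ => ⟨?_, h2⟩, fun ⟨h1, h2⟩ => ⟨inHalf_mono (comps_subset hc) h1, h2⟩⟩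
    obtain ⟨e, he, b, rfl⟩ := h1
    refine ⟨e, ?_, b, rfl⟩
    rw [eq_comp_of_mem hc hv, mem_comp]
    exact ⟨he, (G.conn S).symm (h2 ▸ G.conn_vert he b)⟩
  have hsplit : ∀ (G' : LGraph 𝔖 V E k) (a' : V → MultiIndex d), G'.comps S = G.comps S →
      (∀ c' ∈ G.comps S, c' ≠ c → G'.vac c' (ρ c') a' = G.vac c' (ρ c') a) →
      leftPart χ G' S ρ a' = χ (G'.vac c (ρ c) a')
        * ∏ c' ∈ (G.comps S).erase c, χ (G.vac c' (ρ c') a) := by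
    intro G' a' h1 h2
    unfold leftPart
    rw [h1, ← Finset.mul_prod_erase _ _ hc]
    congr 1
    exact Finset.prod_congr rfl fun c' hc' => by
      rw [h2 c' (Finset.mem_of_mem_erase hc') (Finset.ne_of_mem_erase hc')]
  have h1 : ∀ u ∈ G.verts c, leftPart χ G S ρ (a - unit u i) = χ (G.vac c (ρ c) (a - unit u i))
        * ∏ c' ∈ (G.comps S).erase c, χ (G.vac c' (ρ c') a) := fun u hu =>
    hsplit G _ rfl fun c' hc' hne => vac_congr_unit (hρ c' hc') (comps_disjoint hc hc' hne.symm hu) _ _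
  have h2 : ∀ h, InHalf c h → leftPart χ (G.shift (unit h i)) S ρ a
      = χ ((G.shift (unit h i)).vac c (ρ c) a)
        * ∏ c' ∈ (G.comps S).erase c, χ (G.vac c' (ρ c') a) := fun h hh =>
    hsplit (G.shift (unit h i)) a rfl fun c' hc' hne => vac_shift_eq (unit_inHalf i fun hh' =>
      comps_disjoint hc hc' hne.symm (vert_mem_of_inHalf hh) (vert_mem_of_inHalf hh'))
  rw [Finset.filter_congr fun h _ => hmem h, Finset.sum_congr rfl fun h hh => by
    rw [h2 h (Finset.mem_filter.1 hh).2.1], h1 v hv, Finset.sum_congr (s₁ := G.verts c) rfl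
      fun u hu => by rw [h1 u hu]]
  have h3 := vac_ibp hχ (G.isConn_of_mem_comps hc) (hρ c hc) hv a i
  simp only [← smul_mul_assoc, ← Finset.sum_mul, ← add_mul]
  rw [h3]
  split_ifs
  · rfl
  · rw [zero_mul]

/-- Change of the distinguished vertex of a component: the difference is in the image of the
generators of translations. -/
lemma vac_change_root (hχ : ∀ x, IsRelVac 𝔖 x → χ x = 0)
    (hJ : ∀ τ : VacDiagram 𝔖, 0 < τ.deg → χ τ.toThat = 0) {c : Finset E} (hc : G.IsConn c)
    {r r' : V} (hr : r ∈ G.verts c) (hr' : r' ∈ G.verts c) :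
    ∃ F : Fin d → (V → MultiIndex d) → B,
      (∀ i, ∃ N : ℕ, ∀ a, N < ∑ v ∈ G.verts c, order (a v) → F i a = 0) ∧
      ∀ a, χ (G.vac c r a) = χ (G.vac c r' a)
        + ∑ i, ∑ v ∈ G.verts c, (a v i : ℝ) • F i (a - unit v i) := by
  refine ⟨translateRem (G.verts c : Set V) r (fun n => χ (G.vac c r' n)), fun i => ?_, fun a => ?_⟩
  · obtain ⟨N, hN⟩ := vac_truncated hJ hc hr'
    refine ⟨N, fun a ha => esum_zero fun j hj => ?_⟩
    by_cases hle : multiChoose a j = 0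
    · rw [hle]; simp
    · have hle := multiChoose_le hle
      beta_reduce
      rw [hN, smul_zero]
      refine ha.trans_le ?_
      have h1 : ∀ v, order (a v) = order ((a - j) v) + order (j v) := fun v => by
        rw [← order_add]
        congr 1
        exact (tsub_add_cancel_of_le (hle v)).symm
      have h2 : ∑ v ∈ G.verts c, order (j v) = tot j := by
        refine Finset.sum_subset (Finset.subset_univ _) fun v _ hv => ?_
        rw [hj v hv, order_zero]
      simp only [Pi.add_apply, order_add, h1, Finset.sum_add_distrib, h2]
      refine Nat.add_le_add_left ?_ _
      refine le_trans ?_ (Finset.single_le_sum (f := fun v => order ((Pi.single r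
        (total j + Pi.single i 1) : V → MultiIndex d) v)) (fun _ _ => Nat.zero_le _) hr)
      rw [Pi.single_eq_same, order_add, order_total]
      exact Nat.le_add_right _ _
  · rw [vac_translate hχ hc hr hr', translate_eq]

/-- Change of the distinguished vertex of one component of the extracted subgraph. -/
lemma leftPart_change_root (hχ : ∀ x, IsRelVac 𝔖 x → χ x = 0)
    (hJ : ∀ τ : VacDiagram 𝔖, 0 < τ.deg → χ τ.toThat = 0) {ρ ρ' : Finset E → V}
    (hρ : RootChoice G S ρ) (hρ' : RootChoice G S ρ') {c : Finset E} (hc : c ∈ G.comps S)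
    (hne : ∀ c' ∈ G.comps S, c' ≠ c → ρ c' = ρ' c') :
    ∃ F : Fin d → (V → MultiIndex d) → B, (∀ i, Truncated G S (F i)) ∧
      ∀ a, leftPart χ G S ρ a = leftPart χ G S ρ' a
        + ∑ i, ∑ v ∈ G.verts c, (a v i : ℝ) • F i (a - unit v i) := by
  obtain ⟨F, hF, hFa⟩ := vac_change_root hχ hJ (G.isConn_of_mem_comps hc) (hρ c hc) (hρ' c hc)
  refine ⟨fun i a => F i a * ∏ c' ∈ (G.comps S).erase c, χ (G.vac c' (ρ' c') a), fun i => ?_,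
    fun a => ?_⟩
  · have := truncated_prod (G := G) (S := S)
      (L := fun c' a => if c' = c then F i a else χ (G.vac c' (ρ' c') a)) fun c' hc' => by
        by_cases h : c' = c
        · subst h
          simpa using hF i
        · simpa [h] using vac_truncated hJ (G.isConn_of_mem_comps hc') (hρ' c' hc')
    obtain ⟨N, hN⟩ := this
    refine ⟨N, fun a ha => ?_⟩
    refine Eq.trans ?_ (hN a ha)
    beta_reduce
    rw [← Finset.mul_prod_erase _ _ hc, if_pos rfl]
    congr 1
    exact Finset.prod_congr rfl fun c' hc' => by rw [if_neg (Finset.ne_of_mem_erase hc')]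
  · unfold leftPart
    rw [← Finset.mul_prod_erase _ _ hc, ← Finset.mul_prod_erase _ _ hc, hFa, add_mul,
      Finset.prod_congr rfl fun c' hc' => by
        rw [hne c' (Finset.mem_of_mem_erase hc') (Finset.ne_of_mem_erase hc')]]
    congr 1
    simp only [Finset.sum_mul, smul_mul_assoc]
    refine Finset.sum_congr rfl fun i _ => Finset.sum_congr rfl fun v hv => ?_
    congr 2
    exact Finset.prod_congr rfl fun c' hc' => by
      rw [vac_congr_unit (hρ' c' (Finset.mem_of_mem_erase hc'))
        (comps_disjoint hc (Finset.mem_of_mem_erase hc') (Finset.ne_of_mem_erase hc').symm hv)]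

end Extraction


namespace LGraph

variable {𝔖 : LabelSystem d 𝔏} {V E : Type} {k : ℕ} [Fintype V] [Fintype E]
  {G : LGraph 𝔖 V E k}

/-! ### Values of diagrams -/

lemma not_isConn_empty : ¬ G.IsConn ∅ := fun h => Finset.not_nonempty_empty h.1

lemma vac_empty (r : V) (n : V → MultiIndex d) : G.vac ∅ r n = if n r = 0 then 1 else 0 :=
  dif_neg fun h => not_isConn_empty h.1

lemma mem_verts_comp_univ {r v : V} (h : (G.comp Finset.univ r).Nonempty) :
    v ∈ G.verts (G.comp Finset.univ r) ↔ G.conn Finset.univ r v := by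
  rw [mem_verts_comp]
  refine ⟨fun h => h.2, fun h' => ⟨?_, h'⟩⟩
  by_cases hv : r = v
  · exact hv ▸ (mem_verts_comp.1 (root_mem_verts_comp h)).1
  · exact (G.mem_verts_of_conn h' hv).2

lemma eq_of_comp_empty {r v : V} (h : G.comp Finset.univ r = ∅) (hv : G.conn Finset.univ r v) :
    v = r := by
  by_contra hne
  have h1 := (G.mem_verts_of_conn hv (Ne.symm hne)).1
  have h2 := mem_verts_comp.2 ⟨h1, (G.conn Finset.univ).refl r⟩
  rw [h] at h2
  obtain ⟨e, he, _⟩ := mem_verts.1 h2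
  exact absurd he (Finset.notMem_empty e)

lemma rootVac_congr_dec {r : V} {a a' : V → MultiIndex d}
    (h : ∀ v, G.conn Finset.univ r v → a v = a' v) : G.rootVac r a = G.rootVac r a' := by
  unfold rootVac
  rcases (G.comp Finset.univ r).eq_empty_or_nonempty with h0 | h0
  · rw [h0, vac_empty, vac_empty, h r ((G.conn _).refl r)]
  · exact vac_congr_dec (root_mem_verts_comp h0) fun v hv => h v ((mem_verts_comp_univ h0).1 hv)

/-- A change of label outside of a component does not affect it. -/
lemma rootVac_shift_eq {r : V} {a : V → MultiIndex d} {h : HalfEdge E k} {i : Fin d}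
    (hh : ¬ G.conn Finset.univ r (G.vert h)) :
    (G.shift (unit h i)).rootVac r a = G.rootVac r a :=
  vac_shift_eq (c := G.comp Finset.univ r) fun e he b => Pi.single_eq_of_ne (fun h' => hh (by
    rw [← h']
    exact (G.conn _).trans (mem_comp.1 he).2 (G.conn_vert_univ e b))) _

lemma legDiagram_shift_eq {h : HalfEdge E k} {i : Fin d}
    (hh : ∀ j, ¬ G.conn Finset.univ (G.vert h) (G.leg j)) :
    (G.shift (unit h i)).legDiagram = G.legDiagram := by
  have h0 : (fun h' => (unit h i : HalfEdge E k → MultiIndex d)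
      (legIncl (fun e => ∃ j, G.conn Finset.univ (G.src e) (G.leg j)) h')) = 0 := by
    funext h'
    refine Pi.single_eq_of_ne (fun hne => ?_) _
    rcases h' with (⟨⟨e, j, hj⟩, b⟩ | j)
    · refine hh j ?_
      rw [← hne]
      exact (G.conn _).trans ((G.conn _).symm (G.conn_vert_univ e b)) hj
    · refine hh j ?_
      rw [← hne]
      exact (G.conn _).refl _
  rw [legDiagram_shift, h0]
  unfold FeynmanDiagram.shift
  congr 1
  exact shift_zero _

section Character

variable {B : Type*} [CommRing B] [Algebra ℝ B]

/-- Integration by parts in a component without legs. -/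
lemma rootVac_ibp {ψ : That 𝔖 →ₐ[ℝ] B} (hψ : ∀ x, IsRelVac 𝔖 x → ψ x = 0) {r v : V}
    (hr : ∀ j, ¬ G.conn Finset.univ r (G.leg j)) (hv : G.conn Finset.univ r v)
    (n : V → MultiIndex d) (i : Fin d) :
    (∑ h ∈ Finset.univ.filter (fun h => G.vert h = v),
      halfSign h • ψ ((G.shift (unit h i)).rootVac r n)) + (n v i : ℝ) • ψ (G.rootVac r (n - unit v i))
      = if v = r then ∑ u ∈ Finset.univ.filter (fun u => G.conn Finset.univ r u),
        (n u i : ℝ) • ψ (G.rootVac r (n - unit u i)) else 0 := by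
  rcases (G.comp Finset.univ r).eq_empty_or_nonempty with h0 | h0
  · have hvr := eq_of_comp_empty h0 hv
    subst hvr
    rw [if_pos rfl, Finset.filter_false_of_mem (s := Finset.univ (α := HalfEdge E k)),
      Finset.sum_empty, zero_add]
    · have : Finset.univ.filter (fun u => G.conn Finset.univ v u) = {v} := by
        ext u
        simp only [Finset.mem_filter, Finset.mem_univ, true_and, Finset.mem_singleton]
        exact ⟨eq_of_comp_empty h0, fun h => h ▸ (G.conn _).refl _⟩
      rw [this, Finset.sum_singleton]
    · rintro (⟨e, b⟩ | j) - hh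
      · have : e ∈ G.comp Finset.univ v := mem_comp.2 ⟨Finset.mem_univ _,
          (G.conn _).symm (hh ▸ G.conn_vert_univ e b)⟩
        rw [h0] at this
        exact absurd this (Finset.notMem_empty e)
      · exact hr j (hh ▸ (G.conn _).refl _)
  · have h1 := vac_ibp hψ (G.isConn_comp h0) (root_mem_verts_comp h0)
      ((mem_verts_comp_univ h0).2 hv) n i
    have h2 : G.verts (G.comp Finset.univ r)
        = Finset.univ.filter (fun u => G.conn Finset.univ r u) := by
      ext u
      rw [mem_verts_comp_univ h0]
      simp
    rw [← h2]
    refine Eq.trans ?_ h1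
    congr 1
    refine Finset.sum_congr (Finset.filter_congr fun h _ => ?_) fun _ _ => rfl
    refine ⟨fun hh => ⟨?_, hh⟩, fun hh => hh.2⟩
    rcases h with (⟨e, b⟩ | j)
    · exact ⟨e, mem_comp.2 ⟨Finset.mem_univ _, (G.conn _).trans hv
        ((G.conn _).symm (hh ▸ G.conn_vert_univ e b))⟩, b, rfl⟩
    · exact absurd (hh ▸ hv : G.conn Finset.univ r (G.vert (Sum.inr j))) (hr j)

end Character

/-- The vertices `ρ i` are distinguished vertices for the components of `G` without legs. -/
structure Rooted {ι : Type} (G : LGraph 𝔖 V E k) (R : Finset ι) (ρ : ι → V) : Prop where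
  no_leg : ∀ i ∈ R, ∀ j, ¬ G.conn Finset.univ (ρ i) (G.leg j)
  sep : ∀ i ∈ R, ∀ j ∈ R, G.conn Finset.univ (ρ i) (ρ j) → i = j
  covered : ∀ v, (∃ j, G.conn Finset.univ v (G.leg j)) ∨ ∃ i ∈ R, G.conn Finset.univ (ρ i) v

section Weight

variable {B M : Type*} [CommRing B] [Algebra ℝ B] [AddCommGroup M] [Module ℝ M] [Module B M]
  [IsScalarTower ℝ B M]
variable {ι : Type} {ψ : ι → That 𝔖 →ₐ[ℝ] B} {L : H 𝔖 →ₗ[ℝ] M} {R : Finset ι} {ρ : ι → V}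

/-- The value of a diagram: the components with distinguished vertices `ρ i` are evaluated by the
characters `ψ i`, and the part with legs by the linear map `L`. -/
def weight (ψ : ι → That 𝔖 →ₐ[ℝ] B) (L : H 𝔖 →ₗ[ℝ] M) (G : LGraph 𝔖 V E k) (R : Finset ι)
    (ρ : ι → V) (n : V → MultiIndex d) : M :=
  (∏ i ∈ R, ψ i (G.rootVac (ρ i) n)) • L G.legDiagram.toH

/-- By uniqueness of distinguished vertices, only the factor of one component depends on the labels
and decorations at `v`. -/
lemma weight_ibp_aux (hψ : ∀ i x, IsRelVac 𝔖 x → ψ i x = 0) (hG : G.Rooted R ρ) {i₀ : ι}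
    (hi₀ : i₀ ∈ R) {v : V} (hv : G.conn Finset.univ (ρ i₀) v) (n : V → MultiIndex d) (i : Fin d) :
    (∑ h ∈ Finset.univ.filter (fun h => G.vert h = v),
      halfSign h • weight ψ L (G.shift (unit h i)) R ρ n)
        + (n v i : ℝ) • weight ψ L G R ρ (n - unit v i)
      = if v = ρ i₀ then ∑ u ∈ Finset.univ.filter (fun u => G.conn Finset.univ (ρ i₀) u),
        (n u i : ℝ) • weight ψ L G R ρ (n - unit u i) else 0 := by
  have hother : ∀ j ∈ R.erase i₀, ∀ u, G.conn Finset.univ (ρ i₀) u →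
      ¬ G.conn Finset.univ (ρ j) u := fun j hj u hu hju =>
    Finset.ne_of_mem_erase hj (hG.sep i₀ hi₀ j (Finset.mem_of_mem_erase hj)
      ((G.conn _).trans hu ((G.conn _).symm hju))).symm
  set P : B := ∏ j ∈ R.erase i₀, ψ j (G.rootVac (ρ j) n) with hP
  have h1 : ∀ u, G.conn Finset.univ (ρ i₀) u → weight ψ L G R ρ (n - unit u i)
      = ψ i₀ (G.rootVac (ρ i₀) (n - unit u i)) • P • L G.legDiagram.toH := by
    intro u hu
    rw [weight, ← Finset.mul_prod_erase _ _ hi₀, mul_smul, hP]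
    congr 2
    refine Finset.prod_congr rfl fun j hj => congrArg _ (rootVac_congr_dec fun w hw => ?_)
    have : w ≠ u := fun h => hother j hj u hu (h ▸ hw)
    simp [Pi.single_eq_of_ne this]
  have h2 : ∀ h, G.vert h = v → weight ψ L (G.shift (unit h i)) R ρ n
      = ψ i₀ ((G.shift (unit h i)).rootVac (ρ i₀) n) • P • L G.legDiagram.toH := by
    intro h hh
    rw [weight, ← Finset.mul_prod_erase _ _ hi₀, mul_smul, hP,
      legDiagram_shift_eq fun j hj => hG.no_leg i₀ hi₀ j ((G.conn _).trans hv (hh ▸ hj))]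
    congr 2
    exact Finset.prod_congr rfl fun j hj => congrArg _ (rootVac_shift_eq
      (hh ▸ hother j hj v hv))
  rw [h1 v hv, Finset.sum_congr rfl fun h hh => by rw [h2 h (Finset.mem_filter.1 hh).2],
    Finset.sum_congr (s₁ := Finset.univ.filter (fun u => G.conn Finset.univ (ρ i₀) u)) rfl
      fun u hu => by rw [h1 u (Finset.mem_filter.1 hu).2]]
  simp only [← smul_assoc _ (ψ i₀ _) _, ← Finset.sum_smul, ← add_smul]
  rw [rootVac_ibp (hψ i₀) (hG.no_leg i₀ hi₀) hv]
  split_ifs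
  · rfl
  · rw [zero_smul]

/-- The decoration plays no role in a component with legs. -/
lemma weight_ibp_leg_aux {v : V} (hG : G.Rooted R ρ) (hv : ∃ j, G.conn Finset.univ v (G.leg j))
    (n : V → MultiIndex d) (i : Fin d) :
    ∑ h ∈ Finset.univ.filter (fun h => G.vert h = v),
      halfSign h • weight ψ L (G.shift (unit h i)) R ρ n = 0 := by
  have h1 : ∀ h ∈ Finset.univ.filter (fun h => G.vert h = v),
      halfSign h • weight ψ L (G.shift (unit h i)) R ρ n = (∏ j ∈ R, ψ j (G.rootVac (ρ j) n)) •
        L (halfSign h • (G.shift (unit h i)).legDiagram.toH) := by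
    intro h hh
    obtain ⟨j, hj⟩ := hv
    rw [weight, map_smul, smul_comm]
    congr 1
    refine Finset.prod_congr rfl fun j' hj' => congrArg _ (rootVac_shift_eq fun hc => ?_)
    rw [(Finset.mem_filter.1 hh).2] at hc
    exact hG.no_leg j' hj' j ((G.conn _).trans hc hj)
  rw [Finset.sum_congr rfl h1, ← Finset.smul_sum, ← map_sum, leg_ibp G hv, map_zero, smul_zero]

/-- Integration by parts at a vertex of a component without legs. -/
lemma weight_ibp [DecidableEq V] [DecidableEq (HalfEdge E k)]
    (hψ : ∀ i x, IsRelVac 𝔖 x → ψ i x = 0) (hG : G.Rooted R ρ) {i₀ : ι}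
    (hi₀ : i₀ ∈ R) {v : V} (hv : G.conn Finset.univ (ρ i₀) v) (n : V → MultiIndex d) (i : Fin d) :
    (∑ h ∈ Finset.univ.filter (fun h => G.vert h = v),
      halfSign h • weight ψ L (G.shift (unit h i)) R ρ n)
        + (n v i : ℝ) • weight ψ L G R ρ (n - unit v i)
      = if v = ρ i₀ then ∑ u ∈ Finset.univ.filter (fun u => G.conn Finset.univ (ρ i₀) u),
        (n u i : ℝ) • weight ψ L G R ρ (n - unit u i) else 0 := by
  convert weight_ibp_aux (L := L) hψ hG hi₀ hv n i

/-- Integration by parts at a vertex of a component with legs. -/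
lemma weight_ibp_leg [DecidableEq V] [DecidableEq (HalfEdge E k)] {v : V}
    (hG : G.Rooted R ρ) (hv : ∃ j, G.conn Finset.univ v (G.leg j))
    (n : V → MultiIndex d) (i : Fin d) :
    ∑ h ∈ Finset.univ.filter (fun h => G.vert h = v),
      halfSign h • weight ψ L (G.shift (unit h i)) R ρ n = 0 := by
  convert weight_ibp_leg_aux (ψ := ψ) (L := L) hG hv n i

/-! ### Contracted graphs -/

/-- The graph `G / (S, ℓ)`. -/
abbrev quo (G : LGraph 𝔖 V E k) (S : Finset E) (l : HalfEdge E k → MultiIndex d) :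
    LGraph 𝔖 (Quotient (G.conn S)) {e // e ∉ S} k := (G.shift l).contract S

lemma quo_add (S : Finset E) (l l' : HalfEdge E k → MultiIndex d) :
    G.quo S (l + l') = (G.quo S l).shift (fun h => l' (legIncl _ h)) := by
  refine ext_of (fun _ => rfl) (fun _ => rfl) (fun e => ?_) (fun _ => rfl) fun j => ?_
  · simp only [shift, contract, 𝔖.diff_diff, Pi.add_apply, legIncl, Sum.map_inl, Prod.map, id]
    rw [add_add_add_comm]
  · simp only [shift, contract, 𝔖.diff_diff, Pi.add_apply, legIncl, Sum.map_inr, id]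

lemma quo_vert (S : Finset E) (l : HalfEdge E k → MultiIndex d) (h : HalfEdge {e // e ∉ S} k) :
    (G.quo S l).vert h = Quotient.mk _ (G.vert (legIncl _ h)) := by
  rcases h with (⟨e, b⟩ | j)
  · cases b <;> rfl
  · rfl

lemma exists_legIncl {S : Finset E} {h : HalfEdge E k} (hh : ¬ InHalf S h) :
    ∃ h', legIncl (fun e => e ∉ S) h' = h := by
  rcases h with (⟨e, b⟩ | j)
  · exact ⟨Sum.inl (⟨e, fun he => hh ⟨e, he, b, rfl⟩⟩, b), rfl⟩
  · exact ⟨Sum.inr j, rfl⟩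

lemma not_inHalf_legIncl (S : Finset E) (h : HalfEdge {e // e ∉ S} k) :
    ¬ InHalf S (legIncl _ h) := by
  rintro ⟨e, he, b, hb⟩
  rcases h with (⟨e', b'⟩ | j)
  · have := Sum.inl.inj hb
    exact e'.2 ((Prod.mk.inj this).1 ▸ he)
  · simp [legIncl] at hb

/-- Contraction does not change the components of the ambient graph. -/
lemma conn_quo_iff (S : Finset E) (l : HalfEdge E k → MultiIndex d) {v w : V} :
    (G.quo S l).conn Finset.univ (Quotient.mk _ v) (Quotient.mk _ w)
      ↔ G.conn Finset.univ v w := by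
  refine ⟨fun h => ?_, fun h => (G.shift l).conn_contract h⟩
  set p : Quotient (G.conn S) → Quotient (G.conn Finset.univ) :=
    Quotient.map' id fun _ _ h => G.conn_mono (Finset.subset_univ S) h with hp
  have : p (Quotient.mk _ v) = p (Quotient.mk _ w) :=
    (G.quo S l).conn_le (s := Setoid.ker p) (fun e _ =>
      Quotient.sound (G.conn_edge (Finset.mem_univ e.1))) h
  exact Quotient.exact this

lemma Rooted.quo (hG : G.Rooted R ρ) (S : Finset E) (l : HalfEdge E k → MultiIndex d) :
    (G.quo S l).Rooted R (fun i => Quotient.mk _ (ρ i)) where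
  no_leg i hi j h := hG.no_leg i hi j ((conn_quo_iff S l).1 h)
  sep i hi j hj h := hG.sep i hi j hj ((conn_quo_iff S l).1 h)
  covered q := by
    induction q using Quotient.inductionOn with
    | h v =>
      exact (hG.covered v).imp (fun ⟨j, hj⟩ => ⟨j, (conn_quo_iff S l).2 hj⟩)
        fun ⟨i, hi, h⟩ => ⟨i, hi, (conn_quo_iff S l).2 h⟩

/-- The value of `G / (S, ℓ)` with decoration `b`. -/
def quoWeight (ψ : ι → That 𝔖 →ₐ[ℝ] B) (L : H 𝔖 →ₗ[ℝ] M) (G : LGraph 𝔖 V E k) (S : Finset E)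
    (R : Finset ι) (ρ : ι → V) (l : HalfEdge E k → MultiIndex d) (b : V → MultiIndex d) : M :=
  weight ψ L (G.quo S l) R (fun i => Quotient.mk _ (ρ i)) (G.contractDec S b)

lemma contractDec_eq_fib (S : Finset E) (b : V → MultiIndex d) :
    G.contractDec S b = fib (Quotient.mk (G.conn S)) b := by
  funext q
  unfold contractDec fib
  congr

lemma contractDec_sub (S : Finset E) {b : V → MultiIndex d} {u : V} {i : Fin d} (h : b u i ≠ 0) :
    G.contractDec S (b - unit u i) = G.contractDec S b - unit (Quotient.mk _ u) i := by
  have h1 : b = (b - unit u i) + unit u i := by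
    funext w j
    by_cases hw : w ≠ u ∨ j ≠ i
    · simp only [Pi.add_apply, Pi.sub_apply, unit_apply_ne hw, tsub_zero, add_zero]
    · simp only [not_or, not_not] at hw
      obtain ⟨rfl, rfl⟩ := hw
      simp only [Pi.add_apply, Pi.sub_apply, unit_apply_same]
      omega
  have h2 : G.contractDec S b = G.contractDec S (b - unit u i) + unit (Quotient.mk _ u) i := by
    conv_lhs => rw [h1]
    rw [contractDec_eq_fib, contractDec_eq_fib, fib_add, fib_unit]
  rw [h2, add_tsub_cancel_right]

/-- Lowering of the summed decoration. -/
lemma sum_lower_contractDec (S : Finset E) (F : (Quotient (G.conn S) → MultiIndex d) → M)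
    (Q : Finset (Quotient (G.conn S))) (b : V → MultiIndex d) (i : Fin d) :
    ∑ u ∈ Finset.univ.filter (fun u => Quotient.mk _ u ∈ Q),
      (b u i : ℝ) • F (G.contractDec S (b - unit u i))
      = ∑ q ∈ Q, (G.contractDec S b q i : ℝ) • F (G.contractDec S b - unit q i) := by
  have h1 : ∀ u : V, (b u i : ℝ) • F (G.contractDec S (b - unit u i))
      = (b u i : ℝ) • F (G.contractDec S b - unit (Quotient.mk _ u) i) := by
    intro u
    rcases Nat.eq_zero_or_pos (b u i) with h | h
    · rw [h]; simp
    · rw [contractDec_sub S h.ne']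
  have h2 : ∀ q : Quotient (G.conn S), (G.contractDec S b q i : ℝ)
      = ∑ u ∈ Finset.univ.filter (fun u => Quotient.mk _ u = q), (b u i : ℝ) := by
    intro q
    simp only [contractDec, Finset.sum_apply]
    push_cast
    rfl
  simp only [h1, h2, Finset.sum_smul]
  simp only [Finset.sum_filter]
  rw [Finset.sum_comm]
  refine Finset.sum_congr rfl fun u _ => ?_
  rw [Finset.sum_ite_eq]

lemma sum_half_quo (S : Finset E) (v : V) (l : HalfEdge E k → MultiIndex d)
    (b : V → MultiIndex d) (i : Fin d) :
    ∑ h ∈ Finset.univ.filter (fun h => ¬ InHalf S h ∧ G.conn S (G.vert h) v),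
      halfSign h • quoWeight ψ L G S R ρ (l + unit h i) b
      = ∑ h ∈ Finset.univ.filter (fun h => (G.quo S l).vert h = Quotient.mk _ v),
        halfSign h • weight ψ L ((G.quo S l).shift (unit h i)) R (fun i => Quotient.mk _ (ρ i))
          (G.contractDec S b) := by
  symm
  refine Finset.sum_bij (fun h _ => legIncl _ h) ?_ ?_ ?_ ?_
  · intro h hh
    simp only [Finset.mem_filter, Finset.mem_univ, true_and] at hh ⊢
    rw [quo_vert] at hh
    exact ⟨not_inHalf_legIncl S h, Quotient.exact hh⟩
  · exact fun h _ h' _ hh => legIncl_injective _ hh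
  · intro h hh
    simp only [Finset.mem_filter, Finset.mem_univ, true_and] at hh
    obtain ⟨h', rfl⟩ := exists_legIncl hh.1
    refine ⟨h', ?_, rfl⟩
    simp only [Finset.mem_filter, Finset.mem_univ, true_and]
    rw [quo_vert]
    exact Quotient.sound hh.2
  · intro h _
    rw [halfSign_legIncl, quoWeight, quo_add, single_comp_injective (legIncl_injective _)]

/-- Integration by parts at a node of a contracted graph that belongs to a component without
legs. -/
lemma quoWeight_ibp (hψ : ∀ i x, IsRelVac 𝔖 x → ψ i x = 0) (hG : G.Rooted R ρ) (S : Finset E)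
    {i₀ : ι} (hi₀ : i₀ ∈ R) {v : V} (hv : G.conn Finset.univ (ρ i₀) v)
    (l : HalfEdge E k → MultiIndex d) (b : V → MultiIndex d) (i : Fin d) :
    (∑ h ∈ Finset.univ.filter (fun h => ¬ InHalf S h ∧ G.conn S (G.vert h) v),
      halfSign h • quoWeight ψ L G S R ρ (l + unit h i) b)
        + ∑ u ∈ Finset.univ.filter (fun u => G.conn S u v),
          (b u i : ℝ) • quoWeight ψ L G S R ρ l (b - unit u i)
      = if G.conn S v (ρ i₀) then ∑ u ∈ Finset.univ.filter (fun u => G.conn Finset.univ (ρ i₀) u),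
        (b u i : ℝ) • quoWeight ψ L G S R ρ l (b - unit u i) else 0 := by
  have h1 := weight_ibp (L := L) hψ (hG.quo S l) hi₀ ((conn_quo_iff S l).2 hv)
    (G.contractDec S b) i
  have h2 := sum_half_quo (ψ := ψ) (L := L) (G := G) (R := R) (ρ := ρ) S v l b i
  have h3 := sum_lower_contractDec S (weight ψ L (G.quo S l) R (fun i => Quotient.mk _ (ρ i)))
    {Quotient.mk _ v} b i
  have h4 := sum_lower_contractDec S (weight ψ L (G.quo S l) R (fun i => Quotient.mk _ (ρ i)))
    (Finset.univ.filter fun q => (G.quo S l).conn Finset.univ (Quotient.mk _ (ρ i₀)) q) b i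
  rw [Finset.sum_singleton] at h3
  have h3' : ∑ u ∈ Finset.univ.filter (fun u => G.conn S u v),
      (b u i : ℝ) • quoWeight ψ L G S R ρ l (b - unit u i) = _ :=
    (Finset.sum_congr (Finset.filter_congr fun u _ => by
      rw [Finset.mem_singleton]
      exact Quotient.eq.symm) fun _ _ => rfl).trans h3
  have h4' : ∑ u ∈ Finset.univ.filter (fun u => G.conn Finset.univ (ρ i₀) u),
      (b u i : ℝ) • quoWeight ψ L G S R ρ l (b - unit u i) = _ :=
    (Finset.sum_congr (Finset.filter_congr fun u _ => by
      rw [Finset.mem_filter, conn_quo_iff]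
      simp) fun _ _ => rfl).trans h4
  rw [h2, h3', h4', h1]
  exact if_congr Quotient.eq rfl rfl

/-- Integration by parts at a node of a contracted graph that belongs to a component with legs. -/
lemma quoWeight_ibp_leg (hG : G.Rooted R ρ) (S : Finset E) {v : V}
    (hv : ∃ j, G.conn Finset.univ v (G.leg j)) (l : HalfEdge E k → MultiIndex d)
    (b : V → MultiIndex d) (i : Fin d) :
    ∑ h ∈ Finset.univ.filter (fun h => ¬ InHalf S h ∧ G.conn S (G.vert h) v),
      halfSign h • quoWeight ψ L G S R ρ (l + unit h i) b = 0 := by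
  rw [sum_half_quo]
  exact weight_ibp_leg (hG.quo S l) (hv.imp fun j hj => (conn_quo_iff S l).2 hj) _ i

/-! ### Extraction and integration by parts -/

variable {S : Finset E}

lemma mem_boundary {h : HalfEdge E k} :
    h ∈ G.boundary S ↔ ¬ InHalf S h ∧ G.vert h ∈ G.verts S := by
  simp only [boundary, Finset.mem_filter, Finset.mem_univ, true_and, InHalf]
  rw [and_comm]
  refine and_congr_left fun _ => ?_
  push Not
  exact Iff.rfl

/-- The extraction of `S`, when the contracted graph is evaluated by `quoWeight`. -/
def extractWeight (ψ : ι → That 𝔖 →ₐ[ℝ] B) (L : H 𝔖 →ₗ[ℝ] M) (G : LGraph 𝔖 V E k) (S : Finset E)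
    (R : Finset ι) (ρ : ι → V) (F : (V → MultiIndex d) → B) (n : V → MultiIndex d) : M :=
  extraction G S F (quoWeight ψ L G S R ρ) n

/-- Lowering at all vertices of a component of the extracted subgraph. -/
lemma extractWeight_sum_lower {F : (V → MultiIndex d) → B} (hF : Truncated G S F)
    {c : Finset E} (hc : c ∈ G.comps S) (n : V → MultiIndex d) (i : Fin d) :
    extractWeight ψ L G S R ρ (fun a => ∑ v ∈ G.verts c, (a v i : ℝ) • F (a - unit v i)) n
      = extraction G S F (fun l b =>
        (∑ h ∈ Finset.univ.filter (fun h => ¬ InHalf S h ∧ G.vert h ∈ G.verts c),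
          halfSign h • quoWeight ψ L G S R ρ (l + unit h i) b)
        + ∑ u ∈ G.verts c, (b u i : ℝ) • quoWeight ψ L G S R ρ l (b - unit u i)) n := by
  have h1 := extraction_sum_left (s := G.verts c)
    (L := fun v a => (a v i : ℝ) • F (a - unit v i)) (fun v _ => hF.lower v i) (fun _ => 1)
    (quoWeight ψ L G S R ρ) n
  simp only [one_smul] at h1
  rw [extractWeight, h1, Finset.sum_congr rfl fun v hv => extraction_adjoint hF _ n
    (verts_comps_subset hc hv) i]
  have h2 := extraction_sum_right (s := G.verts c) hF (fun _ => 1) (fun v l b =>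
    (∑ h ∈ Finset.univ.filter (fun h => h ∈ G.boundary S ∧ G.vert h = v),
      halfSign h • quoWeight ψ L G S R ρ (l + unit h i) b)
        + (b v i : ℝ) • quoWeight ψ L G S R ρ l (b - unit v i)) n
  simp only [one_smul] at h2
  rw [← h2]
  refine extraction_congr (fun _ _ => rfl) fun y _ => ?_
  rw [Finset.sum_add_distrib]
  congr 1
  simp only [Finset.sum_filter]
  rw [Finset.sum_comm]
  refine Finset.sum_congr rfl fun h _ => ?_
  have h3 : ∀ v ∈ G.verts c, (h ∈ G.boundary S ∧ G.vert h = v) ↔ (G.vert h = v ∧ ¬ InHalf S h) := by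
    intro v hv
    rw [mem_boundary]
    constructor
    · exact fun h => ⟨h.2, h.1.1⟩
    · exact fun h => ⟨⟨h.2, h.1 ▸ verts_comps_subset hc hv⟩, h.1⟩
  rw [Finset.sum_congr rfl fun v hv => if_congr (h3 v hv) rfl rfl]
  simp only [ite_and]
  rw [Finset.sum_ite_eq]
  split_ifs <;> rfl

lemma conn_iff_of_mem_comps {c : Finset E} (hc : c ∈ G.comps S) {v : V} (hv : v ∈ G.verts c)
    (u : V) : G.conn S u v ↔ u ∈ G.verts c :=
  ⟨fun h => (conn_iff_mem_verts hc hv).1 ((G.conn S).symm h),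
    fun h => (G.conn S).symm ((conn_iff_mem_verts hc hv).2 h)⟩

lemma verts_nonempty_of_mem_comps {c : Finset E} (hc : c ∈ G.comps S) : (G.verts c).Nonempty :=
  G.verts_nonempty (G.isConn_of_mem_comps hc).1

/-- By duality, lowering the decoration at all vertices of an extracted component amounts to
integration by parts at the vertex of the quotient to which the component is contracted. The result
vanishes unless this is the distinguished vertex. -/
lemma extractWeight_lower_comp (hψ : ∀ i x, IsRelVac 𝔖 x → ψ i x = 0) (hG : G.Rooted R ρ)
    {F : (V → MultiIndex d) → B} (hF : Truncated G S F) {c : Finset E} (hc : c ∈ G.comps S)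
    {i₀ : ι} (hi₀ : i₀ ∈ R) (hv : ∀ v ∈ G.verts c, G.conn Finset.univ (ρ i₀) v)
    (n : V → MultiIndex d) (i : Fin d) :
    extractWeight ψ L G S R ρ (fun a => ∑ v ∈ G.verts c, (a v i : ℝ) • F (a - unit v i)) n
      = if ρ i₀ ∈ G.verts c then ∑ u ∈ Finset.univ.filter (fun u => G.conn Finset.univ (ρ i₀) u),
        (n u i : ℝ) • extractWeight ψ L G S R ρ F (n - unit u i) else 0 := by
  obtain ⟨v, hvc⟩ := verts_nonempty_of_mem_comps hc
  have h1 := fun l b => quoWeight_ibp (L := L) hψ hG S hi₀ (hv v hvc) l b i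
  simp only [conn_iff_of_mem_comps hc hvc] at h1
  rw [(G.conn S).comm'] at h1
  simp only [conn_iff_of_mem_comps hc hvc] at h1
  have h2 : Finset.univ.filter (fun u => u ∈ G.verts c) = G.verts c := by ext; simp
  rw [h2] at h1
  rw [extractWeight_sum_lower hF hc]
  simp only [h1]
  split_ifs
  · have h3 := extraction_sum_right
      (s := Finset.univ.filter (fun u => G.conn Finset.univ (ρ i₀) u)) hF (fun _ => 1)
      (fun u l b => (b u i : ℝ) • quoWeight ψ L G S R ρ l (b - unit u i)) n
    simp only [one_smul] at h3
    rw [h3]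
    exact Finset.sum_congr rfl fun u _ => (extraction_lower hF _ n u i).symm
  · exact esum_zero fun y _ => by simp

/-- If the component of the ambient graph has legs, then the sum of the derivatives at the
contracted vertex vanishes. -/
lemma extractWeight_lower_comp_leg (hG : G.Rooted R ρ)
    {F : (V → MultiIndex d) → B} (hF : Truncated G S F) {c : Finset E} (hc : c ∈ G.comps S)
    (hv : ∀ v ∈ G.verts c, ∃ j, G.conn Finset.univ v (G.leg j))
    {n : V → MultiIndex d} (hn : ∀ v ∈ G.verts c, n v = 0) (i : Fin d) :
    extractWeight ψ L G S R ρ (fun a => ∑ v ∈ G.verts c, (a v i : ℝ) • F (a - unit v i)) n = 0 := by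
  obtain ⟨v, hvc⟩ := verts_nonempty_of_mem_comps hc
  have h1 := fun l b => quoWeight_ibp_leg (ψ := ψ) (L := L) hG S (hv v hvc) l b i
  simp only [conn_iff_of_mem_comps hc hvc] at h1
  rw [extractWeight_sum_lower hF hc]
  refine esum_zero fun y _ => ?_
  beta_reduce
  rw [h1, Finset.sum_eq_zero, add_zero, smul_zero, smul_zero, smul_zero]
  intro u hu
  simp [hn u hu]

end Weight

end LGraph

section Translate

variable {V : Type} [Fintype V] {M N : Type*} [AddCommGroup M] [Module ℝ M] [AddCommGroup N]
  [Module ℝ N]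

/-- Two functions of a decoration that differ by an element of the image of the generators of
translations. -/
def LowerEquiv (f f' : (V → MultiIndex d) → M) : Prop :=
  ∃ F : Fin d → (V → MultiIndex d) → M,
    ∀ n, f n = f' n + ∑ i, ∑ v, (n v i : ℝ) • F i (n - unit v i)

lemma LowerEquiv.trans {f f' f'' : (V → MultiIndex d) → M} (h : LowerEquiv f f')
    (h' : LowerEquiv f' f'') : LowerEquiv f f'' := by
  obtain ⟨F, hF⟩ := h
  obtain ⟨F', hF'⟩ := h'
  refine ⟨fun i n => F' i n + F i n, fun n => ?_⟩
  simp only [hF, hF', smul_add, Finset.sum_add_distrib, add_assoc]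

lemma LowerEquiv.refl (f : (V → MultiIndex d) → M) : LowerEquiv f f := ⟨fun _ _ => 0, by simp⟩

lemma translate_add (C : Set V) (r : V) (F F' : (V → MultiIndex d) → M) (n : V → MultiIndex d) :
    translate C r (fun n => F n + F' n) n = translate C r F n + translate C r F' n := by
  unfold translate
  rw [← esum_add (bounded_choose _ _ _ _) (bounded_choose _ _ _ _)]
  simp only [smul_add]

lemma translate_sum {ι : Type*} (s : Finset ι) (C : Set V) (r : V)
    (F : ι → (V → MultiIndex d) → M) (n : V → MultiIndex d) :
    translate C r (fun n => ∑ i ∈ s, F i n) n = ∑ i ∈ s, translate C r (F i) n := by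
  unfold translate
  rw [← esum_sum fun i _ => bounded_choose _ _ _ _]
  simp only [Finset.smul_sum]

lemma translate_map (φ : M →ₗ[ℝ] N) (C : Set V) (r : V) (F : (V → MultiIndex d) → M)
    (n : V → MultiIndex d) : φ (translate C r F n) = translate C r (fun n => φ (F n)) n := by
  refine (esum_map φ.toAddMonoidHom (bounded_choose _ _ _ _)).trans (esum_congr fun j _ => ?_)
  exact map_smul φ _ _

/-- Functions that agree modulo generators of translations agree on translation invariant
polynomials. -/
lemma LowerEquiv.translate_eq {f f' : (V → MultiIndex d) → M} (h : LowerEquiv f f') (r : V)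
    (n : V → MultiIndex d) : translate Set.univ r f n = translate Set.univ r f' n := by
  obtain ⟨F, hF⟩ := h
  rw [show f = fun n => f' n + ∑ i, ∑ v, (n v i : ℝ) • F i (n - unit v i) from funext hF,
    translate_add, translate_sum, Finset.sum_eq_zero fun i _ => translate_sum_lower r (F i) i n,
    add_zero]

/-- If a function vanishes on decorations that do not vanish at `r`, then it is invariant under
translation by `X_r`. -/
lemma translate_of_vanishing {r : V} {f : (V → MultiIndex d) → M}
    (hf : ∀ n, n r ≠ 0 → f n = 0) (n : V → MultiIndex d) : translate Set.univ r f n = f n := by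
  unfold translate esum
  rw [finsum_eq_single _ 0]
  · rw [Set.indicator_of_mem (zero_mem_Supp _)]
    simp [tot_zero, multiChoose, total]
  · intro j hj
    have h1 : total j ≠ 0 := fun h => hj (tot_eq_zero (by rw [← order_total, h, order_zero]))
    rw [Set.indicator_of_mem (fun a ha => absurd (Set.mem_univ a) ha), hf, smul_zero]
    intro h
    refine h1 (funext fun i => ?_)
    have := congrFun h i
    simp only [Pi.add_apply, Pi.single_eq_same, Pi.zero_apply] at this
    simp only [Pi.zero_apply]
    omega

end Translate

namespace LGraph

variable {𝔖 : LabelSystem d 𝔏} {V E : Type} {k : ℕ} [Fintype V] [Fintype E]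
  {G : LGraph 𝔖 V E k} {S : Finset E}
variable {B M : Type*} [CommRing B] [Algebra ℝ B] [AddCommGroup M] [Module ℝ M] [Module B M]
  [IsScalarTower ℝ B M]
variable {ι : Type} {χ : That 𝔖 →ₐ[ℝ] B} {ψ : ι → That 𝔖 →ₐ[ℝ] B} {L : H 𝔖 →ₗ[ℝ] M}
  {R : Finset ι} {ρ : ι → V} {σ σ' : Finset E → V}

/-! ### Independence of distinguished vertices and integration by parts -/

lemma conn_of_mem_comps {c : Finset E} (hc : c ∈ G.comps S) {u v : V} (hu : u ∈ G.verts c)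
    (hv : v ∈ G.verts c) : G.conn Finset.univ u v :=
  G.conn_mono (Finset.subset_univ S) ((conn_iff_mem_verts hc hu).2 hv)

/-- A change of the distinguished vertex of one component changes the extraction by terms where the
decoration of this component is lowered. -/
lemma extractWeight_change_root (hχ : ∀ x, IsRelVac 𝔖 x → χ x = 0)
    (hJ : ∀ τ : VacDiagram 𝔖, 0 < τ.deg → χ τ.toThat = 0)
    (hσ : RootChoice G S σ) (hσ' : RootChoice G S σ') {c : Finset E} (hc : c ∈ G.comps S)
    (hne : ∀ c' ∈ G.comps S, c' ≠ c → σ c' = σ' c') :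
    ∃ F : Fin d → (V → MultiIndex d) → B, (∀ i, Truncated G S (F i)) ∧
      ∀ n, extractWeight ψ L G S R ρ (leftPart χ G S σ) n
        = extractWeight ψ L G S R ρ (leftPart χ G S σ') n + ∑ i, extractWeight ψ L G S R ρ
          (fun a => ∑ v ∈ G.verts c, (a v i : ℝ) • F i (a - unit v i)) n := by
  obtain ⟨F, hF, hFa⟩ := leftPart_change_root hχ hJ hσ hσ' hc hne
  refine ⟨F, hF, fun n => ?_⟩
  have ht : ∀ i, Truncated G S
      (fun a => ∑ v ∈ G.verts c, (a v i : ℝ) • F i (a - unit v i)) := fun i => by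
    simpa using Truncated.sum (s := G.verts c) (c := fun _ => 1) fun v _ => (hF i).lower v i
  have ht' := Truncated.sum (s := Finset.univ) (c := fun _ => 1) fun i _ => ht i
  simp only [one_smul] at ht'
  have h1 := extraction_sum_left (s := Finset.univ) (fun i _ => ht i) (fun _ => 1)
    (quoWeight ψ L G S R ρ) n
  simp only [one_smul] at h1
  unfold extractWeight
  rw [← h1, ← extraction_add_left (leftPart_truncated hJ hσ') ht']
  exact extraction_congr (fun y _ => hFa _) fun _ _ => rfl

/-- The result of the extraction of a subgraph does not depend on the distinguished vertices of
those of its components which do not contain a distinguished vertex of the ambient graph. -/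
lemma extractWeight_congr_root (hχ : ∀ x, IsRelVac 𝔖 x → χ x = 0)
    (hJ : ∀ τ : VacDiagram 𝔖, 0 < τ.deg → χ τ.toThat = 0)
    (hψ : ∀ i x, IsRelVac 𝔖 x → ψ i x = 0) (hG : G.Rooted R ρ)
    (hσ : RootChoice G S σ) (hσ' : RootChoice G S σ')
    (hag : ∀ c ∈ G.comps S, (∃ i ∈ R, ρ i ∈ G.verts c) → σ c = σ' c)
    {n : V → MultiIndex d} (hn : ∀ v j, G.conn Finset.univ v (G.leg j) → n v = 0) :
    extractWeight ψ L G S R ρ (leftPart χ G S σ) n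
      = extractWeight ψ L G S R ρ (leftPart χ G S σ') n := by
  -- The distinguished vertices are changed for one component after the other.
  suffices H : ∀ t : Finset (Finset E), t ⊆ G.comps S →
      extractWeight ψ L G S R ρ (leftPart χ G S σ) n
        = extractWeight ψ L G S R ρ (leftPart χ G S fun c => if c ∈ t then σ' c else σ c) n by
    rw [H _ subset_rfl]
    unfold extractWeight
    refine extraction_congr (fun y _ => ?_) fun _ _ => rfl
    exact Finset.prod_congr rfl fun c hc => by
      beta_reduce
      rw [if_pos hc]
  intro t
  induction t using Finset.induction_on with
  | empty => intro _; simp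
  | insert c t hct ih =>
    intro ht
    have hc := ht (Finset.mem_insert_self c t)
    rw [ih fun c hc => ht (Finset.mem_insert_of_mem hc)]
    by_cases h0 : ∃ i ∈ R, ρ i ∈ G.verts c
    · congr 2
      funext c'
      by_cases hcc : c' = c
      · subst hcc
        simp [hct, hag c' hc h0]
      · simp [hcc]
    · have hch : ∀ t : Finset (Finset E),
          RootChoice G S (fun c => if c ∈ t then σ' c else σ c) := fun t c hc => by
        beta_reduce
        split_ifs
        exacts [hσ' c hc, hσ c hc]
      obtain ⟨F, hF, hFn⟩ := extractWeight_change_root (ψ := ψ) (L := L) (R := R) (ρ := ρ) hχ hJ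
        (hch t) (hch (insert c t)) hc (fun c' hc' hne => by simp [hne])
      rw [hFn n, add_eq_left]
      refine Finset.sum_eq_zero fun i _ => ?_
      obtain ⟨v, hv⟩ := verts_nonempty_of_mem_comps hc
      -- The difference is a total derivative in the quotient. It vanishes since the contracted
      -- component is a vertex of a component with legs, or a vertex that is not distinguished.
      rcases hG.covered v with ⟨j, hj⟩ | ⟨i₀, hi₀, h⟩
      · exact extractWeight_lower_comp_leg hG (hF i) hc
          (fun u hu => ⟨j, (G.conn _).trans (conn_of_mem_comps hc hu hv) hj⟩)
          (fun u hu => hn u j ((G.conn _).trans (conn_of_mem_comps hc hu hv) hj)) i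
      · rw [extractWeight_lower_comp hψ hG (hF i) hc hi₀
          (fun u hu => (G.conn _).trans h (conn_of_mem_comps hc hv hu)), if_neg]
        exact fun h => h0 ⟨i₀, hi₀, h⟩

lemma quo_shift (S : Finset E) (l l' : HalfEdge E k → MultiIndex d) :
    (G.shift l').quo S l = G.quo S (l + l') := by
  refine ext_of (fun _ => rfl) (fun _ => rfl) (fun e => ?_) (fun _ => rfl) fun j => ?_
  · simp only [shift, contract, 𝔖.diff_diff, Pi.add_apply]
    congr 1
    abel
  · simp only [shift, contract, 𝔖.diff_diff, Pi.add_apply]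
    rw [add_comm]

lemma quoWeight_shift (l l' : HalfEdge E k → MultiIndex d) (b : V → MultiIndex d) :
    quoWeight ψ L (G.shift l') S R ρ l b = quoWeight ψ L G S R ρ (l + l') b :=
  congrArg (fun G' : LGraph 𝔖 (Quotient (G.conn S)) {e // e ∉ S} k =>
    weight ψ L G' R (fun i => Quotient.mk _ (ρ i)) (G.contractDec S b)) (quo_shift S l l')

/-- The labels of the contracted edges do not matter in the quotient. -/
lemma quoWeight_add_inHalf {h : HalfEdge E k} (hh : InHalf S h) (i : Fin d)
    (l : HalfEdge E k → MultiIndex d) (b : V → MultiIndex d) :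
    quoWeight ψ L G S R ρ (l + unit h i) b = quoWeight ψ L G S R ρ l b := by
  have h0 : (fun h' => (unit h i : HalfEdge E k → MultiIndex d)
      (legIncl (fun e => e ∉ S) h')) = 0 := by
    funext h'
    exact Pi.single_eq_of_ne (fun hne => not_inHalf_legIncl S h' (by rw [hne]; exact hh)) _
  unfold quoWeight
  rw [quo_add, h0, shift_zero]

/-- Integration by parts for the extraction of a subgraph, in a component without legs. -/
lemma extractWeight_ibp (hχ : ∀ x, IsRelVac 𝔖 x → χ x = 0)
    (hJ : ∀ τ : VacDiagram 𝔖, 0 < τ.deg → χ τ.toThat = 0)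
    (hψ : ∀ i x, IsRelVac 𝔖 x → ψ i x = 0) (hG : G.Rooted R ρ)
    (hσ : RootChoice G S σ) {i₀ : ι} (hi₀ : i₀ ∈ R)
    (hag : ∀ c ∈ G.comps S, ρ i₀ ∈ G.verts c → σ c = ρ i₀) {v : V}
    (hv : G.conn Finset.univ (ρ i₀) v) (n : V → MultiIndex d) (i : Fin d) :
    (∑ h ∈ Finset.univ.filter (fun h => G.vert h = v), halfSign h •
        extractWeight ψ L (G.shift (unit h i)) S R ρ (leftPart χ (G.shift (unit h i)) S σ) n)
      + (n v i : ℝ) • extractWeight ψ L G S R ρ (leftPart χ G S σ) (n - unit v i)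
      = if v = ρ i₀ then ∑ u ∈ Finset.univ.filter (fun u => G.conn Finset.univ (ρ i₀) u),
        (n u i : ℝ) • extractWeight ψ L G S R ρ (leftPart χ G S σ) (n - unit u i) else 0 := by
  have hT := leftPart_truncated hJ hσ
  have hTs : ∀ h, Truncated G S (leftPart χ (G.shift (unit h i)) S σ) := fun h =>
    leftPart_truncated (G := G.shift (unit h i)) hJ hσ
  have h1 : ∀ h, ¬ InHalf S h →
      extractWeight ψ L (G.shift (unit h i)) S R ρ (leftPart χ (G.shift (unit h i)) S σ) n
      = extraction G S (leftPart χ G S σ)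
        (fun l b => quoWeight ψ L G S R ρ (l + unit h i) b) n := by
    intro h hh
    refine extraction_congr (G := G) (fun y _ => ?_) fun y _ => quoWeight_shift _ _ _
    exact Finset.prod_congr rfl fun c hc => by
      rw [vac_shift_eq (unit_inHalf i fun h' => hh (inHalf_mono (comps_subset hc) h'))]
  have h2 : ∀ h, InHalf S h →
      extractWeight ψ L (G.shift (unit h i)) S R ρ (leftPart χ (G.shift (unit h i)) S σ) n
      = extraction G S (leftPart χ (G.shift (unit h i)) S σ) (quoWeight ψ L G S R ρ) n := by
    intro h hh
    refine extraction_congr (G := G) (fun y _ => rfl) fun y _ => ?_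
    rw [quoWeight_shift, quoWeight_add_inHalf hh]
  -- The half-edges that are not extracted and the lowering of the decoration together give
  -- integration by parts in the second factor.
  have h3 : (∑ h ∈ Finset.univ.filter (fun h => ¬ InHalf S h ∧ G.vert h = v), halfSign h •
        extractWeight ψ L (G.shift (unit h i)) S R ρ (leftPart χ (G.shift (unit h i)) S σ) n)
      + (n v i : ℝ) • extractWeight ψ L G S R ρ (leftPart χ G S σ) (n - unit v i)
      = extraction G S (leftPart χ G S σ) (fun l b =>
        (∑ h ∈ Finset.univ.filter (fun h => ¬ InHalf S h ∧ G.vert h = v),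
          halfSign h • quoWeight ψ L G S R ρ (l + unit h i) b)
            + (b v i : ℝ) • quoWeight ψ L G S R ρ l (b - unit v i)) n := by
    rw [extraction_add_right hT, extraction_sum_right hT, ← extraction_lower hT]
    congr 1
    exact Finset.sum_congr rfl fun h hh => by rw [h1 h (Finset.mem_filter.1 hh).2.1]
  have h4 : (∑ h ∈ Finset.univ.filter (fun h => G.vert h = v), halfSign h •
        extractWeight ψ L (G.shift (unit h i)) S R ρ (leftPart χ (G.shift (unit h i)) S σ) n)
      = (∑ h ∈ Finset.univ.filter (fun h => InHalf S h ∧ G.vert h = v), halfSign h •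
        extraction G S (leftPart χ (G.shift (unit h i)) S σ) (quoWeight ψ L G S R ρ) n)
      + ∑ h ∈ Finset.univ.filter (fun h => ¬ InHalf S h ∧ G.vert h = v), halfSign h •
        extractWeight ψ L (G.shift (unit h i)) S R ρ (leftPart χ (G.shift (unit h i)) S σ) n := by
    rw [← Finset.sum_filter_add_sum_filter_not _ (fun h => InHalf S h), Finset.filter_filter,
      Finset.filter_filter]
    congr 1
    · exact Finset.sum_congr (Finset.filter_congr fun h _ => and_comm) fun h hh => by
        rw [h2 h (Finset.mem_filter.1 hh).2.1]
    · exact Finset.sum_congr (Finset.filter_congr fun h _ => and_comm) fun _ _ => rfl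
  rw [h4, add_assoc, h3]
  -- If `v` belongs to `S`, then by duality the second summand is a lowering of the decoration of
  -- the extracted component at `v`, and together with the first one it gives integration by parts
  -- in this component. What remains if `v` is distinguished in this component is the lowering at
  -- all its vertices. If `v` does not belong to `S`, then integration by parts in the quotient
  -- suffices.
  by_cases hvS : v ∈ G.verts S
  · obtain ⟨hc, hvc⟩ := comp_mem_comps hvS
    set c := G.comp S v with hcdef
    have hadj := extraction_adjoint hT (quoWeight ψ L G S R ρ) n hvS i
    have hb : ∀ h, h ∈ G.boundary S ∧ G.vert h = v ↔ ¬ InHalf S h ∧ G.vert h = v := fun h => by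
      rw [mem_boundary]
      exact ⟨fun h => ⟨h.1.1, h.2⟩, fun h => ⟨⟨h.1, h.2 ▸ hvS⟩, h.2⟩⟩
    rw [Finset.filter_congr fun h _ => hb h] at hadj
    rw [← hadj, ← extraction_sum_left fun h _ => hTs h, ← extraction_add_left _ (hT.lower v i)]
    · have hl : ∀ a, (∑ h ∈ Finset.univ.filter (fun h => InHalf S h ∧ G.vert h = v),
          halfSign h • leftPart χ (G.shift (unit h i)) S σ a)
            + (a v i : ℝ) • leftPart χ G S σ (a - unit v i) = _ := fun a =>
        leftPart_ibp hχ hσ hc hvc a i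
      simp only [hl]
      have hcv : ∀ u ∈ G.verts c, G.conn Finset.univ (ρ i₀) u := fun u hu =>
        (G.conn _).trans hv (conn_of_mem_comps hc hvc hu)
      have h5 := extractWeight_lower_comp (L := L) hψ hG hT hc hi₀ hcv n i
      by_cases hvσ : v = σ c
      · simp only [if_pos hvσ]
        refine h5.trans (if_congr ⟨fun h => hvσ.trans (hag c hc h), fun h => h ▸ hvc⟩ rfl rfl)
      · simp only [if_neg hvσ]
        rw [if_neg fun h => hvσ (h.trans (hag c hc (h ▸ hvc)).symm)]
        exact esum_zero fun y _ => by simp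
    · exact Truncated.sum fun h _ => hTs h
  · have hin : ∀ h : HalfEdge E k, ¬ (InHalf S h ∧ G.vert h = v) := fun h hh =>
      hvS (hh.2 ▸ vert_mem_of_inHalf hh.1)
    rw [Finset.filter_false_of_mem fun h _ => hin h, Finset.sum_empty, zero_add]
    have hcl : ∀ u, G.conn S u v ↔ u = v := fun u => by
      refine ⟨fun h => by_contra fun hne => hvS (G.mem_verts_of_conn h hne).2, fun h => ?_⟩
      rw [h]
    have hcl' : G.conn S v (ρ i₀) ↔ v = ρ i₀ := by
      rw [(G.conn S).comm', hcl, eq_comm]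
    have h5 := fun l b => quoWeight_ibp (L := L) hψ hG S hi₀ hv l b i
    simp only [hcl, hcl', Finset.sum_filter, Finset.sum_ite_eq', Finset.mem_univ, if_true] at h5
    simp only [Finset.sum_filter, h5]
    split_ifs
    · simp only [← Finset.sum_filter]
      have h6 := extraction_sum_right
        (s := Finset.univ.filter (fun u => G.conn Finset.univ (ρ i₀) u)) hT (fun _ => 1)
        (fun u l b => (b u i : ℝ) • quoWeight ψ L G S R ρ l (b - unit u i)) n
      simp only [one_smul] at h6
      rw [h6]
      exact Finset.sum_congr rfl fun u _ => (extraction_lower hT _ n u i).symm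
    · exact esum_zero fun y _ => by simp

end LGraph

namespace LGraph

variable {𝔖 : LabelSystem d 𝔏} {V E V' E' : Type} {k k' : ℕ}

/-! ### Embedding of a graph as a union of components -/

/-- The internal edges of the graph `G` are, via the injections `f` and `φ` of its vertices and
edges, those of a union of connected components of `G'`. -/
structure EdgeEmb (G : LGraph 𝔖 V E k) (G' : LGraph 𝔖 V' E' k') (φ : E → E') (f : V → V') :
    Prop where
  injE : Function.Injective φ
  injV : Function.Injective f
  vert : ∀ e b, G'.vert (Sum.inl (φ e, b)) = f (G.vert (Sum.inl (e, b)))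
  cov : ∀ e' b v, G'.vert (Sum.inl (e', b)) = f v → ∃ e, φ e = e'
  lab : ∀ e, G'.lab (φ e) = G.lab e

/-- The graph `G` without legs is a union of connected components without legs of `G'`. -/
structure CompEmb (G : LGraph 𝔖 V E 0) (G' : LGraph 𝔖 V' E' k') (φ : E → E') (f : V → V') : Prop
    extends EdgeEmb G G' φ f where
  no_leg : ∀ j v, G'.leg j ≠ f v

/-- The map between half-edges induced by a map between edges. -/
def halfMap (k' : ℕ) (φ : E → E') : HalfEdge E 0 → HalfEdge E' k'
  | Sum.inl (e, b) => Sum.inl (φ e, b)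
  | Sum.inr j => j.elim0

lemma halfMap_injective {φ : E → E'} (hφ : Function.Injective φ) :
    Function.Injective (halfMap k' φ) := by
  rintro (⟨e, b⟩ | j) (⟨e', b'⟩ | j') h
  · simp only [halfMap, Sum.inl.injEq, Prod.mk.injEq] at h
    rw [hφ h.1, h.2]
  all_goals first | exact j.elim0 | exact j'.elim0

namespace EdgeEmb

variable {G : LGraph 𝔖 V E k} {G' : LGraph 𝔖 V' E' k'} {φ : E → E'} {f : V → V'}

lemma conn_iff (H : EdgeEmb G G' φ f) (S : Finset E) (v w : V) :
    G.conn S v w ↔ G'.conn (S.image φ) (f v) (f w) := by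
  have hs : ∀ e, G'.src (φ e) = f (G.src e) := fun e => H.vert e false
  have ht : ∀ e, G'.tgt (φ e) = f (G.tgt e) := fun e => H.vert e true
  constructor
  · refine G.conn_map f _ fun e he => ?_
    rw [← hs, ← ht]
    exact G'.conn_edge (Finset.mem_image_of_mem φ he)
  · intro h
    have : Nonempty V := ⟨v⟩
    have h1 := G'.conn_map (Function.invFun f) (G.conn S) (fun e' he' => ?_) h
    · rwa [Function.leftInverse_invFun H.injV, Function.leftInverse_invFun H.injV] at h1
    · obtain ⟨e, he, rfl⟩ := Finset.mem_image.1 he'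
      rw [hs, ht, Function.leftInverse_invFun H.injV, Function.leftInverse_invFun H.injV]
      exact G.conn_edge he

/-- The image of an embedding is a union of components. -/
lemma mem_range_of_conn (H : EdgeEmb G G' φ f) {S' : Finset E'} {v' w' : V'}
    (h : G'.conn S' v' w') : v' ∈ Set.range f ↔ w' ∈ Set.range f := by
  have key : ∀ e' b b', G'.vert (Sum.inl (e', b)) ∈ Set.range f →
      G'.vert (Sum.inl (e', b')) ∈ Set.range f := by
    rintro e' b b' ⟨v, hv⟩
    obtain ⟨e, rfl⟩ := H.cov _ _ v hv.symm
    exact ⟨_, (H.vert e b').symm⟩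
  have := G'.conn_le (s := Setoid.ker (· ∈ Set.range f)) (fun e' _ =>
    propext ⟨key e' false true, key e' true false⟩) h
  exact iff_of_eq this

lemma subIso (H : EdgeEmb G G' φ f) (S : Finset E) : SubIso G G' φ S (S.image φ) where
  maps _ he := Finset.mem_image_of_mem _ he
  surj _ he' := Finset.mem_image.1 he'
  inj _ _ _ _ h := H.injE h
  vert e _ e' _ b b' := by rw [H.vert, H.vert, H.injV.eq_iff]
  lab e _ := H.lab e

lemma comp_image (H : EdgeEmb G G' φ f) (S : Finset E) (v : V) :
    G'.comp (S.image φ) (f v) = (G.comp S v).image φ := by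
  ext e'
  rw [mem_comp, Finset.mem_image, Finset.mem_image]
  constructor
  · rintro ⟨⟨e, he, rfl⟩, h⟩
    refine ⟨e, mem_comp.2 ⟨he, ?_⟩, rfl⟩
    rw [H.conn_iff]
    exact (H.vert e false) ▸ h
  · rintro ⟨e, he, rfl⟩
    rw [mem_comp] at he
    refine ⟨⟨e, he.1, rfl⟩, ?_⟩
    have h := (H.conn_iff S _ _).1 he.2
    rwa [← show G'.src (φ e) = f (G.src e) from H.vert e false] at h

lemma comps_image (H : EdgeEmb G G' φ f) (S : Finset E) :
    G'.comps (S.image φ) = (G.comps S).image (Finset.image φ) := by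
  unfold comps
  rw [Finset.image_image, Finset.image_image]
  refine Finset.image_congr fun e _ => ?_
  simp only [Function.comp]
  rw [show G'.src (φ e) = f (G.src e) from H.vert e false, H.comp_image]

lemma mem_verts_image [Fintype V] [Fintype V'] (H : EdgeEmb G G' φ f) (S : Finset E) (v : V) :
    f v ∈ G'.verts (S.image φ) ↔ v ∈ G.verts S := by
  rw [mem_verts, mem_verts]
  constructor
  · rintro ⟨e', he', b, h⟩
    obtain ⟨e, he, rfl⟩ := Finset.mem_image.1 he'
    rw [H.vert] at h
    exact ⟨e, he, b, H.injV h⟩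
  · rintro ⟨e, he, b, rfl⟩
    exact ⟨φ e, Finset.mem_image_of_mem _ he, b, H.vert e b⟩

lemma mem_range_of_verts [Fintype V'] (H : EdgeEmb G G' φ f) {S : Finset E} {v' : V'}
    (h : v' ∈ G'.verts (S.image φ)) : v' ∈ Set.range f := by
  obtain ⟨e', he', b, rfl⟩ := mem_verts.1 h
  obtain ⟨e, he, rfl⟩ := Finset.mem_image.1 he'
  exact ⟨_, (H.vert e b).symm⟩

variable {B : Type*} [CommRing B] [Algebra ℝ B] {χ : That 𝔖 →ₐ[ℝ] B}
variable [Fintype V] [Fintype E] [Fintype V'] [Fintype E']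

lemma vac_eq (hχ : ∀ x, IsRelVac 𝔖 x → χ x = 0) (H : EdgeEmb G G' φ f) (S : Finset E) (r : V)
    (n' : V' → MultiIndex d) :
    χ (G.vac S r fun v => n' (f v)) = χ (G'.vac (S.image φ) (f r) n') :=
  vac_congr hχ (H.subIso S) (fun e _ b => by rw [H.vert])
    (fun e _ b => by rw [H.vert, H.injV.eq_iff]) Iff.rfl

lemma leftPart_eq (hχ : ∀ x, IsRelVac 𝔖 x → χ x = 0) (H : EdgeEmb G G' φ f) {S : Finset E}
    {σ : Finset E → V} {σ' : Finset E' → V'} (hσ : ∀ c ∈ G.comps S, σ' (c.image φ) = f (σ c))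
    (n' : V' → MultiIndex d) :
    leftPart χ G' (S.image φ) σ' n' = leftPart χ G S σ fun v => n' (f v) := by
  unfold leftPart
  rw [H.comps_image, Finset.prod_image]
  · exact Finset.prod_congr rfl fun c hc => by rw [hσ c hc, H.vac_eq hχ]
  · exact fun c _ c' _ h => Finset.image_injective H.injE h

lemma comp_univ (H : EdgeEmb G G' φ f) (v : V) :
    G'.comp Finset.univ (f v) = (G.comp Finset.univ v).image φ := by
  have hc : ∀ {w w'}, G'.conn Finset.univ w w' → w ∈ Set.range f →
      G'.conn (Finset.univ.image φ) w w' := by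
    intro w w' h
    induction h with
    | rel x y h' =>
      obtain ⟨e', -, rfl, rfl⟩ := h'
      rintro ⟨v, hv⟩
      obtain ⟨e, rfl⟩ := H.cov e' false v hv.symm
      exact G'.conn_edge (Finset.mem_image_of_mem φ (Finset.mem_univ e))
    | refl x => exact fun _ => (G'.conn _).refl x
    | symm x y h ih =>
      exact fun hy => (G'.conn _).symm (ih ((H.mem_range_of_conn (S' := Finset.univ) h).2 hy))
    | trans x y z h _ ih ih' =>
      exact fun hx => (G'.conn _).trans (ih hx)
        (ih' ((H.mem_range_of_conn (S' := Finset.univ) h).1 hx))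
  rw [← H.comp_image]
  ext e'
  rw [mem_comp, mem_comp]
  constructor
  · rintro ⟨-, h⟩
    obtain ⟨w, hw⟩ := (H.mem_range_of_conn h).1 ⟨v, rfl⟩
    obtain ⟨e, rfl⟩ := H.cov e' false w hw.symm
    exact ⟨Finset.mem_image_of_mem φ (Finset.mem_univ e), hc h ⟨v, rfl⟩⟩
  · exact fun h => ⟨Finset.mem_univ _, G'.conn_mono (Finset.subset_univ _) h.2⟩

/-- The value of a component does not depend on the graph it belongs to. -/
lemma rootVac_eq (hχ : ∀ x, IsRelVac 𝔖 x → χ x = 0) (H : EdgeEmb G G' φ f) (r : V)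
    (n' : V' → MultiIndex d) :
    χ (G.rootVac r fun v => n' (f v)) = χ (G'.rootVac (f r) n') := by
  unfold rootVac
  rw [H.comp_univ, H.vac_eq hχ]

end EdgeEmb

namespace CompEmb

variable {G : LGraph 𝔖 V E 0} {G' : LGraph 𝔖 V' E' k'} {φ : E → E'} {f : V → V'}
variable {B : Type*} [CommRing B] [Algebra ℝ B] {χ : That 𝔖 →ₐ[ℝ] B}

/-- Changes of labels are compatible with the embedding of a component. -/
lemma shift (H : CompEmb G G' φ f) (l' : HalfEdge E' k' → MultiIndex d) :
    CompEmb (G.shift fun h => l' (halfMap k' φ h)) (G'.shift l') φ f where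
  injE := H.injE
  injV := H.injV
  vert e b := by
    have := H.vert e b
    cases b <;> exact this
  cov e' b v hv := H.cov e' b v (by cases b <;> exact hv)
  lab e := by
    simp only [LGraph.shift, H.lab, halfMap]
  no_leg := H.no_leg

lemma vert_halfMap (H : CompEmb G G' φ f) (h : HalfEdge E 0) :
    G'.vert (halfMap k' φ h) = f (G.vert h) := by
  rcases h with (⟨e, b⟩ | j)
  · exact H.vert e b
  · exact j.elim0

lemma exists_halfMap (H : CompEmb G G' φ f) {h' : HalfEdge E' k'} {v : V}
    (h : G'.vert h' = f v) : ∃ h, halfMap k' φ h = h' := by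
  rcases h' with (⟨e', b⟩ | j)
  · obtain ⟨e, rfl⟩ := H.cov e' b v h
    exact ⟨Sum.inl (e, b), rfl⟩
  · exact absurd h (H.no_leg j v)

variable [Fintype V] [Fintype E] [Fintype V'] [Fintype E']

/-- The map between contracted vertices. -/
def quoMap (H : CompEmb G G' φ f) (S : Finset E) :
    Quotient (G.conn S) → Quotient (G'.conn (S.image φ)) :=
  Quotient.map' f fun v w h => (H.conn_iff S v w).1 h

/-- The map between the edges that are not contracted. -/
def restMap (H : CompEmb G G' φ f) (S : Finset E) (e : {e // e ∉ S}) : {e // e ∉ S.image φ} :=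
  ⟨φ e.1, fun h => e.2 (by
    obtain ⟨e', he', h⟩ := Finset.mem_image.1 h
    exact H.injE h ▸ he')⟩

/-- Contraction is compatible with the embedding of a union of components. -/
lemma quo (H : CompEmb G G' φ f) (S : Finset E) (l' : HalfEdge E' k' → MultiIndex d) :
    CompEmb (G.quo S fun h => l' (halfMap k' φ h)) (G'.quo (S.image φ) l') (H.restMap S)
      (H.quoMap S) where
  injE e e' h := Subtype.ext (H.injE (Subtype.mk.inj h))
  injV q q' h := by
    induction q using Quotient.inductionOn with
    | h v =>
      induction q' using Quotient.inductionOn with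
      | h w => exact Quotient.sound ((H.conn_iff S v w).2 (Quotient.exact h))
  vert e b := by
    rw [quo_vert, quo_vert]
    exact congrArg (Quotient.mk _) (H.vert e.1 b)
  cov e' b q hq := by
    induction q using Quotient.inductionOn with
    | h v =>
      rw [quo_vert] at hq
      obtain ⟨w, hw⟩ := (H.mem_range_of_conn (Quotient.exact hq)).2 ⟨v, rfl⟩
      obtain ⟨e, he⟩ := H.cov e'.1 b w hw.symm
      exact ⟨⟨e, fun h => e'.2 (Finset.mem_image.2 ⟨e, h, he⟩)⟩, Subtype.ext he⟩
  lab e := (H.shift l').lab e.1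
  no_leg j q hq := by
    induction q using Quotient.inductionOn with
    | h v =>
      obtain ⟨w, hw⟩ := (H.mem_range_of_conn (Quotient.exact hq)).2 ⟨v, rfl⟩
      exact H.no_leg j w hw.symm

lemma contractDec_eq (H : CompEmb G G' φ f) (S : Finset E) (b' : V' → MultiIndex d)
    (q : Quotient (G.conn S)) :
    G'.contractDec (S.image φ) b' (H.quoMap S q) = G.contractDec S (fun v => b' (f v)) q := by
  unfold contractDec
  rw [Finset.sum_filter, Finset.sum_filter]
  symm
  induction q using Quotient.inductionOn with
  | h w =>
    refine Fintype.sum_of_injective f H.injV _ _ (fun v' hv' => if_neg fun h => hv' ?_)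
      fun v => if_congr ?_ rfl rfl
    · exact (H.mem_range_of_conn (Quotient.exact h)).2 ⟨w, rfl⟩
    · exact ⟨fun h => congrArg (H.quoMap S) h, fun h => (H.quo S 0).injV h⟩

lemma quo_rootVac_eq (hχ : ∀ x, IsRelVac 𝔖 x → χ x = 0) (H : CompEmb G G' φ f) (S : Finset E)
    (r : V) (l' : HalfEdge E' k' → MultiIndex d) (b' : V' → MultiIndex d) :
    χ ((G'.quo (S.image φ) l').rootVac (Quotient.mk _ (f r)) (G'.contractDec (S.image φ) b'))
      = χ ((G.quo S fun h => l' (halfMap k' φ h)).rootVac (Quotient.mk _ r)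
        (G.contractDec S fun v => b' (f v))) := by
  rw [← show H.quoMap S (Quotient.mk _ r) = Quotient.mk _ (f r) from rfl,
    ← (H.quo S l').rootVac_eq hχ]
  congr 2
  funext q
  exact H.contractDec_eq S b' q

end CompEmb

end LGraph


section Transport

variable {𝔖 : LabelSystem d 𝔏} {V E V' E' : Type} {k' : ℕ} [Fintype V] [Fintype E] [Fintype V']
  [Fintype E']
variable {B M : Type*} [CommRing B] [Algebra ℝ B] [AddCommGroup M] [Module ℝ M] [Module B M]
  [IsScalarTower ℝ B M]
  {G : LGraph 𝔖 V E 0} {G' : LGraph 𝔖 V' E' k'} {φ : E → E'} {f : V → V'}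

lemma LGraph.CompEmb.mem_slots_iff (H : CompEmb G G' φ f) (S : Finset E) (x : HalfEdge E 0 ⊕ V) :
    Sum.map (halfMap k' φ) f x ∈ G'.slots (S.image φ) ↔ x ∈ G.slots S := by
  rcases x with h | v
  · show halfMap k' φ h ∈ G'.boundary (S.image φ) ↔ h ∈ G.boundary S
    rw [mem_boundary, mem_boundary, H.vert_halfMap, H.mem_verts_image]
    refine and_congr_left fun _ => not_congr ?_
    rcases h with (⟨e, b⟩ | j)
    · constructor
      · rintro ⟨e', he', b', h⟩
        obtain ⟨e₁, he₁, rfl⟩ := Finset.mem_image.1 he'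
        have h := Prod.mk.inj (Sum.inl.inj h)
        exact ⟨e, H.injE h.1 ▸ he₁, b, rfl⟩
      · rintro ⟨e', he', b', h⟩
        have h := Prod.mk.inj (Sum.inl.inj h)
        exact ⟨φ e, Finset.mem_image_of_mem _ (h.1 ▸ he'), b, rfl⟩
    · exact j.elim0
  · exact H.mem_verts_image S v

lemma LGraph.CompEmb.exists_slot (H : CompEmb G G' φ f) {S : Finset E} {x' : HalfEdge E' k' ⊕ V'}
    (hx : x' ∈ G'.slots (S.image φ)) : ∃ x, Sum.map (halfMap k' φ) f x = x' := by
  rcases x' with h' | v'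
  · obtain ⟨v, hv⟩ := H.mem_range_of_verts (mem_boundary.1 hx).2
    obtain ⟨h, rfl⟩ := H.exists_halfMap hv.symm
    exact ⟨Sum.inl h, rfl⟩
  · obtain ⟨v, rfl⟩ := H.mem_range_of_verts hx
    exact ⟨Sum.inr v, rfl⟩

/-- Extraction of a subgraph commutes with embeddings of components. -/
lemma LGraph.CompEmb.extraction_eq (H : CompEmb G G' φ f) (S : Finset E) {F : (V → MultiIndex d) → B}
    {F' : (V' → MultiIndex d) → B} (hF : ∀ a', F' a' = F fun v => a' (f v))
    {g : (HalfEdge E 0 → MultiIndex d) → (V → MultiIndex d) → M}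
    {g' : (HalfEdge E' k' → MultiIndex d) → (V' → MultiIndex d) → M}
    (hg : ∀ l' b', g' l' b' = g (fun h => l' (halfMap k' φ h)) fun v => b' (f v))
    (n' : V' → MultiIndex d) :
    extraction G' (S.image φ) F' g' n' = extraction G S F g fun v => n' (f v) := by
  have hinj : Function.Injective (Sum.map (halfMap k' φ) f) :=
    (halfMap_injective H.injE).sumMap H.injV
  refine esum_bij (fun y' x => y' (Sum.map (halfMap k' φ) f x))
    (fun y => Function.extend (Sum.map (halfMap k' φ) f) y 0) ?_ ?_ ?_ ?_ ?_
  · exact fun y' hy' x hx => hy' _ fun h => hx ((H.mem_slots_iff S x).1 h)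
  · intro y hy x' hx'
    by_cases h : ∃ x, Sum.map (halfMap k' φ) f x = x'
    · obtain ⟨x, rfl⟩ := h
      rw [hinj.extend_apply]
      exact hy x fun h => hx' ((H.mem_slots_iff S x).2 h)
    · rw [Function.extend_apply' _ _ _ h]
      rfl
  · intro y' hy'
    funext x'
    by_cases h : ∃ x, Sum.map (halfMap k' φ) f x = x'
    · obtain ⟨x, rfl⟩ := h
      rw [hinj.extend_apply]
    · rw [Function.extend_apply' _ _ _ h, hy' x' fun hx => h (H.exists_slot hx)]
      rfl
  · intro y _
    funext x
    exact hinj.extend_apply _ _ _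
  · intro y' hy'
    have hz : ∀ x', x' ∉ Set.range (Sum.map (halfMap k' φ) f) → y' x' = 0 := fun x' hx' =>
      hy' x' fun h => hx' (H.exists_slot h)
    have h1 : invFact y' = invFact fun x => y' (Sum.map (halfMap k' φ) f x) := by
      unfold invFact
      congr 1
      refine (Fintype.prod_of_injective _ hinj _ _ (fun x' hx' => ?_) fun _ => rfl).symm
      simp [hz x' hx']
    have h2 : slotCoeff n' y'
        = slotCoeff (fun v => n' (f v)) fun x => y' (Sum.map (halfMap k' φ) f x) := by
      unfold slotCoeff outOrder
      congr 1
      · congr 1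
        refine (Fintype.sum_of_injective φ H.injE _ _ (fun e' he' => ?_) fun e => rfl).symm
        show order (y' (Sum.inl (Sum.inl (e', false)))) = 0
        rw [hz, order_zero]
        rintro ⟨(⟨e, b⟩ | j) | v, hx⟩
        · exact he' ⟨e, (Prod.mk.inj (Sum.inl.inj (Sum.inl.inj hx))).1⟩
        · exact j.elim0
        · simp at hx
      · refine (Fintype.prod_of_injective f H.injV _ _ (fun v' hv' => ?_) fun v => rfl).symm
        rw [hz (Sum.inr v')]
        · simp
        · rintro ⟨h | v, hx⟩
          · simp at hx
          · exact hv' ⟨v, Sum.inr.inj hx⟩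
    have h3 : (fun v => fib G'.slotVert y' (f v))
        = fib G.slotVert fun x => y' (Sum.map (halfMap k' φ) f x) := by
      funext v
      unfold fib
      rw [Finset.sum_filter, Finset.sum_filter]
      refine (Fintype.sum_of_injective _ hinj _ _ (fun x' hx' => ?_) fun x => ?_).symm
      · rw [hz x' hx', ite_self]
      · refine if_congr ?_ rfl rfl
        rcases x with h | u
        · show G.vert h = v ↔ G'.vert (halfMap k' φ h) = f v
          rw [H.vert_halfMap, H.injV.eq_iff]
        · exact H.injV.eq_iff.symm
    rw [h1, h2, hF, hg, h3]
    rfl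

end Transport


/-! ### Extraction from vacuum diagrams -/

section EmptyValue

variable (𝔖 : LabelSystem d 𝔏) (B : Type*) [CommRing B] [Algebra ℝ B]

/-- The linear map on `H` that sends the empty diagram to `1` and all other diagrams to `0`. -/
def emptyValue : H 𝔖 →ₗ[ℝ] B :=
  (dT 𝔖).liftQ (Finsupp.linearCombination ℝ fun Γ => if IsEmpty Γ.V then (1 : B) else 0) (by
    refine Submodule.span_le.2 ?_
    rintro _ (⟨Γ, Γ', f⟩ | ⟨Γ, v, i⟩)
    · simp [f.onV.isEmpty_congr]
    · refine LinearMap.mem_ker.2 ?_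
      rw [map_sum]
      refine Finset.sum_eq_zero fun h _ => ?_
      rw [Finsupp.linearCombination_single, if_neg, smul_zero]
      exact fun h => h.false v)

variable {𝔖 B}

lemma emptyValue_toH (Γ : FeynmanDiagram 𝔖) (h : IsEmpty Γ.V) : emptyValue 𝔖 B Γ.toH = 1 := by
  refine ((dT 𝔖).liftQ_apply _ _).trans ?_
  simp [h]

end EmptyValue

namespace LGraph

variable {𝔖 : LabelSystem d 𝔏} {V E : Type} {k : ℕ} [Fintype V] [Fintype E]

/-- The choice of distinguished vertices made in `LGraph.pick`. -/
def pickVert [Nonempty V] (G : LGraph 𝔖 V E k) (R : Finset V) (c : Finset E) : V :=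
  if h : c.Nonempty then (G.pick R c h).1 else Classical.arbitrary V

lemma pickVert_eq [Nonempty V] (G : LGraph 𝔖 V E k) (R : Finset V) {c : Finset E}
    (h : c.Nonempty) : G.pickVert R c = (G.pick R c h).1 := dif_pos h

lemma rootChoice_pickVert [Nonempty V] (G : LGraph 𝔖 V E k) (R : Finset V) (S : Finset E) :
    RootChoice G S (G.pickVert R) := fun c hc => by
  rw [pickVert_eq _ _ (G.isConn_of_mem_comps hc).1]
  exact (G.pick R c _).2

lemma pickVert_mem [Nonempty V] {G : LGraph 𝔖 V E k} {R : Finset V} {c : Finset E} {r : V}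
    (hr : r ∈ R) (hrc : r ∈ G.verts c) : G.pickVert R c ∈ R := by
  have hc : c.Nonempty := by
    obtain ⟨e, he, _⟩ := mem_verts.1 hrc
    exact ⟨e, he⟩
  rw [pickVert_eq _ _ hc, pick, dif_pos ⟨r, hr, hrc⟩]
  exact (Exists.choose_spec (⟨r, hr, hrc⟩ : ∃ v, v ∈ R ∧ v ∈ G.verts c)).1

section Vacuum

variable {G : LGraph 𝔖 V E 0} {S : Finset E}
variable {B : Type*} [CommRing B] [Algebra ℝ B] {χ ψ : That 𝔖 →ₐ[ℝ] B} {r r' : V}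
  {σ σ' : Finset E → V}

/-- The extraction of `S` in a graph without legs with distinguished vertex `r`. The extracted
subgraph is evaluated by `χ` and the quotient by `ψ`. -/
def vacExtract (χ ψ : That 𝔖 →ₐ[ℝ] B) (G : LGraph 𝔖 V E 0) (S : Finset E) (r : V)
    (σ : Finset E → V) (n : V → MultiIndex d) : B :=
  extractWeight (fun _ : Unit => ψ) (emptyValue 𝔖 B) G S {()} (fun _ => r) (leftPart χ G S σ) n

lemma weight_unit {V E : Type} [Fintype V] [Fintype E] (G : LGraph 𝔖 V E 0) (r : V)
    (n : V → MultiIndex d) :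
    weight (fun _ : Unit => ψ) (emptyValue 𝔖 B) G {()} (fun _ => r) n = ψ (G.rootVac r n) := by
  rw [weight, Finset.prod_singleton, emptyValue_toH, smul_eq_mul, mul_one]
  exact ⟨fun v => v.2.choose.elim0⟩

lemma quoWeight_unit (l : HalfEdge E 0 → MultiIndex d) (b : V → MultiIndex d) :
    quoWeight (fun _ : Unit => ψ) (emptyValue 𝔖 B) G S {()} (fun _ => r) l b
      = ψ ((G.quo S l).rootVac (Quotient.mk _ r) (G.contractDec S b)) := weight_unit _ _ _

lemma vacExtract_eq (n : V → MultiIndex d) : vacExtract χ ψ G S r σ n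
    = extraction G S (leftPart χ G S σ) (fun l b =>
      ψ ((G.quo S l).rootVac (Quotient.mk _ r) (G.contractDec S b))) n :=
  extraction_congr (fun _ _ => rfl) fun _ _ => quoWeight_unit _ _

lemma rooted_unit (hG : ∀ v w, G.conn Finset.univ v w) (r : V) :
    G.Rooted {()} (fun _ : Unit => r) where
  no_leg _ _ j := j.elim0
  sep _ _ _ _ _ := rfl
  covered v := Or.inr ⟨(), Finset.mem_singleton_self _, hG r v⟩

/-- The extraction vanishes on decorations that do not vanish at the distinguished vertex. -/
lemma vacExtract_eq_zero (hχ : ∀ x, IsRelVac 𝔖 x → χ x = 0) (hψ : ∀ x, IsRelVac 𝔖 x → ψ x = 0)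
    (hag : ∀ c ∈ G.comps S, r ∈ G.verts c → σ c = r) {n : V → MultiIndex d} (hn : n r ≠ 0) :
    vacExtract χ ψ G S r σ n = 0 := by
  rw [vacExtract_eq]
  refine esum_zero fun y hy => ?_
  beta_reduce
  -- If the decoration at `r` is not extracted, then the decoration of the distinguished vertex of
  -- the quotient does not vanish. Otherwise this holds for the extracted component of `r`.
  by_cases h0 : y (Sum.inr r) = 0
  · rw [show ψ ((G.quo S (halfPart y)).rootVac (Quotient.mk _ r)
      (G.contractDec S (n - vertPart y))) = 0 from ?_, smul_zero, smul_zero, smul_zero]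
    refine vac_root_ne_zero hψ fun h => hn ?_
    have h1 := Finset.sum_eq_zero_iff.1 h r (Finset.mem_filter.2 ⟨Finset.mem_univ _, rfl⟩)
    simpa [vertPart, h0] using h1
  · have hr : r ∈ G.verts S := by_contra fun h => h0 (hy (Sum.inr r) h)
    obtain ⟨hc, hrc⟩ := comp_mem_comps hr
    rw [show leftPart χ G S σ (fib G.slotVert y) = 0 from ?_, zero_smul, smul_zero, smul_zero]
    refine Finset.prod_eq_zero hc ?_
    rw [hag _ hc hrc]
    refine vac_root_ne_zero hχ fun h => h0 ?_
    exact Finset.sum_eq_zero_iff.1 h (Sum.inr r) (Finset.mem_filter.2 ⟨Finset.mem_univ _, rfl⟩)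

/-- Change of the distinguished vertices of the extracted subgraph. -/
lemma vacExtract_lowerEquiv_left (hχ : ∀ x, IsRelVac 𝔖 x → χ x = 0)
    (hJ : ∀ τ : VacDiagram 𝔖, 0 < τ.deg → χ τ.toThat = 0)
    (hψ : ∀ x, IsRelVac 𝔖 x → ψ x = 0) (hG : ∀ v w, G.conn Finset.univ v w)
    (hσ : RootChoice G S σ) (hσ' : RootChoice G S σ') :
    LowerEquiv (vacExtract χ ψ G S r σ) (vacExtract χ ψ G S r σ') := by
  -- The distinguished vertices are changed for one component after the other. Only the component
  -- that contains `r`, if there is one, contributes a term with lowered decorations.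
  suffices H : ∀ t : Finset (Finset E), t ⊆ G.comps S → LowerEquiv (vacExtract χ ψ G S r σ)
      (vacExtract χ ψ G S r fun c => if c ∈ t then σ' c else σ c) by
    have h := H _ subset_rfl
    rwa [show vacExtract χ ψ G S r (fun c => if c ∈ G.comps S then σ' c else σ c)
      = vacExtract χ ψ G S r σ' from ?_] at h
    funext n
    refine extraction_congr (fun y _ => ?_) fun _ _ => rfl
    exact Finset.prod_congr rfl fun c hc => by
      beta_reduce
      rw [if_pos hc]
  intro t
  induction t using Finset.induction_on with
  | empty => intro _; simpa using LowerEquiv.refl _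
  | insert c t hct ih =>
    intro ht
    have hc := ht (Finset.mem_insert_self c t)
    refine (ih fun c hc => ht (Finset.mem_insert_of_mem hc)).trans ?_
    have hch : ∀ t : Finset (Finset E),
        RootChoice G S (fun c => if c ∈ t then σ' c else σ c) := fun t c hc => by
      beta_reduce
      split_ifs
      exacts [hσ' c hc, hσ c hc]
    obtain ⟨F, hF, hFn⟩ := extractWeight_change_root (ψ := fun _ : Unit => ψ)
      (L := emptyValue 𝔖 B) (R := {()}) (ρ := fun _ => r) hχ hJ
      (hch t) (hch (insert c t)) hc (fun c' hc' hne => by simp [hne])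
    have h1 : ∀ i n, _ := fun i n => extractWeight_lower_comp (L := emptyValue 𝔖 B)
      (fun _ : Unit => hψ) (rooted_unit hG r) (hF i) hc (Finset.mem_singleton_self ())
      (fun v _ => hG r v) n i
    by_cases hr : r ∈ G.verts c
    · refine ⟨fun i => extractWeight (fun _ : Unit => ψ) (emptyValue 𝔖 B) G S {()} (fun _ => r)
        (F i), fun n => ?_⟩
      refine (hFn n).trans (congrArg _ (Finset.sum_congr rfl fun i _ => ?_))
      rw [h1, if_pos hr, Finset.filter_true_of_mem fun u _ => hG r u]
    · refine ⟨fun _ _ => 0, fun n => ?_⟩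
      refine (hFn n).trans (congrArg _ (Finset.sum_congr rfl fun i _ => ?_))
      rw [h1, if_neg hr]
      simp

/-- Change of the distinguished vertex of a connected graph. -/
lemma rootVac_translate {V E : Type} [Fintype V] [Fintype E] [Nonempty E] {G : LGraph 𝔖 V E 0}
    (hψ : ∀ x, IsRelVac 𝔖 x → ψ x = 0) (hG : ∀ v w, G.conn Finset.univ v w) (r r' : V)
    (n : V → MultiIndex d) :
    ψ (G.rootVac r n) = translate Set.univ r (fun n => ψ (G.rootVac r' n)) n := by
  have hc : ∀ v, G.comp Finset.univ v = Finset.univ := fun v =>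
    Finset.filter_true_of_mem fun e _ => hG v _
  have hne : (G.comp Finset.univ r).Nonempty := by
    rw [hc]
    exact Finset.univ_nonempty
  have hv : G.verts Finset.univ = Finset.univ := by
    ext v
    rw [← hc r, mem_verts_comp_univ hne]
    simp [hG r v]
  unfold rootVac
  rw [hc, hc]
  have := vac_translate hψ (hc r ▸ G.isConn_comp hne) (r := r) (r' := r') (by rw [hv]; simp)
    (by rw [hv]; simp) n
  rwa [hv, Finset.coe_univ] at this

/-- Change of the distinguished vertex of the ambient graph. -/
lemma vacExtract_lowerEquiv_right (hJ : ∀ τ : VacDiagram 𝔖, 0 < τ.deg → χ τ.toThat = 0)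
    (hψ : ∀ x, IsRelVac 𝔖 x → ψ x = 0) (hG : ∀ v w, G.conn Finset.univ v w)
    (hσ : RootChoice G S σ) (hS : S ≠ Finset.univ) :
    LowerEquiv (vacExtract χ ψ G S r σ) (vacExtract χ ψ G S r' σ) := by
  have : Nonempty {e // e ∉ S} := by
    by_contra h
    exact hS (Finset.eq_univ_iff_forall.2 fun e => by_contra fun he => h ⟨⟨e, he⟩⟩)
  have hconn : ∀ l p q, (G.quo S l).conn Finset.univ p q := by
    intro l p q
    induction p using Quotient.inductionOn with
    | h v =>
      induction q using Quotient.inductionOn with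
      | h w => exact (conn_quo_iff S l).2 (hG v w)
  have hT := leftPart_truncated hJ hσ
  set F : Fin d → (HalfEdge E 0 → MultiIndex d) → (V → MultiIndex d) → B := fun i l b =>
    translateRem Set.univ (Quotient.mk _ r) (fun n => ψ ((G.quo S l).rootVac (Quotient.mk _ r') n))
      i (G.contractDec S b) with hF
  have h1 : ∀ l b, ψ ((G.quo S l).rootVac (Quotient.mk _ r) (G.contractDec S b))
      = ψ ((G.quo S l).rootVac (Quotient.mk _ r') (G.contractDec S b))
        + ∑ i, ∑ u, (b u i : ℝ) • F i l (b - unit u i) := by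
    intro l b
    have h2 := translate_eq (Finset.univ : Finset (Quotient (G.conn S))) (Quotient.mk _ r)
      (fun n => ψ ((G.quo S l).rootVac (Quotient.mk _ r') n)) (G.contractDec S b)
    rw [Finset.coe_univ] at h2
    rw [rootVac_translate hψ (hconn l) _ (Quotient.mk _ r'), h2]
    congr 1
    refine Finset.sum_congr rfl fun i _ => ?_
    have h3 := sum_lower_contractDec S (translateRem Set.univ (Quotient.mk _ r)
      (fun n => ψ ((G.quo S l).rootVac (Quotient.mk _ r') n)) i) Finset.univ b i
    rw [Finset.filter_true_of_mem fun _ _ => Finset.mem_univ _] at h3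
    convert h3.symm
  refine ⟨fun i => extraction G S (leftPart χ G S σ) (F i), fun n => ?_⟩
  rw [vacExtract_eq, vacExtract_eq, funext fun l => funext fun b => h1 l b,
    extraction_add_right hT]
  congr 1
  have h4 := extraction_sum_right (s := Finset.univ) hT (fun _ => 1)
    (fun i l b => ∑ u, (b u i : ℝ) • F i l (b - unit u i)) n
  simp only [one_smul] at h4
  rw [h4]
  refine Finset.sum_congr rfl fun i _ => ?_
  have h5 := extraction_sum_right (s := Finset.univ) hT (fun _ => 1)
    (fun u l b => (b u i : ℝ) • F i l (b - unit u i)) n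
  simp only [one_smul] at h5
  rw [h5]
  exact Finset.sum_congr rfl fun u _ => (extraction_lower hT _ n u i).symm

/-- The extraction of a subgraph is compatible with the change of the distinguished vertex. -/
lemma vacExtract_translate (hχ : ∀ x, IsRelVac 𝔖 x → χ x = 0)
    (hJ : ∀ τ : VacDiagram 𝔖, 0 < τ.deg → χ τ.toThat = 0)
    (hψ : ∀ x, IsRelVac 𝔖 x → ψ x = 0) (hG : ∀ v w, G.conn Finset.univ v w)
    (hσ : RootChoice G S σ) (hσ' : RootChoice G S σ')
    (hag : ∀ c ∈ G.comps S, r ∈ G.verts c → σ c = r) (hS : S ≠ Finset.univ)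
    (n : V → MultiIndex d) :
    vacExtract χ ψ G S r σ n = translate Set.univ r (vacExtract χ ψ G S r' σ') n := by
  rw [← translate_of_vanishing (fun n hn => vacExtract_eq_zero hχ hψ hag hn) n]
  exact ((vacExtract_lowerEquiv_right hJ hψ hG hσ hS).trans
    (vacExtract_lowerEquiv_left hχ hJ hψ hG hσ hσ')).translate_eq r n

/-- The distinguished vertices of the extracted components do not matter, except for the component
that contains the distinguished vertex of the ambient graph. -/
lemma vacExtract_congr_root (hχ : ∀ x, IsRelVac 𝔖 x → χ x = 0)
    (hJ : ∀ τ : VacDiagram 𝔖, 0 < τ.deg → χ τ.toThat = 0)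
    (hψ : ∀ x, IsRelVac 𝔖 x → ψ x = 0) (hG : ∀ v w, G.conn Finset.univ v w)
    (hσ : RootChoice G S σ) (hσ' : RootChoice G S σ')
    (hag : ∀ c ∈ G.comps S, r ∈ G.verts c → σ c = r)
    (hag' : ∀ c ∈ G.comps S, r ∈ G.verts c → σ' c = r) (n : V → MultiIndex d) :
    vacExtract χ ψ G S r σ n = vacExtract χ ψ G S r σ' n :=
  extractWeight_congr_root hχ hJ (fun _ => hψ) (rooted_unit hG r) hσ hσ'
    (fun c hc ⟨_, _, h⟩ => (hag c hc h).trans (hag' c hc h).symm) fun _ j => j.elim0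

end Vacuum

end LGraph


/-! ### Comparison with the coproduct -/

section Conversion

variable {𝔖 : LabelSystem d 𝔏} {V E : Type} {k : ℕ} [Fintype V] [Fintype E]
  {G : LGraph 𝔖 V E k} {S : Finset E}

/-- Summation over the changes of labels and decorations separately. -/
lemma finsum_slots {N : Type*} [AddCommMonoid N]
    (F : (HalfEdge E k → MultiIndex d) → (V → MultiIndex d) → N)
    (hF : Bounded (G.slots S) fun y => F (halfPart y) (vertPart y)) :
    (∑ᶠ l : {h // h ∈ G.boundary S} → MultiIndex d, ∑ᶠ m : {v // v ∈ G.verts S} → MultiIndex d,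
      F (extendZero l) (extendZero m)) = esum (G.slots S) fun y => F (halfPart y) (vertPart y) := by
  rw [finsum_congr fun l => finsum_extendZero (p := (· ∈ G.verts S)) fun m => F (extendZero l) m,
    finsum_extendZero (p := (· ∈ G.boundary S)) fun l => esum {v | v ∈ G.verts S} fun m => F l m]
  symm
  refine esum_prod (fun l m => Sum.elim l m) halfPart vertPart (fun l hl m hm => ⟨?_, rfl, rfl⟩)
    (fun y hy => ⟨fun h hh => hy (Sum.inl h) hh, fun v hv => hy (Sum.inr v) hv, ?_⟩) hF
  · rintro (h | v) hx
    · exact hl h hx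
    · exact hm v hx
  · funext x
    rcases x with h | v <;> rfl

lemma multiFactorial_extendZero {α : Type} [Fintype α] (s : Finset α)
    (l : {a // a ∈ s} → MultiIndex d) : multiFactorial l = multiFactorial (extendZero l) := by
  unfold multiFactorial
  have h : ∀ a : {a // a ∈ s}, ∏ i, (l a i).factorial
      = ∏ i, (extendZero l a.1 i).factorial := fun a => by rw [extendZero_apply]
  rw [Finset.prod_congr rfl fun a _ => h a,
    Finset.prod_coe_sort s fun a => ∏ i, (extendZero l a i).factorial]
  refine Finset.prod_subset (Finset.subset_univ _) fun a _ ha => ?_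
  simp [extendZero, ha]

lemma invFact_mul_slotCoeff (n : V → MultiIndex d) (y : HalfEdge E k ⊕ V → MultiIndex d) :
    (-1 : ℝ) ^ outOrder (halfPart y) / (multiFactorial (halfPart y) : ℝ)
      * (multiChoose n (vertPart y) : ℝ) = invFact y * slotCoeff n y := by
  unfold invFact slotCoeff multiFactorial multiChoose
  rw [Fintype.prod_sum_type fun a => ∏ i, ((y a i).factorial : ℝ)]
  have h1 : ∏ v, ∏ i, ((n v i).descFactorial (y (Sum.inr v) i) : ℝ)
      = (∏ v, ∏ i, ((y (Sum.inr v) i).factorial : ℝ))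
        * ∏ v, ∏ i, ((n v i).choose (y (Sum.inr v) i) : ℝ) := by
    simp only [← Finset.prod_mul_distrib]
    refine Finset.prod_congr rfl fun v _ => Finset.prod_congr rfl fun i _ => ?_
    rw [Nat.descFactorial_eq_factorial_mul_choose]
    push_cast
    rfl
  have h2 : (∏ v, ∏ i, ((y (Sum.inr v) i).factorial : ℝ)) ≠ 0 :=
    Finset.prod_ne_zero_iff.2 fun v _ => Finset.prod_ne_zero_iff.2 fun i _ => by positivity
  have h3 : (∏ h, ∏ i, ((y (Sum.inl h) i).factorial : ℝ)) ≠ 0 :=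
    Finset.prod_ne_zero_iff.2 fun v _ => Finset.prod_ne_zero_iff.2 fun i _ => by positivity
  rw [h1]
  push_cast
  simp only [halfPart, vertPart]
  field_simp

lemma fib_slotVert (y : HalfEdge E k ⊕ V → MultiIndex d) :
    fib G.slotVert y = vertPart y + G.push (halfPart y) := by
  funext v
  unfold fib push
  rw [Finset.sum_filter, Fintype.sum_sum_type, Pi.add_apply, add_comm]
  congr 1
  · refine (Finset.sum_eq_single v (fun w _ hw => if_neg hw) (by simp)).trans ?_
    exact if_pos rfl
  · rw [Finset.sum_filter]
    exact Finset.sum_congr rfl fun h _ => by congr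

/-- The extraction of a subgraph, written as a sum over changes of labels and decorations. -/
lemma extraction_eq_finsum {B M : Type*} [CommRing B] [Algebra ℝ B] [AddCommGroup M] [Module ℝ M]
    [Module B M] [IsScalarTower ℝ B M] {L : (V → MultiIndex d) → B} (hL : Truncated G S L)
    (g : (HalfEdge E k → MultiIndex d) → (V → MultiIndex d) → M) (n : V → MultiIndex d) :
    extraction G S L g n = ∑ᶠ l : {h // h ∈ G.boundary S} → MultiIndex d,
      ∑ᶠ m : {v // v ∈ G.verts S} → MultiIndex d,
        ((-1 : ℝ) ^ outOrder (extendZero l) / (multiFactorial l : ℝ)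
          * (multiChoose n (extendZero m) : ℝ)) •
        L (extendZero m + G.push (extendZero l)) • g (extendZero l) (n - extendZero m) := by
  simp only [multiFactorial_extendZero]
  refine Eq.trans ?_ (finsum_slots (G := G) (S := S) (fun l m =>
    ((-1 : ℝ) ^ outOrder l / (multiFactorial l : ℝ) * (multiChoose n m : ℝ)) •
        L (m + G.push l) • g l (n - m)) ?_).symm
  · refine esum_congr fun y _ => ?_
    rw [invFact_mul_slotCoeff, mul_smul, fib_slotVert]
  · refine (hL.bounded invFact (slotCoeff n) fun y => g (halfPart y) (n - vertPart y)).congr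
      fun y _ h => ?_
    rw [invFact_mul_slotCoeff, mul_smul, ← fib_slotVert]
    exact h

/-- Extraction commutes with semilinear maps. -/
lemma map_extraction {B M B' M' : Type*} [CommRing B] [Algebra ℝ B] [AddCommGroup M] [Module ℝ M]
    [Module B M] [IsScalarTower ℝ B M] [CommRing B'] [Algebra ℝ B'] [AddCommGroup M'] [Module ℝ M']
    [Module B' M'] [IsScalarTower ℝ B' M'] (A : B →ₐ[ℝ] B') (φ : M →ₗ[ℝ] M')
    (hφ : ∀ b m, φ (b • m) = A b • φ m) {L : (V → MultiIndex d) → B} (hL : Truncated G S L)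
    (g : (HalfEdge E k → MultiIndex d) → (V → MultiIndex d) → M) (n : V → MultiIndex d) :
    φ (extraction G S L g n) = extraction G S (fun a => A (L a)) (fun l b => φ (g l b)) n := by
  refine (esum_map φ.toAddMonoidHom (hL.bounded _ _ _)).trans (esum_congr fun y _ => ?_)
  show φ _ = _
  rw [map_smul, map_smul, hφ]

variable {B : Type*} [CommRing B] [Algebra ℝ B] {χ : That 𝔖 →ₐ[ℝ] B}

lemma map_leftPart {B' : Type*} [CommRing B'] [Algebra ℝ B'] (A : B →ₐ[ℝ] B')
    (σ : Finset E → V) (a : V → MultiIndex d) :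
    A (leftPart χ G S σ a) = leftPart (A.comp χ) G S σ a := map_prod A _ _

lemma map_extract [Nonempty V] (R : Finset V) (a : V → MultiIndex d) :
    χ (G.extract R S a) = leftPart χ G S (G.pickVert R) a := by
  unfold extract leftPart
  rw [map_prod, ← Finset.prod_attach (G.comps S)]
  refine Finset.prod_congr rfl fun c _ => ?_
  rw [piece_toThat, pickVert_eq _ _ (G.isConn_of_mem_comps c.2).1]

lemma map_toThat (hχ : ∀ x, IsRelVac 𝔖 x → χ x = 0) (τ : VacDiagram 𝔖) :
    χ τ.toThat = χ (τ.G.rootVac τ.root τ.n) := by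
  have hc : τ.G.comp Finset.univ τ.root = Finset.univ :=
    Finset.filter_true_of_mem fun e _ => τ.connected _ _
  have hne : (τ.G.comp Finset.univ τ.root).Nonempty := by
    rw [hc]
    exact Finset.univ_nonempty
  have hr := root_mem_verts_comp hne
  have hv : ∀ v, v ∈ τ.G.verts (τ.G.comp Finset.univ τ.root) := fun v =>
    (mem_verts_comp_univ hne).2 (τ.connected _ _)
  unfold rootVac
  rw [vac_of_isConn (τ.G.isConn_comp hne) hr, eq_comm, ← sub_eq_zero, ← map_sub]
  refine hχ _ (IsRelVac.iso _ _ ⟨Equiv.subtypeUnivEquiv hv,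
    Equiv.subtypeUnivEquiv fun e => by
      rw [hc]
      exact Finset.mem_univ e, rfl, fun _ => rfl, fun _ => rfl,
    fun _ => rfl, fun j => j.elim0, fun j => j.elim0⟩ rfl fun _ => rfl)

end Conversion

section Vacuum

variable {𝔖 : LabelSystem d 𝔏} {B : Type*} [CommRing B] [Algebra ℝ B] {χ ψ : That 𝔖 →ₐ[ℝ] B}

instance (τ : VacDiagram 𝔖) : Nonempty τ.V := ⟨τ.root⟩

/-- The contribution of the subgraph `S` to `M (χ ⊗ ψ) Δ^- τ`. -/
def VacDiagram.term (χ ψ : That 𝔖 →ₐ[ℝ] B) (τ : VacDiagram 𝔖) (S : Finset τ.E) : B :=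
  vacExtract χ ψ τ.G S τ.root (τ.G.pickVert {τ.root}) τ.n

/-- If the whole diagram is contracted, then the quotient is an isolated vertex, which is `1` or `0`
according to its decoration. -/
lemma map_quot (hψ : ∀ x, IsRelVac 𝔖 x → ψ x = 0) (τ : VacDiagram 𝔖) (S : Finset τ.E)
    (l : HalfEdge τ.E 0 → MultiIndex d) (b : τ.V → MultiIndex d) :
    ψ (τ.quot S l b) = ψ ((τ.G.quo S l).rootVac (Quotient.mk _ τ.root) (τ.G.contractDec S b)) := by
  unfold VacDiagram.quot
  split_ifs with h1 h2
  · exact map_toThat hψ _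
  all_goals
    rw [not_not] at h1
    subst h1
    have he : (τ.G.quo Finset.univ l).comp Finset.univ (Quotient.mk _ τ.root) = ∅ :=
      Finset.eq_empty_of_forall_notMem fun e _ => e.2 (Finset.mem_univ _)
    have hd : τ.G.contractDec Finset.univ b (Quotient.mk _ τ.root) = ∑ v, b v := by
      unfold contractDec
      rw [Finset.filter_true_of_mem fun v _ => Quotient.sound (τ.connected v τ.root)]
    rw [rootVac, he, vac_empty, hd]
  · rw [if_pos h2]
  · rw [if_neg h2]

lemma toHminus_rel (x : That 𝔖) (hx : IsRelVac 𝔖 x) : toHminus 𝔖 x = 0 :=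
  Ideal.Quotient.eq_zero_iff_mem.2 (Ideal.mem_sup_left (Ideal.subset_span hx))

lemma toHminus_deg (τ : VacDiagram 𝔖) (hτ : 0 < τ.deg) : toHminus 𝔖 τ.toThat = 0 :=
  Ideal.Quotient.eq_zero_iff_mem.2 (Ideal.mem_sup_right (Ideal.subset_span ⟨τ, hτ, rfl⟩))

lemma toHhat_rel (x : That 𝔖) (hx : IsRelVac 𝔖 x) : toHhat 𝔖 x = 0 :=
  Ideal.Quotient.eq_zero_iff_mem.2 (Ideal.subset_span hx)

/-- The defining property of the twisted antipode in terms of `VacDiagram.term`. -/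
lemma coproduct_eq (A : Hminus 𝔖 →ₐ[ℝ] Hhat 𝔖) (τ : VacDiagram 𝔖) :
    LinearMap.mul' ℝ (Hhat 𝔖) (TensorProduct.map A.toLinearMap LinearMap.id (coproduct τ))
      = ∑ S, τ.term (A.comp (toHminus 𝔖)) (toHhat 𝔖) S := by
  unfold coproduct
  rw [map_sum, map_sum]
  refine Finset.sum_congr rfl fun S _ => ?_
  have hT := leftPart_truncated (χ := toHminus 𝔖) toHminus_deg
    (rootChoice_pickVert τ.G {τ.root} S)
  have h1 := extraction_eq_finsum hT (M := Hminus 𝔖 ⊗[ℝ] Hhat 𝔖)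
    (fun l b => 1 ⊗ₜ[ℝ] toHhat 𝔖 (τ.quot S l b)) τ.n
  have h2 : ∀ (x : Hminus 𝔖) (y : Hhat 𝔖), x • ((1 : Hminus 𝔖) ⊗ₜ[ℝ] y) = x ⊗ₜ[ℝ] y := fun x y => by
    rw [TensorProduct.smul_tmul', smul_eq_mul, mul_one]
  simp only [h2, ← map_extract] at h1
  rw [← h1]
  have h3 := map_extraction A ((LinearMap.mul' ℝ (Hhat 𝔖)).comp
    (TensorProduct.map A.toLinearMap LinearMap.id)) (fun b m => ?_) hT
    (fun l b => 1 ⊗ₜ[ℝ] toHhat 𝔖 (τ.quot S l b)) τ.n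
  · refine h3.trans ?_
    rw [VacDiagram.term, vacExtract_eq]
    refine extraction_congr (fun y _ => map_leftPart A _ _) fun y _ => ?_
    simp only [LinearMap.comp_apply, TensorProduct.map_tmul, LinearMap.mul'_apply,
      AlgHom.toLinearMap_apply, map_one, one_mul, LinearMap.id_apply]
    exact map_quot toHhat_rel τ S _ _
  · induction m using TensorProduct.induction_on with
    | zero => simp
    | tmul x y =>
      rw [TensorProduct.smul_tmul']
      simp [mul_assoc]
    | add x y hx hy => rw [smul_add, map_add, hx, hy, map_add, smul_add]

end Vacuum


/-! ### Contributions of subgraphs -/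

section Antipode

variable {𝔖 : LabelSystem d 𝔏} {B : Type*} [CommRing B] [Algebra ℝ B] {χ χ' ψ : That 𝔖 →ₐ[ℝ] B}

lemma VacDiagram.comp_univ (τ : VacDiagram 𝔖) (v : τ.V) : τ.G.comp Finset.univ v = Finset.univ :=
  Finset.filter_true_of_mem fun _ _ => τ.connected v _

lemma VacDiagram.mem_verts_univ (τ : VacDiagram 𝔖) (v : τ.V) : v ∈ τ.G.verts Finset.univ := by
  have h : (τ.G.comp Finset.univ v).Nonempty := by
    rw [τ.comp_univ]
    exact Finset.univ_nonempty
  have := root_mem_verts_comp h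
  rwa [τ.comp_univ] at this

lemma VacDiagram.comps_univ (τ : VacDiagram 𝔖) : τ.G.comps Finset.univ = {Finset.univ} := by
  unfold comps
  simp only [τ.comp_univ]
  exact Finset.image_const Finset.univ_nonempty _

lemma VacDiagram.pickVert_eq_root (τ : VacDiagram 𝔖) {c : Finset τ.E} (h : τ.root ∈ τ.G.verts c) :
    τ.G.pickVert {τ.root} c = τ.root :=
  Finset.mem_singleton.1 (pickVert_mem (Finset.mem_singleton_self _) h)

/-- The contribution of the full graph: only the term where the whole decoration is extracted is
non-zero. -/
lemma VacDiagram.term_univ (hχ : ∀ x, IsRelVac 𝔖 x → χ x = 0) (hψ : ∀ x, IsRelVac 𝔖 x → ψ x = 0)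
    (τ : VacDiagram 𝔖) : τ.term χ ψ Finset.univ = χ τ.toThat := by
  have hb : ∀ y ∈ Supp d (τ.G.slots Finset.univ), halfPart y = 0 := fun y hy => by
    funext h
    refine hy (Sum.inl h) fun hh => (mem_boundary.1 hh).1 ?_
    rcases h with (⟨e, b⟩ | j)
    · exact ⟨e, Finset.mem_univ e, b, rfl⟩
    · exact j.elim0
  rw [VacDiagram.term, vacExtract_eq, extraction, esum,
    finsum_eq_single _ (Sum.elim 0 τ.n : HalfEdge τ.E 0 ⊕ τ.V → MultiIndex d)]
  · rw [Set.indicator_of_mem]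
    · have h1 : halfPart (Sum.elim 0 τ.n : HalfEdge τ.E 0 ⊕ τ.V → MultiIndex d) = 0 := rfl
      have h2 : vertPart (Sum.elim 0 τ.n : HalfEdge τ.E 0 ⊕ τ.V → MultiIndex d) = τ.n := rfl
      rw [smul_smul, ← invFact_mul_slotCoeff, fib_slotVert, ← map_quot hψ, h1, h2]
      have h3 : τ.G.push (0 : HalfEdge τ.E 0 → MultiIndex d) = 0 := by
        funext v
        simp [push]
      have h4 : τ.quot Finset.univ 0 (τ.n - τ.n) = 1 := by
        simp [VacDiagram.quot]
      have h5 : outOrder (0 : HalfEdge τ.E 0 → MultiIndex d) = 0 := by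
        simp [outOrder, order_zero]
      have h6 : multiFactorial (0 : HalfEdge τ.E 0 → MultiIndex d) = 1 := by
        simp [multiFactorial]
      have h7 : multiChoose τ.n τ.n = 1 := by
        simp [multiChoose]
      rw [h3, h4, h5, h6, h7, add_zero, map_one, pow_zero, Nat.cast_one, div_one, mul_one,
        one_smul, smul_eq_mul, mul_one, leftPart, τ.comps_univ, Finset.prod_singleton,
        τ.pickVert_eq_root (τ.mem_verts_univ _), map_toThat hχ, rootVac, τ.comp_univ]
    · rintro (h | v) hx
      · rfl
      · exact absurd (τ.mem_verts_univ v) hx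
  · intro y hy
    by_cases hys : y ∈ Supp d (τ.G.slots Finset.univ)
    · rw [Set.indicator_of_mem hys, smul_smul, ← invFact_mul_slotCoeff, ← map_quot hψ]
      by_cases hc : multiChoose τ.n (vertPart y) = 0
      · rw [hc]
        simp
      · rw [VacDiagram.quot, dif_neg (by simp), if_neg, map_zero, smul_zero, smul_zero]
        intro h
        refine hy (funext fun x => ?_)
        rcases x with h' | v
        · exact congrFun (hb y hys) h'
        · have h1 := Finset.sum_eq_zero_iff.1 h v (Finset.mem_univ v)
          exact le_antisymm (multiChoose_le hc v) (tsub_eq_zero_iff_le.1 h1)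
    · exact Set.indicator_of_notMem hys _

/-- The contribution of a proper subgraph depends on the values of `χ` on smaller diagrams only. -/
lemma VacDiagram.term_congr {τ : VacDiagram 𝔖} {S : Finset τ.E} (hS : S ≠ Finset.univ)
    (h : ∀ τ' : VacDiagram 𝔖, Fintype.card τ'.E < Fintype.card τ.E → χ τ'.toThat = χ' τ'.toThat) :
    τ.term χ ψ S = τ.term χ' ψ S := by
  refine extraction_congr (fun y _ => ?_) fun _ _ => rfl
  refine Finset.prod_congr rfl fun c hc => ?_
  rw [vac_of_isConn (τ.G.isConn_of_mem_comps hc) (rootChoice_pickVert τ.G _ S c hc)]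
  refine h _ ?_
  have h1 : Fintype.card {e // e ∈ c} = c.card := Fintype.card_coe c
  have h2 : c.card ≤ S.card := Finset.card_le_card (comps_subset hc)
  have h3 : S.card < Fintype.card τ.E := Finset.card_lt_univ_of_notMem
    (not_forall.1 fun h => hS (Finset.eq_univ_iff_forall.2 h)).choose_spec
  calc _ = c.card := h1
    _ < _ := h2.trans_lt h3

/-- The third type of relation in terms of `translate`. -/
lemma map_translate (χ : That 𝔖 →ₐ[ℝ] B) (τ : VacDiagram 𝔖) (v : τ.V) :
    χ (∑ᶠ m : τ.V → MultiIndex d, ((-1 : ℝ) ^ (∑ u, order (m u)) * (multiChoose τ.n m : ℝ)) •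
      (τ.redecorate v (τ.n - m + Pi.single τ.root (∑ u, m u))).toThat)
      = translate Set.univ τ.root (fun n => χ (τ.redecorate v n).toThat) τ.n := by
  have h1 : ∀ g : (τ.V → MultiIndex d) → That 𝔖, ∑ᶠ m, g m = esum Set.univ g := fun g => by
    unfold esum
    congr 1
    funext m
    rw [Set.indicator_of_mem fun a ha => absurd (Set.mem_univ a) ha]
  rw [h1]
  exact translate_map χ.toLinearMap Set.univ τ.root (fun n => (τ.redecorate v n).toThat) τ.n

/-! ### Functions compatible with the relations -/

/-- A function on connected vacuum diagrams that is compatible with the relations. -/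
structure VacInvariant (f : VacDiagram 𝔖 → B) : Prop where
  iso : ∀ (τ τ' : VacDiagram 𝔖) (φ : LGraph.Iso τ.G τ'.G), τ'.root = φ.onV τ.root →
    (∀ v, τ'.n (φ.onV v) = τ.n v) → f τ = f τ'
  ibp : ∀ (τ : VacDiagram 𝔖) (v : τ.V) (i : Fin d),
    (∑ h ∈ Finset.univ.filter (fun h => τ.G.vert h = v), halfSign h • f (τ.shift (unit h i)))
      + (τ.n v i : ℝ) • f (τ.redecorate τ.root (τ.n - unit v i))
      = if v = τ.root then ∑ u, (τ.n u i : ℝ) • f (τ.redecorate τ.root (τ.n - unit u i)) else 0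
  move : ∀ (τ : VacDiagram 𝔖) (v : τ.V),
    f τ = translate Set.univ τ.root (fun n => f (τ.redecorate v n)) τ.n

/-- The character of the free algebra given by an invariant function annihilates all relations. -/
lemma VacInvariant.aeval_eq_zero {f : VacDiagram 𝔖 → B} (hf : VacInvariant f) {x : That 𝔖}
    (hx : IsRelVac 𝔖 x) : MvPolynomial.aeval f x = 0 := by
  have hX : ∀ τ : VacDiagram 𝔖, MvPolynomial.aeval f τ.toThat = f τ := fun τ =>
    MvPolynomial.aeval_X f τ
  rcases hx with ⟨τ, τ', φ, hr, hn⟩ | ⟨τ, v, hv, i⟩ | ⟨τ, i⟩ | ⟨τ, v⟩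
  · rw [map_sub, hX, hX, hf.iso τ τ' φ hr hn, sub_self]
  · have := hf.ibp τ v i
    rw [if_neg hv] at this
    simpa only [map_add, VacDiagram.sumHalf, VacDiagram.lower, map_sum, map_smul, hX] using this
  · have := hf.ibp τ τ.root i
    rw [if_pos rfl, ← Finset.sum_filter_add_sum_filter_not Finset.univ (fun v => v ≠ τ.root)] at this
    simp only [not_not] at this
    rw [Finset.sum_filter (fun u => u = τ.root), Finset.sum_ite_eq' Finset.univ τ.root,
      if_pos (Finset.mem_univ _), add_left_inj] at this
    simp only [map_sub, VacDiagram.sumHalf, VacDiagram.lower, map_sum, map_smul, hX]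
    rw [sub_eq_zero]
    exact this
  · rw [map_sub, hX, hf.move τ v, sub_eq_zero, map_translate]
    simp only [hX]

lemma order_unit {α : Type*} [DecidableEq α] (a b : α) (i : Fin d) :
    order ((unit a i : α → MultiIndex d) b) = if b = a then 1 else 0 := by
  split_ifs with h
  · subst h
    rw [unit, Pi.single_eq_same, order_single]
  · rw [unit, Pi.single_eq_of_ne h, order_zero]

lemma sum_deg_shift_unit {V E : Type} [Fintype E] (G : LGraph 𝔖 V E 0) (h : HalfEdge E 0)
    (i : Fin d) : ∑ e, 𝔖.deg ((G.shift (unit h i)).lab e) = ∑ e, 𝔖.deg (G.lab e) - 1 := by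
  rcases h with (⟨e₀, b⟩ | j)
  · have h1 : ∀ e, 𝔖.deg ((G.shift (unit (Sum.inl (e₀, b)) i)).lab e)
        = 𝔖.deg (G.lab e) - if e = e₀ then 1 else 0 := by
      intro e
      have h2 : order ((unit (Sum.inl (e₀, b)) i : HalfEdge E 0 → MultiIndex d) (Sum.inl (e, false))
        + (unit (Sum.inl (e₀, b)) i : HalfEdge E 0 → MultiIndex d) (Sum.inl (e, true)))
          = if e = e₀ then 1 else 0 := by
        rw [order_add, order_unit, order_unit]
        by_cases he : e = e₀ <;> cases b <;> simp [he]
      refine (𝔖.deg_diff _ _).trans ?_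
      rw [h2]
      push_cast
      rfl
    rw [Finset.sum_congr rfl fun e _ => h1 e, Finset.sum_sub_distrib, Finset.sum_ite_eq',
      if_pos (Finset.mem_univ e₀)]
  · exact j.elim0

lemma deg_shift_unit (τ : VacDiagram 𝔖) (h : HalfEdge τ.E 0) (i : Fin d) :
    (τ.shift (unit h i)).deg = τ.deg - 1 := by
  have h1 := sum_deg_shift_unit τ.G h i
  refine (congrArg (fun x => x + ∑ v, (order (τ.n v) : ℝ)
    + (d : ℝ) * ((Fintype.card τ.V : ℝ) - 1)) h1).trans ?_
  unfold VacDiagram.deg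
  ring

lemma sum_order (V : Type) [Fintype V] (n : V → MultiIndex d) :
    ∑ v, (order (n v) : ℝ) = (tot n : ℝ) := by
  unfold tot
  push_cast
  rfl

lemma deg_redecorate (τ : VacDiagram 𝔖) (v : τ.V) (n : τ.V → MultiIndex d) :
    (τ.redecorate v n).deg = τ.deg + tot n - tot τ.n := by
  show ∑ e, 𝔖.deg (τ.G.lab e) + ∑ v, (order (n v) : ℝ) + (d : ℝ) * ((Fintype.card τ.V : ℝ) - 1) = _
  unfold VacDiagram.deg
  rw [sum_order, sum_order]
  ring

lemma tot_sub_unit {V : Type} [Fintype V] {n : V → MultiIndex d} {v : V} {i : Fin d}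
    (h : n v i ≠ 0) : (tot (n - unit v i) : ℝ) = tot n - 1 := by
  have h1 : n = (n - unit v i) + unit v i := by
    funext w j
    by_cases hw : w ≠ v ∨ j ≠ i
    · simp only [Pi.add_apply, Pi.sub_apply, unit_apply_ne hw, tsub_zero, add_zero]
    · simp only [not_or, not_not] at hw
      obtain ⟨rfl, rfl⟩ := hw
      simp only [Pi.add_apply, Pi.sub_apply, unit_apply_same]
      omega
  conv_rhs => rw [h1, tot_add, tot_unit]
  push_cast
  ring

lemma tot_move {V : Type} [Fintype V] {n j : V → MultiIndex d} (hj : j ≤ n) (r : V) :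
    tot (n - j + Pi.single r (total j)) = tot n := by
  have h1 : tot (Pi.single r (total j) : V → MultiIndex d) = tot j := by
    unfold tot
    rw [Finset.sum_eq_single r, Pi.single_eq_same, order_total]
    · rfl
    · intro v _ hv
      rw [Pi.single_eq_of_ne hv, order_zero]
    · simp
  rw [tot_add, h1, ← tot_add, tsub_add_cancel_of_le hj]

/-- The relations are homogeneous, so that they are preserved by truncation to the diagrams whose
degree is not positive. -/
lemma VacInvariant.truncate {f : VacDiagram 𝔖 → B} (hf : VacInvariant f) :
    VacInvariant (fun τ => if τ.deg ≤ 0 then f τ else 0) where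
  iso τ τ' φ hr hn := by
    have : τ.deg = τ'.deg := by
      unfold VacDiagram.deg
      rw [Fintype.card_congr φ.onV, Fintype.sum_equiv φ.onE _ (fun e => 𝔖.deg (τ'.G.lab e))
        (fun e => by rw [φ.lab_eq]), Fintype.sum_equiv φ.onV _ (fun v => (order (τ'.n v) : ℝ))
        (fun v => by rw [hn])]
    rw [this, hf.iso τ τ' φ hr hn]
  ibp τ v i := by
    have h1 : ∀ u, (τ.n u i : ℝ) • (if (τ.redecorate τ.root (τ.n - unit u i)).deg ≤ 0
        then f (τ.redecorate τ.root (τ.n - unit u i)) else 0)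
        = if τ.deg - 1 ≤ 0 then (τ.n u i : ℝ) • f (τ.redecorate τ.root (τ.n - unit u i)) else 0 := by
      intro u
      rcases Nat.eq_zero_or_pos (τ.n u i) with h | h
      · simp [h]
      · rw [deg_redecorate, tot_sub_unit h.ne', show τ.deg + ((tot τ.n : ℝ) - 1) - tot τ.n
          = τ.deg - 1 by ring, smul_ite, smul_zero]
    simp only [h1, deg_shift_unit]
    have := hf.ibp τ v i
    by_cases h2 : τ.deg - 1 ≤ 0
    · simp only [if_pos h2]
      exact this
    · simp only [if_neg h2, smul_zero, Finset.sum_const_zero, add_zero, ite_self]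
  move τ v := by
    unfold translate
    by_cases h : τ.deg ≤ 0
    · rw [if_pos h, hf.move τ v]
      refine esum_congr fun j _ => ?_
      by_cases hc : multiChoose τ.n j = 0
      · simp [hc]
      · beta_reduce
        rw [if_pos]
        rw [deg_redecorate, tot_move (multiChoose_le hc)]
        linarith
    · rw [if_neg h]
      refine (esum_zero fun j _ => ?_).symm
      by_cases hc : multiChoose τ.n j = 0
      · simp [hc]
      · beta_reduce
        rw [if_neg, smul_zero]
        rw [deg_redecorate, tot_move (multiChoose_le hc)]
        linarith

/-- The sum of the contributions of all proper subgraphs. -/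
def properSum (χ ψ : That 𝔖 →ₐ[ℝ] B) (τ : VacDiagram 𝔖) : B :=
  ∑ S ∈ Finset.univ.filter (fun S => S ≠ Finset.univ), τ.term χ ψ S

lemma sum_term (hχ : ∀ x, IsRelVac 𝔖 x → χ x = 0) (hψ : ∀ x, IsRelVac 𝔖 x → ψ x = 0)
    (τ : VacDiagram 𝔖) : ∑ S, τ.term χ ψ S = properSum χ ψ τ + χ τ.toThat := by
  rw [properSum, ← τ.term_univ hχ hψ,
    ← Finset.sum_filter_add_sum_filter_not Finset.univ (fun S : Finset τ.E => S ≠ Finset.univ)]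
  congr 1
  simp only [not_not]
  rw [Finset.sum_filter, Finset.sum_ite_eq' Finset.univ Finset.univ, if_pos (Finset.mem_univ _)]

lemma properSum_congr {τ : VacDiagram 𝔖}
    (h : ∀ τ' : VacDiagram 𝔖, Fintype.card τ'.E < Fintype.card τ.E → χ τ'.toThat = χ' τ'.toThat) :
    properSum χ ψ τ = properSum χ' ψ τ :=
  Finset.sum_congr rfl fun _ hS => VacDiagram.term_congr (Finset.mem_filter.1 hS).2 h

/-- The contribution of a subgraph can be computed in any graph that contains the vacuum diagram as
a connected component. -/
lemma LGraph.CompEmb.extraction_eq_term {τ : VacDiagram 𝔖} {V' E' : Type} {k' : ℕ} [Fintype V']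
    [Fintype E'] {G' : LGraph 𝔖 V' E' k'} {φ : τ.E → E'} {f : τ.V → V'} (H : CompEmb τ.G G' φ f)
    (hχ : ∀ x, IsRelVac 𝔖 x → χ x = 0) (hJ : ∀ τ : VacDiagram 𝔖, 0 < τ.deg → χ τ.toThat = 0)
    (hψ : ∀ x, IsRelVac 𝔖 x → ψ x = 0) {S : Finset τ.E} {σ : Finset E' → V'}
    (hσ : RootChoice G' (S.image φ) σ)
    (hag : ∀ c ∈ G'.comps (S.image φ), f τ.root ∈ G'.verts c → σ c = f τ.root)
    {n' : V' → MultiIndex d} (hn : ∀ v, n' (f v) = τ.n v) :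
    extraction G' (S.image φ) (leftPart χ G' (S.image φ) σ)
      (fun l b => ψ ((G'.quo (S.image φ) l).rootVac (Quotient.mk _ (f τ.root))
        (G'.contractDec (S.image φ) b))) n' = τ.term χ ψ S := by
  set σ₀ : Finset τ.E → τ.V := fun c => Function.invFun f (σ (c.image φ)) with hσ₀
  have hcomp : ∀ c ∈ τ.G.comps S, c.image φ ∈ G'.comps (S.image φ) := by
    intro c hc
    rw [H.comps_image]
    exact Finset.mem_image_of_mem _ hc
  have hσc : ∀ c ∈ τ.G.comps S, σ (c.image φ) = f (σ₀ c) := fun c hc =>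
    (Function.invFun_eq (H.mem_range_of_verts (hσ _ (hcomp c hc)))).symm
  have hch : RootChoice τ.G S σ₀ := fun c hc => by
    rw [← H.mem_verts_image, ← hσc c hc]
    exact hσ _ (hcomp c hc)
  have hag₀ : ∀ c ∈ τ.G.comps S, τ.root ∈ τ.G.verts c → σ₀ c = τ.root := by
    intro c hc hrc
    rw [← H.mem_verts_image] at hrc
    exact H.injV ((hσc c hc).symm.trans (hag _ (hcomp c hc) hrc))
  rw [VacDiagram.term, vacExtract_congr_root hχ hJ hψ τ.connected (rootChoice_pickVert τ.G _ S)
    hch (fun c _ h => τ.pickVert_eq_root h) hag₀, vacExtract_eq, ← funext hn]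
  exact H.extraction_eq S (fun a' => H.leftPart_eq (S := S) hχ hσc a')
    (g := fun l b => ψ ((τ.G.quo S l).rootVac (Quotient.mk _ τ.root) (τ.G.contractDec S b)))
    (fun l' b' => H.quo_rootVac_eq hψ S τ.root l' b') n'

/-- The contribution of a subgraph is invariant under isomorphisms. -/
lemma VacDiagram.term_iso (hχ : ∀ x, IsRelVac 𝔖 x → χ x = 0)
    (hJ : ∀ τ : VacDiagram 𝔖, 0 < τ.deg → χ τ.toThat = 0)
    (hψ : ∀ x, IsRelVac 𝔖 x → ψ x = 0) {τ τ' : VacDiagram 𝔖} (φ : LGraph.Iso τ.G τ'.G)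
    (hr : τ'.root = φ.onV τ.root) (hn : ∀ v, τ'.n (φ.onV v) = τ.n v) (S : Finset τ.E) :
    τ'.term χ ψ (S.image φ.onE) = τ.term χ ψ S := by
  have H : CompEmb τ.G τ'.G φ.onE φ.onV :=
    ⟨⟨φ.onE.injective, φ.onV.injective, fun e b => by
      cases b
      · exact φ.src_eq e
      · exact φ.tgt_eq e, fun e' _ _ _ => ⟨φ.onE.symm e', φ.onE.apply_symm_apply e'⟩, φ.lab_eq⟩,
      fun j => j.elim0⟩
  rw [← H.extraction_eq_term hχ hJ hψ (rootChoice_pickVert τ'.G {τ'.root} (S.image φ.onE))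
    (fun c _ h => by
      rw [← hr] at h ⊢
      exact τ'.pickVert_eq_root h) hn, ← hr]
  exact vacExtract_eq (G := τ'.G) (χ := χ) (ψ := ψ) τ'.n

/-- Integration by parts holds for each subgraph separately. -/
lemma properSum_ibp (hχ : ∀ x, IsRelVac 𝔖 x → χ x = 0)
    (hJ : ∀ τ : VacDiagram 𝔖, 0 < τ.deg → χ τ.toThat = 0)
    (hψ : ∀ x, IsRelVac 𝔖 x → ψ x = 0) (τ : VacDiagram 𝔖) (v : τ.V) (i : Fin d) :
    (∑ h ∈ Finset.univ.filter (fun h => τ.G.vert h = v),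
        halfSign h • properSum χ ψ (τ.shift (unit h i)))
      + (τ.n v i : ℝ) • properSum χ ψ (τ.redecorate τ.root (τ.n - unit v i))
      = if v = τ.root then
        ∑ u, (τ.n u i : ℝ) • properSum χ ψ (τ.redecorate τ.root (τ.n - unit u i)) else 0 := by
  set P := Finset.univ.filter (fun S : Finset τ.E => S ≠ Finset.univ)
  have h2 : ∑ S ∈ P, _ = ∑ S ∈ P, _ := Finset.sum_congr rfl fun S _ =>
    extractWeight_ibp (L := emptyValue 𝔖 B) (R := {()}) (ρ := fun _ => τ.root)
      hχ hJ (fun _ : Unit => hψ) (rooted_unit τ.connected τ.root) (rootChoice_pickVert τ.G {τ.root} S)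
      (Finset.mem_singleton_self ()) (fun c _ h => τ.pickVert_eq_root h) (τ.connected τ.root v) τ.n i
  rw [Finset.sum_add_distrib, Finset.sum_comm] at h2
  simp only [← Finset.smul_sum] at h2
  refine h2.trans ?_
  split_ifs
  · rw [Finset.sum_comm, Finset.filter_true_of_mem fun u _ => τ.connected τ.root u]
    simp only [← Finset.smul_sum]
    rfl
  · exact Finset.sum_const_zero

/-- Compatibility with the change of the distinguished vertex holds for each proper subgraph
separately. -/
lemma properSum_move (hχ : ∀ x, IsRelVac 𝔖 x → χ x = 0)
    (hJ : ∀ τ : VacDiagram 𝔖, 0 < τ.deg → χ τ.toThat = 0)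
    (hψ : ∀ x, IsRelVac 𝔖 x → ψ x = 0) (τ : VacDiagram 𝔖) (v : τ.V) :
    properSum χ ψ τ
      = translate Set.univ τ.root (fun n => properSum χ ψ (τ.redecorate v n)) τ.n := by
  have h1 : ∀ n, properSum χ ψ (τ.redecorate v n)
      = ∑ S ∈ Finset.univ.filter (fun S : Finset τ.E => S ≠ Finset.univ),
        vacExtract χ ψ τ.G S v (τ.G.pickVert {v}) n := fun _ => rfl
  simp only [h1]
  rw [translate_sum]
  exact Finset.sum_congr rfl fun S hS => vacExtract_translate hχ hJ hψ τ.connected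
    (rootChoice_pickVert τ.G {τ.root} S) (rootChoice_pickVert τ.G {v} S)
    (fun c _ h => τ.pickVert_eq_root h) (Finset.mem_filter.1 hS).2 τ.n

/-- The recursive definition of the twisted antipode respects the relations. -/
lemma properSum_invariant (hχ : ∀ x, IsRelVac 𝔖 x → χ x = 0)
    (hJ : ∀ τ : VacDiagram 𝔖, 0 < τ.deg → χ τ.toThat = 0)
    (hψ : ∀ x, IsRelVac 𝔖 x → ψ x = 0) : VacInvariant (properSum χ ψ) where
  iso τ τ' φ hr hn := by
    unfold properSum
    refine Finset.sum_equiv (Equiv.finsetCongr φ.onE) (fun S => ?_) fun S _ => ?_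
    · simp only [Finset.mem_filter, Finset.mem_univ, true_and, Equiv.finsetCongr_apply]
      rw [not_iff_not, ← Finset.map_univ_equiv φ.onE, Finset.map_inj]
    · rw [Equiv.finsetCongr_apply, Finset.map_eq_image]
      exact (VacDiagram.term_iso hχ hJ hψ φ hr hn S).symm
  ibp := properSum_ibp hχ hJ hψ
  move := properSum_move hχ hJ hψ

lemma VacInvariant.neg {f : VacDiagram 𝔖 → B} (hf : VacInvariant f) :
    VacInvariant (fun τ => - f τ) where
  iso τ τ' φ hr hn := by rw [hf.iso τ τ' φ hr hn]
  ibp τ v i := by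
    have := congrArg Neg.neg (hf.ibp τ v i)
    simp only [smul_neg, Finset.sum_neg_distrib]
    rw [← neg_add, this]
    split_ifs
    · rfl
    · exact neg_zero
  move τ v := by
    conv_lhs => rw [hf.move τ v]
    exact translate_map (-LinearMap.id : B →ₗ[ℝ] B) _ _ _ _

/-! ### Existence and uniqueness of the twisted antipode -/

variable (𝔖) in
/-- The values of the twisted antipode on the connected vacuum diagrams with at most `N` edges. -/
def antipodeValue : ℕ → VacDiagram 𝔖 → Hhat 𝔖
  | 0 => fun _ => 0
  | N + 1 => fun τ => if τ.deg ≤ 0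
      then -properSum (MvPolynomial.aeval (antipodeValue N)) (toHhat 𝔖) τ else 0

lemma antipodeValue_of_deg_pos (N : ℕ) {τ : VacDiagram 𝔖} (h : 0 < τ.deg) :
    antipodeValue 𝔖 N τ = 0 := by
  cases N with
  | zero => rfl
  | succ N => exact if_neg h.not_ge

/-- By induction, the character `antipodeValue 𝔖 N` satisfies the relations and vanishes on diagrams
of positive degree, so that `properSum_invariant` applies to it. -/
lemma antipodeValue_invariant (N : ℕ) : VacInvariant (antipodeValue 𝔖 N) := by
  induction N with
  | zero =>
    refine ⟨fun _ _ _ _ _ => rfl, fun τ v i => ?_, fun τ v => ?_⟩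
    · simp [antipodeValue]
    · exact (esum_zero fun j _ => smul_zero _).symm
  | succ N ih =>
    refine VacInvariant.truncate (VacInvariant.neg (properSum_invariant
      (fun x hx => ih.aeval_eq_zero hx) (fun τ hτ => ?_) toHhat_rel))
    rw [MvPolynomial.aeval_X, antipodeValue_of_deg_pos N hτ]

/-- The value on a diagram does not depend on `N` once `N` is at least its number of edges, since
proper subgraphs have fewer edges. -/
lemma antipodeValue_stable (n : ℕ) : ∀ (N M : ℕ) (τ : VacDiagram 𝔖), Fintype.card τ.E ≤ n →
    n ≤ N → n ≤ M → antipodeValue 𝔖 N τ = antipodeValue 𝔖 M τ := by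
  induction n with
  | zero =>
    intro N M τ h
    exact absurd (Fintype.card_pos (α := τ.E)) (by omega)
  | succ n ih =>
    intro N M τ h hN hM
    obtain ⟨N, rfl⟩ := Nat.exists_eq_add_of_le' hN
    obtain ⟨M, rfl⟩ := Nat.exists_eq_add_of_le' hM
    show (if _ then _ else _) = (if _ then _ else _)
    congr 2
    refine properSum_congr fun τ' hτ' => ?_
    rw [MvPolynomial.aeval_X, MvPolynomial.aeval_X]
    exact ih _ _ τ' (by omega) (Nat.le_add_left n N) (Nat.le_add_left n M)

variable (𝔖) in
/-- The twisted antipode, as a character of the free algebra. -/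
def antipodeChar : That 𝔖 →ₐ[ℝ] Hhat 𝔖 :=
  MvPolynomial.aeval fun τ => antipodeValue 𝔖 (Fintype.card τ.E) τ

/-- All relations are relations between diagrams with the same number of edges. -/
lemma antipodeChar_rel {x : That 𝔖} (hx : IsRelVac 𝔖 x) : antipodeChar 𝔖 x = 0 := by
  refine VacInvariant.aeval_eq_zero ⟨fun τ τ' φ hr hn => ?_, fun τ v i => ?_, fun τ v => ?_⟩ hx
  · rw [Fintype.card_congr φ.onE]
    exact (antipodeValue_invariant _).iso τ τ' φ hr hn
  · exact (antipodeValue_invariant (Fintype.card τ.E)).ibp τ v i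
  · exact (antipodeValue_invariant (Fintype.card τ.E)).move τ v

lemma antipodeChar_deg {τ : VacDiagram 𝔖} (h : 0 < τ.deg) : antipodeChar 𝔖 τ.toThat = 0 :=
  (MvPolynomial.aeval_X _ _).trans (antipodeValue_of_deg_pos _ h)

/-- The recursion for the twisted antipode. -/
lemma antipodeChar_eq {τ : VacDiagram 𝔖} (h : τ.deg ≤ 0) :
    antipodeChar 𝔖 τ.toThat = -properSum (antipodeChar 𝔖) (toHhat 𝔖) τ := by
  obtain ⟨N, hN⟩ := Nat.exists_eq_succ_of_ne_zero (Fintype.card_pos (α := τ.E)).ne'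
  refine (MvPolynomial.aeval_X _ _).trans ?_
  rw [hN]
  refine (if_pos h).trans (congrArg Neg.neg (properSum_congr fun τ' hτ' => ?_))
  rw [antipodeChar, MvPolynomial.aeval_X, MvPolynomial.aeval_X]
  exact antipodeValue_stable _ _ _ τ' le_rfl (by omega) le_rfl

/-- The recursively defined character descends to `H_-`. By the recursion, the contribution of the
full graph cancels that of all proper subgraphs. -/
lemma exists_twistedAntipode : ∃ A : Hminus 𝔖 →ₐ[ℝ] Hhat 𝔖, IsTwistedAntipode A := by
  have hle : dThat 𝔖 ⊔ Jplus 𝔖 ≤ RingHom.ker (antipodeChar 𝔖) := by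
    refine sup_le (Ideal.span_le.2 fun x hx => antipodeChar_rel hx) (Ideal.span_le.2 ?_)
    rintro _ ⟨τ, hτ, rfl⟩
    exact antipodeChar_deg hτ
  refine ⟨Ideal.Quotient.liftₐ _ (antipodeChar 𝔖) fun x hx => hle hx, fun τ hτ => ?_⟩
  rw [coproduct_eq]
  have hA : (Ideal.Quotient.liftₐ _ (antipodeChar 𝔖) fun x hx => hle hx).comp (toHminus 𝔖)
      = antipodeChar 𝔖 := Ideal.Quotient.liftₐ_comp _ _ _
  rw [hA, sum_term (fun x hx => antipodeChar_rel hx) toHhat_rel, antipodeChar_eq hτ, add_neg_cancel]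

lemma comp_toHminus_rel (A : Hminus 𝔖 →ₐ[ℝ] Hhat 𝔖) (x : That 𝔖) (hx : IsRelVac 𝔖 x) :
    A.comp (toHminus 𝔖) x = 0 := by
  rw [AlgHom.comp_apply, toHminus_rel x hx, map_zero]

lemma comp_toHminus_deg (A : Hminus 𝔖 →ₐ[ℝ] Hhat 𝔖) (τ : VacDiagram 𝔖) (hτ : 0 < τ.deg) :
    A.comp (toHminus 𝔖) τ.toThat = 0 := by
  rw [AlgHom.comp_apply, toHminus_deg τ hτ, map_zero]

lemma IsTwistedAntipode.sum_term_eq_zero {A : Hminus 𝔖 →ₐ[ℝ] Hhat 𝔖} (hA : IsTwistedAntipode A)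
    {τ : VacDiagram 𝔖} (h : τ.deg ≤ 0) :
    ∑ S, τ.term (A.comp (toHminus 𝔖)) (toHhat 𝔖) S = 0 := by
  rw [← coproduct_eq, hA τ h]

/-- The contribution of the full graph to the defining identity is the value of the antipode itself,
and all other contributions are determined by diagrams with fewer edges. -/
lemma IsTwistedAntipode.unique {A A' : Hminus 𝔖 →ₐ[ℝ] Hhat 𝔖} (hA : IsTwistedAntipode A)
    (hA' : IsTwistedAntipode A') : A = A' := by
  refine Ideal.Quotient.algHom_ext _ (MvPolynomial.algHom_ext fun τ => ?_)
  suffices H : ∀ (n : ℕ) (τ : VacDiagram 𝔖), Fintype.card τ.E ≤ n →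
      A.comp (toHminus 𝔖) τ.toThat = A'.comp (toHminus 𝔖) τ.toThat from H _ τ le_rfl
  intro n
  induction n with
  | zero =>
    intro τ h
    exact absurd (Fintype.card_pos (α := τ.E)) (by omega)
  | succ n ih =>
    intro τ h
    rcases le_or_gt τ.deg 0 with hd | hd
    · have h1 := hA.sum_term_eq_zero hd
      have h2 := hA'.sum_term_eq_zero hd
      rw [sum_term (comp_toHminus_rel A) toHhat_rel] at h1
      rw [sum_term (comp_toHminus_rel A') toHhat_rel,
        ← properSum_congr fun τ' hτ' => ih τ' (by omega)] at h2
      exact add_left_cancel (h1.trans h2.symm)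
    · rw [comp_toHminus_deg A τ hd, comp_toHminus_deg A' τ hd]

end Antipode


/-! ### Extraction of vertex-disjoint subgraphs -/

lemma esum_union {α : Type*} {M : Type*} [Fintype α] [AddCommMonoid M] {I J : Set α}
    (hIJ : Disjoint I J) {f : (α → MultiIndex d) → M} (hf : Bounded (I ∪ J) f) :
    esum (I ∪ J) f = esum I fun y => esum J fun z => f (y + z) := by
  refine esum_prod (fun y z => y + z) (fun x => I.indicator x) (fun x => J.indicator x)
    (fun y hy z hz => ⟨fun a ha => ?_, funext fun a => ?_, funext fun a => ?_⟩)
    (fun x hx => ⟨fun a ha => Set.indicator_of_notMem ha _,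
      fun a ha => Set.indicator_of_notMem ha _, funext fun a => ?_⟩) hf
  · rw [Pi.add_apply, hy a fun h => ha (Or.inl h), hz a fun h => ha (Or.inr h), add_zero]
  · by_cases ha : a ∈ I
    · rw [Set.indicator_of_mem ha, Pi.add_apply, hz a (Set.disjoint_left.1 hIJ ha), add_zero]
    · rw [Set.indicator_of_notMem ha, hy a ha]
  · by_cases ha : a ∈ J
    · rw [Set.indicator_of_mem ha, Pi.add_apply, hy a (Set.disjoint_right.1 hIJ ha), zero_add]
    · rw [Set.indicator_of_notMem ha, hz a ha]
  · rw [Pi.add_apply]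
    by_cases ha : a ∈ I
    · rw [Set.indicator_of_mem ha, Set.indicator_of_notMem (Set.disjoint_left.1 hIJ ha), add_zero]
    · rw [Set.indicator_of_notMem ha, zero_add]
      by_cases ha' : a ∈ J
      · rw [Set.indicator_of_mem ha']
      · rw [Set.indicator_of_notMem ha', hx a fun h => h.elim ha ha']

lemma prod_add_of_disjoint {α R : Type*} [Fintype α] [CommMonoid R] {I J : Set α}
    (hIJ : Disjoint I J) {y z : α → MultiIndex d} (hy : y ∈ Supp d I) (hz : z ∈ Supp d J)
    (F : α → MultiIndex d → R) (hF : ∀ a, F a 0 = 1) :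
    ∏ a, F a ((y + z) a) = (∏ a, F a (y a)) * ∏ a, F a (z a) := by
  rw [← Finset.prod_mul_distrib]
  refine Finset.prod_congr rfl fun a _ => ?_
  rw [Pi.add_apply]
  by_cases ha : a ∈ I
  · rw [hz a (Set.disjoint_left.1 hIJ ha), add_zero, hF, mul_one]
  · rw [hy a ha, zero_add, hF, one_mul]

lemma invFact_add_of_disjoint {α : Type*} [Fintype α] {I J : Set α} (hIJ : Disjoint I J)
    {y z : α → MultiIndex d} (hy : y ∈ Supp d I) (hz : z ∈ Supp d J) :
    invFact (y + z) = invFact y * invFact z := by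
  unfold invFact
  rw [← mul_inv]
  congr 1
  exact prod_add_of_disjoint hIJ hy hz (fun _ k => ∏ i, ((k i).factorial : ℝ)) (by simp)

section Union

variable {𝔖 : LabelSystem d 𝔏} {V E : Type} {k : ℕ} [Fintype V] [Fintype E]
  {G : LGraph 𝔖 V E k} {S₁ S₂ : Finset E}

lemma slotCoeff_add_of_disjoint {I J : Set (HalfEdge E k ⊕ V)} (hIJ : Disjoint I J)
    {y z : HalfEdge E k ⊕ V → MultiIndex d} (hy : y ∈ Supp d I) (hz : z ∈ Supp d J)
    (n : V → MultiIndex d) : slotCoeff n (y + z) = slotCoeff n y * slotCoeff n z := by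
  have h1 : ∏ v, ∏ i, ((n v i).descFactorial ((y + z) (Sum.inr v) i) : ℝ)
      = (∏ v, ∏ i, ((n v i).descFactorial (y (Sum.inr v) i) : ℝ))
        * ∏ v, ∏ i, ((n v i).descFactorial (z (Sum.inr v) i) : ℝ) :=
    prod_add_of_disjoint (I := Sum.inr ⁻¹' I) (J := Sum.inr ⁻¹' J)
      (Disjoint.preimage _ hIJ) (y := vertPart y) (z := vertPart z)
      (fun a ha => hy _ ha) (fun a ha => hz _ ha)
      (fun v k => ∏ i, ((n v i).descFactorial (k i) : ℝ)) (by simp)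
  have h2 : outOrder (halfPart (y + z)) = outOrder (halfPart y) + outOrder (halfPart z) := by
    unfold outOrder
    rw [← Finset.sum_add_distrib]
    exact Finset.sum_congr rfl fun e _ => order_add _ _
  unfold slotCoeff
  rw [h1, h2, pow_add]
  ring

namespace LGraph

lemma verts_union : G.verts (S₁ ∪ S₂) = G.verts S₁ ∪ G.verts S₂ := by
  ext v
  simp only [mem_verts, Finset.mem_union, or_and_right, exists_or]

lemma disjoint_of_disjoint_verts (h : Disjoint (G.verts S₁) (G.verts S₂)) : Disjoint S₁ S₂ :=
  Finset.disjoint_left.2 fun _ he he' =>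
    Finset.disjoint_left.1 h (G.src_mem he) (G.src_mem he')

lemma slots_union (h : Disjoint (G.verts S₁) (G.verts S₂)) :
    G.slots (S₁ ∪ S₂) = G.slots S₁ ∪ G.slots S₂ ∧ Disjoint (G.slots S₁) (G.slots S₂) := by
  have hv : ∀ v, v ∈ G.verts S₁ → v ∉ G.verts S₂ := fun _ hv => Finset.disjoint_left.1 h hv
  constructor
  · ext x
    rcases x with x | v
    · show x ∈ G.boundary (S₁ ∪ S₂) ↔ x ∈ G.boundary S₁ ∨ x ∈ G.boundary S₂
      rw [mem_boundary, mem_boundary, mem_boundary, verts_union, Finset.mem_union]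
      have h1 : InHalf (S₁ ∪ S₂) x ↔ InHalf S₁ x ∨ InHalf S₂ x := by
        unfold InHalf
        simp only [Finset.mem_union, or_and_right, exists_or]
      have h2 : InHalf S₁ x → G.vert x ∈ G.verts S₁ := vert_mem_of_inHalf
      have h3 : InHalf S₂ x → G.vert x ∈ G.verts S₂ := vert_mem_of_inHalf
      have h4 := hv (G.vert x)
      tauto
    · show v ∈ G.verts (S₁ ∪ S₂) ↔ v ∈ G.verts S₁ ∨ v ∈ G.verts S₂
      rw [verts_union, Finset.mem_union]
  · refine Set.disjoint_left.2 fun x hx hx' => hv _ (slotVert_mem hx) (slotVert_mem hx')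

lemma conn_union (h : Disjoint (G.verts S₁) (G.verts S₂)) {v w : V} (hv : v ∈ G.verts S₁) :
    G.conn (S₁ ∪ S₂) v w ↔ G.conn S₁ v w := by
  refine ⟨fun hvw => ?_, G.conn_mono Finset.subset_union_left⟩
  suffices (v ∈ G.verts S₁ ↔ w ∈ G.verts S₁) ∧ (v ∈ G.verts S₁ → G.conn S₁ v w) from this.2 hv
  clear hv
  induction hvw with
  | rel x y h' =>
    obtain ⟨e, he, rfl, rfl⟩ := h'
    rcases Finset.mem_union.1 he with he | he
    · exact ⟨iff_of_true (G.src_mem he) (G.tgt_mem he), fun _ => G.conn_edge he⟩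
    · exact ⟨iff_of_false (Finset.disjoint_right.1 h (G.src_mem he))
        (Finset.disjoint_right.1 h (G.tgt_mem he)),
        fun h' => absurd h' (Finset.disjoint_right.1 h (G.src_mem he))⟩
  | refl x => exact ⟨Iff.rfl, fun _ => (G.conn _).refl x⟩
  | symm x y _ ih => exact ⟨ih.1.symm, fun h => (G.conn _).symm (ih.2 (ih.1.2 h))⟩
  | trans x y z _ _ ih ih' =>
    exact ⟨ih.1.trans ih'.1, fun h => (G.conn _).trans (ih.2 h) (ih'.2 (ih.1.1 h))⟩

lemma comp_union (h : Disjoint (G.verts S₁) (G.verts S₂)) {v : V} (hv : v ∈ G.verts S₁) :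
    G.comp (S₁ ∪ S₂) v = G.comp S₁ v := by
  ext e
  rw [mem_comp, mem_comp, conn_union h hv, Finset.mem_union]
  refine ⟨fun ⟨he, hc⟩ => ⟨he.resolve_right fun he => ?_, hc⟩, fun ⟨he, hc⟩ => ⟨Or.inl he, hc⟩⟩
  refine Finset.disjoint_right.1 h (G.src_mem he) ?_
  by_cases hvw : v = G.src e
  · exact hvw ▸ hv
  · exact (G.mem_verts_of_conn hc hvw).2

lemma comps_union (h : Disjoint (G.verts S₁) (G.verts S₂)) :
    G.comps (S₁ ∪ S₂) = G.comps S₁ ∪ G.comps S₂ := by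
  unfold comps
  rw [Finset.image_union]
  congr 1
  · exact Finset.image_congr fun e he => comp_union h (G.src_mem he)
  · refine Finset.image_congr fun e he => ?_
    rw [Finset.union_comm, comp_union h.symm (G.src_mem he)]

lemma comps_disjoint_of_verts (h : Disjoint (G.verts S₁) (G.verts S₂)) :
    Disjoint (G.comps S₁) (G.comps S₂) := by
  refine Finset.disjoint_left.2 fun c hc hc' => ?_
  obtain ⟨v, hv⟩ := verts_nonempty_of_mem_comps hc
  exact Finset.disjoint_left.1 h (verts_comps_subset hc hv) (verts_comps_subset hc' hv)

lemma rootChoice_union_iff (h : Disjoint (G.verts S₁) (G.verts S₂)) {σ : Finset E → V} :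
    RootChoice G (S₁ ∪ S₂) σ ↔ RootChoice G S₁ σ ∧ RootChoice G S₂ σ := by
  unfold RootChoice
  rw [comps_union h]
  simp only [Finset.mem_union, or_imp, forall_and]

end LGraph

variable {B : Type*} [CommRing B] [Algebra ℝ B] {χ : That 𝔖 →ₐ[ℝ] B}

lemma leftPart_union (h : Disjoint (G.verts S₁) (G.verts S₂)) (σ : Finset E → V)
    (a : V → MultiIndex d) :
    leftPart χ G (S₁ ∪ S₂) σ a = leftPart χ G S₁ σ a * leftPart χ G S₂ σ a := by
  unfold leftPart
  rw [comps_union h, Finset.prod_union (comps_disjoint_of_verts h)]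

lemma leftPart_congr_dec {S : Finset E} {σ : Finset E → V} (hσ : RootChoice G S σ)
    {a a' : V → MultiIndex d} (h : ∀ v ∈ G.verts S, a v = a' v) :
    leftPart χ G S σ a = leftPart χ G S σ a' :=
  Finset.prod_congr rfl fun c hc => by
    rw [vac_congr_dec (hσ c hc) fun v hv => h v (verts_comps_subset hc hv)]

lemma fib_eq_zero {S : Finset E} {y : HalfEdge E k ⊕ V → MultiIndex d}
    (hy : y ∈ Supp d (G.slots S)) {v : V} (hv : v ∉ G.verts S) : fib G.slotVert y v = 0 :=
  Finset.sum_eq_zero fun x hx => hy x fun h => hv (by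
    rw [← (Finset.mem_filter.1 hx).2]
    exact slotVert_mem h)

variable {M : Type*} [AddCommGroup M] [Module ℝ M] [Module B M] [IsScalarTower ℝ B M]

lemma smul_smul_smul_shuffle (a b c e : ℝ) (x x' : B) (m : M) :
    (a * b) • (c * e) • (x * x') • m = b • e • x' • (a • c • x) • m := by
  have key : ∀ (r : ℝ) (m : M), r • m = algebraMap ℝ B r • m := fun r m =>
    (algebraMap_smul B r m).symm
  simp only [key, smul_smul, Algebra.smul_def, map_mul]
  congr 1
  ring

lemma extraction_const_smul {S : Finset E} {F : (V → MultiIndex d) → B} (hF : Truncated G S F)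
    (x : B) (g : (HalfEdge E k → MultiIndex d) → (V → MultiIndex d) → M) (n : V → MultiIndex d) :
    extraction G S F (fun l b => x • g l b) n = x • extraction G S F g n := by
  refine Eq.trans (esum_congr fun y _ => ?_)
    (esum_map (DistribSMul.toAddMonoidHom M x) (hF.bounded _ _ _)).symm
  show _ = x • (invFact y • slotCoeff n y • F (fib G.slotVert y) •
    g (halfPart y) (n - vertPart y))
  rw [smul_comm x, smul_comm x, smul_comm x]

/-- Extraction of two vertex-disjoint subgraphs, one after the other. -/
lemma extraction_union (h : Disjoint (G.verts S₁) (G.verts S₂)) {σ : Finset E → V}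
    (hJ : ∀ τ : VacDiagram 𝔖, 0 < τ.deg → χ τ.toThat = 0) (hσ : RootChoice G (S₁ ∪ S₂) σ)
    (g : (HalfEdge E k → MultiIndex d) → (V → MultiIndex d) → M) (n : V → MultiIndex d) :
    extraction G (S₁ ∪ S₂) (leftPart χ G (S₁ ∪ S₂) σ) g n
      = esum (G.slots S₁) fun y => invFact y • slotCoeff n y •
        leftPart χ G S₁ σ (fib G.slotVert y) • extraction G S₂ (leftPart χ G S₂ σ)
          (fun l b => g (halfPart y + l) (b - vertPart y)) n := by
  obtain ⟨hu, hd⟩ := slots_union h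
  obtain ⟨hσ₁, hσ₂⟩ := (rootChoice_union_iff h).1 hσ
  have hT := (leftPart_truncated (χ := χ) hJ hσ).bounded invFact (slotCoeff n)
    fun y => g (halfPart y) (n - vertPart y)
  rw [hu] at hT
  rw [extraction, hu, esum_union hd hT]
  refine esum_congr fun y hy => ?_
  have h1 : ∀ (c c' : ℝ) (x : B) (m : M), c • c' • x • m = (c • c' • x) • m := fun c c' x m => by
    simp only [smul_assoc]
  rw [h1, ← extraction_const_smul (leftPart_truncated hJ hσ₂)]
  refine esum_congr fun z hz => ?_
  have h2 : ∀ v ∈ G.verts S₁, fib G.slotVert (y + z) v = fib G.slotVert y v := fun v hv => by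
    rw [fib_add, Pi.add_apply, fib_eq_zero hz (Finset.disjoint_left.1 h hv), add_zero]
  have h3 : ∀ v ∈ G.verts S₂, fib G.slotVert (y + z) v = fib G.slotVert z v := fun v hv => by
    rw [fib_add, Pi.add_apply, fib_eq_zero hy (Finset.disjoint_right.1 h hv), zero_add]
  rw [invFact_add_of_disjoint hd hy hz, slotCoeff_add_of_disjoint hd hy hz, leftPart_union h,
    leftPart_congr_dec hσ₁ h2, leftPart_congr_dec hσ₂ h3]
  have h4 : halfPart (y + z) = halfPart y + halfPart z := rfl
  have h5 : n - vertPart (y + z) = n - vertPart z - vertPart y := by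
    rw [tsub_tsub, add_comm]
    rfl
  rw [h4, h5]
  exact smul_smul_smul_shuffle (B := B) (M := M) _ _ _ _ _ _ _

/-- If the value of the quotient factorizes, then so does the extraction of a vertex-disjoint
union. -/
lemma extraction_mul (h : Disjoint (G.verts S₁) (G.verts S₂)) {σ : Finset E → V}
    (hJ : ∀ τ : VacDiagram 𝔖, 0 < τ.deg → χ τ.toThat = 0) (hσ : RootChoice G (S₁ ∪ S₂) σ)
    {g g₂ : (HalfEdge E k → MultiIndex d) → (V → MultiIndex d) → M}
    {g₁ : (HalfEdge E k → MultiIndex d) → (V → MultiIndex d) → B} {n : V → MultiIndex d}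
    (hg : ∀ y ∈ Supp d (G.slots S₁), ∀ z ∈ Supp d (G.slots S₂),
      g (halfPart y + halfPart z) (n - vertPart z - vertPart y)
        = g₁ (halfPart y) (n - vertPart y) • g₂ (halfPart z) (n - vertPart z)) :
    extraction G (S₁ ∪ S₂) (leftPart χ G (S₁ ∪ S₂) σ) g n
      = extraction G S₁ (leftPart χ G S₁ σ) g₁ n • extraction G S₂ (leftPart χ G S₂ σ) g₂ n := by
  obtain ⟨hσ₁, hσ₂⟩ := (rootChoice_union_iff h).1 hσ
  rw [extraction_union h hJ hσ]
  refine Eq.trans (esum_congr fun y hy => ?_) (esum_map ((smulAddHom B M).flip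
    (extraction G S₂ (leftPart χ G S₂ σ) g₂ n))
    ((leftPart_truncated hJ hσ₁).bounded invFact (slotCoeff n) _)).symm
  show _ = (invFact y • slotCoeff n y • leftPart χ G S₁ σ (fib G.slotVert y)
    • g₁ (halfPart y) (n - vertPart y)) • extraction G S₂ (leftPart χ G S₂ σ) g₂ n
  simp only [smul_assoc]
  rw [← extraction_const_smul (leftPart_truncated hJ hσ₂) (g₁ (halfPart y) (n - vertPart y))]
  refine congrArg (fun m : M => invFact y • slotCoeff n y •
    leftPart χ G S₁ σ (fib G.slotVert y) • m) ?_
  exact extraction_congr (fun _ _ => rfl) fun z hz => hg y hy z hz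

end Union


/-! ### Splitting off a connected subgraph -/

namespace LGraph

variable {𝔖 : LabelSystem d 𝔏} {V E V' E' : Type} {k k' : ℕ} [Fintype V] [Fintype E]
  [Fintype V'] [Fintype E']

namespace EdgeEmb

variable {G : LGraph 𝔖 V E k} {G' : LGraph 𝔖 V' E' k} {φ : E → E'} {f : V → V'}

lemma conn_univ_iff (H : EdgeEmb G G' φ f) (v w : V) :
    G.conn Finset.univ v w ↔ G'.conn Finset.univ (f v) (f w) := by
  refine ⟨fun h => G'.conn_mono (Finset.subset_univ _) ((H.conn_iff _ v w).1 h), fun h => ?_⟩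
  by_cases hvw : f v = f w
  · rw [H.injV hvw]
  · obtain ⟨e', -, b, hb⟩ := mem_verts.1 (G'.mem_verts_of_conn h hvw).2
    obtain ⟨e, rfl⟩ := H.cov e' b w hb
    have hw : G.vert (Sum.inl (e, b)) = w := H.injV (by rw [← H.vert, hb])
    have he : φ e ∈ G'.comp Finset.univ (f v) := mem_comp.2 ⟨Finset.mem_univ _,
      (G'.conn _).trans h ((G'.conn _).symm (hb ▸ G'.conn_vert_univ (φ e) b))⟩
    rw [H.comp_univ, Finset.mem_image] at he
    obtain ⟨e₁, he₁, h₁⟩ := he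
    rw [H.injE h₁, mem_comp] at he₁
    exact (G.conn _).trans he₁.2 (hw ▸ G.conn_vert_univ e b)

/-- If the legs are preserved, then so is the part of the graph with legs. -/
lemma legDiagram_eq (H : EdgeEmb G G' φ f) (hleg : ∀ j, G'.leg j = f (G.leg j))
    (hlab : ∀ j, G'.legLab j = G.legLab j) : G.legDiagram.toH = G'.legDiagram.toH := by
  have hs : ∀ e, G'.src (φ e) = f (G.src e) := fun e => H.vert e false
  have hE : ∀ e, G.LegEdge e ↔ G'.LegEdge (φ e) := fun e => by
    refine exists_congr fun j => ?_
    rw [hs, hleg, ← H.conn_univ_iff]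
  have hvert : ∀ h, G'.vert (Sum.map (Prod.map φ id) id h) = f (G.vert h) := by
    rintro (⟨e, b⟩ | j)
    · exact H.vert e b
    · exact hleg j
  refine legDiagram_congr φ (fun e => (hE e).1) (fun e' he' => ?_) (fun e e' _ _ h => H.injE h)
    (fun h h' _ _ => by rw [hvert, hvert, H.injV.eq_iff]) (fun e _ => H.lab e) hlab
  obtain ⟨j, hj⟩ := he'
  rw [hleg] at hj
  obtain ⟨v, hv⟩ := (H.mem_range_of_conn hj).2 ⟨_, rfl⟩
  obtain ⟨e, rfl⟩ := H.cov e' false v hv.symm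
  exact ⟨e, (hE e).2 ⟨j, by rwa [hleg]⟩, rfl⟩

end EdgeEmb

namespace SubIso

variable {G : LGraph 𝔖 V E k} {G' : LGraph 𝔖 V' E' k'} {φ : E → E'} {S : Finset E}
    {S' : Finset E'}

lemma comps_image (h : SubIso G G' φ S S') : G'.comps S' = (G.comps S).image (Finset.image φ) := by
  unfold comps
  rw [← h.image_eq, Finset.image_image, Finset.image_image]
  refine Finset.image_congr fun e he => ?_
  show G'.comp (S.image φ) (G'.src (φ e)) = (G.comp S (G.src e)).image φ
  have hs : ∀ e' ∈ S, G'.conn (S.image φ) (G'.src (φ e)) (G'.src (φ e'))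
      ↔ G.conn S (G.src e) (G.src e') := fun e' he' => by
    rw [h.image_eq]
    exact (h.conn_iff he he' false false).symm
  ext e'
  rw [mem_comp, Finset.mem_image, Finset.mem_image]
  constructor
  · rintro ⟨⟨e₁, he₁, rfl⟩, h1⟩
    exact ⟨e₁, mem_comp.2 ⟨he₁, (hs e₁ he₁).1 h1⟩, rfl⟩
  · rintro ⟨e₁, he₁, rfl⟩
    rw [mem_comp] at he₁
    exact ⟨⟨e₁, he₁.1, rfl⟩, (hs e₁ he₁.1).2 he₁.2⟩

/-- The degree is invariant under isomorphisms of decorated subgraphs. -/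
lemma subDeg_eq (h : SubIso G G' φ S S') {n : V → MultiIndex d} {n' : V' → MultiIndex d}
    (hn : ∀ e ∈ S, ∀ b, n' (G'.vert (Sum.inl (φ e, b))) = n (G.vert (Sum.inl (e, b)))) :
    G'.subDeg S' n' = G.subDeg S n := by
  obtain ⟨f, hf⟩ := h.exists_verts_equiv
  have h1 : ∀ v : {v // v ∈ G.verts S}, n' (f v).1 = n v.1 := by
    rintro ⟨v, hv⟩
    obtain ⟨e, he, b, rfl⟩ := mem_verts.1 hv
    rw [hf e he b]
    exact hn e he b
  unfold subDeg
  congr 1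
  · congr 1
    · rw [← h.image_eq, Finset.sum_image fun e he e' he' hee => h.inj e he e' he' hee]
      exact Finset.sum_congr rfl fun e he => by rw [h.lab e he]
    · rw [← Finset.sum_coe_sort (G.verts S) fun v => (order (n v) : ℝ),
        ← Finset.sum_coe_sort (G'.verts S') fun v => (order (n' v) : ℝ)]
      exact (Fintype.sum_equiv f _ _ fun v => by rw [h1]).symm
  · rw [← Fintype.card_coe, ← Fintype.card_coe, Fintype.card_congr f]

variable {B : Type*} [CommRing B] [Algebra ℝ B] {χ : That 𝔖 →ₐ[ℝ] B}

lemma leftPart_eq (hχ : ∀ x, IsRelVac 𝔖 x → χ x = 0) (h : SubIso G G' φ S S')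
    {σ : Finset E → V} {σ' : Finset E' → V'} {n : V → MultiIndex d} {n' : V' → MultiIndex d}
    (hn : ∀ e ∈ S, ∀ b, n' (G'.vert (Sum.inl (φ e, b))) = n (G.vert (Sum.inl (e, b))))
    (hσ : RootChoice G S σ) (hσ' : ∀ c ∈ G.comps S, ∀ e ∈ c, ∀ b,
      G.vert (Sum.inl (e, b)) = σ c ↔ G'.vert (Sum.inl (φ e, b)) = σ' (c.image φ)) :
    leftPart χ G' S' σ' n' = leftPart χ G S σ n := by
  unfold leftPart
  rw [h.comps_image, Finset.prod_image]
  · refine Finset.prod_congr rfl fun c hc => Eq.symm ?_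
    have hcS := comps_subset hc
    refine vac_congr hχ (h.mono hcS) (fun e he b => hn e (hcS he) b) (hσ' c hc) ?_
    obtain ⟨e, he, b, hb⟩ := mem_verts.1 (hσ c hc)
    rw [← (hσ' c hc e he b).1 hb, ← hb, hn e (hcS he)]
  · intro c hc c' hc' hcc
    have hsub : ∀ c ∈ G.comps S, ∀ c' ∈ G.comps S, c.image φ = c'.image φ → c ⊆ c' := by
      intro c hc c' hc' hcc e he
      have := Finset.mem_image_of_mem φ he
      rw [hcc] at this
      obtain ⟨e', he', h'⟩ := Finset.mem_image.1 this
      rw [← h.inj e' (comps_subset hc' he') e (comps_subset hc he) h']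
      exact he'
    exact (hsub c hc c' hc' hcc).antisymm (hsub c' hc' c hc hcc.symm)

end SubIso

variable {G : LGraph 𝔖 V E k} {c S : Finset E}

lemma splitOff_vert_of_mem {e : E} (he : e ∈ c) (b : Bool) :
    (G.splitOff c).vert (Sum.inl (e, b)) = Sum.inl ⟨G.vert (Sum.inl (e, b)), G.vert_mem he b⟩ := by
  cases b
  · exact dif_pos he
  · exact dif_pos he

lemma splitOff_vert_of_not {h : HalfEdge E k} (hh : ¬ InHalf c h) :
    (G.splitOff c).vert h = Sum.inr (Quotient.mk _ (G.vert h)) := by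
  rcases h with (⟨e, b⟩ | j)
  · have he : e ∉ c := fun he => hh ⟨e, he, b, rfl⟩
    cases b
    · exact dif_neg he
    · exact dif_neg he
  · rfl

lemma not_inHalf_inl {e : E} {b : Bool} (he : e ∉ c) :
    ¬ InHalf c (Sum.inl (e, b) : HalfEdge E k) := by
  rintro ⟨e', he', b', h⟩
  exact he ((Prod.mk.inj (Sum.inl.inj h)).1 ▸ he')

lemma splitOff_vert_of_notMem {e : E} (he : e ∉ c) (b : Bool) :
    (G.splitOff c).vert (Sum.inl (e, b))
      = Sum.inr (Quotient.mk _ (G.vert (Sum.inl (e, b)))) :=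
  splitOff_vert_of_not (not_inHalf_inl he)

/-- The class modulo paths of edges of `S` of a vertex of the graph where `c` is split off, as a
vertex of the split off copy of `c` or as a vertex of the graph where both `c` and `S` are
contracted. -/
def splitClass (G : LGraph 𝔖 V E k) (c S : Finset E) :
    {v // v ∈ G.verts c} ⊕ Quotient (G.conn c) →
      {v // v ∈ G.verts c} ⊕ Quotient (G.conn (c ∪ S)) :=
  Sum.map id (Quotient.map' id fun _ _ h => G.conn_mono Finset.subset_union_left h)

lemma splitOff_conn_iff (hd : Disjoint c S) (x y : {v // v ∈ G.verts c} ⊕ Quotient (G.conn c)) :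
    (G.splitOff c).conn S x y ↔ G.splitClass c S x = G.splitClass c S y := by
  constructor
  · intro h
    refine (G.splitOff c).conn_le (s := Setoid.ker (G.splitClass c S)) (fun e he => ?_) h
    have hec := Finset.disjoint_right.1 hd he
    have h1 : (G.splitOff c).src e = Sum.inr (Quotient.mk _ (G.src e)) :=
      splitOff_vert_of_notMem hec false
    have h2 : (G.splitOff c).tgt e = Sum.inr (Quotient.mk _ (G.tgt e)) :=
      splitOff_vert_of_notMem hec true
    rw [h1, h2]
    exact congrArg Sum.inr (Quotient.sound (G.conn_edge (Finset.mem_union_right _ he)))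
  · intro h
    rcases x with v | p <;> rcases y with w | q
    · rw [show v = w from Sum.inl.inj h]
    · exact absurd h (by simp [splitClass])
    · exact absurd h (by simp [splitClass])
    · induction p using Quotient.inductionOn with
      | h v =>
        induction q using Quotient.inductionOn with
        | h w =>
          have h' : G.conn (c ∪ S) v w := Quotient.exact (Sum.inr.inj h)
          refine G.conn_map (fun v => Sum.inr (Quotient.mk _ v)) _ (fun e he => ?_) h'
          by_cases hec : e ∈ c
          · rw [show (Quotient.mk (G.conn c) (G.src e)) = Quotient.mk _ (G.tgt e) from
              Quotient.sound (G.conn_edge hec)]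
          · have h1 : (G.splitOff c).src e = Sum.inr (Quotient.mk _ (G.src e)) :=
              splitOff_vert_of_notMem hec false
            have h2 : (G.splitOff c).tgt e = Sum.inr (Quotient.mk _ (G.tgt e)) :=
              splitOff_vert_of_notMem hec true
            rw [← h1, ← h2]
            exact (G.splitOff c).conn_edge ((Finset.mem_union.1 he).resolve_left hec)

lemma splitOff_conn_inr_iff (hd : Disjoint c S) (v w : V) :
    (G.splitOff c).conn S (Sum.inr (Quotient.mk _ v)) (Sum.inr (Quotient.mk _ w))
      ↔ G.conn (c ∪ S) v w := by
  rw [splitOff_conn_iff hd]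
  exact ⟨fun h => Quotient.exact (Sum.inr.inj h), fun h => congrArg Sum.inr (Quotient.sound h)⟩

lemma splitOff_conn_inl_iff (hd : Disjoint c S) (v : {v // v ∈ G.verts c})
    (y : {v // v ∈ G.verts c} ⊕ Quotient (G.conn c)) :
    (G.splitOff c).conn S (Sum.inl v) y ↔ y = Sum.inl v := by
  rw [splitOff_conn_iff hd]
  rcases y with w | q
  · exact ⟨fun h => congrArg Sum.inl (Sum.inl.inj h).symm, fun h => congrArg _ h.symm⟩
  · exact ⟨fun h => absurd h (by simp [splitClass]), fun h => absurd h (by simp)⟩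

/-- The map from the vertices of the graph where `c` and `S` are contracted. -/
def splitQuoMap (G : LGraph 𝔖 V E k) {c S : Finset E} (hd : Disjoint c S) :
    Quotient (G.conn (c ∪ S)) → Quotient ((G.splitOff c).conn S) :=
  Quotient.map' (fun v => Sum.inr (Quotient.mk _ v)) fun v w h =>
    (splitOff_conn_inr_iff hd v w).2 h

/-- Contracting `S` after `c` has been split off amounts to contracting both, up to the additional
component given by `c`. -/
lemma edgeEmb_splitOff (hd : Disjoint c S) :
    EdgeEmb (G.contract (c ∪ S)) ((G.splitOff c).contract S)
      (fun e => ⟨e.1, fun h => e.2 (Finset.mem_union_right _ h)⟩) (G.splitQuoMap hd) where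
  injE e e' h := Subtype.ext (congrArg (fun e : {e // e ∉ S} => e.1) h)
  injV p q h := by
    induction p using Quotient.inductionOn with
    | h v =>
      induction q using Quotient.inductionOn with
      | h w => exact Quotient.sound ((splitOff_conn_inr_iff hd v w).1 (Quotient.exact h))
  vert e b := by
    have hec : e.1 ∉ c := fun h => e.2 (Finset.mem_union_left _ h)
    have h := congrArg (Quotient.mk ((G.splitOff c).conn S)) (splitOff_vert_of_notMem (G := G) hec b)
    cases b
    · exact h
    · exact h
  cov e' b q hq := by
    induction q using Quotient.inductionOn with
    | h v =>
      refine ⟨⟨e'.1, fun h => ?_⟩, rfl⟩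
      have hec := (Finset.mem_union.1 h).resolve_right e'.2
      have h1 : Quotient.mk ((G.splitOff c).conn S) ((G.splitOff c).vert (Sum.inl (e'.1, b)))
          = Quotient.mk _ (Sum.inr (Quotient.mk _ v)) := by
        cases b
        · exact hq
        · exact hq
      rw [splitOff_vert_of_mem hec] at h1
      have := (splitOff_conn_inl_iff hd _ _).1 (Quotient.exact h1)
      simp at this
  lab e := rfl

/-- The subgraph `c` and the subgraphs that are vertex-disjoint from it are unchanged when `c` is
split off. -/
lemma subIso_splitOff (h : Disjoint (G.verts c) (G.verts S)) :
    SubIso G (G.splitOff c) id (c ∪ S) (c ∪ S) where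
  maps _ he := he
  surj e he := ⟨e, he, rfl⟩
  inj _ _ _ _ h := h
  vert e he e' he' b b' := by
    have key : ∀ e ∈ c ∪ S, e ∈ c ∨ (e ∉ c ∧ e ∈ S) := fun e he => by
      by_cases hec : e ∈ c
      · exact Or.inl hec
      · exact Or.inr ⟨hec, (Finset.mem_union.1 he).resolve_left hec⟩
    simp only [id]
    rcases key e he with h1 | ⟨h1, h1'⟩ <;> rcases key e' he' with h2 | ⟨h2, h2'⟩
    · rw [splitOff_vert_of_mem h1, splitOff_vert_of_mem h2, Sum.inl.injEq, Subtype.mk.injEq]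
    · rw [splitOff_vert_of_mem h1, splitOff_vert_of_notMem h2]
      exact iff_of_false (fun hv => Finset.disjoint_left.1 h (G.vert_mem h1 b)
        (hv ▸ G.vert_mem h2' b')) (by simp)
    · rw [splitOff_vert_of_notMem h1, splitOff_vert_of_mem h2]
      exact iff_of_false (fun hv => Finset.disjoint_left.1 h (G.vert_mem h2 b')
        (hv ▸ G.vert_mem h1' b)) (by simp)
    · rw [splitOff_vert_of_notMem h1, splitOff_vert_of_notMem h2, Sum.inr.injEq]
      refine ⟨fun hv => by rw [hv], fun hv => ?_⟩
      by_contra hne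
      exact Finset.disjoint_right.1 h (G.vert_mem h1' b)
        (G.mem_verts_of_conn (Quotient.exact hv) hne).1
  lab e _ := rfl

lemma mk_eq_iff_of_notMem {v w : V} (hw : w ∉ G.verts c) :
    Quotient.mk (G.conn c) v = Quotient.mk _ w ↔ v = w := by
  refine ⟨fun h => ?_, fun h => h ▸ rfl⟩
  by_contra hne
  exact hw (G.mem_verts_of_conn (Quotient.exact h) hne).2

lemma mem_verts_splitOff (hd : Disjoint c S) {x : {v // v ∈ G.verts c} ⊕ Quotient (G.conn c)} :
    x ∈ (G.splitOff c).verts S ↔ ∃ v ∈ G.verts S, Sum.inr (Quotient.mk _ v) = x := by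
  rw [mem_verts]
  constructor
  · rintro ⟨e, he, b, rfl⟩
    rw [splitOff_vert_of_notMem (Finset.disjoint_right.1 hd he)]
    exact ⟨_, G.vert_mem he b, rfl⟩
  · rintro ⟨v, hv, rfl⟩
    obtain ⟨e, he, b, rfl⟩ := mem_verts.1 hv
    exact ⟨e, he, b, splitOff_vert_of_notMem (Finset.disjoint_right.1 hd he) b⟩

lemma mem_boundary_splitOff (h : Disjoint (G.verts c) (G.verts S)) {x : HalfEdge E k} :
    x ∈ (G.splitOff c).boundary S ↔ x ∈ G.boundary S := by
  rw [mem_boundary, mem_boundary, mem_verts_splitOff (disjoint_of_disjoint_verts h)]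
  refine and_congr_right fun _ => ?_
  by_cases hx : InHalf c x
  · refine iff_of_false ?_ (Finset.disjoint_left.1 h (vert_mem_of_inHalf hx))
    obtain ⟨e, he, b, rfl⟩ := hx
    rw [splitOff_vert_of_mem he]
    simp
  · rw [splitOff_vert_of_not hx]
    constructor
    · rintro ⟨v, hv, h'⟩
      rw [Sum.inr.injEq, eq_comm, mk_eq_iff_of_notMem (Finset.disjoint_right.1 h hv)] at h'
      exact h' ▸ hv
    · exact fun hv => ⟨_, hv, rfl⟩

lemma contractDec_apply_of_notMem (b : V → MultiIndex d) {v : V} (hv : v ∉ G.verts c) :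
    G.contractDec c b (Quotient.mk _ v) = b v := by
  unfold contractDec
  rw [Finset.sum_filter, Finset.sum_eq_single v]
  · exact if_pos rfl
  · exact fun w _ hw => if_neg fun h => hw ((mk_eq_iff_of_notMem hv).1 h)
  · simp

/-- Contraction in stages of the decorations. -/
lemma contractDec_splitOff (hd : Disjoint c S) (a : {v // v ∈ G.verts c} → MultiIndex d)
    (b : V → MultiIndex d) :
    (∀ v, (G.splitOff c).contractDec S (Sum.elim a (G.contractDec c b))
      (Quotient.mk _ (Sum.inl v)) = a v) ∧
    ∀ q, (G.splitOff c).contractDec S (Sum.elim a (G.contractDec c b)) (G.splitQuoMap hd q)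
      = G.contractDec (c ∪ S) b q := by
  constructor
  · intro v
    unfold contractDec
    rw [Finset.sum_filter, Finset.sum_eq_single (Sum.inl v)]
    · exact if_pos rfl
    · exact fun w _ hw => if_neg fun h =>
        hw ((splitOff_conn_inl_iff hd v w).1 (((G.splitOff c).conn S).symm (Quotient.exact h)))
    · simp
  · intro q
    induction q using Quotient.inductionOn with
    | h v =>
      have h1 : ∀ w : {v // v ∈ G.verts c}, ¬ (Quotient.mk ((G.splitOff c).conn S) (Sum.inl w)
          = G.splitQuoMap hd (Quotient.mk _ v)) := fun w h => by
        have := (splitOff_conn_inl_iff hd w _).1 (Quotient.exact h)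
        simp at this
      have h2 : ∀ w, Quotient.mk ((G.splitOff c).conn S) (Sum.inr (Quotient.mk _ w))
          = G.splitQuoMap hd (Quotient.mk _ v) ↔ Quotient.mk (G.conn (c ∪ S)) w = Quotient.mk _ v :=
        fun w => ⟨fun h => Quotient.sound ((splitOff_conn_inr_iff hd w v).1 (Quotient.exact h)),
          fun h => congrArg (G.splitQuoMap hd) h⟩
      unfold contractDec
      rw [Finset.sum_filter, Fintype.sum_sum_type, Finset.sum_filter]
      simp only [h1, if_false, Finset.sum_const_zero, zero_add, Sum.elim_inr]
      simp only [Finset.sum_filter]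
      have h3 : ∀ q : Quotient (G.conn c),
          (if Quotient.mk ((G.splitOff c).conn S) (Sum.inr q) = G.splitQuoMap hd (Quotient.mk _ v)
            then ∑ w, (if Quotient.mk (G.conn c) w = q then b w else 0) else 0)
          = ∑ w, if Quotient.mk (G.conn c) w = q then
            (if Quotient.mk ((G.splitOff c).conn S) (Sum.inr q)
              = G.splitQuoMap hd (Quotient.mk _ v) then b w else 0) else 0 := fun q => by
        split_ifs
        · rfl
        · simp
      rw [Finset.sum_congr rfl fun q _ => h3 q, Finset.sum_comm]
      refine Finset.sum_congr rfl fun w _ => ?_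
      rw [Finset.sum_ite_eq, if_pos (Finset.mem_univ _)]
      exact if_congr (h2 w) rfl rfl

end LGraph


namespace LGraph

variable {𝔖 : LabelSystem d 𝔏} {V E : Type} {k : ℕ} [Fintype V] [Fintype E]
variable {G : LGraph 𝔖 V E k} {c S : Finset E}
variable {B M : Type*} [CommRing B] [Algebra ℝ B] [AddCommGroup M] [Module ℝ M] [Module B M]
  [IsScalarTower ℝ B M]

lemma conn_contract_iff {v w : V} :
    (G.contract S).conn Finset.univ (Quotient.mk _ v) (Quotient.mk _ w)
      ↔ G.conn Finset.univ v w := conn_quo_iff (G := G) S 0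

/-- The split off copy of `c` is a component. -/
lemma splitOff_comp_inl (hc : G.IsConn c) (p : {v // v ∈ G.verts c}) :
    (G.splitOff c).comp Finset.univ (Sum.inl p) = c := by
  ext e
  rw [mem_comp]
  constructor
  · rintro ⟨-, h⟩
    by_contra he
    rw [show (G.splitOff c).src e = Sum.inr (Quotient.mk _ (G.src e)) from
      splitOff_vert_of_notMem he false] at h
    have := G.splitOff_reflect h
    simp [compOf] at this
  · intro he
    rw [show (G.splitOff c).src e = Sum.inl ⟨G.src e, G.src_mem he⟩ from
      splitOff_vert_of_mem he false]
    exact ⟨Finset.mem_univ _, G.splitOff_conn_inl hc _ _⟩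

lemma splitOff_conn_univ_inr_iff {v w : V} : (G.splitOff c).conn Finset.univ
    (Sum.inr (Quotient.mk _ v)) (Sum.inr (Quotient.mk _ w)) ↔ G.conn Finset.univ v w :=
  ⟨G.splitOff_reflect_inr, G.splitOff_conn_inr c⟩

/-- The other components lose the edges of `c`. -/
lemma splitOff_comp_inr (r : V) :
    (G.splitOff c).comp Finset.univ (Sum.inr (Quotient.mk _ r)) = G.comp Finset.univ r \ c := by
  ext e
  rw [Finset.mem_sdiff, mem_comp, mem_comp]
  by_cases he : e ∈ c
  · refine iff_of_false (fun h => ?_) fun h => h.2 he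
    rw [show (G.splitOff c).src e = Sum.inl ⟨G.src e, G.src_mem he⟩ from
      splitOff_vert_of_mem he false] at h
    have := G.splitOff_reflect h.2
    simp [compOf] at this
  · rw [show (G.splitOff c).src e = Sum.inr (Quotient.mk _ (G.src e)) from
      splitOff_vert_of_notMem he false, splitOff_conn_univ_inr_iff]
    simp [he]

section Character

variable {χ : That 𝔖 →ₐ[ℝ] B}

/-- The contraction of `S` does not affect the split off copy of `c`. -/
lemma rootVac_splitOff_inl (hχ : ∀ x, IsRelVac 𝔖 x → χ x = 0) (hd : Disjoint c S)
    (hc : G.IsConn c) (p : {v // v ∈ G.verts c}) {m : V → MultiIndex d}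
    {n' : Quotient ((G.splitOff c).conn S) → MultiIndex d}
    (hn : ∀ v : {v // v ∈ G.verts c}, n' (Quotient.mk _ (Sum.inl v)) = m v.1) :
    χ (((G.splitOff c).contract S).rootVac (Quotient.mk _ (Sum.inl p)) n') = χ (G.vac c p.1 m) := by
  have hcomp : ∀ e, e ∈ ((G.splitOff c).contract S).comp Finset.univ (Quotient.mk _ (Sum.inl p))
      ↔ e.1 ∈ c := fun e => by
    have h1 : e.1 ∈ (G.splitOff c).comp Finset.univ (Sum.inl p) ↔ e.1 ∈ c := by
      rw [splitOff_comp_inl hc p]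
    have h2 : ((G.splitOff c).contract S).src e = Quotient.mk _ ((G.splitOff c).src e.1) := rfl
    rw [mem_comp] at h1
    rw [mem_comp, h2, conn_contract_iff]
    simpa using h1
  have hvert : ∀ e : {e // e ∉ S}, ∀ b (he : e.1 ∈ c),
      ((G.splitOff c).contract S).vert (Sum.inl (e, b))
        = Quotient.mk _ (Sum.inl ⟨G.vert (Sum.inl (e.1, b)), G.vert_mem he b⟩) := by
    intro e b he
    have h := congrArg (Quotient.mk ((G.splitOff c).conn S)) (splitOff_vert_of_mem (G := G) he b)
    cases b
    · exact h
    · exact h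
  have hinj : ∀ v w : {v // v ∈ G.verts c}, Quotient.mk ((G.splitOff c).conn S) (Sum.inl v)
      = Quotient.mk _ (Sum.inl w) ↔ v.1 = w.1 := fun v w =>
    ⟨fun h => congrArg Subtype.val (Sum.inl.inj ((splitOff_conn_inl_iff hd _ _).1
      (Quotient.exact h))).symm, fun h => by rw [Subtype.ext h]⟩
  refine vac_congr hχ (φ := Subtype.val)
    ⟨fun e he => (hcomp e).1 he, fun e he => ?_, fun e _ e' _ h => Subtype.ext h,
      fun e he e' he' b b' => ?_, fun e _ => rfl⟩ (fun e he b => ?_) (fun e he b => ?_) ?_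
  · exact ⟨⟨e, Finset.disjoint_left.1 hd he⟩, (hcomp _).2 he, rfl⟩
  · rw [hvert e b ((hcomp e).1 he), hvert e' b' ((hcomp e').1 he'), hinj]
  · rw [hvert e b ((hcomp e).1 he), hn]
  · rw [hvert e b ((hcomp e).1 he), hinj]
  · rw [hn]

/-- The value of the graph where `c` is split off and `S` is contracted. -/
lemma weight_splitOff {L : H 𝔖 →ₗ[ℝ] M} {ψ : V → That 𝔖 →ₐ[ℝ] B}
    {ψ' : {v // v ∈ G.verts c} ⊕ Quotient (G.conn c) → That 𝔖 →ₐ[ℝ] B} {R : Finset V}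
    {p : {v // v ∈ G.verts c}} (hψ : ∀ i x, IsRelVac 𝔖 x → ψ i x = 0)
    (hd : Disjoint c S) (hc : G.IsConn c) (hp : ∀ x, IsRelVac 𝔖 x → ψ' (Sum.inl p) x = 0)
    (hψ' : ∀ r ∈ R, ψ' (Sum.inr (Quotient.mk _ r)) = ψ r)
    (hR : ∀ r ∈ R, ∀ r' ∈ R, G.conn c r r' → r = r') (m b : V → MultiIndex d) :
    weight ψ' L ((G.splitOff c).contract S)
      (insert (Sum.inl p) (R.image fun r => Sum.inr (Quotient.mk _ r))) (fun x => Quotient.mk _ x)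
      ((G.splitOff c).contractDec S (Sum.elim (fun v => m v.1) (G.contractDec c b)))
    = ψ' (Sum.inl p) (G.vac c p.1 m) • weight ψ L (G.contract (c ∪ S)) R
      (fun r => Quotient.mk _ r) (G.contractDec (c ∪ S) b) := by
  have H := edgeEmb_splitOff (G := G) hd
  obtain ⟨h1, h2⟩ := contractDec_splitOff (G := G) hd (fun v => m v.1) b
  unfold weight
  rw [Finset.prod_insert (by simp), mul_smul, ← H.legDiagram_eq (fun _ => rfl) (fun _ => rfl),
    rootVac_splitOff_inl hp hd hc p h1, Finset.prod_image]
  · congr 2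
    refine Finset.prod_congr rfl fun r hr => ?_
    beta_reduce
    rw [hψ' r hr, show Quotient.mk ((G.splitOff c).conn S) (Sum.inr (Quotient.mk _ r))
      = G.splitQuoMap hd (Quotient.mk _ r) from rfl, ← H.rootVac_eq (hψ r)]
    simp only [h2]
  · exact fun r hr r' hr' h => hR r hr r' hr' (Quotient.exact (Sum.inr.inj h))

end Character

/-! ### Extraction after splitting off -/

lemma contractDec_sub_of_disjoint (h : Disjoint (G.verts c) (G.verts S)) (b : V → MultiIndex d)
    {z : V → MultiIndex d} (hz : ∀ v, v ∉ G.verts S → z v = 0) :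
    G.contractDec c (b - z) = G.contractDec c b - G.contractDec c z := by
  funext q
  induction q using Quotient.inductionOn with
  | h v =>
    rw [Pi.sub_apply]
    by_cases hv : v ∈ G.verts c
    · have h0 : ∀ w ∈ Finset.univ.filter (fun w => Quotient.mk (G.conn c) w = Quotient.mk _ v),
          z w = 0 := fun w hw => hz w fun hwS => by
        have hwc : w ∈ G.verts c := by
          by_cases hwv : w = v
          · rwa [hwv]
          · exact (G.mem_verts_of_conn (Quotient.exact (Finset.mem_filter.1 hw).2) hwv).1
        exact Finset.disjoint_left.1 h hwc hwS
      unfold contractDec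
      rw [Finset.sum_eq_zero h0, tsub_zero]
      exact Finset.sum_congr rfl fun w hw => by rw [Pi.sub_apply, h0 w hw, tsub_zero]
    · rw [contractDec_apply_of_notMem _ hv, contractDec_apply_of_notMem _ hv,
        contractDec_apply_of_notMem _ hv, Pi.sub_apply]

/-- Directions of extraction of `S` in the graph where `c` is split off. -/
def splitSlots (G : LGraph 𝔖 V E k) (c : Finset E) (z : HalfEdge E k ⊕ V → MultiIndex d) :
    HalfEdge E k ⊕ ({v // v ∈ G.verts c} ⊕ Quotient (G.conn c)) → MultiIndex d :=
  Sum.elim (halfPart z) (Sum.elim 0 (G.contractDec c (vertPart z)))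

lemma prod_splitOff {N : Type*} [CommMonoid N] (h : Disjoint (G.verts c) (G.verts S))
    {g : {v // v ∈ G.verts c} ⊕ Quotient (G.conn c) → N} {g' : V → N}
    (hg : ∀ x, x ∉ (G.splitOff c).verts S → g x = 1) (hg' : ∀ v, v ∉ G.verts S → g' v = 1)
    (hgg : ∀ v ∈ G.verts S, g (Sum.inr (Quotient.mk _ v)) = g' v) : ∏ x, g x = ∏ v, g' v := by
  have hd := disjoint_of_disjoint_verts h
  rw [← Finset.prod_subset (Finset.subset_univ ((G.splitOff c).verts S)) fun x _ hx => hg x hx,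
    ← Finset.prod_subset (Finset.subset_univ (G.verts S)) fun v _ hv => hg' v hv]
  symm
  refine Finset.prod_bij (fun v _ => Sum.inr (Quotient.mk _ v))
    (fun v hv => (mem_verts_splitOff hd).2 ⟨v, hv, rfl⟩) (fun v _ w hw hvw => ?_)
    (fun x hx => ?_) fun v hv => (hgg v hv).symm
  · exact (mk_eq_iff_of_notMem (Finset.disjoint_right.1 h hw)).1 (Sum.inr.inj hvw)
  · obtain ⟨v, hv, rfl⟩ := (mem_verts_splitOff hd).1 hx
    exact ⟨v, hv, rfl⟩

lemma splitSlots_inr_of_notMem (h : Disjoint (G.verts c) (G.verts S))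
    {z : HalfEdge E k ⊕ V → MultiIndex d} (hz : z ∈ Supp d (G.slots S)) :
    (∀ x, x ∉ (G.splitOff c).verts S → G.splitSlots c z (Sum.inr x) = 0) ∧
    ∀ v ∈ G.verts S, G.splitSlots c z (Sum.inr (Sum.inr (Quotient.mk _ v))) = z (Sum.inr v) := by
  have hd := disjoint_of_disjoint_verts h
  refine ⟨fun x hx => ?_, fun v hv => contractDec_apply_of_notMem _ (Finset.disjoint_right.1 h hv)⟩
  rcases x with v | q
  · rfl
  · refine Finset.sum_eq_zero fun v hv => hz _ fun hvS => hx ?_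
    exact (mem_verts_splitOff hd).2 ⟨v, hvS, congrArg Sum.inr (Finset.mem_filter.1 hv).2⟩

lemma fib_splitSlots (h : Disjoint (G.verts c) (G.verts S))
    {z : HalfEdge E k ⊕ V → MultiIndex d} (hz : z ∈ Supp d (G.slots S)) {v : V}
    (hv : v ∈ G.verts S) :
    fib (G.splitOff c).slotVert (G.splitSlots c z) (Sum.inr (Quotient.mk _ v))
      = fib G.slotVert z v := by
  rw [fib_slotVert, fib_slotVert, Pi.add_apply, Pi.add_apply]
  have hvc := Finset.disjoint_right.1 h hv
  congr 1
  · exact (splitSlots_inr_of_notMem h hz).2 v hv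
  · unfold push
    rw [Finset.sum_filter, Finset.sum_filter]
    refine Finset.sum_congr rfl fun x _ => ?_
    have key : (G.splitOff c).vert x = Sum.inr (Quotient.mk _ v) ↔ G.vert x = v := ?_
    · simp only [key]
      rfl
    by_cases hx : InHalf c x
    · refine iff_of_false ?_ fun hxv => hvc (hxv ▸ vert_mem_of_inHalf hx)
      obtain ⟨e, he, b, rfl⟩ := hx
      rw [splitOff_vert_of_mem he]
      simp
    · rw [splitOff_vert_of_not hx, Sum.inr.injEq, mk_eq_iff_of_notMem hvc]

/-- If `S` has no vertex in common with `c`, then the half-edges and vertices involved in its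
extraction are the same before and after `c` is split off. -/
lemma extraction_splitOff (h : Disjoint (G.verts c) (G.verts S)) {n b : V → MultiIndex d}
    (hb : ∀ v ∈ G.verts S, b v = n v) (a : {v // v ∈ G.verts c} → MultiIndex d)
    {F' : ({v // v ∈ G.verts c} ⊕ Quotient (G.conn c) → MultiIndex d) → B}
    {F : (V → MultiIndex d) → B}
    {g' : (HalfEdge E k → MultiIndex d) →
      ({v // v ∈ G.verts c} ⊕ Quotient (G.conn c) → MultiIndex d) → M}
    {g : (HalfEdge E k → MultiIndex d) → (V → MultiIndex d) → M}
    (hF : ∀ z ∈ Supp d (G.slots S),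
      F' (fib (G.splitOff c).slotVert (G.splitSlots c z)) = F (fib G.slotVert z))
    (hg : ∀ z ∈ Supp d (G.slots S), g' (halfPart z)
      (Sum.elim a (G.contractDec c (b - vertPart z))) = g (halfPart z) (n - vertPart z)) :
    extraction (G.splitOff c) S F' g' (Sum.elim a (G.contractDec c b)) = extraction G S F g n := by
  have hd := disjoint_of_disjoint_verts h
  symm
  refine esum_bij (G.splitSlots c) (fun y => Sum.elim (halfPart y)
    fun v => y (Sum.inr (Sum.inr (Quotient.mk _ v)))) ?_ ?_ ?_ ?_ ?_
  · rintro z hz (x | x) hx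
    · exact hz _ fun hxS => hx ((mem_boundary_splitOff h).2 hxS)
    · exact (splitSlots_inr_of_notMem h hz).1 x hx
  · rintro y hy (x | v) hx
    · exact hy _ fun hxS => hx ((mem_boundary_splitOff h).1 hxS)
    · refine hy _ fun hv => hx ?_
      obtain ⟨w, hw, hwv⟩ := (mem_verts_splitOff hd).1 hv
      rw [Sum.inr.injEq, eq_comm, mk_eq_iff_of_notMem (Finset.disjoint_right.1 h hw)] at hwv
      exact hwv ▸ hw
  · intro z hz
    funext x
    rcases x with x | v
    · rfl
    · show G.splitSlots c z (Sum.inr (Sum.inr (Quotient.mk _ v))) = z (Sum.inr v)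
      by_cases hv : v ∈ G.verts S
      · exact (splitSlots_inr_of_notMem h hz).2 v hv
      · refine ((splitSlots_inr_of_notMem h hz).1 _ fun hx => hv ?_).trans (hz (Sum.inr v) hv).symm
        obtain ⟨w, hw, hwv⟩ := (mem_verts_splitOff hd).1 hx
        rw [Sum.inr.injEq, eq_comm, mk_eq_iff_of_notMem (Finset.disjoint_right.1 h hw)] at hwv
        exact hwv ▸ hw
  · intro y hy
    have hmem : ∀ v, v ∉ G.verts S → y (Sum.inr (Sum.inr (Quotient.mk _ v))) = 0 := by
      intro v hv
      refine hy _ fun hx => hv ?_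
      obtain ⟨w, hw, hwv⟩ := (mem_verts_splitOff hd).1 hx
      rw [Sum.inr.injEq, eq_comm, mk_eq_iff_of_notMem (Finset.disjoint_right.1 h hw)] at hwv
      exact hwv ▸ hw
    funext x
    rcases x with x | v | q
    · rfl
    · refine (hy _ fun hx => ?_).symm
      obtain ⟨w, hw, hwv⟩ := (mem_verts_splitOff hd).1 hx
      simp at hwv
    · induction q using Quotient.inductionOn with
      | h v =>
        by_cases hv : v ∈ G.verts c
        · refine Eq.trans (Finset.sum_eq_zero fun w hw => ?_)
            (hmem v (Finset.disjoint_left.1 h hv)).symm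
          have := (Finset.mem_filter.1 hw).2
          show y (Sum.inr (Sum.inr (Quotient.mk _ w))) = 0
          rw [this]
          exact hmem v (Finset.disjoint_left.1 h hv)
        · exact contractDec_apply_of_notMem _ hv
  · intro z hz
    obtain ⟨h1, h2⟩ := splitSlots_inr_of_notMem h hz
    have h3 : invFact (G.splitSlots c z) = invFact z := by
      unfold invFact
      rw [Fintype.prod_sum_type fun x => ∏ i, ((G.splitSlots c z x i).factorial : ℝ),
        Fintype.prod_sum_type fun x => ∏ i, ((z x i).factorial : ℝ)]
      congr 2
      refine prod_splitOff h (fun x hx => ?_) (fun v hv => ?_) fun v hv => ?_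
      · rw [h1 x hx]; simp
      · rw [hz (Sum.inr v) hv]; simp
      · rw [h2 v hv]
    have h4 : slotCoeff (Sum.elim a (G.contractDec c b)) (G.splitSlots c z) = slotCoeff n z := by
      unfold slotCoeff
      congr 1
      refine prod_splitOff h (fun x hx => ?_) (fun v hv => ?_) fun v hv => ?_
      · rw [h1 x hx]; simp
      · rw [hz (Sum.inr v) hv]; simp
      · rw [h2 v hv, Sum.elim_inr,
          contractDec_apply_of_notMem _ (Finset.disjoint_right.1 h hv), hb v hv]
    have h5 : Sum.elim a (G.contractDec c b) - vertPart (G.splitSlots c z)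
        = Sum.elim a (G.contractDec c (b - vertPart z)) := by
      rw [contractDec_sub_of_disjoint h b (z := vertPart z) fun v hv => hz (Sum.inr v) hv]
      funext x
      rcases x with v | q
      · exact tsub_zero _
      · rfl
    rw [h3, h4, h5, hF z hz]
    exact congrArg (fun m : M => invFact z • slotCoeff n z • F (fib G.slotVert z) • m)
      (hg z hz).symm

section Character

variable {χ : That 𝔖 →ₐ[ℝ] B}

lemma leftPart_shift_eq {σ : Finset E → V} {l : HalfEdge E k → MultiIndex d}
    (hl : ∀ e ∈ S, ∀ b, l (Sum.inl (e, b)) = 0) (a : V → MultiIndex d) :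
    leftPart χ (G.shift l) S σ a = leftPart χ G S σ a :=
  Finset.prod_congr rfl fun _ hc => congrArg χ
    (vac_shift_eq fun e he b => hl e (comps_subset (G := G) hc he) b)

lemma slots_apply_of_mem {y : HalfEdge E k ⊕ V → MultiIndex d} (hy : y ∈ Supp d (G.slots S))
    {e : E} {T : Finset E} (hT : T = S ∨ Disjoint (G.verts T) (G.verts S)) (he : e ∈ T) (b : Bool) :
    halfPart y (Sum.inl (e, b)) = 0 := by
  refine hy (Sum.inl (Sum.inl (e, b))) fun h => ?_
  have h' := mem_boundary.1 (show Sum.inl (e, b) ∈ G.boundary S from h)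
  rcases hT with rfl | hT
  · exact h'.1 ⟨e, he, b, rfl⟩
  · exact Finset.disjoint_left.1 hT (G.vert_mem he b) h'.2

lemma quoWeight_eq {ι : Type} {ψ : ι → That 𝔖 →ₐ[ℝ] B} {L : H 𝔖 →ₗ[ℝ] M} {R : Finset ι}
    {ρ : ι → V} {G' : LGraph 𝔖 V E k} {l : HalfEdge E k → MultiIndex d} (h : G' = G.shift l)
    (b : V → MultiIndex d) :
    weight ψ L (G'.contract S) R (fun i => Quotient.mk _ (ρ i)) (G'.contractDec S b)
      = quoWeight ψ L G S R ρ l b := by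
  subst h
  rfl

/-- Extraction of `S` from the graph where `c` is split off. -/
lemma extractWeight_splitOff (hχ : ∀ x, IsRelVac 𝔖 x → χ x = 0)
    (hJ : ∀ τ : VacDiagram 𝔖, 0 < τ.deg → χ τ.toThat = 0)
    {L : H 𝔖 →ₗ[ℝ] M} {ψ : V → That 𝔖 →ₐ[ℝ] B}
    {ψ' : {v // v ∈ G.verts c} ⊕ Quotient (G.conn c) → That 𝔖 →ₐ[ℝ] B} {R : Finset V}
    {p : {v // v ∈ G.verts c}} (hψ : ∀ i x, IsRelVac 𝔖 x → ψ i x = 0)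
    (h : Disjoint (G.verts c) (G.verts S)) (hc : G.IsConn c) (hp : ψ' (Sum.inl p) = χ)
    (hψ' : ∀ r ∈ R, ψ' (Sum.inr (Quotient.mk _ r)) = ψ r)
    (hR : ∀ r ∈ R, ∀ r' ∈ R, G.conn c r r' → r = r') {σ : Finset E → V}
    (hσ : RootChoice G S σ) {y : HalfEdge E k ⊕ V → MultiIndex d} (hy : y ∈ Supp d (G.slots c))
    (n : V → MultiIndex d) :
    extractWeight ψ' L ((G.shift (halfPart y)).splitOff c) S
      (insert (Sum.inl p) (R.image fun r => Sum.inr (Quotient.mk _ r))) id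
      (leftPart χ ((G.shift (halfPart y)).splitOff c) S fun c' => Sum.inr (Quotient.mk _ (σ c')))
      (Sum.elim (fun v => fib G.slotVert y v.1) (G.contractDec c (n - vertPart y)))
    = χ (G.vac c p.1 (fib G.slotVert y)) • extraction G S (leftPart χ G S σ)
      (fun l b => quoWeight ψ L G (c ∪ S) R id (halfPart y + l) (b - vertPart y)) n := by
  have hd := disjoint_of_disjoint_verts h
  rw [← extraction_const_smul (B := B) (M := M) (leftPart_truncated hJ hσ)]
  refine extraction_splitOff (B := B) (M := M) (G := G.shift (halfPart y)) h (n := n)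
    (b := n - vertPart y) (F := leftPart χ G S σ)
    (F' := leftPart χ ((G.shift (halfPart y)).splitOff c) S fun c' =>
      Sum.inr (Quotient.mk _ (σ c')))
    (g := fun l b => χ (G.vac c p.1 (fib G.slotVert y)) •
      quoWeight ψ L G (c ∪ S) R id (halfPart y + l) (b - vertPart y))
    (g' := quoWeight ψ' L ((G.shift (halfPart y)).splitOff c) S
      (insert (Sum.inl p) (R.image fun r => Sum.inr (Quotient.mk _ r))) id)
    (fun v hv => ?_) (fun v => fib G.slotVert y v.1) (fun z hz => ?_) fun z hz => ?_
  · have : vertPart y v = 0 := hy (Sum.inr v) (Finset.disjoint_right.1 h hv)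
    rw [Pi.sub_apply, this, tsub_zero]
  · have H := (subIso_splitOff (G := G.shift (halfPart y)) h).mono
      (Finset.subset_union_right (s₁ := c) (s₂ := S))
    rw [Finset.image_id] at H
    refine (H.leftPart_eq hχ (n := fib G.slotVert z) (σ := σ) (fun e he b => ?_) hσ
      fun c' hc' e he b => ?_).trans
      (leftPart_shift_eq (fun e he b => slots_apply_of_mem hy (Or.inr h.symm) he b) _)
    · rw [id, splitOff_vert_of_notMem (Finset.disjoint_right.1 hd he)]
      exact fib_splitSlots (G := G.shift (halfPart y)) h hz (G.vert_mem he b)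
    · have heS := comps_subset (G := G) hc' he
      rw [id, splitOff_vert_of_notMem (Finset.disjoint_right.1 hd heS), Sum.inr.injEq,
        Finset.image_id]
      exact (mk_eq_iff_of_notMem (Finset.disjoint_right.1 h
        (verts_comps_subset hc' (hσ c' hc')))).symm
  · have h1 := weight_splitOff (G := (G.shift (halfPart y)).shift (halfPart z)) (L := L) (ψ := ψ)
      (ψ' := ψ') (R := R) (p := p) hψ hd hc (hp ▸ hχ) hψ' hR (fib G.slotVert y)
      (n - vertPart y - vertPart z)
    refine h1.trans (congrArg₂ (fun (x : B) (m : M) => x • m)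
      ((DFunLike.congr_fun hp _).trans (congrArg χ ?_)) ?_)
    · refine (vac_shift_eq (G := G.shift (halfPart y)) fun e he b =>
        slots_apply_of_mem hz (Or.inr h) he b).trans ?_
      exact vac_shift_eq fun e he b => slots_apply_of_mem hy (Or.inl rfl) he b
    · rw [tsub_right_comm]
      exact quoWeight_eq (ρ := id) (shift_shift G _ _) _

lemma comps_of_isConn (hc : G.IsConn c) : G.comps c = {c} := by
  ext c'
  rw [mem_comps, Finset.mem_singleton]
  have h : ∀ e ∈ c, G.comp c (G.src e) = c := fun e he =>
    Finset.filter_true_of_mem fun e' he' => hc.2 e he e' he'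
  constructor
  · rintro ⟨e, he, rfl⟩
    exact h e he
  · rintro rfl
    obtain ⟨e, he⟩ := hc.1
    exact ⟨e, he, h e he⟩

/-- Extraction of a subgraph with several components, one of which is split off first. -/
lemma extractWeight_union (hJ : ∀ τ : VacDiagram 𝔖, 0 < τ.deg → χ τ.toThat = 0)
    {ι : Type} {ψ : ι → That 𝔖 →ₐ[ℝ] B} {L : H 𝔖 →ₗ[ℝ] M} {R : Finset ι} {ρ : ι → V}
    (h : Disjoint (G.verts c) (G.verts S)) (hc : G.IsConn c) {σ : Finset E → V}
    (hσ : RootChoice G (c ∪ S) σ) (n : V → MultiIndex d) :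
    extractWeight ψ L G (c ∪ S) R ρ (leftPart χ G (c ∪ S) σ) n
      = esum (G.slots c) fun y => invFact y • slotCoeff n y •
        χ (G.vac c (σ c) (fib G.slotVert y)) • extraction G S (leftPart χ G S σ)
          (fun l b => quoWeight ψ L G (c ∪ S) R ρ (halfPart y + l) (b - vertPart y)) n := by
  refine (extraction_union h hJ hσ _ n).trans (esum_congr fun y _ => ?_)
  unfold leftPart
  rw [comps_of_isConn hc, Finset.prod_singleton]

end Character

end LGraph


/-! ### Values of mixed diagrams -/

section SubIsoId

variable {𝔖 : LabelSystem d 𝔏} {V V' V'' E : Type} {k k' k'' : ℕ} [Fintype V] [Fintype V']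
  [Fintype V''] {G : LGraph 𝔖 V E k} {G' : LGraph 𝔖 V' E k'} {G'' : LGraph 𝔖 V'' E k''}
  {S T T' : Finset E}

namespace LGraph.SubIso

lemma mono_id (h : SubIso G G' id S S) (hT : T ⊆ S) : SubIso G G' id T T := by
  simpa using h.mono hT

lemma trans_id (h : SubIso G G' id S S) (h' : SubIso G' G'' id S S) : SubIso G G'' id S S where
  maps _ he := he
  surj e he := ⟨e, he, rfl⟩
  inj _ _ _ _ h := h
  vert e he e' he' b b' := (h.vert e he e' he' b b').trans (h'.vert e he e' he' b b')
  lab e he := (h'.lab e he).trans (h.lab e he)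

lemma comps_eq [Fintype E] (h : SubIso G G' id S S) : G'.comps S = G.comps S := by
  have h1 := h.comps_image
  have h2 : Finset.image (id : E → E) = id := funext fun s => Finset.image_id
  rw [h1, h2, Finset.image_id]

lemma disjoint_verts_iff (h : SubIso G G' id S S) (hT : T ⊆ S) (hT' : T' ⊆ S) :
    Disjoint (G.verts T) (G.verts T') ↔ Disjoint (G'.verts T) (G'.verts T') := by
  simp only [Finset.disjoint_left, mem_verts]
  constructor
  · rintro H v ⟨e, he, b, rfl⟩ ⟨e', he', b', hv⟩
    exact H ⟨e, he, b, rfl⟩ ⟨e', he', b', (h.vert e' (hT' he') e (hT he) b' b).2 hv⟩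
  · rintro H v ⟨e, he, b, rfl⟩ ⟨e', he', b', hv⟩
    exact H ⟨e, he, b, rfl⟩ ⟨e', he', b', (h.vert e' (hT' he') e (hT he) b' b).1 hv⟩

end LGraph.SubIso

lemma LGraph.subIso_shift {l : HalfEdge E k → MultiIndex d}
    (hl : ∀ e ∈ S, ∀ b, l (Sum.inl (e, b)) = 0) : SubIso G (G.shift l) id S S where
  maps _ he := he
  surj e he := ⟨e, he, rfl⟩
  inj _ _ _ _ h := h
  vert e _ e' _ b b' := by cases b <;> cases b' <;> rfl
  lab e he := by
    simp only [shift, id, hl e he]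
    rw [add_zero, 𝔖.diff_zero]

end SubIsoId

namespace MixedDiagram

variable {𝔖 : LabelSystem d 𝔏} {E : Type} [Fintype E] {k : ℕ}
variable {B M : Type*} [CommRing B] [Algebra ℝ B] [AddCommGroup M] [Module ℝ M] [Module B M]
  [IsScalarTower ℝ B M]
variable {χ ψ : That 𝔖 →ₐ[ℝ] B} {L : H 𝔖 →ₗ[ℝ] M}

lemma rooted (D : MixedDiagram 𝔖 E k) : D.G.Rooted D.roots id where
  no_leg := D.no_leg
  sep := D.root_unique
  covered v := (D.covered v).imp_right fun ⟨r, hr, h⟩ => ⟨r, hr, (D.G.conn _).symm h⟩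

/-- The character by which the component of a distinguished vertex is evaluated: `χ` if it meets
the set `P` of edges, and `ψ` otherwise. -/
def charOf (χ ψ : That 𝔖 →ₐ[ℝ] B) (P : Finset E) (D : MixedDiagram 𝔖 E k) (r : D.V) :
    That 𝔖 →ₐ[ℝ] B := if Disjoint (D.G.comp Finset.univ r) P then ψ else χ

/-- The value of a mixed diagram. -/
def value (χ ψ : That 𝔖 →ₐ[ℝ] B) (L : H 𝔖 →ₗ[ℝ] M) (P : Finset E) (D : MixedDiagram 𝔖 E k) : M :=
  weight (D.charOf χ ψ P) L D.G D.roots id D.n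

/-- The result of the extraction of `S` from a mixed diagram. -/
def extractValue (χ ψ : That 𝔖 →ₐ[ℝ] B) (L : H 𝔖 →ₗ[ℝ] M) (P : Finset E)
    (D : MixedDiagram 𝔖 E k) (S : Finset E) (σ : Finset E → D.V) : M :=
  extractWeight (D.charOf χ ψ P) L D.G S D.roots id (leftPart χ D.G S σ) D.n

/-- A choice of distinguished vertices for the components of `S` that is compatible with those of
the diagram. -/
def Admissible (D : MixedDiagram 𝔖 E k) (S : Finset E) (σ : Finset E → D.V) : Prop :=
  RootChoice D.G S σ ∧ ∀ c ∈ D.G.comps S, ∀ r ∈ D.roots, r ∈ D.G.verts c → σ c = r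

lemma charOf_rel (hχ : ∀ x, IsRelVac 𝔖 x → χ x = 0) (hψ : ∀ x, IsRelVac 𝔖 x → ψ x = 0)
    (P : Finset E) (D : MixedDiagram 𝔖 E k) (r : D.V) (x : That 𝔖) (hx : IsRelVac 𝔖 x) :
    D.charOf χ ψ P r x = 0 := by
  unfold charOf
  split_ifs
  exacts [hψ x hx, hχ x hx]

lemma root_eq_of_mem_verts (D : MixedDiagram 𝔖 E k) {c : Finset E} (hc : D.G.IsConn c)
    {r r' : D.V} (hr : r ∈ D.roots) (hr' : r' ∈ D.roots) (h : r ∈ D.G.verts c)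
    (h' : r' ∈ D.G.verts c) : r = r' :=
  D.root_unique r hr r' hr' (D.G.conn_mono (Finset.subset_univ _) (D.G.conn_of_mem_verts hc h h'))

lemma admissible_pickVert (D : MixedDiagram 𝔖 E k) [Nonempty D.V] (S : Finset E) :
    D.Admissible S (D.G.pickVert D.roots) :=
  ⟨rootChoice_pickVert _ _ _, fun _ hc _ hr hrc => D.root_eq_of_mem_verts
    (D.G.isConn_of_mem_comps hc) (pickVert_mem hr hrc) hr (rootChoice_pickVert _ _ _ _ hc) hrc⟩

/-- The choice of distinguished vertices of the extracted components does not matter. -/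
lemma extractValue_congr (hχ : ∀ x, IsRelVac 𝔖 x → χ x = 0)
    (hJ : ∀ τ : VacDiagram 𝔖, 0 < τ.deg → χ τ.toThat = 0) (hψ : ∀ x, IsRelVac 𝔖 x → ψ x = 0)
    {P : Finset E} {D : MixedDiagram 𝔖 E k} {S : Finset E} {σ σ' : Finset E → D.V}
    (hσ : D.Admissible S σ) (hσ' : D.Admissible S σ') :
    extractValue χ ψ L P D S σ = extractValue χ ψ L P D S σ' := by
  refine extractWeight_congr_root hχ hJ (charOf_rel hχ hψ P D) D.rooted hσ.1 hσ'.1 ?_ D.n_eq_zero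
  rintro c hc ⟨r, hr, hrc⟩
  rw [hσ.2 c hc r hr hrc, hσ'.2 c hc r hr hrc]

/-- The split off copy of `c` is evaluated by `χ`. -/
lemma charOf_splitOff_inl (D : MixedDiagram 𝔖 E k) {P c : Finset E} (hc : D.G.IsConn c)
    (l : HalfEdge E k → MultiIndex d) (m : D.V → MultiIndex d) (p : {v // v ∈ D.G.verts c}) :
    (D.splitOff c hc l m).charOf χ ψ (P ∪ c) (Sum.inl p) = χ := by
  have h : (D.splitOff c hc l m).G.comp Finset.univ (Sum.inl p) = c :=
    splitOff_comp_inl (G := D.G.shift l) hc p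
  refine if_neg fun h' => ?_
  rw [h] at h'
  obtain ⟨e, he⟩ := hc.1
  exact Finset.disjoint_left.1 h' he (Finset.mem_union_right _ he)

/-- The character of the other components is not changed. -/
lemma charOf_splitOff_inr (D : MixedDiagram 𝔖 E k) {P c : Finset E} (hc : D.G.IsConn c)
    (hP : Disjoint P c) (l : HalfEdge E k → MultiIndex d) (m : D.V → MultiIndex d) (r : D.V) :
    (D.splitOff c hc l m).charOf χ ψ (P ∪ c) (Sum.inr (Quotient.mk _ r)) = D.charOf χ ψ P r := by
  have h : (D.splitOff c hc l m).G.comp Finset.univ (Sum.inr (Quotient.mk _ r))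
      = D.G.comp Finset.univ r \ c := splitOff_comp_inr (G := D.G.shift l) r
  unfold charOf
  rw [h]
  refine if_congr ?_ rfl rfl
  simp only [Finset.disjoint_left, Finset.mem_sdiff, Finset.mem_union] at hP ⊢
  exact ⟨fun H e he heP => H ⟨he, hP heP⟩ (Or.inl heP), fun H e he heP => heP.elim (H he.1) he.2⟩

lemma mem_roots_splitOff (D : MixedDiagram 𝔖 E k) {c : Finset E} (hc : D.G.IsConn c)
    {l : HalfEdge E k → MultiIndex d} {m : D.V → MultiIndex d}
    {x : {v // v ∈ D.G.verts c} ⊕ Quotient (D.G.conn c)} :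
    x ∈ (D.splitOff c hc l m).roots ↔ x = Sum.inl (D.G.pick D.roots c hc.1) ∨
      ∃ r ∈ D.roots, Sum.inr (Quotient.mk (D.G.conn c) r) = x :=
  (@Finset.mem_insert _ _ _ _ _).trans (or_congr_right (@Finset.mem_image _ _ _ _ _ _))

/-- Extraction of several components, the first of which is split off. -/
lemma extractValue_union (hχ : ∀ x, IsRelVac 𝔖 x → χ x = 0)
    (hJ : ∀ τ : VacDiagram 𝔖, 0 < τ.deg → χ τ.toThat = 0) (hψ : ∀ x, IsRelVac 𝔖 x → ψ x = 0)
    {P c S : Finset E} {D : MixedDiagram 𝔖 E k} (h : Disjoint (D.G.verts c) (D.G.verts S))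
    (hc : D.G.IsConn c) (hP : Disjoint P c) {σ : Finset E → D.V} (hσ : D.Admissible (c ∪ S) σ) :
    extractValue χ ψ L P D (c ∪ S) σ = esum (D.G.slots c) fun y =>
      if D.G.subDeg c (fib D.G.slotVert y) ≤ 0 then (invFact y * slotCoeff D.n y) •
        extractValue χ ψ L (P ∪ c) (D.splitOff c hc (halfPart y) (vertPart y)) S
          (fun c' => Sum.inr (Quotient.mk _ (σ c')))
      else 0 := by
  have hcS : c ∉ D.G.comps S := fun h' => by
    obtain ⟨v, hv⟩ := D.G.verts_nonempty hc.1
    exact Finset.disjoint_left.1 h hv (verts_comps_subset h' hv)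
  -- The distinguished vertex of `c` may be assumed to be the one that `c` gets when it is split
  -- off.
  set p := D.G.pick D.roots c hc.1 with hp
  have hσ₁ : D.Admissible (c ∪ S) (Function.update σ c p.1) := by
    have key : ∀ c' ∈ D.G.comps (c ∪ S), c' = c ∨ (c' ≠ c ∧ c' ∈ D.G.comps (c ∪ S)) :=
      fun c' hc' => (em (c' = c)).imp_right fun h => ⟨h, hc'⟩
    refine ⟨fun c' hc' => ?_, fun c' hc' r hr hrc => ?_⟩
    · rcases key c' hc' with rfl | ⟨hne, hc'⟩
      · rw [Function.update_self]
        exact p.2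
      · rw [Function.update_of_ne hne]
        exact hσ.1 c' hc'
    · rcases key c' hc' with rfl | ⟨hne, hc'⟩
      · rw [Function.update_self]
        refine D.root_eq_of_mem_verts hc ?_ hr p.2 hrc
        rw [hp, pick, dif_pos ⟨r, hr, hrc⟩]
        exact (Exists.choose_spec (⟨r, hr, hrc⟩ : ∃ v, v ∈ D.roots ∧ v ∈ D.G.verts c')).1
      · rw [Function.update_of_ne hne]
        exact hσ.2 c' hc' r hr hrc
  have hσS : RootChoice D.G S σ := ((rootChoice_union_iff h).1 hσ.1).2
  have hLσ : ∀ a, leftPart χ D.G S (Function.update σ c p.1) a = leftPart χ D.G S σ a := fun a =>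
    Finset.prod_congr rfl fun c' hc' => by
      have hne : c' ≠ c := by
        rintro rfl
        exact hcS hc'
      rw [Function.update_of_ne hne]
  rw [extractValue_congr hχ hJ hψ hσ hσ₁, extractValue, extractWeight_union hJ h hc hσ₁.1]
  refine esum_congr fun y hy => ?_
  rw [Function.update_self]
  split_ifs with hdeg
  · rw [mul_smul]
    refine congrArg (fun m : M => invFact y • slotCoeff D.n y • m) ?_
    refine Eq.trans ?_ (extractWeight_splitOff (B := B) (M := M) (L := L) hχ hJ
      (charOf_rel hχ hψ P D) h hc (D.charOf_splitOff_inl (P := P) hc (halfPart y) (vertPart y) p)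
      (fun r _ => D.charOf_splitOff_inr hc hP (halfPart y) (vertPart y) r)
      (fun r hr r' hr' hrr => D.root_unique r hr r' hr'
        (D.G.conn_mono (Finset.subset_univ _) hrr)) hσS hy D.n).symm |>.trans ?_
    · refine congrArg (fun m : M => χ (D.G.vac c p.1 (fib D.G.slotVert y)) • m) ?_
      exact extraction_congr (fun y _ => hLσ _) fun _ _ => rfl
    · rw [fib_slotVert]
      rfl
  · rw [vac_deg_pos hJ hc p.2 (not_le.1 hdeg), zero_smul, smul_zero, smul_zero]

lemma bounded_of_subDeg {N : Type*} [AddCommMonoid N] (D : MixedDiagram 𝔖 E k) (c : Finset E)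
    (f : (HalfEdge E k ⊕ D.V → MultiIndex d) → N) : Bounded (D.G.slots c) fun y =>
      if D.G.subDeg c (fib D.G.slotVert y) ≤ 0 then f y else 0 := by
  obtain ⟨N, hN⟩ := exists_nat_gt (-D.G.subDeg c 0)
  refine ⟨N, fun y hy h => if_neg fun hle => ?_⟩
  rw [subDeg_eq, ← tot_le_fib hy] at hle
  have : (N : ℝ) < (tot y : ℝ) := by exact_mod_cast h
  linarith

/-- The contraction operator as a sum over all families of multiindices. -/
lemma contractAt_eq (D : MixedDiagram 𝔖 E k) {c : Finset E} (hc : D.G.IsConn c) :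
    contractAt c D = esum (D.G.slots c) fun y =>
      if D.G.subDeg c (fib D.G.slotVert y) ≤ 0 then
        Finsupp.single (D.splitOff c hc (halfPart y) (vertPart y)) (invFact y * slotCoeff D.n y)
      else 0 := by
  rw [contractAt, dif_pos hc]
  simp only [multiFactorial_extendZero]
  refine (finsum_slots (G := D.G) (S := c) (fun l m => if D.G.subDeg c (m + D.G.push l) ≤ 0 then
    Finsupp.single (D.splitOff c hc l m) ((-1 : ℝ) ^ outOrder l / (multiFactorial l : ℝ)
      * (multiChoose D.n m : ℝ)) else 0) ?_).trans ?_
  · simp only [← fib_slotVert]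
    exact D.bounded_of_subDeg c _
  · refine esum_congr fun y _ => ?_
    rw [invFact_mul_slotCoeff, fib_slotVert]

lemma map_contractAt {N : Type*} [AddCommGroup N] [Module ℝ N] (F : TMixed 𝔖 E k →ₗ[ℝ] N)
    (D : MixedDiagram 𝔖 E k) {c : Finset E} (hc : D.G.IsConn c) :
    F (contractAt c D) = esum (D.G.slots c) fun y =>
      if D.G.subDeg c (fib D.G.slotVert y) ≤ 0 then (invFact y * slotCoeff D.n y) •
        F (Finsupp.single (D.splitOff c hc (halfPart y) (vertPart y)) 1) else 0 := by
  rw [D.contractAt_eq hc]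
  refine (esum_map F.toAddMonoidHom (D.bounded_of_subDeg c _)).trans (esum_congr fun y _ => ?_)
  show F _ = _
  rw [apply_ite F, map_zero, ← map_smul, Finsupp.smul_single, smul_eq_mul, mul_one]

/-- The set `c` is the set of edges of a component without legs, of degree at most zero. -/
def Done (D : MixedDiagram 𝔖 E k) (c : Finset E) : Prop :=
  ∃ r ∈ D.roots, D.G.comp Finset.univ r = c ∧ D.G.subDeg c D.n ≤ 0

lemma subIso_splitOff (D : MixedDiagram 𝔖 E k) {c S : Finset E} (hc : D.G.IsConn c)
    (h : Disjoint (D.G.verts c) (D.G.verts S)) {y : HalfEdge E k ⊕ D.V → MultiIndex d}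
    (hy : y ∈ Supp d (D.G.slots c)) :
    SubIso D.G (D.splitOff c hc (halfPart y) (vertPart y)).G id (c ∪ S) (c ∪ S) := by
  refine (subIso_shift fun e he b => ?_).trans_id
    (LGraph.subIso_splitOff (G := D.G.shift (halfPart y)) h)
  rcases Finset.mem_union.1 he with he | he
  · exact slots_apply_of_mem hy (Or.inl rfl) he b
  · exact slots_apply_of_mem hy (Or.inr h.symm) he b

lemma done_splitOff_self (D : MixedDiagram 𝔖 E k) {c : Finset E} (hc : D.G.IsConn c)
    {y : HalfEdge E k ⊕ D.V → MultiIndex d} (hy : y ∈ Supp d (D.G.slots c))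
    (hdeg : D.G.subDeg c (fib D.G.slotVert y) ≤ 0) :
    (D.splitOff c hc (halfPart y) (vertPart y)).Done c := by
  refine ⟨_, (D.mem_roots_splitOff hc).2 (Or.inl rfl), splitOff_comp_inl (G := D.G.shift (halfPart y)) hc _, ?_⟩
  have H := (D.subIso_splitOff (S := ∅) hc (by simp [verts]) hy).mono_id Finset.subset_union_left
  rw [H.subDeg_eq (n := fib D.G.slotVert y)]
  · exact hdeg
  · intro e he b
    have h1 : (D.splitOff c hc (halfPart y) (vertPart y)).G.vert (Sum.inl (e, b)) = Sum.inl
        ⟨D.G.vert (Sum.inl (e, b)), D.G.vert_mem he b⟩ := by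
      refine (splitOff_vert_of_mem (G := D.G.shift (halfPart y)) he b).trans ?_
      cases b <;> rfl
    rw [id, h1, fib_slotVert]
    rfl

lemma Done.splitOff {D : MixedDiagram 𝔖 E k} {c c₀ : Finset E} (hc : D.G.IsConn c)
    (h : Disjoint (D.G.verts c) (D.G.verts c₀)) {y : HalfEdge E k ⊕ D.V → MultiIndex d}
    (hy : y ∈ Supp d (D.G.slots c)) (hD : D.Done c₀) :
    (D.splitOff c hc (halfPart y) (vertPart y)).Done c₀ := by
  obtain ⟨r, hr, hr₀, hdeg⟩ := hD
  have hd := disjoint_of_disjoint_verts h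
  refine ⟨_, (D.mem_roots_splitOff hc).2 (Or.inr ⟨r, hr, rfl⟩),
    (splitOff_comp_inr (G := D.G.shift (halfPart y)) r).trans ?_, ?_⟩
  · refine Eq.trans ?_ (Finset.sdiff_eq_self_of_disjoint hd.symm)
    rw [← hr₀]
    rfl
  · have H := (D.subIso_splitOff hc h hy).mono_id Finset.subset_union_right
    rw [H.subDeg_eq (n := D.n)]
    · exact hdeg
    · intro e he b
      have hec := Finset.disjoint_right.1 hd he
      have hv := Finset.disjoint_right.1 h (D.G.vert_mem he b)
      have h1 : (D.splitOff c hc (halfPart y) (vertPart y)).G.vert (Sum.inl (e, b)) = Sum.inr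
          (Quotient.mk _ (D.G.vert (Sum.inl (e, b)))) := by
        refine (splitOff_vert_of_notMem (G := D.G.shift (halfPart y)) hec b).trans ?_
        cases b <;> rfl
      rw [id, h1]
      refine (contractDec_apply_of_notMem _ hv).trans ?_
      rw [Pi.sub_apply, show vertPart y (D.G.vert (Sum.inl (e, b))) = 0 from
        hy (Sum.inr _) hv, tsub_zero]

/-- The edges of a family of subgraphs. -/
abbrev edges (𝒞 : Finset (Finset E)) : Finset E := 𝒞.biUnion id

lemma contractList_append (l : List (Finset E)) (c : Finset E) (D : MixedDiagram 𝔖 E k) :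
    ((l ++ [c]).map (contractOp 𝔖 k)).prod (Finsupp.single D 1)
      = (l.map (contractOp 𝔖 k)).prod (contractAt c D) := by
  rw [List.map_append, List.prod_append, List.map_singleton, List.prod_singleton,
    Module.End.mul_apply, contractOp, Finsupp.linearCombination_single, one_smul]

lemma disjoint_verts_edges {V : Type} [Fintype V] {G : LGraph 𝔖 V E k} {c : Finset E}
    {𝒞 : Finset (Finset E)} (h : ∀ c' ∈ 𝒞, Disjoint (G.verts c) (G.verts c')) :
    Disjoint (G.verts c) (G.verts (edges 𝒞)) := by
  refine Finset.disjoint_left.2 fun v hv hv' => ?_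
  obtain ⟨e, he, b, rfl⟩ := mem_verts.1 hv'
  obtain ⟨c', hc', he⟩ := Finset.mem_biUnion.1 he
  exact Finset.disjoint_left.1 (h c' hc') hv (G.vert_mem he b)

/-- After the contraction of vertex-disjoint subgraphs, evaluation of the extracted components
by `χ` yields the extraction of their union. -/
lemma value_contractList (hχ : ∀ x, IsRelVac 𝔖 x → χ x = 0)
    (hJ : ∀ τ : VacDiagram 𝔖, 0 < τ.deg → χ τ.toThat = 0) (hψ : ∀ x, IsRelVac 𝔖 x → ψ x = 0)
    (hempty : ∀ (P : Finset E) (D : MixedDiagram 𝔖 E k) (σ : Finset E → D.V),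
      extractValue χ ψ L P D ∅ σ = value χ ψ L P D)
    (l : List (Finset E)) : ∀ (P : Finset E) (D : MixedDiagram 𝔖 E k) (σ : Finset E → D.V),
      (∀ c ∈ l, D.G.IsConn c) → l.Pairwise (fun c c' => Disjoint (D.G.verts c) (D.G.verts c')) →
      (∀ c ∈ l, Disjoint P c) → D.Admissible (edges l.toFinset) σ →
      Finsupp.linearCombination ℝ (value χ ψ L (P ∪ edges l.toFinset))
        ((l.map (contractOp 𝔖 k)).prod (Finsupp.single D 1))
      = extractValue χ ψ L P D (edges l.toFinset) σ := by
  induction l using List.reverseRecOn with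
  | nil =>
    intro P D σ _ _ _ _
    simp [edges, hempty]
  | append_singleton l c ih =>
    intro P D σ hconn hpw hP hσ
    have hc := hconn c (by simp)
    rw [List.pairwise_append] at hpw
    have hdis : ∀ c' ∈ l, Disjoint (D.G.verts c) (D.G.verts c') := fun c' hc' =>
      (hpw.2.2 c' hc' c (by simp)).symm
    have hdv : Disjoint (D.G.verts c) (D.G.verts (edges l.toFinset)) :=
      disjoint_verts_edges fun c' hc' => hdis c' (List.mem_toFinset.1 hc')
    have hun : edges (l ++ [c]).toFinset = c ∪ edges l.toFinset := by
      ext e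
      simp [edges]
    rw [hun] at hσ ⊢
    -- The operator of `c` is applied first. The other subgraphs are not affected when `c` is split
    -- off.
    rw [extractValue_union hχ hJ hψ hdv hc (hP c (by simp)) hσ, contractList_append]
    refine (map_contractAt ((Finsupp.linearCombination ℝ _).comp (l.map (contractOp 𝔖 k)).prod)
      D hc).trans (esum_congr fun y hy => ?_)
    split_ifs with hdeg
    · refine congrArg (fun m : M => (invFact y * slotCoeff D.n y) • m) ?_
      have H := D.subIso_splitOff hc hdv hy
      have hsub : ∀ c' ∈ l, c' ⊆ edges l.toFinset := fun c' hc' =>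
        Finset.subset_biUnion_of_mem id (List.mem_toFinset.2 hc')
      have hsub' : ∀ c' ∈ l, c' ⊆ c ∪ edges l.toFinset := fun c' hc' =>
        (hsub c' hc').trans Finset.subset_union_right
      rw [← Finset.union_assoc]
      refine ih (P ∪ c) _ _ (fun c' hc' => ?_) ?_ (fun c' hc' => ?_) ⟨fun c' hc' => ?_, ?_⟩
      · exact (H.mono_id (hsub' c' hc')).isConn_iff.1 (hconn c' (by simp [hc']))
      · exact hpw.1.imp_of_mem fun {a b} ha hb hab =>
          (H.disjoint_verts_iff (hsub' a ha) (hsub' b hb)).1 hab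
      · rw [Finset.disjoint_union_left]
        exact ⟨hP c' (by simp [hc']), disjoint_of_disjoint_verts (hdis c' hc')⟩
      · rw [(H.mono_id Finset.subset_union_right).comps_eq] at hc'
        have h1 := hσ.1 c' (by rw [comps_union hdv]; exact Finset.mem_union_right _ hc')
        have hd := (disjoint_of_disjoint_verts hdv).mono_right (comps_subset hc')
        exact (mem_verts_splitOff (G := D.G.shift (halfPart y)) hd).2 ⟨_, h1, rfl⟩
      · intro c' hc' r hr hrc
        rw [(H.mono_id Finset.subset_union_right).comps_eq] at hc'
        have hcc : c' ∈ D.G.comps (c ∪ edges l.toFinset) := by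
          rw [comps_union hdv]; exact Finset.mem_union_right _ hc'
        have hd := (disjoint_of_disjoint_verts hdv).mono_right (comps_subset hc')
        obtain ⟨v, hv, hvr⟩ := (mem_verts_splitOff (G := D.G.shift (halfPart y)) hd).1 hrc
        rcases (D.mem_roots_splitOff hc).1 hr with rfl | ⟨r, hr₀, rfl⟩
        · simp at hvr
        · have hvc : v ∉ D.G.verts c :=
            Finset.disjoint_right.1 hdv (verts_comps_subset hc' hv)
          have hrv : r = v := (mk_eq_iff_of_notMem hvc).1 (Sum.inr.inj hvr).symm
          exact congrArg (fun r => Sum.inr (Quotient.mk _ r)) (hσ.2 c' hcc r hr₀ (hrv ▸ hv))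
    · rfl

lemma esum_mem {α N : Type*} [Fintype α] [AddCommGroup N] [Module ℝ N] (p : Submodule ℝ N)
    {I : Set α} {f : (α → MultiIndex d) → N} (h : ∀ y ∈ Supp d I, f y ∈ p) : esum I f ∈ p := by
  refine finsum_induction (· ∈ p) p.zero_mem (fun _ _ => p.add_mem) fun y => ?_
  by_cases hy : y ∈ Supp d I
  · rw [Set.indicator_of_mem hy]
    exact h y hy
  · rw [Set.indicator_of_notMem hy]
    exact p.zero_mem

/-- The structure of the diagrams obtained by contraction of vertex-disjoint subgraphs: these
subgraphs have become components without legs, and are otherwise unchanged. -/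
lemma contractList_mem_supported (l : List (Finset E)) : ∀ (𝒞 : Finset (Finset E))
      (D : MixedDiagram 𝔖 E k), (∀ c ∈ l, D.G.IsConn c) →
      l.Pairwise (fun c c' => Disjoint (D.G.verts c) (D.G.verts c')) →
      (∀ c ∈ l, ∀ c' ∈ 𝒞, Disjoint (D.G.verts c) (D.G.verts c')) → (∀ c ∈ 𝒞, D.Done c) →
      (l.map (contractOp 𝔖 k)).prod (Finsupp.single D 1) ∈ Finsupp.supported ℝ ℝ
        {D' | SubIso D.G D'.G id (edges (l.toFinset ∪ 𝒞)) (edges (l.toFinset ∪ 𝒞)) ∧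
          ∀ c ∈ l.toFinset ∪ 𝒞, D'.Done c} := by
  induction l using List.reverseRecOn with
  | nil =>
    intro 𝒞 D _ _ _ h𝒞
    refine Finsupp.single_mem_supported ℝ _ ⟨?_, by simpa using h𝒞⟩
    exact ⟨fun _ he => he, fun e he => ⟨e, he, rfl⟩, fun _ _ _ _ h => h,
      fun _ _ _ _ _ _ => Iff.rfl, fun _ _ => rfl⟩
  | append_singleton l c ih =>
    intro 𝒞 D hconn hpw hl𝒞 h𝒞
    have hc := hconn c (by simp)
    rw [List.pairwise_append] at hpw
    have hdis : ∀ c' ∈ l.toFinset ∪ 𝒞, Disjoint (D.G.verts c) (D.G.verts c') := fun c' hc' => by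
      rcases Finset.mem_union.1 hc' with hc' | hc'
      · exact (hpw.2.2 c' (List.mem_toFinset.1 hc') c (by simp)).symm
      · exact hl𝒞 c (by simp) c' hc'
    have hdv : Disjoint (D.G.verts c) (D.G.verts (edges (l.toFinset ∪ 𝒞))) :=
      disjoint_verts_edges hdis
    have hfin : (l ++ [c]).toFinset ∪ 𝒞 = l.toFinset ∪ insert c 𝒞 := by
      ext c'
      simp only [List.toFinset_append, Finset.mem_union, List.mem_toFinset, List.mem_singleton,
        Finset.mem_insert]
      tauto
    have hun : edges ((l ++ [c]).toFinset ∪ 𝒞) = c ∪ edges (l.toFinset ∪ 𝒞) := by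
      rw [hfin, Finset.union_insert, edges, Finset.biUnion_insert]
      rfl
    rw [contractList_append, D.contractAt_eq hc]
    rw [← Submodule.mem_comap]
    refine esum_mem _ fun y hy => ?_
    split_ifs with hdeg
    · have H := D.subIso_splitOff hc hdv hy
      have hsub : ∀ c' ∈ l.toFinset ∪ insert c 𝒞, c' ⊆ c ∪ edges (l.toFinset ∪ 𝒞) :=
        fun c' hc' => by
          rw [← hun, hfin]
          exact Finset.subset_biUnion_of_mem id hc'
      have hl : ∀ c' ∈ l, c' ∈ l.toFinset ∪ insert c 𝒞 := fun c' hc' =>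
        Finset.mem_union_left _ (List.mem_toFinset.2 hc')
      have h𝒞' : ∀ c' ∈ insert c 𝒞, c' ∈ l.toFinset ∪ insert c 𝒞 := fun c' hc' =>
        Finset.mem_union_right _ hc'
      rw [Submodule.mem_comap, ← mul_one (invFact y * _), ← smul_eq_mul, ← Finsupp.smul_single,
        map_smul]
      refine Submodule.smul_mem _ _ (Finsupp.supported_mono ?_ (ih (insert c 𝒞)
        (D.splitOff c hc (halfPart y) (vertPart y)) (fun c' hc' => ?_) ?_ ?_ ?_))
      · rintro D' ⟨h1, h2⟩
        rw [← hfin, hun] at h1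
        refine ⟨?_, by rwa [hfin]⟩
        rw [hun]
        exact H.trans_id h1
      · exact (H.mono_id (hsub c' (hl c' hc'))).isConn_iff.1 (hconn c' (by simp [hc']))
      · exact hpw.1.imp_of_mem fun {a b} ha hb hab =>
          (H.disjoint_verts_iff (hsub a (hl a ha)) (hsub b (hl b hb))).1 hab
      · intro c₁ hc₁ c₂ hc₂
        rw [← H.disjoint_verts_iff (hsub c₁ (hl c₁ hc₁)) (hsub c₂ (h𝒞' c₂ hc₂))]
        rcases Finset.mem_insert.1 hc₂ with rfl | hc₂
        · exact hpw.2.2 c₁ hc₁ c₂ (by simp)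
        · exact hl𝒞 c₁ (by simp [hc₁]) c₂ hc₂
      · intro c' hc'
        rcases Finset.mem_insert.1 hc' with rfl | hc'
        · exact D.done_splitOff_self hc hy hdeg
        · exact (h𝒞 c' hc').splitOff hc (hdis c' (Finset.mem_union_right _ hc')) hy
    · exact Submodule.zero_mem _

end MixedDiagram


/-! ### Locality of contraction -/

section Locality

variable {𝔖 : LabelSystem d 𝔏} {V E : Type} {k : ℕ} [Fintype V] [Fintype E] {G : LGraph 𝔖 V E k}
  {S S' : Finset E} {p : V → Prop}

/-- If `p` is a property of components, then the edges of `S` in these components determine the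
connectedness of their vertices. -/
lemma conn_iff_of_local (hSS : S' ⊆ S) (hp : ∀ v w, G.conn Finset.univ v w → (p v ↔ p w))
    (hS : ∀ e ∈ S, p (G.src e) → e ∈ S') {v w : V} (hv : p v) :
    G.conn S v w ↔ G.conn S' v w := by
  refine ⟨fun h => ?_, G.conn_mono hSS⟩
  have hp' : ∀ {v w}, G.conn S v w → (p v ↔ p w) := fun h =>
    hp _ _ (G.conn_mono (Finset.subset_univ S) h)
  suffices p v → G.conn S' v w from this hv
  clear hv
  induction h with
  | rel x y h' =>
    obtain ⟨e, he, rfl, rfl⟩ := h'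
    exact fun h => G.conn_edge (hS e he h)
  | refl x => exact fun _ => (G.conn _).refl x
  | symm x y h ih => exact fun hy => (G.conn _).symm (ih ((hp' h).2 hy))
  | trans x y z h _ ih ih' => exact fun hx => (G.conn _).trans (ih hx) (ih' ((hp' h).1 hx))

lemma contractDec_eq_of_local (hSS : S' ⊆ S) (hp : ∀ v w, G.conn Finset.univ v w → (p v ↔ p w))
    (hS : ∀ e ∈ S, p (G.src e) → e ∈ S') {b b' : V → MultiIndex d} (hb : ∀ v, p v → b v = b' v)
    {v : V} (hv : p v) :
    G.contractDec S b (Quotient.mk _ v) = G.contractDec S' b' (Quotient.mk _ v) := by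
  have key : ∀ w, Quotient.mk (G.conn S) w = Quotient.mk _ v
      ↔ Quotient.mk (G.conn S') w = Quotient.mk _ v := fun w => by
    have h := conn_iff_of_local hSS hp hS (w := w) hv
    exact ⟨fun h' => Quotient.sound (Setoid.symm' _ (h.1 (Setoid.symm' _ (Quotient.exact h')))),
      fun h' => Quotient.sound (Setoid.symm' _ (h.2 (Setoid.symm' _ (Quotient.exact h'))))⟩
  unfold contractDec
  rw [Finset.sum_filter, Finset.sum_filter]
  refine Finset.sum_congr rfl fun w _ => ?_
  simp only [key]
  split_ifs with h
  · refine hb w ((hp v w ?_).1 hv)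
    exact G.conn_mono (Finset.subset_univ S') (Setoid.symm' _ (Quotient.exact h))
  · rfl

lemma quo_vert_eq_iff_of_local (hSS : S' ⊆ S)
    (hp : ∀ v w, G.conn Finset.univ v w → (p v ↔ p w)) (hS : ∀ e ∈ S, p (G.src e) → e ∈ S')
    {v w : V} (hv : p v) : Quotient.mk (G.conn S) v = Quotient.mk _ w
      ↔ Quotient.mk (G.conn S') v = Quotient.mk _ w := by
  have h := conn_iff_of_local hSS hp hS (w := w) hv
  exact ⟨fun h' => Quotient.sound (h.1 (Quotient.exact h')),
    fun h' => Quotient.sound (h.2 (Quotient.exact h'))⟩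

/-- The contraction on a component depends only on the contracted edges in this component. -/
lemma rootVac_quo_congr {B : Type*} [CommRing B] [Algebra ℝ B] {ψ : That 𝔖 →ₐ[ℝ] B}
    (hψ : ∀ x, IsRelVac 𝔖 x → ψ x = 0) (hSS : S' ⊆ S) {r : V}
    (hS : ∀ e ∈ S, G.conn Finset.univ r (G.src e) → e ∈ S') {l l' : HalfEdge E k → MultiIndex d}
    (hl : ∀ e, G.conn Finset.univ r (G.src e) → ∀ b, l (Sum.inl (e, b)) = l' (Sum.inl (e, b)))
    {b b' : V → MultiIndex d} (hb : ∀ v, G.conn Finset.univ r v → b v = b' v) :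
    ψ ((G.quo S l).rootVac (Quotient.mk _ r) (G.contractDec S b))
      = ψ ((G.quo S' l').rootVac (Quotient.mk _ r) (G.contractDec S' b')) := by
  have hp : ∀ v w, G.conn Finset.univ v w →
      (G.conn Finset.univ r v ↔ G.conn Finset.univ r w) := fun v w h =>
    ⟨fun h' => (G.conn _).trans h' h, fun h' => (G.conn _).trans h' ((G.conn _).symm h)⟩
  have hc : ∀ (S : Finset E) (l : HalfEdge E k → MultiIndex d) (e : {e // e ∉ S}),
      e ∈ (G.quo S l).comp Finset.univ (Quotient.mk _ r)
        ↔ G.conn Finset.univ r (G.src e.1) := fun S l e => by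
    rw [mem_comp]
    exact (and_iff_right (Finset.mem_univ _)).trans (conn_quo_iff S l)
  have hcv : ∀ e b, G.conn Finset.univ r (G.src e) →
      G.conn Finset.univ r (G.vert (Sum.inl (e, b))) := fun e b h =>
    (G.conn _).trans h (G.conn_vert_univ e b)
  unfold rootVac
  refine vac_congr hψ (φ := fun e : {e // e ∉ S} => (⟨e.1, fun h => e.2 (hSS h)⟩ : {e // e ∉ S'}))
    ⟨fun e he => (hc S' l' _).2 ((hc S l e).1 he), fun e he => ?_,
      fun e _ e' _ h => Subtype.ext (congrArg (fun e : {e // e ∉ S'} => e.1) h),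
      fun e he e' he' b b' => ?_, fun e he => ?_⟩
    (fun e he b => ?_) (fun e he b => ?_) ?_
  · have he₁ := (hc S' l' _).1 he
    exact ⟨⟨e.1, fun h => e.2 (hS _ h he₁)⟩, (hc S l _).2 he₁, rfl⟩
  · rw [quo_vert, quo_vert, quo_vert, quo_vert]
    exact quo_vert_eq_iff_of_local hSS hp hS (hcv _ b ((hc _ _ _).1 he))
  · have he₁ := (hc _ _ _).1 he
    simp only [quo, contract, shift, hl _ he₁]
  · rw [quo_vert, quo_vert]
    exact (contractDec_eq_of_local hSS hp hS hb (hcv _ b ((hc _ _ _).1 he))).symm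
  · rw [quo_vert, quo_vert]
    exact quo_vert_eq_iff_of_local hSS hp hS (hcv _ b ((hc _ _ _).1 he))
  · rw [contractDec_eq_of_local hSS hp hS hb ((G.conn _).refl r)]

/-- The components with legs of a contracted graph depend only on the contracted edges in
components with legs. -/
lemma legDiagram_quo_congr (hSS : S' ⊆ S) (hS : ∀ e ∈ S, G.LegEdge e → e ∈ S')
    {l l' : HalfEdge E k → MultiIndex d}
    (hl : ∀ e, G.LegEdge e → ∀ b, l (Sum.inl (e, b)) = l' (Sum.inl (e, b)))
    (hl' : ∀ j, l (Sum.inr j) = l' (Sum.inr j)) :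
    (G.quo S l).legDiagram.toH = (G.quo S' l').legDiagram.toH := by
  have hp : ∀ v w, G.conn Finset.univ v w →
      ((∃ j, G.conn Finset.univ v (G.leg j)) ↔ ∃ j, G.conn Finset.univ w (G.leg j)) :=
    fun v w h => exists_congr fun j =>
    ⟨fun h' => (G.conn _).trans ((G.conn _).symm h) h', fun h' => (G.conn _).trans h h'⟩
  have hc : ∀ (S : Finset E) (l : HalfEdge E k → MultiIndex d) (e : {e // e ∉ S}),
      (G.quo S l).LegEdge e ↔ G.LegEdge e.1 := fun S l e =>
    exists_congr fun j => conn_quo_iff S l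
  refine legDiagram_congr
    (fun e : {e // e ∉ S} => (⟨e.1, fun h => e.2 (hSS h)⟩ : {e // e ∉ S'}))
    (fun e he => (hc S' l' _).2 ((hc S l e).1 he)) (fun e he => ?_)
    (fun e e' _ _ h => Subtype.ext (congrArg (fun e : {e // e ∉ S'} => e.1) h))
    (fun h h' hh hh' => ?_) (fun e he => ?_) fun j => ?_
  · have he₁ := (hc S' l' _).1 he
    exact ⟨⟨e.1, fun h => e.2 (hS _ h he₁)⟩, (hc S l _).2 he₁, rfl⟩
  · rw [quo_vert, quo_vert, quo_vert, quo_vert]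
    have h0 : ∀ h : HalfEdge {e // e ∉ S} k, legIncl (fun e => e ∉ S') (Sum.map (Prod.map
        (fun e : {e // e ∉ S} => (⟨e.1, fun h => e.2 (hSS h)⟩ : {e // e ∉ S'})) id) id h)
        = legIncl _ h := by
      rintro (⟨e, b⟩ | j) <;> rfl
    rw [h0, h0]
    refine quo_vert_eq_iff_of_local hSS hp hS ?_
    rcases h with (⟨e, b⟩ | j)
    · exact (hp _ _ (G.conn_vert_univ e.1 b)).1 ((hc _ _ _).1 (hh e b rfl))
    · exact ⟨j, (G.conn _).refl _⟩
  · have he₁ := (hc _ _ _).1 he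
    simp only [quo, contract, shift, hl _ he₁]
  · simp only [quo, contract, shift, hl']

end Locality

/-! ### Extraction of the empty subgraph -/

section Empty

variable {𝔖 : LabelSystem d 𝔏} {V E : Type} {k : ℕ} [Fintype V] [Fintype E] {G : LGraph 𝔖 V E k}
variable {B M : Type*} [CommRing B] [Algebra ℝ B] [AddCommGroup M] [Module ℝ M] [Module B M]
  [IsScalarTower ℝ B M]

lemma eq_of_conn_empty {v w : V} (h : G.conn ∅ v w) : v = w := by
  by_contra hvw
  have h' := (G.mem_verts_of_conn h hvw).1
  simp [verts] at h'

lemma extraction_empty (F : (V → MultiIndex d) → B)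
    (g : (HalfEdge E k → MultiIndex d) → (V → MultiIndex d) → M) (n : V → MultiIndex d) :
    extraction G ∅ F g n = F 0 • g 0 n := by
  have hs : G.slots ∅ = ∅ := Set.eq_empty_of_forall_notMem fun x hx => by
    have := slotVert_mem hx
    simp [verts] at this
  have h0 : outOrder (halfPart (0 : HalfEdge E k ⊕ V → MultiIndex d)) = 0 := by
    simp [outOrder, order, halfPart]
  rw [extraction, esum, hs, finsum_eq_single _ (0 : HalfEdge E k ⊕ V → MultiIndex d)]
  · rw [Set.indicator_of_mem (show (0 : HalfEdge E k ⊕ V → MultiIndex d) ∈ Supp d ∅ from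
      fun _ _ => rfl)]
    have h1 : invFact (0 : HalfEdge E k ⊕ V → MultiIndex d) = 1 := by simp [invFact]
    have h2 : slotCoeff n (0 : HalfEdge E k ⊕ V → MultiIndex d) = 1 := by simp [slotCoeff, h0]
    have h3 : fib G.slotVert (0 : HalfEdge E k ⊕ V → MultiIndex d) = 0 := by
      funext v
      simp [fib]
    rw [h1, h2, h3, one_smul, one_smul]
    exact congrArg (fun b => F 0 • g 0 b) (tsub_zero n)
  · intro y hy
    exact Set.indicator_of_notMem (fun h : y ∈ Supp d ∅ =>
      hy (funext fun x => h x (Set.notMem_empty x))) _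

lemma edgeEmb_quo_empty (G : LGraph 𝔖 V E k) :
    EdgeEmb G (G.quo ∅ 0) (fun e => ⟨e, Finset.notMem_empty e⟩) (Quotient.mk _) where
  injE e e' h := congrArg (fun e : {e // e ∉ (∅ : Finset E)} => e.1) h
  injV v w h := eq_of_conn_empty (Quotient.exact h)
  vert e b := quo_vert _ _ _
  cov e' _ _ _ := ⟨e'.1, rfl⟩
  lab e := by
    show 𝔖.diff (0 + 0) _ = _
    rw [add_zero, 𝔖.diff_zero]

lemma extractWeight_empty {χ : That 𝔖 →ₐ[ℝ] B} {ι : Type} {ψ : ι → That 𝔖 →ₐ[ℝ] B}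
    (hψ : ∀ i x, IsRelVac 𝔖 x → ψ i x = 0) (L : H 𝔖 →ₗ[ℝ] M) (R : Finset ι) (ρ : ι → V)
    (σ : Finset E → V) (n : V → MultiIndex d) :
    extractWeight ψ L G ∅ R ρ (leftPart χ G ∅ σ) n = weight ψ L G R ρ n := by
  have H := edgeEmb_quo_empty G
  have hn : ∀ v, G.contractDec ∅ n (Quotient.mk _ v) = n v := fun v => by
    unfold contractDec
    refine Finset.sum_eq_single v (fun w hw hwv => ?_) fun h => ?_
    · exact absurd (eq_of_conn_empty (Quotient.exact (Finset.mem_filter.1 hw).2)) hwv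
    · exact absurd (Finset.mem_filter.2 ⟨Finset.mem_univ v, (rfl : Quotient.mk (G.conn ∅) v = _)⟩) h
  rw [extractWeight, extraction_empty, leftPart, show G.comps ∅ = ∅ from Finset.image_empty _,
    Finset.prod_empty, one_smul, quoWeight, weight, weight,
    ← H.legDiagram_eq (fun _ => rfl) fun j => 𝔖.diff_zero _]
  congr 1
  refine Finset.prod_congr rfl fun i _ => ?_
  rw [← H.rootVac_eq (hψ i)]
  simp only [hn]

end Empty


/-! ### Evaluation of extracted components by the twisted antipode -/

lemma sum_powerset_union {E N : Type*} [AddCommMonoid N] {c U : Finset E} (h : Disjoint c U)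
    {p q : Finset E → Prop} [DecidablePred p] [DecidablePred q]
    (hp : ∀ T ⊆ c, ∀ S ⊆ U, p (T ∪ S) ↔ p S) (hq : ∀ S, q S ↔ ¬ c ⊆ S ∧ p S) (f : Finset E → N) :
    ∑ S ∈ (c ∪ U).powerset.filter q, f S
      = ∑ S ∈ U.powerset.filter p, ∑ T ∈ c.ssubsets, f (T ∪ S) := by
  have hT : ∀ S ⊆ c ∪ U, S ∩ c ∪ S ∩ U = S := fun S hS => by
    rw [← Finset.inter_union_distrib_left, Finset.inter_eq_left.2 hS]
  have h1 : ∀ T ⊆ c, ∀ S ⊆ U, (T ∪ S) ∩ c = T ∧ (T ∪ S) ∩ U = S := fun T hT S hS => by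
    have h2 := h.mono_left hT
    have h3 := h.symm.mono_left hS
    rw [Finset.union_inter_distrib_right, Finset.union_inter_distrib_right,
      Finset.inter_eq_left.2 hT, Finset.inter_eq_left.2 hS, Finset.disjoint_iff_inter_eq_empty.1 h2,
      Finset.disjoint_iff_inter_eq_empty.1 h3]
    simp
  rw [← Finset.sum_product']
  refine Finset.sum_nbij' (fun S => (S ∩ U, S ∩ c)) (fun x => x.2 ∪ x.1) ?_ ?_ ?_ ?_ ?_
  · intro S hS
    simp only [Finset.mem_filter, Finset.mem_powerset, hq] at hS
    simp only [Finset.mem_product, Finset.mem_filter, Finset.mem_powerset, Finset.mem_ssubsets]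
    refine ⟨⟨Finset.inter_subset_right, ?_⟩, Finset.inter_subset_right, fun hc =>
      hS.2.1 (hc.trans Finset.inter_subset_left)⟩
    rw [← hp (S ∩ c) Finset.inter_subset_right (S ∩ U) Finset.inter_subset_right, hT S hS.1]
    exact hS.2.2
  · rintro ⟨S, T⟩ hx
    simp only [Finset.mem_product, Finset.mem_filter, Finset.mem_powerset,
      Finset.mem_ssubsets] at hx
    simp only [Finset.mem_filter, Finset.mem_powerset, hq]
    refine ⟨Finset.union_subset_union hx.2.1 hx.1.1, fun hc => hx.2.2 ?_,
      (hp T hx.2.1 S hx.1.1).2 hx.1.2⟩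
    intro e he
    exact (Finset.mem_union.1 (hc he)).resolve_right fun h' =>
      Finset.disjoint_left.1 h he (hx.1.1 h')
  · intro S hS
    exact hT S (Finset.mem_powerset.1 (Finset.mem_filter.1 hS).1)
  · rintro ⟨S, T⟩ hx
    simp only [Finset.mem_product, Finset.mem_filter, Finset.mem_powerset,
      Finset.mem_ssubsets] at hx
    obtain ⟨h2, h3⟩ := h1 T hx.2.1 S hx.1.1
    exact Prod.ext h3 h2
  · intro S hS
    exact congrArg f (hT S (Finset.mem_powerset.1 (Finset.mem_filter.1 hS).1)).symm

namespace MixedDiagram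

variable {𝔖 : LabelSystem d 𝔏} {E : Type} [Fintype E] {k : ℕ}
variable {B M : Type*} [CommRing B] [Algebra ℝ B] [AddCommGroup M] [Module ℝ M] [Module B M]
  [IsScalarTower ℝ B M]
variable {χ ψ : That 𝔖 →ₐ[ℝ] B} {L : H 𝔖 →ₗ[ℝ] M}

/-- The component of a distinguished vertex `r` as a graph on its own. -/
lemma compEmb_comp (D : MixedDiagram 𝔖 E k) {r : D.V} (hr : r ∈ D.roots)
    (h : (D.G.comp Finset.univ r).Nonempty) :
    CompEmb (D.G.pieceAt (D.G.comp Finset.univ r) (D.G.isConn_comp h)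
      ⟨r, root_mem_verts_comp h⟩ D.n).G D.G Subtype.val Subtype.val where
  injE := Subtype.val_injective
  injV := Subtype.val_injective
  vert e b := by cases b <;> rfl
  cov e' b v hv := by
    have hv' := (mem_verts_comp_univ h).1 v.2
    refine ⟨⟨e', ?_⟩, rfl⟩
    rw [mem_comp]
    refine ⟨Finset.mem_univ _, (D.G.conn _).trans ?_ ((D.G.conn _).symm (D.G.conn_vert_univ e' b))⟩
    rw [hv]
    exact hv'
  lab _ := rfl
  no_leg j v hv := D.no_leg r hr j (by
    rw [hv]
    exact (mem_verts_comp_univ h).1 v.2)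

/-- The contribution of the component of `r` if `T` is extracted from it. -/
def compExtract (χ ψ : That 𝔖 →ₐ[ℝ] B) (D : MixedDiagram 𝔖 E k) (σ : Finset E → D.V) (r : D.V)
    (T : Finset E) : B :=
  extraction D.G T (leftPart χ D.G T σ) (fun l b =>
    ψ ((D.G.quo T l).rootVac (Quotient.mk _ r) (D.G.contractDec T b))) D.n

/-- The defining property of the twisted antipode on the component of `r`. -/
lemma sum_compExtract (hχ : ∀ x, IsRelVac 𝔖 x → χ x = 0)
    (hJ : ∀ τ : VacDiagram 𝔖, 0 < τ.deg → χ τ.toThat = 0) (hψ : ∀ x, IsRelVac 𝔖 x → ψ x = 0)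
    (hA : ∀ τ : VacDiagram 𝔖, τ.deg ≤ 0 → ∑ S, τ.term χ ψ S = 0)
    (D : MixedDiagram 𝔖 E k) {σ : Finset E → D.V} (hσ : ∀ S, D.Admissible S σ) {r : D.V}
    (hr : r ∈ D.roots) (h : (D.G.comp Finset.univ r).Nonempty)
    (hdeg : D.G.subDeg (D.G.comp Finset.univ r) D.n ≤ 0) :
    ∑ T ∈ (D.G.comp Finset.univ r).ssubsets, D.compExtract χ ψ σ r T
      = - χ (D.G.rootVac r D.n) := by
  set c := D.G.comp Finset.univ r with hc
  -- The subgraphs of the component are those of the vacuum diagram `τ` given by this component.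
  set τ := D.G.pieceAt c (D.G.isConn_comp h) ⟨r, root_mem_verts_comp h⟩ D.n with hτ
  have H : CompEmb τ.G D.G Subtype.val Subtype.val := D.compEmb_comp hr h
  have hterm : ∀ S : Finset τ.E, D.compExtract χ ψ σ r (S.image Subtype.val) = τ.term χ ψ S :=
    fun S => H.extraction_eq_term hχ hJ hψ (hσ _).1 (fun c hc h => (hσ _).2 c hc r hr h)
      fun v => rfl
  have himg : (Finset.univ : Finset τ.E).image Subtype.val = c := by
    ext e
    simp only [Finset.mem_image, Finset.mem_univ, true_and]
    exact ⟨fun ⟨e', he'⟩ => he' ▸ e'.2, fun he => ⟨⟨e, he⟩, rfl⟩⟩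
  have hsum : ∑ T ∈ c.powerset, D.compExtract χ ψ σ r T = ∑ S, τ.term χ ψ S := by
    symm
    refine Finset.sum_nbij (fun S => S.image Subtype.val) (fun S _ => ?_) (fun S _ S' _ hSS => ?_)
      (fun T hT => ?_) fun S _ => (hterm S).symm
    · exact Finset.mem_powerset.2
        ((Finset.image_subset_image (Finset.subset_univ S)).trans himg.subset)
    · exact Finset.image_injective Subtype.val_injective hSS
    · refine ⟨Finset.univ.filter fun e : τ.E => e.1 ∈ T, Finset.mem_coe.2 (Finset.mem_univ _), ?_⟩
      ext e
      simp only [Finset.mem_image, Finset.mem_filter, Finset.mem_univ, true_and]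
      exact ⟨fun ⟨e', he', h⟩ => h ▸ he', fun he =>
        ⟨⟨e, Finset.mem_powerset.1 (Finset.mem_coe.1 hT) he⟩, he, rfl⟩⟩
  have hdeg' : τ.deg ≤ 0 := (pieceAt_deg ..).trans_le hdeg
  have hself : D.compExtract χ ψ σ r c = χ (D.G.rootVac r D.n) := by
    have h1 := hterm Finset.univ
    rw [himg, τ.term_univ hχ hψ] at h1
    rw [h1, rootVac, ← hc, vac_of_isConn (D.G.isConn_comp h) (root_mem_verts_comp h)]
  rw [hA τ hdeg', ← Finset.insert_erase (Finset.mem_powerset_self c), Finset.sum_insert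
    (Finset.notMem_erase _ _), hself] at hsum
  exact eq_neg_of_add_eq_zero_right hsum

/-- The extraction factorizes over the components without legs. -/
lemma extractWeight_insert (hJ : ∀ τ : VacDiagram 𝔖, 0 < τ.deg → χ τ.toThat = 0)
    (hψ : ∀ x, IsRelVac 𝔖 x → ψ x = 0) (D : MixedDiagram 𝔖 E k) {σ : Finset E → D.V}
    (hσ : ∀ S, D.Admissible S σ) {r : D.V} {R : Finset D.V} (hr : r ∉ R)
    (hR : insert r R ⊆ D.roots) {T S : Finset E} (hT : T ⊆ D.G.comp Finset.univ r)
    (hS : Disjoint S (D.G.comp Finset.univ r)) :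
    extractWeight (fun _ => ψ) L D.G (T ∪ S) (insert r R) id (leftPart χ D.G (T ∪ S) σ) D.n
      = D.compExtract χ ψ σ r T •
        extractWeight (fun _ => ψ) L D.G S R id (leftPart χ D.G S σ) D.n := by
  have hrr := hR (Finset.mem_insert_self r R)
  have hmem : ∀ e, e ∈ D.G.comp Finset.univ r ↔ D.G.conn Finset.univ r (D.G.src e) := fun e => by
    rw [mem_comp, and_iff_right (Finset.mem_univ e)]
  have hsv : ∀ e b, D.G.conn Finset.univ r (D.G.src e)
      ↔ D.G.conn Finset.univ r (D.G.vert (Sum.inl (e, b))) := fun e b =>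
    ⟨fun h => (D.G.conn _).trans h (D.G.conn_vert_univ e b),
      fun h => (D.G.conn _).trans h ((D.G.conn _).symm (D.G.conn_vert_univ e b))⟩
  have hTv : ∀ v ∈ D.G.verts T, D.G.conn Finset.univ r v := fun v hv => by
    obtain ⟨e, he, b, rfl⟩ := mem_verts.1 hv
    exact (hsv e b).1 ((hmem e).1 (hT he))
  have hSv : ∀ v ∈ D.G.verts S, ¬ D.G.conn Finset.univ r v := fun v hv h => by
    obtain ⟨e, he, b, rfl⟩ := mem_verts.1 hv
    exact Finset.disjoint_left.1 hS he ((hmem e).2 ((hsv e b).2 h))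
  refine extraction_mul (Finset.disjoint_left.2 fun v hv hv' => hSv v hv' (hTv v hv)) hJ
    (hσ _).1 fun y hy z hz => ?_
  have hy0 : ∀ x, ¬ D.G.conn Finset.univ r (D.G.slotVert x) → y x = 0 := fun x hx =>
    hy x fun h => hx (hTv _ (slotVert_mem h))
  have hz0 : ∀ x, D.G.conn Finset.univ r (D.G.slotVert x) → z x = 0 := fun x hx =>
    hz x fun h => hSv _ (slotVert_mem h) hx
  have hl : ∀ x, ¬ D.G.conn Finset.univ r (D.G.vert x) →
      (halfPart y + halfPart z) x = halfPart z x := fun x hx => by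
    rw [Pi.add_apply, show halfPart y x = 0 from hy0 (Sum.inl x) hx, zero_add]
  have hl' : ∀ x, D.G.conn Finset.univ r (D.G.vert x) →
      (halfPart y + halfPart z) x = halfPart y x := fun x hx => by
    rw [Pi.add_apply, show halfPart z x = 0 from hz0 (Sum.inl x) hx, add_zero]
  unfold quoWeight weight
  rw [Finset.prod_insert hr, mul_smul]
  refine congrArg₂ (fun (x : B) (m : M) => x • m) ?_ (congrArg₂ (fun (x : B) (m : M) => x • m) ?_ ?_)
  · refine rootVac_quo_congr hψ Finset.subset_union_left (fun e he hre => ?_) (fun e he b => ?_)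
      fun v hv => ?_
    · exact (Finset.mem_union.1 he).resolve_right fun he' =>
        Finset.disjoint_left.1 hS he' ((hmem e).2 hre)
    · exact hl' _ ((hsv e b).1 he)
    · rw [Pi.sub_apply, Pi.sub_apply, Pi.sub_apply,
        show vertPart z v = 0 from hz0 (Sum.inr v) hv, tsub_zero]
  · refine Finset.prod_congr rfl fun i hi => ?_
    have hir : ∀ v, D.G.conn Finset.univ i v → ¬ D.G.conn Finset.univ r v := fun v hv hv' => by
      have := D.root_unique r hrr i (hR (Finset.mem_insert_of_mem hi))
        ((D.G.conn _).trans hv' ((D.G.conn _).symm hv))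
      exact hr (this ▸ hi)
    refine rootVac_quo_congr hψ Finset.subset_union_right (fun e he hre => ?_) (fun e he b => ?_)
      fun v hv => ?_
    · exact (Finset.mem_union.1 he).resolve_left fun he' => hir _ hre ((hmem e).1 (hT he'))
    · exact hl _ fun h => hir _ he ((hsv e b).2 h)
    · rw [Pi.sub_apply, show vertPart y v = 0 from hy0 (Sum.inr v) (hir v hv), tsub_zero]
  · have hleg : ∀ e, D.G.LegEdge e → ¬ D.G.conn Finset.univ r (D.G.src e) := fun e ⟨j, hj⟩ h =>
      D.no_leg r hrr j ((D.G.conn _).trans h hj)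
    refine congrArg L (legDiagram_quo_congr Finset.subset_union_right (fun e he hre => ?_)
      (fun e he b => ?_) fun j => ?_)
    · exact (Finset.mem_union.1 he).resolve_left fun he' => hleg e hre ((hmem e).1 (hT he'))
    · exact hl _ fun h => hleg e he ((hsv e b).2 h)
    · exact hl _ (D.no_leg r hrr j)

/-- Replacing `ψ` by `χ` on some components amounts to the extraction of proper subgraphs of
these. -/
lemma weight_eq_sum (hχ : ∀ x, IsRelVac 𝔖 x → χ x = 0)
    (hJ : ∀ τ : VacDiagram 𝔖, 0 < τ.deg → χ τ.toThat = 0) (hψ : ∀ x, IsRelVac 𝔖 x → ψ x = 0)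
    (hA : ∀ τ : VacDiagram 𝔖, τ.deg ≤ 0 → ∑ S, τ.term χ ψ S = 0)
    (D : MixedDiagram 𝔖 E k) {σ : Finset E → D.V} (hσ : ∀ S, D.Admissible S σ)
    (R' : Finset D.V) : ∀ R : Finset D.V, R' ⊆ R → R ⊆ D.roots →
      (∀ r ∈ R', (D.G.comp Finset.univ r).Nonempty ∧
        D.G.subDeg (D.G.comp Finset.univ r) D.n ≤ 0) →
      weight (fun r => if r ∈ R' then χ else ψ) L D.G R id D.n = (-1 : ℝ) ^ R'.card •
        ∑ S ∈ (R'.biUnion (D.G.comp Finset.univ)).powerset.filter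
          (fun S => ∀ r ∈ R', ¬ D.G.comp Finset.univ r ⊆ S),
          extractWeight (fun _ => ψ) L D.G S R id (leftPart χ D.G S σ) D.n := by
  induction R' using Finset.induction_on with
  | empty =>
    intro R _ _ _
    simp [extractWeight_empty (fun _ => hψ)]
  | insert r R' hr ih =>
    intro R hR' hR h
    have hrR := hR' (Finset.mem_insert_self r R')
    have hrr := hR hrR
    have hdis : ∀ r' ∈ R', Disjoint (D.G.comp Finset.univ r) (D.G.comp Finset.univ r') :=
      fun r' hr' => Finset.disjoint_left.2 fun e he he' => hr (by
        rwa [D.root_unique r hrr r' (hR (hR' (Finset.mem_insert_of_mem hr')))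
          ((D.G.conn _).trans (mem_comp.1 he).2 ((D.G.conn _).symm (mem_comp.1 he').2))])
    have hdU : Disjoint (D.G.comp Finset.univ r) (R'.biUnion (D.G.comp Finset.univ)) :=
      (Finset.disjoint_biUnion_right _ _ _).2 hdis
    have hwt : weight (fun r' => if r' ∈ insert r R' then χ else ψ) L D.G R id D.n
        = χ (D.G.rootVac r D.n) •
          weight (fun r' => if r' ∈ R' then χ else ψ) L D.G (R.erase r) id D.n := by
      unfold weight
      rw [← Finset.mul_prod_erase R _ hrR, mul_smul]
      beta_reduce
      rw [if_pos (Finset.mem_insert_self r R')]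
      refine congrArg₂ (fun (x : B) (m : M) => x • m) rfl
        (congrArg₂ (fun (x : B) (m : M) => x • m) (Finset.prod_congr rfl fun i hi => ?_) rfl)
      simp only [Finset.mem_insert, Finset.ne_of_mem_erase hi, false_or]
    rw [hwt, ih (R.erase r) (fun i hi => Finset.mem_erase.2 ⟨fun h => hr (h ▸ hi),
      hR' (Finset.mem_insert_of_mem hi)⟩) ((Finset.erase_subset _ _).trans hR)
      (fun i hi => h i (Finset.mem_insert_of_mem hi)), Finset.biUnion_insert]
    have hsum := sum_powerset_union hdU
      (p := fun S => ∀ r ∈ R', ¬ D.G.comp Finset.univ r ⊆ S) (fun T hT S hS => by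
        refine forall₂_congr fun r' hr' => not_congr ⟨fun H e he => ?_,
          fun H => H.trans Finset.subset_union_right⟩
        exact (Finset.mem_union.1 (H he)).resolve_left fun he' =>
          Finset.disjoint_left.1 (hdis r' hr') (hT he') he)
      (fun S => Finset.forall_mem_insert r R' fun r' => ¬ D.G.comp Finset.univ r' ⊆ S)
      (fun S => extractWeight (fun _ => ψ) L D.G S R id (leftPart χ D.G S σ) D.n)
    rw [hsum, Finset.card_insert_of_notMem hr, pow_succ, mul_neg_one, neg_smul, ← smul_neg,
      smul_comm (χ _), Finset.smul_sum, ← Finset.sum_neg_distrib]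
    refine congrArg _ (Finset.sum_congr rfl fun S hS => ?_)
    have hSd : Disjoint S (D.G.comp Finset.univ r) :=
      (hdU.mono_right (Finset.mem_powerset.1 (Finset.mem_filter.1 hS).1)).symm
    have h1 : ∀ T ∈ (D.G.comp Finset.univ r).ssubsets,
        extractWeight (fun _ => ψ) L D.G (T ∪ S) R id (leftPart χ D.G (T ∪ S) σ) D.n
          = D.compExtract χ ψ σ r T • extractWeight (fun _ => ψ) L D.G S (R.erase r) id
            (leftPart χ D.G S σ) D.n := fun T hT => by
      have h2 := D.extractWeight_insert (L := L) hJ hψ hσ (Finset.notMem_erase r R)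
        (by rwa [Finset.insert_erase hrR]) (Finset.mem_ssubsets.1 hT).1 hSd
      rwa [Finset.insert_erase hrR] at h2
    rw [Finset.sum_congr rfl h1, ← Finset.sum_smul, D.sum_compExtract hχ hJ hψ hA hσ hrr
      (h r (Finset.mem_insert_self r R')).1 (h r (Finset.mem_insert_self r R')).2, neg_smul,
      neg_neg]

/-- The evaluation of the components in `S` by `χ` in terms of the extraction of subgraphs of `S`
that do not contain any component. -/
lemma value_eq_sum (hχ : ∀ x, IsRelVac 𝔖 x → χ x = 0)
    (hJ : ∀ τ : VacDiagram 𝔖, 0 < τ.deg → χ τ.toThat = 0) (hψ : ∀ x, IsRelVac 𝔖 x → ψ x = 0)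
    (hA : ∀ τ : VacDiagram 𝔖, τ.deg ≤ 0 → ∑ S, τ.term χ ψ S = 0)
    (D : MixedDiagram 𝔖 E k) {σ : Finset E → D.V} (hσ : ∀ S, D.Admissible S σ) {S : Finset E}
    (hS : ∀ c ∈ D.G.comps S, D.Done c) :
    value χ ψ L S D = (-1 : ℝ) ^ (D.G.comps S).card •
      ∑ S' ∈ S.powerset.filter (fun S' => ∀ c ∈ D.G.comps S, ¬ c ⊆ S'),
        extractValue χ ψ L ∅ D S' σ := by
  have hinj : ∀ r ∈ D.roots, ∀ r' ∈ D.roots, ∀ e, e ∈ D.G.comp Finset.univ r →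
      e ∈ D.G.comp Finset.univ r' → r = r' := fun r hr r' hr' e he he' =>
    D.root_unique r hr r' hr' ((D.G.conn _).trans (mem_comp.1 he).2
      ((D.G.conn _).symm (mem_comp.1 he').2))
  -- The vertices `R'` are the distinguished vertices of the components of `S`. Their components are
  -- those on which `χ` is used.
  set R' := D.roots.filter fun r => D.G.comp Finset.univ r ∈ D.G.comps S with hR'
  have hR'mem : ∀ r ∈ R', r ∈ D.roots ∧ D.G.comp Finset.univ r ∈ D.G.comps S := fun r hr =>
    Finset.mem_filter.1 hr
  have hne : ∀ c ∈ D.G.comps S, c.Nonempty := fun c hc => (D.G.isConn_of_mem_comps hc).1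
  have himg : R'.image (D.G.comp Finset.univ) = D.G.comps S := by
    ext c
    rw [Finset.mem_image]
    constructor
    · rintro ⟨r, hr, rfl⟩
      exact (hR'mem r hr).2
    · intro hc
      obtain ⟨r, hr, rfl, _⟩ := hS c hc
      exact ⟨r, Finset.mem_filter.2 ⟨hr, hc⟩, rfl⟩
  have hcard : (D.G.comps S).card = R'.card := by
    rw [← himg, Finset.card_image_of_injOn]
    intro r hr r' hr' h
    obtain ⟨e, he⟩ := hne _ (hR'mem r hr).2
    exact hinj r (hR'mem r hr).1 r' (hR'mem r' hr').1 e he (h ▸ he)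
  have hun : R'.biUnion (D.G.comp Finset.univ) = S := by
    ext e
    rw [Finset.mem_biUnion]
    constructor
    · rintro ⟨r, hr, he⟩
      exact comps_subset (hR'mem r hr).2 he
    · intro he
      have hc : D.G.comp S (D.G.src e) ∈ D.G.comps S := mem_comps.2 ⟨e, he, rfl⟩
      rw [← himg, Finset.mem_image] at hc
      obtain ⟨r, hr, hrc⟩ := hc
      exact ⟨r, hr, hrc ▸ mem_comp.2 ⟨he, (D.G.conn _).refl _⟩⟩
  have hchar : weight (D.charOf χ ψ S) L D.G D.roots id D.n
      = weight (fun r => if r ∈ R' then χ else ψ) L D.G D.roots id D.n := by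
    unfold weight
    refine congrArg₂ (fun (x : B) (m : M) => x • m) (Finset.prod_congr rfl fun r hr => ?_) rfl
    have hiff : Disjoint (D.G.comp Finset.univ r) S ↔ r ∉ R' := by
      constructor
      · intro hd hr'
        obtain ⟨e, he⟩ := hne _ (hR'mem r hr').2
        exact Finset.disjoint_left.1 hd he (comps_subset (hR'mem r hr').2 he)
      · refine fun hr' => Finset.disjoint_left.2 fun e he heS => hr' ?_
        rw [← hun, Finset.mem_biUnion] at heS
        obtain ⟨r', hr'', he'⟩ := heS
        rwa [hinj r hr r' (hR'mem r' hr'').1 e he he']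
    unfold charOf
    simp only [hiff, ite_not]
  have h0 : D.charOf χ ψ ∅ = fun _ => ψ := funext fun r => if_pos (Finset.disjoint_empty_right _)
  rw [value, hchar, D.weight_eq_sum hχ hJ hψ hA hσ R' D.roots (Finset.filter_subset _ _)
    subset_rfl (fun r hr => ⟨hne _ (hR'mem r hr).2, ?_⟩), hun, hcard, ← himg]
  · simp only [Finset.forall_mem_image, extractValue, h0]
  · obtain ⟨r', hr', hrr, hdeg⟩ := hS _ (hR'mem r hr).2
    exact hdeg

end MixedDiagram


/-! ### Forests -/

lemma mem_forestRoots {E : Type} {F : Finset (Finset E)} {γ : Finset E} :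
    γ ∈ forestRoots F ↔ γ ∈ F ∧ ∀ γ' ∈ F, γ ⊆ γ' → γ' = γ := Finset.mem_filter

lemma forestRoots_subset {E : Type} (F : Finset (Finset E)) : forestRoots F ⊆ F :=
  Finset.filter_subset _ _

section Forests

variable {𝔖 : LabelSystem d 𝔏} {V V' E : Type} {k k' : ℕ} [Fintype V] [Fintype V'] [Fintype E]
  {G : LGraph 𝔖 V E k} {G' : LGraph 𝔖 V' E k'} {F : Finset (Finset E)} {S c : Finset E}

open MixedDiagram (edges disjoint_verts_edges)

/-- A forest of subgraphs of the graph `G`. -/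
def LGraph.IsForest (G : LGraph 𝔖 V E k) (F : Finset (Finset E)) : Prop :=
  (∀ γ ∈ F, G.IsConn γ ∧ G.subDeg γ 0 ≤ 0) ∧
  ∀ γ ∈ F, ∀ γ' ∈ F, γ ⊆ γ' ∨ γ' ⊆ γ ∨ Disjoint (G.verts γ) (G.verts γ')

lemma LGraph.SubIso.isForest_iff (h : SubIso G G' id S S) (hF : ∀ γ ∈ F, γ ⊆ S) :
    G.IsForest F ↔ G'.IsForest F := by
  refine and_congr (forall₂_congr fun γ hγ => ?_) (forall₂_congr fun γ hγ =>
    forall₂_congr fun γ' hγ' => ?_)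
  · have h' := h.mono_id (hF γ hγ)
    rw [h'.isConn_iff, h'.subDeg_eq (n := 0) (n' := 0) fun _ _ _ => rfl]
  · rw [h.disjoint_verts_iff (hF γ hγ) (hF γ' hγ')]

lemma LGraph.IsForest.mono (h : G.IsForest F) {F' : Finset (Finset E)} (hF : F' ⊆ F) :
    G.IsForest F' :=
  ⟨fun γ hγ => h.1 γ (hF hγ), fun γ hγ γ' hγ' => h.2 γ (hF hγ) γ' (hF hγ')⟩

lemma comps_edges {𝒞 : Finset (Finset E)} (hc : ∀ c ∈ 𝒞, G.IsConn c)
    (h : ∀ c ∈ 𝒞, ∀ c' ∈ 𝒞, c ≠ c' → Disjoint (G.verts c) (G.verts c')) :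
    G.comps (edges 𝒞) = 𝒞 := by
  induction 𝒞 using Finset.induction_on with
  | empty => rfl
  | insert c 𝒞 hcC ih =>
    have hd : Disjoint (G.verts c) (G.verts (edges 𝒞)) := disjoint_verts_edges fun c' hc' =>
      h c (Finset.mem_insert_self c 𝒞) c' (Finset.mem_insert_of_mem hc') fun h' => hcC (h' ▸ hc')
    rw [edges, Finset.biUnion_insert, id, comps_union hd,
      comps_of_isConn (hc c (Finset.mem_insert_self c 𝒞)),
      ih (fun c' hc' => hc c' (Finset.mem_insert_of_mem hc')) fun c₁ h₁ c₂ h₂ =>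
        h c₁ (Finset.mem_insert_of_mem h₁) c₂ (Finset.mem_insert_of_mem h₂), Finset.insert_eq]

lemma edges_comps (G : LGraph 𝔖 V E k) (S : Finset E) : edges (G.comps S) = S := by
  ext e
  rw [edges, Finset.mem_biUnion]
  exact ⟨fun ⟨c, hc, he⟩ => comps_subset hc he, fun he =>
    ⟨_, mem_comps.2 ⟨e, he, rfl⟩, mem_comp.2 ⟨he, (G.conn _).refl _⟩⟩⟩

/-- The maximal elements of a forest are the connected components of its union. -/
lemma LGraph.IsForest.roots_eq (h : G.IsForest F) : forestRoots F = G.comps (edges F) := by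
  have hroot : ∀ γ ∈ forestRoots F, γ ∈ F ∧ ∀ γ' ∈ F, γ ⊆ γ' → γ' = γ := fun γ hγ =>
    mem_forestRoots.1 hγ
  have hun : edges F = edges (forestRoots F) := by
    refine Finset.Subset.antisymm (fun e he => ?_)
      (Finset.biUnion_subset_biUnion_of_subset_left _ (forestRoots_subset F))
    obtain ⟨γ, hγ, he⟩ := Finset.mem_biUnion.1 he
    obtain ⟨γ', hle, hγ'⟩ := F.exists_le_maximal hγ
    exact Finset.mem_biUnion.2 ⟨γ', mem_forestRoots.2 ⟨hγ'.1, fun γ'' h₁ h₂ =>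
      (hγ'.2 h₁ h₂).antisymm h₂⟩, hle he⟩
  rw [hun, comps_edges (fun c hc => (h.1 c (hroot c hc).1).1)]
  intro c hc c' hc' hne
  rcases h.2 c (hroot c hc).1 c' (hroot c' hc').1 with h' | h' | h'
  · exact absurd ((hroot c hc).2 c' (hroot c' hc').1 h').symm hne
  · exact absurd ((hroot c' hc').2 c (hroot c hc).1 h') hne
  · exact h'

/-- A connected subgraph of `S` is contained in a component of `S`. -/
lemma exists_comps_of_isConn (hc : G.IsConn c) (hS : c ⊆ S) : ∃ c' ∈ G.comps S, c ⊆ c' := by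
  obtain ⟨e, he⟩ := hc.1
  exact ⟨_, mem_comps.2 ⟨e, hS he, rfl⟩, fun e' he' =>
    mem_comp.2 ⟨hS he', G.conn_mono hS (hc.2 e he e' he')⟩⟩

lemma eq_of_comps_subset {c' : Finset E} (hc : c ∈ G.comps S) (hc' : c' ∈ G.comps S)
    (h : c ⊆ c') : c = c' := by
  by_contra hne
  obtain ⟨v, hv⟩ := verts_nonempty_of_mem_comps hc
  exact comps_disjoint hc hc' hne hv (G.verts_mono h hv)

/-- No component of the union of a forest is covered by its non-maximal elements. -/
lemma LGraph.IsForest.not_subset (h : G.IsForest F) (hc : c ∈ G.comps (edges F)) :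
    ¬ c ⊆ edges (F \ G.comps (edges F)) := by
  intro hcF
  have h' := h.mono (Finset.sdiff_subset (t := G.comps (edges F)))
  obtain ⟨c', hc', hcc⟩ := exists_comps_of_isConn (G.isConn_of_mem_comps hc) hcF
  rw [← h'.roots_eq] at hc'
  obtain ⟨hF, hnot⟩ := Finset.mem_sdiff.1 (mem_forestRoots.1 hc').1
  obtain ⟨c'', hc'', hcc'⟩ := exists_comps_of_isConn (h.1 c' hF).1
    (Finset.subset_biUnion_of_mem id hF)
  have heq := eq_of_comps_subset hc hc'' (hcc.trans hcc')
  subst heq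
  exact hnot ((hcc.antisymm hcc') ▸ hc)

/-- The components of `S` can be added to a forest of subgraphs of `S`. -/
lemma LGraph.IsForest.union_comps (h : G.IsForest F) (hF : ∀ γ ∈ F, γ ⊆ S)
    (hS : ∀ c ∈ G.comps S, G.subDeg c 0 ≤ 0) : G.IsForest (F ∪ G.comps S) := by
  have key : ∀ γ ∈ F, ∀ c ∈ G.comps S, γ ⊆ c ∨ Disjoint (G.verts γ) (G.verts c) := by
    intro γ hγ c hc
    obtain ⟨c', hc', hγc⟩ := exists_comps_of_isConn (h.1 γ hγ).1 (hF γ hγ)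
    by_cases hcc : c' = c
    · exact Or.inl (hcc ▸ hγc)
    · exact Or.inr (Finset.disjoint_left.2 fun v hv =>
        comps_disjoint hc' hc hcc (G.verts_mono hγc hv))
  refine ⟨fun γ hγ => ?_, fun γ hγ γ' hγ' => ?_⟩
  · rcases Finset.mem_union.1 hγ with hγ | hγ
    · exact h.1 γ hγ
    · exact ⟨G.isConn_of_mem_comps hγ, hS γ hγ⟩
  · rcases Finset.mem_union.1 hγ with hγ | hγ <;> rcases Finset.mem_union.1 hγ' with hγ' | hγ'
    · exact h.2 γ hγ γ' hγ'
    · exact (key γ hγ γ' hγ').imp_right Or.inr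
    · exact Or.inr ((key γ' hγ' γ hγ).imp_right fun h => h.symm)
    · by_cases hne : γ = γ'
      · exact Or.inl hne.subset
      · exact Or.inr (Or.inr (Finset.disjoint_left.2 fun v hv => comps_disjoint hγ hγ' hne hv))

/-- The maximal elements are contracted first. -/
lemma forestOp_of_nonempty (hF : F.Nonempty) : forestOp 𝔖 k F
    = forestOp 𝔖 k (F \ forestRoots F) * ((forestRoots F).toList.map (contractOp 𝔖 k)).prod := by
  rw [forestOp, dif_pos hF]

lemma forestOp_empty : forestOp 𝔖 k (∅ : Finset (Finset E)) = 1 := by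
  rw [forestOp, dif_neg Finset.not_nonempty_empty]

/-- Forests with union `S` correspond to forests of subgraphs of `S` whose union contains no
component of `S`, provided that these components are divergent. -/
lemma sum_forests_edges {N : Type*} [AddCommMonoid N] (hS : ∀ c ∈ G.comps S, G.subDeg c 0 ≤ 0)
    (f : Finset (Finset E) → N) :
    ∑ F ∈ Finset.univ.filter (fun F => G.IsForest F ∧ edges F = S), f F
      = ∑ F ∈ Finset.univ.filter (fun F => G.IsForest F ∧ edges F ⊆ S ∧
          ∀ c ∈ G.comps S, ¬ c ⊆ edges F), f (F ∪ G.comps S) := by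
  have hsub : ∀ F : Finset (Finset E), edges F ⊆ S → ∀ γ ∈ F, γ ⊆ S := fun F h γ hγ =>
    (Finset.subset_biUnion_of_mem id hγ).trans h
  have hback : ∀ F, G.IsForest F → edges F = S → F \ G.comps S ∪ G.comps S = F := by
    rintro F hF rfl
    refine Finset.sdiff_union_of_subset ?_
    rw [← hF.roots_eq]
    exact forestRoots_subset F
  refine Finset.sum_nbij' (fun F => F \ G.comps S) (fun F => F ∪ G.comps S) ?_ ?_ ?_ ?_ ?_
  · intro F hFS
    obtain ⟨hF, rfl⟩ : G.IsForest F ∧ edges F = S := (Finset.mem_filter.1 hFS).2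
    exact Finset.mem_filter.2 ⟨Finset.mem_univ _, hF.mono Finset.sdiff_subset,
      Finset.biUnion_subset_biUnion_of_subset_left _ Finset.sdiff_subset,
      fun c hc => hF.not_subset hc⟩
  · intro F hF
    obtain ⟨hF, hFS, hFc⟩ := (Finset.mem_filter.1 hF).2
    refine Finset.mem_filter.2 ⟨Finset.mem_univ _, hF.union_comps (hsub F hFS) hS, ?_⟩
    have h1 : edges (F ∪ G.comps S) = edges F ∪ edges (G.comps S) := Finset.union_biUnion
    rw [h1, edges_comps, Finset.union_eq_right.2 hFS]
  · intro F hF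
    obtain ⟨hF, hFS⟩ := (Finset.mem_filter.1 hF).2
    exact hback F hF hFS
  · intro F hF
    obtain ⟨hF, hFS, hFc⟩ := (Finset.mem_filter.1 hF).2
    rw [Finset.union_sdiff_right, Finset.sdiff_eq_self_iff_disjoint]
    exact Finset.disjoint_left.2 fun γ hγ hγ' => hFc γ hγ' (Finset.subset_biUnion_of_mem id hγ)
  · intro F hF
    obtain ⟨hF, hFS⟩ := (Finset.mem_filter.1 hF).2
    rw [hback F hF hFS]

end Forests

namespace MixedDiagram

variable {𝔖 : LabelSystem d 𝔏} {E : Type} [Fintype E] {k : ℕ}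
variable {B M : Type*} [CommRing B] [Algebra ℝ B] [AddCommGroup M] [Module ℝ M] [Module B M]
  [IsScalarTower ℝ B M]
variable {χ ψ : That 𝔖 →ₐ[ℝ] B} {L : H 𝔖 →ₗ[ℝ] M}

lemma extractValue_empty (hχ : ∀ x, IsRelVac 𝔖 x → χ x = 0) (hψ : ∀ x, IsRelVac 𝔖 x → ψ x = 0)
    (P : Finset E) (D : MixedDiagram 𝔖 E k) (σ : Finset E → D.V) :
    extractValue χ ψ L P D ∅ σ = value χ ψ L P D :=
  extractWeight_empty (charOf_rel hχ hψ P D) L D.roots id σ D.n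

lemma eq_of_mem_supported {α N : Type*} [AddCommGroup N] [Module ℝ N] {s : Set α}
    {f g : (α →₀ ℝ) →ₗ[ℝ] N} (h : ∀ a ∈ s, f (Finsupp.single a 1) = g (Finsupp.single a 1))
    {x : α →₀ ℝ} (hx : x ∈ Finsupp.supported ℝ ℝ s) : f x = g x := by
  rw [Finsupp.supported_eq_span_single] at hx
  refine LinearMap.eqOn_span ?_ hx
  rintro _ ⟨a, ha, rfl⟩
  exact h a ha

/-- If a component of `S` is not divergent, then its extraction vanishes. -/
lemma extractValue_eq_zero (hJ : ∀ τ : VacDiagram 𝔖, 0 < τ.deg → χ τ.toThat = 0)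
    (P : Finset E) (D : MixedDiagram 𝔖 E k) {S c : Finset E} {σ : Finset E → D.V}
    (hσ : RootChoice D.G S σ) (hc : c ∈ D.G.comps S) (hdeg : 0 < D.G.subDeg c 0) :
    extractValue χ ψ L P D S σ = 0 := by
  have h0 : ∀ a, leftPart χ D.G S σ a = 0 := fun a => by
    refine Finset.prod_eq_zero hc (vac_deg_pos hJ (D.G.isConn_of_mem_comps hc) (hσ c hc) ?_)
    rw [subDeg_eq]
    exact hdeg.trans_le (le_add_of_nonneg_right (by positivity))
  refine (esum_congr (g := fun _ => 0) fun y _ => ?_).trans (esum_zero fun _ _ => rfl)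
  rw [h0, zero_smul, smul_zero, smul_zero]

/-- The empty forest is the only one with empty union. -/
lemma sum_forests_empty (f : MixedDiagram 𝔖 E k → M) (D : MixedDiagram 𝔖 E k) :
    ∑ F ∈ Finset.univ.filter (fun F => D.G.IsForest F ∧ edges F = ∅), (-1 : ℝ) ^ F.card •
      Finsupp.linearCombination ℝ f (forestOp 𝔖 k F (Finsupp.single D 1)) = f D := by
  have h0 : Finset.univ.filter (fun F => D.G.IsForest F ∧ edges F = ∅) = {∅} := by
    ext F
    simp only [Finset.mem_filter, Finset.mem_univ, true_and, Finset.mem_singleton]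
    constructor
    · rintro ⟨hF, h⟩
      refine Finset.eq_empty_of_forall_notMem fun γ hγ => ?_
      obtain ⟨e, he⟩ := (hF.1 γ hγ).1.1
      exact Finset.notMem_empty e (h ▸ Finset.mem_biUnion.2 ⟨γ, hγ, he⟩)
    · rintro rfl
      exact ⟨⟨fun γ hγ => absurd hγ (Finset.notMem_empty γ),
        fun γ hγ => absurd hγ (Finset.notMem_empty γ)⟩, rfl⟩
  rw [h0, Finset.sum_singleton, Finset.card_empty, pow_zero, one_smul, forestOp_empty,
    Module.End.one_apply, Finsupp.linearCombination_single, one_smul]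

/-- The extraction of `S` as a sum over all forests with union `S`. The components of `S` are
split off first; once they are on their own, their evaluation by `χ` is replaced by extractions of
proper subgraphs, to which the same formula applies. -/
theorem extractValue_eq_sum_forests (hχ : ∀ x, IsRelVac 𝔖 x → χ x = 0)
    (hJ : ∀ τ : VacDiagram 𝔖, 0 < τ.deg → χ τ.toThat = 0) (hψ : ∀ x, IsRelVac 𝔖 x → ψ x = 0)
    (hA : ∀ τ : VacDiagram 𝔖, τ.deg ≤ 0 → ∑ S, τ.term χ ψ S = 0) (S : Finset E) :
    ∀ (D : MixedDiagram 𝔖 E k) (σ : Finset E → D.V), (∀ S, D.Admissible S σ) →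
      extractValue χ ψ L ∅ D S σ
        = ∑ F ∈ Finset.univ.filter (fun F => D.G.IsForest F ∧ edges F = S), (-1 : ℝ) ^ F.card •
          Finsupp.linearCombination ℝ (value χ ψ L ∅) (forestOp 𝔖 k F (Finsupp.single D 1)) := by
  induction S using Finset.strongInduction with
  | H S ih =>
  intro D σ hσ
  rcases S.eq_empty_or_nonempty with rfl | hne
  · rw [extractValue_empty hχ hψ, sum_forests_empty]
  -- If some component of `S` is not divergent, then both sides vanish: this component is a maximal
  -- element of any forest with union `S`.
  by_cases hdeg : ∀ c ∈ D.G.comps S, D.G.subDeg c 0 ≤ 0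
  swap
  · push Not at hdeg
    obtain ⟨c, hc, hdeg⟩ := hdeg
    rw [extractValue_eq_zero hJ ∅ D (hσ S).1 hc hdeg]
    refine (Finset.sum_eq_zero fun F hFS => ?_).symm
    obtain ⟨hF, rfl⟩ := (Finset.mem_filter.1 hFS).2
    rw [← hF.roots_eq] at hc
    exact absurd (hF.1 c (forestRoots_subset F hc)).2 (not_le.2 hdeg)
  -- The components of `S` are contracted one after the other, which yields the combination `x` of
  -- diagrams in which they are on their own.
  have hlist : (D.G.comps S).toList.toFinset = D.G.comps S := Finset.toList_toFinset _
  have hmem : ∀ c ∈ (D.G.comps S).toList, c ∈ D.G.comps S := fun c hc => Finset.mem_toList.1 hc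
  have hpw : (D.G.comps S).toList.Pairwise
      fun c c' => Disjoint (D.G.verts c) (D.G.verts c') :=
    (Finset.nodup_toList _).pairwise_of_forall_ne fun c hc c' hc' hne =>
      Finset.disjoint_left.2 fun v hv => comps_disjoint (hmem c hc) (hmem c' hc') hne hv
  have hconn : ∀ c ∈ (D.G.comps S).toList, D.G.IsConn c := fun c hc =>
    D.G.isConn_of_mem_comps (hmem c hc)
  set x := ((D.G.comps S).toList.map (contractOp 𝔖 k)).prod (Finsupp.single D 1) with hx
  have hval : Finsupp.linearCombination ℝ (value χ ψ L S) x = extractValue χ ψ L ∅ D S σ := by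
    have h := value_contractList (L := L) hχ hJ hψ (extractValue_empty hχ hψ)
      (D.G.comps S).toList ∅ D σ hconn hpw (fun c _ => Finset.disjoint_empty_left c) (hσ _)
    rwa [hlist, edges_comps, Finset.empty_union] at h
  have hsupp := contractList_mem_supported (D.G.comps S).toList ∅ D hconn hpw
    (fun _ _ c' hc' => absurd hc' (Finset.notMem_empty c'))
    (fun c' hc' => absurd hc' (Finset.notMem_empty c'))
  rw [hlist, Finset.union_empty, edges_comps, ← hx] at hsupp
  rw [← hval, sum_forests_edges hdeg]
  -- The components of `S` are removed from the forests, so that the remaining operators act on `x`.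
  set Φ := Finset.univ.filter (fun F => D.G.IsForest F ∧ edges F ⊆ S ∧
    ∀ c ∈ D.G.comps S, ¬ c ⊆ edges F) with hΦ
  have hΦmem : ∀ F ∈ Φ, D.G.IsForest F ∧ edges F ⊆ S ∧ ∀ c ∈ D.G.comps S, ¬ c ⊆ edges F :=
    fun F hF => (Finset.mem_filter.1 hF).2
  have hforest : ∀ F ∈ Φ, (-1 : ℝ) ^ (F ∪ D.G.comps S).card •
      Finsupp.linearCombination ℝ (value χ ψ L ∅)
        (forestOp 𝔖 k (F ∪ D.G.comps S) (Finsupp.single D 1))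
      = (((-1 : ℝ) ^ (D.G.comps S).card * (-1 : ℝ) ^ F.card) •
        (Finsupp.linearCombination ℝ (value χ ψ L ∅)).comp (forestOp 𝔖 k F)) x := by
    intro F hF
    obtain ⟨hF, hFS, hFc⟩ := hΦmem F hF
    have hd : Disjoint F (D.G.comps S) := Finset.disjoint_left.2 fun γ hγ hγ' =>
      hFc γ hγ' (Finset.subset_biUnion_of_mem id hγ)
    have hne' : (F ∪ D.G.comps S).Nonempty := by
      obtain ⟨e, he⟩ := hne
      exact ⟨_, Finset.mem_union_right _ (mem_comps.2 ⟨e, he, rfl⟩)⟩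
    have h1 : edges (F ∪ D.G.comps S) = S := by
      rw [edges, Finset.union_biUnion]
      refine (congrArg (edges F ∪ ·) (edges_comps D.G S)).trans (Finset.union_eq_right.2 hFS)
    have h2 := (hF.union_comps (fun γ hγ => (Finset.subset_biUnion_of_mem id hγ).trans hFS)
      hdeg).roots_eq
    rw [h1] at h2
    rw [forestOp_of_nonempty hne', h2, Finset.union_sdiff_right,
      Finset.sdiff_eq_self_iff_disjoint.2 hd, Finset.card_union_of_disjoint hd, add_comm, pow_add]
    rfl
  rw [Finset.sum_congr rfl hforest, ← LinearMap.sum_apply]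
  -- It suffices to consider a single diagram in the support of `x`. Here the antipode identity
  -- replaces `χ` by extractions of subgraphs of `S` without full components.
  refine eq_of_mem_supported (fun D' hD' => ?_) hsupp
  obtain ⟨hiso, hdone⟩ := hD'
  have hne' : Nonempty D'.V := ⟨D'.G.src hne.choose⟩
  have hcomps : D'.G.comps S = D.G.comps S := hiso.comps_eq
  have hσ' := D'.admissible_pickVert
  rw [Finsupp.linearCombination_single, one_smul, D'.value_eq_sum hχ hJ hψ hA hσ'
    (by rwa [hcomps]), hcomps, LinearMap.sum_apply, Finset.smul_sum]
  have hmaps : ∀ F ∈ Φ, edges F ∈ S.powerset.filter fun S' => ∀ c ∈ D.G.comps S, ¬ c ⊆ S' :=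
    fun F hF => Finset.mem_filter.2 ⟨Finset.mem_powerset.2 (hΦmem F hF).2.1, (hΦmem F hF).2.2⟩
  -- The forests are sorted according to their union, to which the induction hypothesis applies.
  rw [← Finset.sum_fiberwise_of_maps_to hmaps]
  refine Finset.sum_congr rfl fun S' hS' => ?_
  obtain ⟨hS'S, hS'c⟩ := Finset.mem_filter.1 hS'
  rw [Finset.mem_powerset] at hS'S
  have hss : S' ⊂ S := hS'S.ssubset_of_ne fun h => by
    obtain ⟨e, he⟩ := hne
    have hc : D.G.comp S (D.G.src e) ∈ D.G.comps S := mem_comps.2 ⟨e, he, rfl⟩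
    exact hS'c _ hc (by rw [h]; exact comps_subset hc)
  have hfib : Finset.univ.filter (fun F => D'.G.IsForest F ∧ edges F = S')
      = Φ.filter fun F => edges F = S' := by
    ext F
    simp only [hΦ, Finset.mem_filter, Finset.mem_univ, true_and]
    refine and_congr_left fun hF => ?_
    subst hF
    rw [hiso.isForest_iff fun γ hγ => (Finset.subset_biUnion_of_mem id hγ).trans hS'S]
    exact ⟨fun h => ⟨h, hS'S, hS'c⟩, fun h => h.1⟩
  rw [ih S' hss D' _ hσ', hfib, Finset.smul_sum]
  refine Finset.sum_congr rfl fun F _ => ?_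
  rw [smul_smul]
  rfl

end MixedDiagram


/-! ### The forest formula -/

section ForestFormula

variable {𝔖 : LabelSystem d 𝔏}

open MixedDiagram (edges)

lemma FeynmanDiagram.toH_eq (Γ : FeynmanDiagram 𝔖) : Γ.toH = Γ.G.legDiagram.toH :=
  toH_eq_of_iso
    { onV := (Equiv.subtypeUnivEquiv Γ.has_leg).symm
      onE := (Equiv.subtypeUnivEquiv fun e => Γ.has_leg (Γ.G.src e)).symm
      legs := rfl
      src_eq := fun _ => rfl
      tgt_eq := fun _ => rfl
      lab_eq := fun _ => rfl
      leg_eq := fun _ => rfl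
      legLab_eq := fun _ => rfl }

/-- A vector of `H` as an element of `Ĥ_- ⊗ H`. -/
abbrev inclH (𝔖 : LabelSystem d 𝔏) : H 𝔖 →ₗ[ℝ] Hhat 𝔖 ⊗[ℝ] H 𝔖 := TensorProduct.mk ℝ _ _ 1

namespace MixedDiagram

variable {E : Type} [Fintype E] {k : ℕ}

lemma rootComponent_eq (D : MixedDiagram 𝔖 E k) {r : D.V} (hr : r ∈ D.roots) :
    D.rootComponent r = D.G.rootVac r D.n := by
  unfold rootComponent rootVac
  split_ifs with h h'
  · rw [piece_toThat]
    have hp := (D.G.pick D.roots (D.G.comp Finset.univ r) h).2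
    have hr' := root_mem_verts_comp h
    have hpr : (D.G.pick D.roots (D.G.comp Finset.univ r) h).1 ∈ D.roots := by
      rw [pick, dif_pos ⟨r, hr, hr'⟩]
      exact (Exists.choose_spec (⟨r, hr, hr'⟩ :
        ∃ v, v ∈ D.roots ∧ v ∈ D.G.verts (D.G.comp Finset.univ r))).1
    rw [D.root_eq_of_mem_verts (D.G.isConn_comp h) hpr hr hp hr']
  · rw [Finset.not_nonempty_iff_eq_empty.1 h, vac_empty, if_pos h']
  · rw [Finset.not_nonempty_iff_eq_empty.1 h, vac_empty, if_neg h']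

/-- For `P = ∅` no component is evaluated by `χ`, so that the value of a mixed diagram is its image
in `Ĥ_- ⊗ H`. -/
lemma toTensor_eq_value (χ : That 𝔖 →ₐ[ℝ] Hhat 𝔖) (D : MixedDiagram 𝔖 E k) :
    D.toTensor = value χ (toHhat 𝔖) (inclH 𝔖) ∅ D := by
  have h : ∀ r, D.charOf χ (toHhat 𝔖) ∅ r = toHhat 𝔖 := fun r =>
    if_pos (Finset.disjoint_empty_right _)
  unfold toTensor value weight
  rw [Finset.prod_congr rfl fun r hr => D.rootComponent_eq hr, map_prod, TensorProduct.mk_apply,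
    TensorProduct.smul_tmul', smul_eq_mul, mul_one]
  simp only [h]
  rfl

end MixedDiagram

/-- The contribution of a subgraph to the left-hand side of the forest formula. -/
def coactionTerm (χ : That 𝔖 →ₐ[ℝ] Hhat 𝔖) (Γ : FeynmanDiagram 𝔖) (S : Finset Γ.E) :
    Hhat 𝔖 ⊗[ℝ] H 𝔖 :=
  extraction Γ.G S (fun a => χ (Γ.G.extract ∅ S a))
    (fun l _ => inclH 𝔖 (Γ.G.quo S l).legDiagram.toH) 0

lemma truncated_extract {B : Type*} [CommRing B] [Algebra ℝ B] {χ : That 𝔖 →ₐ[ℝ] B}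
    (hJ : ∀ τ : VacDiagram 𝔖, 0 < τ.deg → χ τ.toThat = 0) {V E : Type} {k : ℕ} [Fintype V]
    [Fintype E] (G : LGraph 𝔖 V E k) (S : Finset E) :
    Truncated G S fun a => χ (G.extract ∅ S a) := by
  rcases isEmpty_or_nonempty V with hV | hV
  · exact ⟨0, fun a h => absurd h (by simp [Finset.eq_empty_of_isEmpty])⟩
  · simp only [map_extract]
    exact leftPart_truncated hJ (rootChoice_pickVert G ∅ S)

/-- A sum over all subgraphs, in each of which the antipode is applied to the extracted components.
-/
lemma map_coaction (A : Hminus 𝔖 →ₐ[ℝ] Hhat 𝔖) (Γ : FeynmanDiagram 𝔖) :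
    TensorProduct.map A.toLinearMap (LinearMap.id : H 𝔖 →ₗ[ℝ] H 𝔖) (coaction Γ)
      = ∑ S, coactionTerm (A.comp (toHminus 𝔖)) Γ S := by
  unfold coaction
  rw [map_sum]
  refine Finset.sum_congr rfl fun S _ => ?_
  have hT := truncated_extract (χ := toHminus 𝔖) toHminus_deg Γ.G S
  have h1 := extraction_eq_finsum hT (M := Hminus 𝔖 ⊗[ℝ] H 𝔖)
    (fun l _ => 1 ⊗ₜ[ℝ] (Γ.G.quo S l).legDiagram.toH) 0
  have h2 : ∀ (x : Hminus 𝔖) (y : H 𝔖), x • ((1 : Hminus 𝔖) ⊗ₜ[ℝ] y) = x ⊗ₜ[ℝ] y := fun x y => by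
    rw [TensorProduct.smul_tmul', smul_eq_mul, mul_one]
  -- the node decoration of a Feynman diagram is zero, so that none of it can be extracted
  have h3 : ∀ l : {h // h ∈ Γ.G.boundary S} → MultiIndex d,
      (∑ᶠ m : {v // v ∈ Γ.G.verts S} → MultiIndex d,
        ((-1 : ℝ) ^ outOrder (extendZero l) / (multiFactorial l : ℝ)
          * (multiChoose (0 : Γ.V → MultiIndex d) (extendZero m) : ℝ)) •
        (toHminus 𝔖 (Γ.G.extract ∅ S (extendZero m + Γ.G.push (extendZero l)))
          ⊗ₜ[ℝ] (Γ.G.quo S (extendZero l)).legDiagram.toH))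
      = ((-1 : ℝ) ^ outOrder (extendZero l) / (multiFactorial l : ℝ)) •
        (toHminus 𝔖 (Γ.G.extract ∅ S (Γ.G.push (extendZero l)))
          ⊗ₜ[ℝ] (Γ.contract S (extendZero l)).toH) := fun l => by
    have h4 : extendZero (0 : {v // v ∈ Γ.G.verts S} → MultiIndex d) = 0 := by
      funext v
      simp [extendZero]
    rw [finsum_eq_single _ 0, h4, zero_add, (Γ.contract S (extendZero l)).toH_eq]
    · have h5 : multiChoose (0 : Γ.V → MultiIndex d) 0 = 1 := by simp [multiChoose]
      rw [h5, Nat.cast_one, mul_one]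
      rfl
    · intro m hm
      have h5 : multiChoose (0 : Γ.V → MultiIndex d) (extendZero m) = 0 := by
        by_contra hne
        refine hm (funext fun v => ?_)
        have h6 := multiChoose_le hne v.1
        simpa [extendZero, v.2] using h6
      rw [h5, Nat.cast_zero, mul_zero, zero_smul]
  simp only [h2, h3] at h1
  rw [← h1]
  refine (map_extraction A (TensorProduct.map A.toLinearMap LinearMap.id) (fun b m => ?_) hT
    (fun l _ => 1 ⊗ₜ[ℝ] (Γ.G.quo S l).legDiagram.toH) 0).trans ?_
  · induction m using TensorProduct.induction_on with
    | zero => simp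
    | tmul x y =>
      rw [TensorProduct.smul_tmul']
      simp [TensorProduct.smul_tmul']
    | add x y hx hy => rw [smul_add, map_add, hx, hy, map_add, smul_add]
  · refine extraction_congr (fun y _ => rfl) fun y _ => ?_
    simp

/-- A Feynman diagram, seen as a mixed diagram, has no distinguished vertices. -/
lemma coactionTerm_eq_extractValue (χ : That 𝔖 →ₐ[ℝ] Hhat 𝔖) (Γ : FeynmanDiagram 𝔖)
    [Nonempty Γ.V] (S : Finset Γ.E) : coactionTerm χ Γ S
      = Γ.toMixed.extractValue χ (toHhat 𝔖) (inclH 𝔖) ∅ S (Γ.G.pickVert ∅) := by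
  refine extraction_congr (fun y _ => map_extract ∅ _) fun y _ => ?_
  show _ = (∏ i ∈ (∅ : Finset Γ.V), _) • inclH 𝔖 _
  rw [Finset.prod_empty, one_smul]
  rfl

lemma coactionTerm_empty (χ : That 𝔖 →ₐ[ℝ] Hhat 𝔖) (Γ : FeynmanDiagram 𝔖) :
    coactionTerm χ Γ ∅ = Γ.toMixed.value χ (toHhat 𝔖) (inclH 𝔖) ∅ := by
  have h1 : Γ.G.extract ∅ ∅ 0 = 1 := by
    unfold extract
    rw [Finset.attach_eq_empty_iff.2 (show Γ.G.comps ∅ = ∅ from Finset.image_empty _),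
      Finset.prod_empty]
  rw [coactionTerm, extraction_empty, h1, map_one, one_smul,
    ← (edgeEmb_quo_empty Γ.G).legDiagram_eq (fun _ => rfl) fun j => 𝔖.diff_zero _]
  show _ = (∏ i ∈ (∅ : Finset Γ.V), _) • inclH 𝔖 _
  rw [Finset.prod_empty, one_smul]
  rfl

/-- Zimmermann's forest formula. -/
theorem forest_formula {A : Hminus 𝔖 →ₐ[ℝ] Hhat 𝔖} (hA : IsTwistedAntipode A)
    (Γ : FeynmanDiagram 𝔖) :
    TensorProduct.map A.toLinearMap (LinearMap.id : H 𝔖 →ₗ[ℝ] H 𝔖) (coaction Γ)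
      = ∑ F ∈ Γ.forests, (-1 : ℝ) ^ F.card • toTensor 𝔖 Γ.E Γ.k (Γ.contractForest F) := by
  set χ := A.comp (toHminus 𝔖) with hχ
  have hval : toTensor 𝔖 Γ.E Γ.k
      = Finsupp.linearCombination ℝ (MixedDiagram.value χ (toHhat 𝔖) (inclH 𝔖) ∅) := by
    unfold toTensor
    congr 1
    funext D
    exact D.toTensor_eq_value χ
  -- Both sides are sorted by subgraphs: on the right-hand side, by the union of the forest.
  rw [map_coaction, ← Finset.sum_fiberwise Γ.forests edges]
  refine Finset.sum_congr rfl fun S _ => ?_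
  have hfil : Γ.forests.filter (fun F => edges F = S)
      = Finset.univ.filter fun F => Γ.toMixed.G.IsForest F ∧ edges F = S := by
    ext F
    simp only [FeynmanDiagram.forests, Finset.mem_filter, Finset.mem_univ, true_and]
    rfl
  rw [hfil, hval]
  rcases S.eq_empty_or_nonempty with rfl | hne
  · rw [coactionTerm_empty]
    exact (MixedDiagram.sum_forests_empty _ Γ.toMixed).symm
  · have hV : Nonempty Γ.V := ⟨Γ.G.src hne.choose⟩
    have hV' : Nonempty Γ.toMixed.V := hV
    rw [coactionTerm_eq_extractValue]
    exact MixedDiagram.extractValue_eq_sum_forests (comp_toHminus_rel A) (comp_toHminus_deg A)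
      toHhat_rel (fun τ hτ => hA.sum_term_eq_zero hτ) S Γ.toMixed _ Γ.toMixed.admissible_pickVert

end ForestFormula

end BPHZ

end

theorem mainTheorem3 {d : ℕ} (hd : 0 < d) {𝔏 : Type} (𝔖 : BPHZ.LabelSystem d 𝔏) :
    (∃! A : BPHZ.Hminus 𝔖 →ₐ[ℝ] BPHZ.Hhat 𝔖, BPHZ.IsTwistedAntipode A) ∧
    ∀ A : BPHZ.Hminus 𝔖 →ₐ[ℝ] BPHZ.Hhat 𝔖, BPHZ.IsTwistedAntipode A →
      ∀ Γ : BPHZ.FeynmanDiagram 𝔖,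
        TensorProduct.map A.toLinearMap (LinearMap.id : BPHZ.H 𝔖 →ₗ[ℝ] BPHZ.H 𝔖)
            (BPHZ.coaction Γ) =
          ∑ F ∈ Γ.forests,
            (-1 : ℝ) ^ F.card • BPHZ.toTensor 𝔖 Γ.E Γ.k (Γ.contractForest F) := by
  obtain ⟨A, hA⟩ := BPHZ.exists_twistedAntipode (𝔖 := 𝔖)
  exact ⟨⟨A, hA, fun A' hA' => hA'.unique hA⟩, fun A hA Γ => BPHZ.forest_formula hA Γ⟩
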